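/- **Setting.** Let $(x_i,y_i)_{i=1}^n$ be data with $x_i\in\mathbb R^d$, $\|x_i\|\le r$, and let each loss $u\mapsto\ell(u,y_i)$ be differentiable, $\sigma$-strongly convex and $L$-smooth on $\mathbb R$ ($\frac{\sigma}{2}(a-b)^2\le \ell(a,y_i)-\ell(b,y_i)-\ell'(b,y_i)(a-b)\le\frac L2(a-b)^2$). Put $\ell_i(\theta)=\ell(\theta^\top x_i,y_i)+\frac\mu2\|\theta\|^2$ and $F=\frac1n\sum_i\ell_i$ with minimizer $\theta^*$, and let $\bar H=\frac Ln\sum_i x_ix_i^\top+\mu I$. For $w\in\mathbb R^d$ let $q_{w,i}(\theta)=\ell_i(w)+\langle\nabla\ell_i(w),\theta-w\rangle+\frac L2(x_i^\top(\theta-w))^2+\frac\mu2\|\theta-w\|^2$ and $Q_w=\frac1n\sum_i q_{w,i}=F(w)+\langle\nabla F(w),\theta-w\rangle+\frac12(\theta-w)^\top\bar H(\theta-w)$. For a batch $S$ write $q_{w,S}=\frac1{|S|}\sum_{i\in S}q_{w,i}$. **Algorithm (HSDMPG for generic losses).** In outer iteration $t=1,\dots,T$ put $w=\theta_{t-1}$,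 draw a uniformly random subset $S$ of $\{1,\dots,n\}$ of size $s$, start at $\vartheta_0=w$ and for $k=1,\dots,K_t$: draw a uniformly random subset $S_k$ of size $\lceil\frac{16\nu^2(\mu+2\gamma)^2}{\mu^2}e^{\mu k/(\mu+2\gamma)}\rceil\wedge n$, and run SVRG from $\vartheta_{k-1}$ on the finite sum $P(\vartheta)=q_{w,S}(\vartheta)+\langle\nabla q_{w,S_k}(\vartheta_{k-1})-\nabla q_{w,S}(\vartheta_{k-1}),\vartheta\rangle+\frac\gamma2\|\vartheta-\vartheta_{k-1}\|^2$ until a snapshot $\vartheta_k$ satisfies $\|\nabla P(\vartheta_k)\|\le\varepsilon_k$. Then $\theta_t=\vartheta_{K_t}$. All draws are independent and uniform. Here $$\gamma=\frac{(\sqrt{\log d}+\sqrt2)Lr^2}{\sqrt s},\quad \varepsilon_k=\frac{\mu^{1.5}}{4(\mu+2\gamma)}e^{-\frac{\mu(k-1)}{2(\mu+2\gamma)}},\quad \varepsilon'_t=\frac{\sigma}{2L}e^{-\frac{\sigma t}{2L}},$$ $$K_t=\Big\lceil\tfrac{\mu+2\gamma}{\mu}\log\tfrac{\zeta}{\varepsilon'_t}\Big\rceil,\quad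 T=\Big\lceil\tfrac{2L}{\sigma}\log\big((1+\Delta)\sqrt n\big)\Big\rceil .$$ SVRG has step size $1/(10(Lr^2+\mu+\gamma))$, epochs of $m=\lceil 50(Lr^2+\mu+\gamma)/(\mu+\gamma)\rceil$ steps, and its next snapshot is a uniformly random one of the inner iterates $0,\dots,m-1$ of the epoch. An IFO call is the evaluation of one component gradient: an inner iteration that needs $J$ epochs of SVRG costs $|S_k|+(J+1)s+2mJ$ calls. **Statement.** Let $L,\sigma,r,\kappa_0,\nu_0>0$ and $\Delta\ge0$. There is $\zeta_0>0$ such that for every $\zeta\ge\zeta_0$ there are $C,n_0$, all depending only on these constants ($C,n_0$ also on $\zeta$), for which the following holds for all $n\ge \max(n_0,2)$, $d\ge2$, $\nu\ge\nu_0$, all data and losses as above with $\mu>0$ and $\kappa=L/\mu\le\kappa_0\sqrt n$, and all $\theta_0$ with $F(\theta_0)-F(\theta^*)\le\Delta$. Let $$s=\Big\lceil\frac{\nu\,n^{0.75}\log^{0.5}d}{\log^{1.5}n}\Big\rceil\wedge n\qquad\Big(\text{so } s=\mathcal O\Big(\frac{\nu n^{0.75}\log^{0.5}d}{\log n}\Big)\Big),$$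 and suppose that the gradient variance of the quadratic models is bounded by $\nu^2$ at the iterates of the algorithm, $\mathbb E\big[\frac1n\sum_{i}\|\bar H^{-1/2}(\nabla Q_w(\vartheta_k)-\nabla q_{w,i}(\vartheta_k))\|^2\big]\le\nu^2$ for $w=\theta_{t-1}$, $1\le t\le T$, $0\le k<K_t$ (for instance because $\sup_{\vartheta}\frac1n\sum_i\|\bar H^{-1/2}(\nabla Q_w(\vartheta)-\nabla q_{w,i}(\vartheta))\|^2\le\nu^2$ for all $w$). Then the algorithm achieves $$\mathbb E\big[Q_{\theta_{t-1}}(\theta_t)-\min Q_{\theta_{t-1}}\big]\le\varepsilon'_t\quad(1\le t\le T),\qquad \mathbb E[F(\theta_T)-F(\theta^*)]\le\frac1{\sqrt n},$$ and its expected number of IFO calls is at most $C\big(\nu^{0.5}n^{0.875}\log^{0.75}(d)\log^{2.25}(n)+\nu^2n^{0.5}\big)$. -/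

import Mathlib

namespace HSDMPG

noncomputable section

/-- The parameter space `ℝᵈ` with the Euclidean norm. -/
abbrev E (d : ℕ) : Type := EuclideanSpace ℝ (Fin d)

/-- A differentiable function on `ℝ` that is `σ`-strongly convex and `L`-smooth: the Bregman
divergence `g a - g b - g' b (a - b)` lies between `σ/2 (a - b)²` and `L/2 (a - b)²`. -/
def StronglyConvexSmooth (σ L : ℝ) (g : ℝ → ℝ) : Prop :=
  Differentiable ℝ g ∧ ∀ a b : ℝ,
    σ / 2 * (a - b) ^ 2 ≤ g a - g b - deriv g b * (a - b) ∧
      g a - g b - deriv g b * (a - b) ≤ L / 2 * (a - b) ^ 2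

/-! ### Finite sums -/

/-- Average of the component functions over a batch `S` of indices. -/
def avg {n d : ℕ} (f : Fin n → E d → ℝ) (S : Finset (Fin n)) (θ : E d) : ℝ :=
  (S.card : ℝ)⁻¹ * ∑ i ∈ S, f i θ

/-! ### SVRG on the finite sum `avg p S` -/

/-- The inner steps of one SVRG epoch with step size `η`, started at the snapshot `x`;
`c i` is the index of the component that is sampled in step `i`. -/
def svrgInner {n d : ℕ} (p : Fin n → E d → ℝ) (S : Finset (Fin n)) (η : ℝ) (x : E d)
    (c : ℕ → Fin n) : ℕ → E d
  | 0 => x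
  | i + 1 =>
      svrgInner p S η x c i -
        η • (gradient (p (c i)) (svrgInner p S η x c i) - gradient (p (c i)) x
              + gradient (avg p S) x)

/-- The snapshots of SVRG: the snapshot after epoch `j` is the inner iterate number `pick j`
of that epoch. -/
def svrgSnapshot {n d : ℕ} (p : Fin n → E d → ℝ) (S : Finset (Fin n)) (η : ℝ) (x : E d)
    (c : ℕ → ℕ → Fin n) (pick : ℕ → ℕ) : ℕ → E d
  | 0 => x
  | j + 1 => svrgInner p S η (svrgSnapshot p S η x c pick j) (c j) (pick j)

/-- Number of epochs until the first snapshot at which the gradient norm of `avg p S` is at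
most `ε` (infinite if there is none). -/
def svrgEpochs {n d : ℕ} (p : Fin n → E d → ℝ) (S : Finset (Fin n)) (η ε : ℝ) (x : E d)
    (c : ℕ → ℕ → Fin n) (pick : ℕ → ℕ) : ℕ∞ :=
  sInf ((fun j : ℕ => (j : ℕ∞)) ''
    {j : ℕ | ‖gradient (avg p S) (svrgSnapshot p S η x c pick j)‖ ≤ ε})

/-- Output of SVRG: the first snapshot at which the gradient norm of `avg p S` is at most `ε`
(the starting point if there is none; then the number of epochs is infinite). -/
def svrgOutput {n d : ℕ} (p : Fin n → E d → ℝ) (S : Finset (Fin n)) (η ε : ℝ) (x : E d)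
    (c : ℕ → ℕ → Fin n) (pick : ℕ → ℕ) : E d :=
  svrgSnapshot p S η x c pick (svrgEpochs p S η ε x c pick).toNat

/-! ### The quadratic-loss algorithm, for a finite sum with components `f` -/

/-- The components `pᵢ(θ) = fᵢ(θ) + ⟨∇f_{S'}(w) - ∇f_S(w), θ⟩ + γ/2 ‖θ - w‖²` of the proximal
objective `P`. -/
def proxComponent {n d : ℕ} (f : Fin n → E d → ℝ) (S S' : Finset (Fin n)) (γ : ℝ) (w : E d)
    (i : Fin n) (θ : E d) : ℝ :=
  f i θ + inner ℝ (gradient (avg f S') w - gradient (avg f S) w) θ + γ / 2 * ‖θ - w‖ ^ 2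

/-- The average over `S` of the components is
`P(θ) = f_S(θ) + ⟨∇f_{S'}(w) - ∇f_S(w), θ⟩ + γ/2 ‖θ - w‖²`. -/
theorem avg_proxComponent {n d : ℕ} (f : Fin n → E d → ℝ) (S S' : Finset (Fin n)) (γ : ℝ)
    (w θ : E d) (hS : 0 < S.card) :
    avg (proxComponent f S S' γ w) S θ =
      avg f S θ + inner ℝ (gradient (avg f S') w - gradient (avg f S) w) θ
        + γ / 2 * ‖θ - w‖ ^ 2 := by
  have h : (S.card : ℝ) ≠ 0 := by positivity
  generalize hg : gradient (avg f S') w - gradient (avg f S) w = g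
  simp only [avg, proxComponent, hg, Finset.sum_add_distrib, Finset.sum_const, nsmul_eq_mul]
  field_simp

/-- The iterates of the algorithm on the finite sum with components `f`: batch `S`, minibatch
`mini k` in iteration `k ≥ 1`, proximal weight `γ`, accuracies `ε k`, SVRG step size `η`, SVRG
draws `c k`, `pick k`, and starting point `x`. -/
def innerIter {n d : ℕ} (f : Fin n → E d → ℝ) (S : Finset (Fin n)) (mini : ℕ → Finset (Fin n))
    (γ η : ℝ) (ε : ℕ → ℝ) (c : ℕ → ℕ → ℕ → Fin n) (pick : ℕ → ℕ → ℕ) (x : E d) : ℕ → E d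
  | 0 => x
  | k + 1 =>
      svrgOutput
        (proxComponent f S (mini (k + 1)) γ (innerIter f S mini γ η ε c pick x k))
        S η (ε (k + 1)) (innerIter f S mini γ η ε c pick x k) (c (k + 1)) (pick (k + 1))

/-- Number of oracle calls (evaluations of the gradient of one component) in iteration `k + 1`:
the minibatch gradient costs `|mini (k + 1)|`; the gradient over `S` at each snapshot, including
the starting point and the last one, costs `|S|`; each of the `m` inner steps of an SVRG epoch
costs `2`. -/
def iterCalls {n d : ℕ} (f : Fin n → E d → ℝ) (S : Finset (Fin n)) (mini : ℕ → Finset (Fin n))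
    (γ η : ℝ) (ε : ℕ → ℝ) (m : ℕ) (c : ℕ → ℕ → ℕ → Fin n) (pick : ℕ → ℕ → ℕ) (x : E d)
    (k : ℕ) : ℕ∞ :=
  let w := innerIter f S mini γ η ε c pick x k
  let J := svrgEpochs (proxComponent f S (mini (k + 1)) γ w) S η (ε (k + 1)) w
    (c (k + 1)) (pick (k + 1))
  ((mini (k + 1)).card : ℕ∞) + (J + 1) * (S.card : ℕ∞) + J * (2 * (m : ℕ∞))

/-! ### The regularized risk and its quadratic models -/

/-- A regularized empirical risk minimization problem for a linear model: data `x i`, labels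
`y i`, loss `ℓ`, regularization `μ`, smoothness constant `L` of the loss. -/
structure ERM (n d : ℕ) (Y : Type*) where
  x : Fin n → E d
  y : Fin n → Y
  ℓ : ℝ → Y → ℝ
  μ : ℝ
  L : ℝ

namespace ERM

variable {n d : ℕ} {Y : Type*} (p : ERM n d Y)

/-- `ℓᵢ(θ) = ℓ(θᵀxᵢ, yᵢ) + μ/2 ‖θ‖²`. -/
def component (i : Fin n) (θ : E d) : ℝ :=
  p.ℓ (inner ℝ θ (p.x i)) (p.y i) + p.μ / 2 * ‖θ‖ ^ 2

/-- The regularized empirical risk `F(θ) = 1/n ∑ ℓ(θᵀxᵢ, yᵢ) + μ/2 ‖θ‖²`. -/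
def risk (θ : E d) : ℝ :=
  1 / (n : ℝ) * ∑ i, p.ℓ (inner ℝ θ (p.x i)) (p.y i) + p.μ / 2 * ‖θ‖ ^ 2

/-- The components of the quadratic model at `w`. One oracle call for `ℓᵢ` at `w` gives the
gradient of `qComponent w i` at any point. -/
def qComponent (w : E d) (i : Fin n) (θ : E d) : ℝ :=
  p.component i w + inner ℝ (gradient (p.component i) w) (θ - w)
    + (p.L / 2 * (inner ℝ (p.x i) (θ - w)) ^ 2 + p.μ / 2 * ‖θ - w‖ ^ 2)

/-- The matrix `H̄ = L/n ∑ xᵢ xᵢᵀ + μ I`. -/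
def hessianBound : Matrix (Fin d) (Fin d) ℝ :=
  (p.L / n) • ∑ i, Matrix.vecMulVec (p.x i).ofLp (p.x i).ofLp
    + p.μ • (1 : Matrix (Fin d) (Fin d) ℝ)

/-- The quadratic model `Q_w(θ) = F(w) + ⟨∇F(w), θ - w⟩ + 1/2 (θ - w)ᵀ H̄ (θ - w)`. -/
def quadModel (w θ : E d) : ℝ :=
  p.risk w + inner ℝ (gradient p.risk w) (θ - w)
    + 1 / 2 * ((θ - w).ofLp ⬝ᵥ p.hessianBound.mulVec (θ - w).ofLp)

/-- `‖H̄^{-1/2} v‖² = vᵀ H̄⁻¹ v`. -/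
def invHessianSq (v : E d) : ℝ :=
  v.ofLp ⬝ᵥ (p.hessianBound)⁻¹.mulVec v.ofLp

/-- The variance `1/n ∑ ‖H̄^{-1/2} (∇Q_w(θ) - ∇q_{w,i}(θ))‖²` of the component gradients of the
quadratic model `Q_w` at `θ`. -/
def gradVariance (w θ : E d) : ℝ :=
  1 / (n : ℝ) * ∑ i,
    p.invHessianSq (gradient (p.quadModel w) θ - gradient (p.qComponent w i) θ)

end ERM

/-! ### The random draws -/

/-- Batch size `s`, minibatch sizes `b k` and epoch length `m`. -/
structure Sizes (n : ℕ) where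
  s : ℕ
  b : ℕ → ℕ
  m : ℕ
  s_pos : 0 < s
  s_le : s ≤ n
  b_le : ∀ k, b k ≤ n
  m_pos : 0 < m

/-- Names of the random draws, in outer iteration `t`: the batch `S`; the minibatch of inner
iteration `k`; the component sampled in inner iteration `k`, epoch `j`, step `i`; the choice of
the next snapshot in inner iteration `k`, epoch `j`. -/
inductive Draw : Type
  | batch (t : ℕ)
  | mini (t k : ℕ)
  | comp (t k j i : ℕ)
  | pick (t k j : ℕ)

/-- The finite set in which a draw takes its value. A sampled component is given by its position
in the increasing enumeration of the batch. -/
def Draw.Val {n : ℕ} (z : Sizes n) : Draw → Type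
  | .batch _ => {S : Finset (Fin n) // S.card = z.s}
  | .mini _ k => {S : Finset (Fin n) // S.card = z.b k}
  | .comp _ _ _ _ => Fin z.s
  | .pick _ _ _ => Fin z.m

theorem exists_card_eq {n k : ℕ} (h : k ≤ n) : Nonempty {S : Finset (Fin n) // S.card = k} := by
  obtain ⟨S, -, hS⟩ := Finset.exists_subset_card_eq (s := (Finset.univ : Finset (Fin n)))
    (n := k) (by simpa using h)
  exact ⟨⟨S, hS⟩⟩

instance {n : ℕ} (z : Sizes n) (a : Draw) : Fintype (a.Val z) :=
  match a with
  | .batch _ => inferInstanceAs (Fintype {S : Finset (Fin n) // S.card = z.s})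
  | .mini _ k => inferInstanceAs (Fintype {S : Finset (Fin n) // S.card = z.b k})
  | .comp _ _ _ _ => inferInstanceAs (Fintype (Fin z.s))
  | .pick _ _ _ => inferInstanceAs (Fintype (Fin z.m))

instance {n : ℕ} (z : Sizes n) (a : Draw) : Nonempty (a.Val z) := by
  cases a with
  | batch t => exact exists_card_eq z.s_le
  | mini t k => exact exists_card_eq (z.b_le k)
  | comp t k j i => exact ⟨⟨0, z.s_pos⟩⟩
  | pick t k j => exact ⟨⟨0, z.m_pos⟩⟩

instance {n : ℕ} (z : Sizes n) (a : Draw) : MeasurableSpace (a.Val z) := ⊤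

instance {n : ℕ} (z : Sizes n) (a : Draw) : MeasurableSingletonClass (a.Val z) :=
  ⟨fun _ => trivial⟩

/-- The sample space: one value for each draw. -/
abbrev Outcome {n : ℕ} (z : Sizes n) : Type := (a : Draw) → a.Val z

/-- The law of the draws: they are independent, and each of them is uniform. -/
def law {n : ℕ} (z : Sizes n) : MeasureTheory.Measure (Outcome z) :=
  MeasureTheory.Measure.infinitePi fun a => (PMF.uniformOfFintype (a.Val z)).toMeasure

section Draws

variable {n : ℕ} {z : Sizes n}

/-- The batch of outer iteration `t`, a uniformly random subset of size `s`. -/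
def batch (ω : Outcome z) (t : ℕ) : Finset (Fin n) :=
  Subtype.val (p := fun S : Finset (Fin n) => S.card = z.s) (ω (.batch t))

/-- The minibatch of inner iteration `k` of outer iteration `t`, a uniformly random subset of
size `b k`. -/
def minibatch (ω : Outcome z) (t k : ℕ) : Finset (Fin n) :=
  Subtype.val (p := fun S : Finset (Fin n) => S.card = z.b k) (ω (.mini t k))

theorem batch_card (ω : Outcome z) (t : ℕ) : (batch ω t).card = z.s :=
  Subtype.property (p := fun S : Finset (Fin n) => S.card = z.s) (ω (.batch t))

/-- The component sampled by SVRG, a uniformly random element of the batch. -/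
def sampled (ω : Outcome z) (t k j i : ℕ) : Fin n :=
  (batch ω t).orderEmbOfFin (batch_card ω t) (show Fin z.s from ω (.comp t k j i))

/-- The number of the inner iterate that becomes the next snapshot of SVRG, uniformly random in
`{0, …, m - 1}`. -/
def picked (ω : Outcome z) (t k j : ℕ) : ℕ :=
  Fin.val (show Fin z.m from ω (.pick t k j))

end Draws

/-! ### The algorithm for generic losses -/

/-- The real parameters of the algorithm: proximal weight `γ`, SVRG step size `η`, accuracies
`ε k` of the proximal subproblems, and number `K t` of inner iterations in outer iteration `t`. -/
structure Tuning where
  γ : ℝ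
  η : ℝ
  ε : ℕ → ℝ
  K : ℕ → ℕ

section Algorithm

variable {n d : ℕ} {Y : Type*} (p : ERM n d Y) (z : Sizes n) (τ : Tuning) (θ₀ : E d)

/-- The inner iterates of outer iteration `t`, started at `w`: the quadratic-loss algorithm on
the quadratic model of the risk at `w`. -/
def innerRun (ω : Outcome z) (t : ℕ) (w : E d) : ℕ → E d :=
  innerIter (p.qComponent w) (batch ω t) (minibatch ω t) τ.γ τ.η τ.ε (sampled ω t) (picked ω t) w

/-- The outer iterates `θ_t`. -/
def outerRun (ω : Outcome z) : ℕ → E d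
  | 0 => θ₀
  | t + 1 => innerRun p z τ ω (t + 1) (outerRun ω t) (τ.K (t + 1))

/-- Number of oracle calls in the first `T` outer iterations. -/
def oracleCalls (ω : Outcome z) (T : ℕ) : ℕ∞ :=
  ∑ t ∈ Finset.range T, ∑ k ∈ Finset.range (τ.K (t + 1)),
    iterCalls (p.qComponent (outerRun p z τ θ₀ ω t)) (batch ω (t + 1)) (minibatch ω (t + 1))
      τ.γ τ.η τ.ε z.m (sampled ω (t + 1)) (picked ω (t + 1)) (outerRun p z τ θ₀ ω t) k

end Algorithm

/-! ### The choice of the parameters -/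

/-- Batch size `s = ν n^{3/4} log^{1/2} d / log^{3/2} n ∧ n`, rounded up. -/
def batchSize (n d : ℕ) (ν : ℝ) : ℕ :=
  min ⌈ν * (n : ℝ) ^ (3 / 4 : ℝ) * √(Real.log d) / Real.log n ^ (3 / 2 : ℝ)⌉₊ n

/-- Proximal weight `γ = (√log d + √2) L r² / √s`. -/
def proxWeight (d s : ℕ) (L r : ℝ) : ℝ :=
  (√(Real.log d) + √2) * L * r ^ 2 / √(s : ℝ)

/-- Minibatch sizes `16 ν² (μ + 2γ)² / μ² exp(μ k / (μ + 2γ)) ∧ n`, rounded up. -/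
def miniSize (n : ℕ) (ν μ γ : ℝ) (k : ℕ) : ℕ :=
  min ⌈16 * ν ^ 2 * (μ + 2 * γ) ^ 2 / μ ^ 2 * Real.exp (μ * k / (μ + 2 * γ))⌉₊ n

/-- Accuracies `ε_k = μ^{3/2} / (4 (μ + 2γ)) exp(-μ (k - 1) / (2 (μ + 2γ)))` of the proximal
subproblems. -/
def proxAccuracy (μ γ : ℝ) (k : ℕ) : ℝ :=
  μ ^ (3 / 2 : ℝ) / (4 * (μ + 2 * γ)) * Real.exp (-(μ * ((k : ℝ) - 1) / (2 * (μ + 2 * γ))))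

/-- Accuracies `ε'_t = σ / (2L) exp(-σ t / (2L))` of the quadratic models. -/
def modelAccuracy (σ L : ℝ) (t : ℕ) : ℝ :=
  σ / (2 * L) * Real.exp (-(σ * t / (2 * L)))

/-- Number of inner iterations `(μ + 2γ) / μ · log(ζ / ε'_t)`, rounded up. -/
def innerCount (σ L μ γ ζ : ℝ) (t : ℕ) : ℕ :=
  ⌈(μ + 2 * γ) / μ * Real.log (ζ / modelAccuracy σ L t)⌉₊

/-- Number of outer iterations `2L/σ · log((1 + Δ) √n)`, rounded up. -/
def outerCount (n : ℕ) (σ L Δ : ℝ) : ℕ :=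
  ⌈2 * L / σ * Real.log ((1 + Δ) * √(n : ℝ))⌉₊

/-- The tuned real parameters. The components of the proximal subproblems are
`(L r² + μ + γ)`-smooth and `(μ + γ)`-strongly convex; the SVRG step size is
`1 / (10 (L r² + μ + γ))`. -/
def tuning (s d : ℕ) (σ L r μ ζ : ℝ) : Tuning :=
  let γ := proxWeight d s L r
  { γ := γ
    η := 1 / (10 * (L * r ^ 2 + μ + γ))
    ε := proxAccuracy μ γ
    K := innerCount σ L μ γ ζ }

/-- The tuned sizes; the SVRG epoch length is `50 (L r² + μ + γ) / (μ + γ)`, rounded up. -/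
def IsTunedSizes {n : ℕ} (z : Sizes n) (d : ℕ) (L r μ ν : ℝ) : Prop :=
  let γ := proxWeight d z.s L r
  z.s = batchSize n d ν ∧ (∀ k, z.b k = miniSize n ν μ γ k) ∧
    z.m = ⌈50 * (L * r ^ 2 + μ + γ) / (μ + γ)⌉₊

/-- The order of the number of oracle calls,
`ν^{0.5} n^{0.875} log^{0.75} d log^{2.25} n + ν² n^{0.5}`. -/
def callOrder (n d : ℕ) (ν : ℝ) : ℝ :=
  ν ^ (0.5 : ℝ) * (n : ℝ) ^ (0.875 : ℝ) * Real.log d ^ (0.75 : ℝ) * Real.log n ^ (2.25 : ℝ)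
    + ν ^ 2 * (n : ℝ) ^ (0.5 : ℝ)

end

end HSDMPG

namespace HSDMPG

noncomputable section

open Matrix

/-! ### Trace inequalities for symmetric real matrices. -/

section Trace

variable {m : Type*} [Fintype m] [DecidableEq m]

/-! The outer loop is an inexact majorization scheme. Smoothness of the losses makes Q_w a majorant
of F, and strong convexity gives a minorant in which the same quadratic form is scaled by a = σ/L.
Testing the model at w + a(θ* - w) shows that minimizing Q_w up to an error δ gives F(θ) - F* ≤ (1 -
a)(F(w) - F*) + δ (`ERM.risk_sub_le`). With δ = (a/2) exp(-at/2) the expected gap is at most (1 + Δ)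
exp(-at/2) (`lintegral_risk_outerRun_le`), and T is the time at which this reaches 1/√n. What
remains is one outer iteration: a quadratic with Hessian H = H̄, started from an error that is
bounded in expectation.

An inner iteration is gradient descent preconditioned by G_S, the Hessian over the batch plus γ, and
perturbed by the minibatch noise and the SVRG residual. If G_S is within relative error 1/5 of its
full-sample counterpart (`ERM.IsGood`), then diagonalizing G_S and H simultaneously gives the
contraction factor 1 - 3ρ/4 in the energy norm, where ρ = μ/(μ + 2γ) (`ERM.IsGood.step_le`). After
squaring with Young's inequality the rate is still exp(-ρ) with some slack (`contraction_add_le`).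
Minibatches growing like exp(ρk) and squared accuracies shrinking like exp(-ρk) keep the
perturbation below that slack.

The batch is fixed throughout an outer iteration, so bad batches have to be paid for. On them the
excess grows by at most a factor Γ = 256(1 + Lr²/μ)³ per iteration
(`setLIntegral_excess_succ_le_of_any`), and it suffices that P(bad)·(3Γ)^K is bounded. The variance
assumption is an expectation over all draws and says nothing about a rare event. There the variance
is compared with its value at the start of the outer iteration, which is independent of the batch,
so that P(bad) factors out.

That P(bad) is exponentially small is a concentration theorem for sampling without replacement,
proved with matrix exchangeable pairs: exchanging a member of the batch with a nonmember gives a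
recursion for the trace moments of the deviation (`devMoment_succ_le`). It starts from the second
moment, so no dimension factor appears (`card_bad_subsets_le`). The choice of γ permits q of order
√(s log d) moments and hence P(bad) ≤ 25·3^(-q), while q of order K log n, that is √(n log d / s)
log² n, is required. The two are compatible once s ≥ C √n log² n, which holds for large n
(`exists_exponent`).

An epoch of SVRG at least halves the expected gap of the proximal objective, so the expected number
of epochs is logarithmic in the ratio of the starting gap to ε_k², and this ratio is bounded
uniformly in k (`lintegral_epochs_le_of_excess`). The same bound shows that SVRG stops almost
surely, which is needed before its output can be used. Error bounds and epoch bounds are therefore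
proved in a single induction, `lintegral_excess_le`.

For the cost put h = √(n log d / s); then 1/ρ = O(h). There are O(log n) outer iterations with O(h
log n) inner iterations each, and each needs O(log n) epochs of cost O(s), apart from a correction
when the batch size is capped at n. The batches thus cost s h log³ n and the minibatches ν² √n h³
(`sum_cost_le`). The prescribed s balances the two. -/

theorem exists_orthogonal_diagonalization {A : Matrix m m ℝ} (hA : A.IsSymm) :
    ∃ (U : Matrix m m ℝ) (α : m → ℝ), Uᵀ * U = 1 ∧ U * Uᵀ = 1 ∧ A = U * diagonal α * Uᵀ := by
  have hA' : A.IsHermitian := by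
    rw [Matrix.IsHermitian, conjTranspose_eq_transpose_of_trivial]; exact hA
  refine ⟨hA'.eigenvectorUnitary, hA'.eigenvalues, ?_, ?_, ?_⟩
  · have := Unitary.coe_star_mul_self hA'.eigenvectorUnitary
    rwa [star_eq_conjTranspose, conjTranspose_eq_transpose_of_trivial] at this
  · have := Unitary.coe_mul_star_self hA'.eigenvectorUnitary
    rwa [Unitary.coe_star, star_eq_conjTranspose, conjTranspose_eq_transpose_of_trivial] at this
  · have := hA'.spectral_theorem
    rw [Unitary.conjStarAlgAut_apply, star_eq_conjTranspose,
      conjTranspose_eq_transpose_of_trivial] at this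
    exact this

theorem orthogonal_conj_diagonal_pow {U : Matrix m m ℝ} (hU : Uᵀ * U = 1) (hU' : U * Uᵀ = 1)
    (α : m → ℝ) (j : ℕ) :
    (U * diagonal α * Uᵀ) ^ j = U * diagonal (fun a => α a ^ j) * Uᵀ := by
  induction j with
  | zero => simp [hU']
  | succ j ih =>
    rw [pow_succ, ih]
    calc U * diagonal (fun a => α a ^ j) * Uᵀ * (U * diagonal α * Uᵀ)
        = U * diagonal (fun a => α a ^ j) * (Uᵀ * U) * diagonal α * Uᵀ := by
          simp only [Matrix.mul_assoc]
      _ = _ := by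
          rw [hU, Matrix.mul_one, Matrix.mul_assoc U, diagonal_mul_diagonal]
          simp [pow_succ]

/-- The joint spectral weights of two symmetric matrices. -/
theorem exists_trace_pow_mul_pow {A B : Matrix m m ℝ} (hA : A.IsSymm) (hB : B.IsSymm) :
    ∃ (α β : m → ℝ) (w : m → m → ℝ), ∀ j l : ℕ,
      trace (A ^ j * B ^ l) = ∑ a, ∑ b, α a ^ j * β b ^ l * w a b ^ 2 := by
  obtain ⟨U, α, hU, hU', rfl⟩ := exists_orthogonal_diagonalization hA
  obtain ⟨V, β, hV, hV', rfl⟩ := exists_orthogonal_diagonalization hB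
  -- The weights are the squared overlaps of the two eigenbases. They do not depend on j and l, so a
  -- linear combination of such traces is a nonnegatively weighted sum of a polynomial over pairs of
  -- eigenvalues, although A and B need not commute.
  refine ⟨α, β, Uᵀ * V, fun j l => ?_⟩
  rw [orthogonal_conj_diagonal_pow hU hU', orthogonal_conj_diagonal_pow hV hV']
  have : trace (U * diagonal (fun a => α a ^ j) * Uᵀ * (V * diagonal (fun a => β a ^ l) * Vᵀ))
      = trace (diagonal (fun a => α a ^ j) * (Uᵀ * V) *
          (diagonal (fun a => β a ^ l) * (Uᵀ * V)ᵀ)) := by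
    rw [Matrix.mul_assoc U, Matrix.mul_assoc U, trace_mul_comm U]
    simp only [Matrix.mul_assoc, transpose_mul, transpose_transpose]
  rw [this, trace]
  refine Finset.sum_congr rfl fun a _ => ?_
  rw [diag_apply, mul_apply]
  refine Finset.sum_congr rfl fun b _ => ?_
  rw [diagonal_mul, diagonal_mul, transpose_apply]
  ring

/-- The left side is (a - b)² times a geometric sum. Each term a^i b^j of that sum is paired with
its mirror image, and a^i b^j + a^j b^i ≤ a^(i+j) + b^(i+j) because the powers of |a| and |b| are
ordered alike. Signs do not matter since i + j = 2k is even. -/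
theorem sub_mul_pow_sub_pow_le (a b : ℝ) (k : ℕ) :
    (a - b) * (a ^ (2 * k + 1) - b ^ (2 * k + 1)) ≤
      (2 * k + 1) / 2 * ((a - b) ^ 2 * (a ^ (2 * k) + b ^ (2 * k))) := by
  have key : ∀ i ∈ Finset.range (2 * k + 1), a ^ i * b ^ (2 * k + 1 - 1 - i)
      + a ^ (2 * k + 1 - 1 - i) * b ^ i ≤ a ^ (2 * k) + b ^ (2 * k) := by
    intro i hi
    have hi' : i ≤ 2 * k := by simpa [Nat.lt_succ_iff] using hi
    obtain ⟨j, hj⟩ := Nat.exists_eq_add_of_le hi'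
    have e : 2 * k + 1 - 1 - i = j := by omega
    rw [e, hj]
    have h1 : a ^ i * b ^ j + a ^ j * b ^ i ≤ |a| ^ i * |b| ^ j + |a| ^ j * |b| ^ i := by
      refine add_le_add ?_ ?_ <;>
      · refine (le_abs_self _).trans (le_of_eq ?_)
        rw [abs_mul, abs_pow, abs_pow]
    have h2 : 0 ≤ (|a| ^ i - |b| ^ i) * (|a| ^ j - |b| ^ j) := by
      rcases le_total |a| |b| with h | h
      · exact mul_nonneg_of_nonpos_of_nonpos
          (sub_nonpos.2 (pow_le_pow_left₀ (abs_nonneg _) h _))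
          (sub_nonpos.2 (pow_le_pow_left₀ (abs_nonneg _) h _))
      · exact mul_nonneg (sub_nonneg.2 (pow_le_pow_left₀ (abs_nonneg _) h _))
          (sub_nonneg.2 (pow_le_pow_left₀ (abs_nonneg _) h _))
    have hev : Even (i + j) := by rw [← hj]; exact even_two_mul k
    have h3 : |a| ^ i * |a| ^ j = a ^ (i + j) := by rw [← pow_add, hev.pow_abs]
    have h4 : |b| ^ i * |b| ^ j = b ^ (i + j) := by rw [← pow_add, hev.pow_abs]
    nlinarith
  have hsum := Finset.sum_le_sum key
  rw [Finset.sum_add_distrib, Finset.sum_const, Finset.card_range, nsmul_eq_mul] at hsum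
  have hsym : ∑ i ∈ Finset.range (2 * k + 1), a ^ (2 * k + 1 - 1 - i) * b ^ i
      = ∑ i ∈ Finset.range (2 * k + 1), a ^ i * b ^ (2 * k + 1 - 1 - i) := by
    rw [← Finset.sum_range_reflect]
    refine Finset.sum_congr rfl fun i hi => ?_
    have hi' : i ≤ 2 * k := by simpa [Nat.lt_succ_iff] using hi
    congr 2; omega
  rw [hsym] at hsum
  have hg := (Commute.all a b).geom_sum₂_mul (2 * k + 1)
  have : (a - b) * (a ^ (2 * k + 1) - b ^ (2 * k + 1)) = (a - b) ^ 2 *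
      ∑ i ∈ Finset.range (2 * k + 1), a ^ i * b ^ (2 * k + 1 - 1 - i) := by
    rw [← hg]; ring
  rw [this]
  have h := mul_le_mul_of_nonneg_left hsum (sq_nonneg (a - b))
  rw [Nat.cast_add, Nat.cast_mul, Nat.cast_one, Nat.cast_ofNat] at h
  linarith

/-- Mean value trace inequality for odd powers. -/
theorem trace_sub_mul_pow_sub_pow_le {A B : Matrix m m ℝ} (hA : A.IsSymm) (hB : B.IsSymm)
    (k : ℕ) :
    trace ((A - B) * (A ^ (2 * k + 1) - B ^ (2 * k + 1))) ≤
      (2 * k + 1) / 2 *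
        (trace ((A - B) ^ 2 * A ^ (2 * k)) + trace ((A - B) ^ 2 * B ^ (2 * k))) := by
  obtain ⟨α, β, w, h⟩ := exists_trace_pow_mul_pow hA hB
  -- Cyclicity of the trace brings every word to the form A^j B^l. The inequality then becomes the
  -- scalar one, summed against the joint spectral weights.
  have e1 : trace ((A - B) * (A ^ (2 * k + 1) - B ^ (2 * k + 1)))
      = ∑ a, ∑ b, (α a - β b) * (α a ^ (2 * k + 1) - β b ^ (2 * k + 1)) * w a b ^ 2 := by
    have : trace ((A - B) * (A ^ (2 * k + 1) - B ^ (2 * k + 1)))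
        = trace (A ^ (2 * k + 2) * B ^ 0) - trace (A ^ 1 * B ^ (2 * k + 1))
          - trace (A ^ (2 * k + 1) * B ^ 1) + trace (A ^ 0 * B ^ (2 * k + 2)) := by
      rw [Matrix.sub_mul, Matrix.mul_sub, Matrix.mul_sub, trace_sub, trace_sub, trace_sub,
        trace_mul_comm B (A ^ _)]
      simp only [pow_zero, mul_one, one_mul, pow_one, ← pow_succ']
      ring
    rw [this, h, h, h, h, ← Finset.sum_sub_distrib, ← Finset.sum_sub_distrib,
      ← Finset.sum_add_distrib]
    refine Finset.sum_congr rfl fun a _ => ?_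
    rw [← Finset.sum_sub_distrib, ← Finset.sum_sub_distrib, ← Finset.sum_add_distrib]
    exact Finset.sum_congr rfl fun b _ => by ring
  have e2 : trace ((A - B) ^ 2 * A ^ (2 * k))
      = ∑ a, ∑ b, (α a - β b) ^ 2 * α a ^ (2 * k) * w a b ^ 2 := by
    have : trace ((A - B) ^ 2 * A ^ (2 * k))
        = trace (A ^ (2 * k + 2) * B ^ 0) - 2 * trace (A ^ (2 * k + 1) * B ^ 1)
          + trace (A ^ (2 * k) * B ^ 2) := by
      have e : (A - B) ^ 2 * A ^ (2 * k) = A ^ 2 * A ^ (2 * k) - A * (B * A ^ (2 * k))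
          - B * (A * A ^ (2 * k)) + B ^ 2 * A ^ (2 * k) := by noncomm_ring
      rw [e, trace_add, trace_sub, trace_sub, trace_mul_comm A (B * _), Matrix.mul_assoc B,
        ← pow_succ, ← pow_succ', trace_mul_comm B, trace_mul_comm (B ^ 2), ← pow_add,
        add_comm 2 (2 * k), pow_zero, mul_one, pow_one]
      ring
    rw [this, h, h, h, Finset.mul_sum, ← Finset.sum_sub_distrib, ← Finset.sum_add_distrib]
    refine Finset.sum_congr rfl fun a _ => ?_
    rw [Finset.mul_sum, ← Finset.sum_sub_distrib, ← Finset.sum_add_distrib]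
    exact Finset.sum_congr rfl fun b _ => by ring
  have e3 : trace ((A - B) ^ 2 * B ^ (2 * k))
      = ∑ a, ∑ b, (α a - β b) ^ 2 * β b ^ (2 * k) * w a b ^ 2 := by
    have : trace ((A - B) ^ 2 * B ^ (2 * k))
        = trace (A ^ 2 * B ^ (2 * k)) - 2 * trace (A ^ 1 * B ^ (2 * k + 1))
          + trace (A ^ 0 * B ^ (2 * k + 2)) := by
      have e : (A - B) ^ 2 * B ^ (2 * k) = A ^ 2 * B ^ (2 * k) - A * (B * B ^ (2 * k))
          - B * (A * B ^ (2 * k)) + B ^ 2 * B ^ (2 * k) := by noncomm_ring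
      rw [e, trace_add, trace_sub, trace_sub, trace_mul_comm B (A * _), Matrix.mul_assoc A,
        ← pow_succ, ← pow_succ', ← pow_add,
        add_comm 2 (2 * k), pow_zero, one_mul, pow_one]
      ring
    rw [this, h, h, h, Finset.mul_sum, ← Finset.sum_sub_distrib, ← Finset.sum_add_distrib]
    refine Finset.sum_congr rfl fun a _ => ?_
    rw [Finset.mul_sum, ← Finset.sum_sub_distrib, ← Finset.sum_add_distrib]
    exact Finset.sum_congr rfl fun b _ => by ring
  rw [e1, e2, e3, ← Finset.sum_add_distrib, Finset.mul_sum]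
  refine Finset.sum_le_sum fun a _ => ?_
  rw [← Finset.sum_add_distrib, Finset.mul_sum]
  refine Finset.sum_le_sum fun b _ => ?_
  have := mul_le_mul_of_nonneg_right (sub_mul_pow_sub_pow_le (α a) (β b) k) (sq_nonneg (w a b))
  linarith

theorem trace_sq_mul_sq_nonneg {C Z : Matrix m m ℝ} (hC : C.IsSymm) (hZ : Z.IsSymm) :
    0 ≤ trace (C ^ 2 * Z ^ 2) := by
  have h := (posSemidef_conjTranspose_mul_self (C * Z)).trace_nonneg
  rw [conjTranspose_eq_transpose_of_trivial, transpose_mul, hC.eq, hZ.eq] at h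
  calc (0 : ℝ) ≤ _ := h
    _ = _ := by
      rw [Matrix.mul_assoc, trace_mul_comm Z]
      simp only [pow_two, Matrix.mul_assoc]

theorem isSymm_pow {Z : Matrix m m ℝ} (hZ : Z.IsSymm) (k : ℕ) : (Z ^ k).IsSymm := by
  rw [Matrix.IsSymm, transpose_pow, hZ.eq]

/-- The traces of (X ± 1)² X^(2k) are nonnegative: this is |x| ≤ (1 + x²)/2 with weight x^(2k). -/
theorem abs_trace_odd_le {X : Matrix m m ℝ} (hX : X.IsSymm) (k : ℕ) :
    |trace (X * X ^ (2 * k))| ≤ (trace (X ^ (2 * k)) + trace (X ^ (2 * (k + 1)))) / 2 := by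
  have h1 := trace_sq_mul_sq_nonneg (C := X - 1) (hX.sub isSymm_one) (isSymm_pow hX k)
  have h2 := trace_sq_mul_sq_nonneg (C := X + 1) (hX.add isSymm_one) (isSymm_pow hX k)
  have e : X ^ (2 * (k + 1)) = X ^ 2 * X ^ (2 * k) := by rw [← pow_add]; congr 1; ring
  rw [← pow_mul, mul_comm k 2] at h1 h2
  have e1 : (X - 1) ^ 2 * X ^ (2 * k) = X ^ 2 * X ^ (2 * k) - (2 : ℝ) • (X * X ^ (2 * k))
      + X ^ (2 * k) := by
    rw [two_smul]; noncomm_ring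
  have e2 : (X + 1) ^ 2 * X ^ (2 * k) = X ^ 2 * X ^ (2 * k) + (2 : ℝ) • (X * X ^ (2 * k))
      + X ^ (2 * k) := by
    rw [two_smul]; noncomm_ring
  rw [e1, trace_add, trace_sub, trace_smul, smul_eq_mul] at h1
  rw [e2, trace_add, trace_add, trace_smul, smul_eq_mul] at h2
  rw [e, abs_le]
  constructor <;> linarith

theorem trace_mul_sq_le {P Z : Matrix m m ℝ} (hP : (1 - P).PosSemidef) (hZ : Z.IsSymm) :
    trace (P * Z ^ 2) ≤ trace (Z ^ 2) := by
  have h := (hP.conjTranspose_mul_mul_same Z).trace_nonneg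
  rw [conjTranspose_eq_transpose_of_trivial, hZ.eq, trace_mul_comm, ← Matrix.mul_assoc, ← pow_two,
    trace_mul_comm, Matrix.sub_mul, Matrix.one_mul, trace_sub] at h
  linarith

theorem trace_vecMulVec_mul_sq (a : m → ℝ) {Z : Matrix m m ℝ} (hZ : Z.IsSymm) :
    trace (vecMulVec a a * Z ^ 2) = (Z *ᵥ a) ⬝ᵥ (Z *ᵥ a) := by
  rw [pow_two, ← Matrix.mul_assoc, trace_mul_comm, ← Matrix.mul_assoc, mul_vecMulVec, vecMulVec_mul,
    trace_vecMulVec, ← mulVec_transpose, hZ.eq]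

theorem vecMulVec_sq (a : m → ℝ) :
    vecMulVec a a ^ 2 = (a ⬝ᵥ a) • vecMulVec a a := by
  rw [pow_two, vecMulVec_mul_vecMulVec, vecMulVec_smul]

/-- A symmetric matrix with a large quadratic form has large even power traces. -/
theorem pow_le_trace_pow {X : Matrix m m ℝ} (hX : X.IsSymm) {δ : ℝ} (hδ : 0 ≤ δ) {u : m → ℝ}
    (hu : δ * (u ⬝ᵥ u) < |u ⬝ᵥ X *ᵥ u|) (q : ℕ) : δ ^ (2 * q) ≤ trace (X ^ (2 * q)) := by
  obtain ⟨U, α, hU, hU', rfl⟩ := exists_orthogonal_diagonalization hX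
  set v := Uᵀ *ᵥ u with hv
  have h1 : u ⬝ᵥ (U * diagonal α * Uᵀ) *ᵥ u = ∑ a, α a * v a ^ 2 := by
    rw [← mulVec_mulVec, ← mulVec_mulVec, dotProduct_mulVec, ← mulVec_transpose, ← hv]
    simp only [dotProduct, mulVec_diagonal]
    exact Finset.sum_congr rfl fun a _ => by ring
  have h2 : u ⬝ᵥ u = ∑ a, v a ^ 2 := by
    have : v ⬝ᵥ v = u ⬝ᵥ u := by
      rw [hv, dotProduct_mulVec, vecMul_transpose, mulVec_mulVec, hU', one_mulVec]
    rw [← this]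
    simp only [dotProduct, pow_two]
  -- If all eigenvalues were below δ in modulus, the form at `u` could not exceed δ times the
  -- squared norm. A single large eigenvalue suffices, since the other even powers are nonnegative.
  have hex : ∃ a, δ ≤ |α a| := by
    by_contra! hcon
    refine absurd hu (not_lt.2 ?_)
    rw [h1, h2, Finset.mul_sum]
    refine (Finset.abs_sum_le_sum_abs _ _).trans (Finset.sum_le_sum fun a _ => ?_)
    rw [abs_mul, abs_of_nonneg (sq_nonneg (v a))]
    exact mul_le_mul_of_nonneg_right (hcon a).le (sq_nonneg _)
  obtain ⟨a, ha⟩ := hex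
  have h3 : trace ((U * diagonal α * Uᵀ) ^ (2 * q)) = ∑ a, α a ^ (2 * q) := by
    rw [orthogonal_conj_diagonal_pow hU hU', Matrix.mul_assoc, trace_mul_comm, Matrix.mul_assoc, hU,
      Matrix.mul_one, trace_diagonal]
  rw [h3]
  calc δ ^ (2 * q) ≤ |α a| ^ (2 * q) := pow_le_pow_left₀ hδ ha _
    _ = α a ^ (2 * q) := (even_two_mul q).pow_abs _
    _ ≤ _ := Finset.single_le_sum (f := fun a => α a ^ (2 * q))
      (fun b _ => (even_two_mul q).pow_nonneg _) (Finset.mem_univ a)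

end Trace

/-! ### Spectral concentration for sampling without replacement, by exchangeable pairs. -/

section Swap

variable {ι : Type*} [Fintype ι] [DecidableEq ι]

/-- Exchanging a member of a random subset with a nonmember gives an exchangeable pair. -/
theorem sum_swap (s : ℕ) (f : Finset ι → Finset ι → ι → ι → ℝ) :
    ∑ S ∈ Finset.powersetCard s (Finset.univ : Finset ι), ∑ i ∈ S, ∑ j ∈ Sᶜ,
        f S (insert j (S.erase i)) i j =
      ∑ S ∈ Finset.powersetCard s (Finset.univ : Finset ι), ∑ i ∈ S, ∑ j ∈ Sᶜ,
        f (insert j (S.erase i)) S j i := by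
  simp only [Finset.sum_sigma']
  -- The map (S, i, j) ↦ (S - i + j, j, i) is an involution of the admissible triples.
  have key : ∀ (S : Finset ι) (i j : ι), S.card = s ∧ i ∈ S ∧ j ∉ S →
      ((insert j (S.erase i)).card = s ∧ j ∈ insert j (S.erase i) ∧ i ∉ insert j (S.erase i)) ∧
        insert i ((insert j (S.erase i)).erase j) = S := by
    rintro S i j ⟨hS, hi, hj⟩
    have hij : i ≠ j := fun h => hj (h ▸ hi)
    refine ⟨⟨?_, by simp, by simp [hij]⟩, ?_⟩
    · rw [Finset.card_insert_of_notMem (by simp [hj]), Finset.card_erase_add_one hi, hS]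
    · rw [Finset.erase_insert (by simp [hj]), Finset.insert_erase hi]
  refine Finset.sum_bij' (fun x _ => ⟨insert x.2.2 (x.1.erase x.2.1), x.2.2, x.2.1⟩)
    (fun x _ => ⟨insert x.2.2 (x.1.erase x.2.1), x.2.2, x.2.1⟩) ?_ ?_ ?_ ?_ ?_
  all_goals
    rintro ⟨S, i, j⟩ h
    have h' : S.card = s ∧ i ∈ S ∧ j ∉ S := by simpa using h
    have h2 := key S i j h'
  · simpa using h2.1
  · simpa using h2.1
  · simp only [h2.2]
  · simp only [h2.2]
  · simp only [h2.2]

end Swap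

section Moments

variable {ι m : Type*} [Fintype ι] [DecidableEq ι] [Fintype m] [DecidableEq m]

/-- The deviation of the average of `aᵢ aᵢᵀ` over `S` from its average over all indices. -/
def covDev (a : ι → m → ℝ) (S : Finset ι) : Matrix m m ℝ :=
  (S.card : ℝ)⁻¹ • ∑ i ∈ S, vecMulVec (a i) (a i) -
    (Fintype.card ι : ℝ)⁻¹ • ∑ i, vecMulVec (a i) (a i)

omit [Fintype m] [DecidableEq m] in
theorem isSymm_vecMulVec (v : m → ℝ) : (vecMulVec v v).IsSymm := by
  rw [Matrix.IsSymm, transpose_vecMulVec]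

omit [Fintype ι] [DecidableEq ι] [Fintype m] [DecidableEq m] in
theorem isSymm_sum_vecMulVec (a : ι → m → ℝ) (S : Finset ι) :
    (∑ i ∈ S, vecMulVec (a i) (a i)).IsSymm := by
  rw [Matrix.IsSymm, transpose_sum]
  exact Finset.sum_congr rfl fun i _ => isSymm_vecMulVec _

omit [DecidableEq ι] in
theorem isSymm_covDev (a : ι → m → ℝ) (S : Finset ι) : (covDev a S).IsSymm :=
  ((isSymm_sum_vecMulVec a S).smul _).sub ((isSymm_sum_vecMulVec a _).smul _)

omit [Fintype m] [DecidableEq m] in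
theorem covDev_sub_swap (a : ι → m → ℝ) {S : Finset ι} {i j : ι} (hi : i ∈ S) (hj : j ∉ S) :
    covDev a S - covDev a (insert j (S.erase i)) =
      (S.card : ℝ)⁻¹ • (vecMulVec (a i) (a i) - vecMulVec (a j) (a j)) := by
  have hc : (insert j (S.erase i)).card = S.card := by
    rw [Finset.card_insert_of_notMem (by simp [hj]), Finset.card_erase_add_one hi]
  rw [covDev, covDev, hc, Finset.sum_insert (by simp [hj]), ← Finset.add_sum_erase S _ hi]
  simp only [smul_add, smul_sub]
  abel

omit [Fintype m] [DecidableEq m] in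
theorem sum_compl_vecMulVec (a : ι → m → ℝ) (S : Finset ι) :
    ∑ j ∈ Sᶜ, vecMulVec (a j) (a j) =
      ∑ j, vecMulVec (a j) (a j) - ∑ i ∈ S, vecMulVec (a i) (a i) := by
  rw [← Finset.sum_add_sum_compl S]; abel

-- Stein's linear regression property: the increments over all swaps add up to a multiple of the
-- deviation itself, so a factor X in a moment can be replaced by increments.
omit [Fintype m] [DecidableEq m] in
theorem sum_covDev_sub_swap (a : ι → m → ℝ) {S : Finset ι} (hS : 0 < S.card) :
    ∑ i ∈ S, ∑ j ∈ Sᶜ, (covDev a S - covDev a (insert j (S.erase i))) =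
      (Fintype.card ι : ℝ) • covDev a S := by
  have h1 : ∑ i ∈ S, ∑ j ∈ Sᶜ, (covDev a S - covDev a (insert j (S.erase i))) =
      ∑ i ∈ S, ∑ j ∈ Sᶜ, (S.card : ℝ)⁻¹ • (vecMulVec (a i) (a i) - vecMulVec (a j) (a j)) :=
    Finset.sum_congr rfl fun i hi => Finset.sum_congr rfl fun j hj =>
      covDev_sub_swap a hi (by simpa using hj)
  have hs : (S.card : ℝ) ≠ 0 := by positivity
  have hn : (Fintype.card ι : ℝ) ≠ 0 := by
    have := S.card_le_univ
    exact_mod_cast (by omega : Fintype.card ι ≠ 0)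
  rw [h1]
  simp only [← Finset.smul_sum, Finset.sum_sub_distrib, Finset.sum_const, Finset.card_compl,
    sum_compl_vecMulVec]
  rw [covDev]
  set P := ∑ i ∈ S, vecMulVec (a i) (a i)
  set Q := ∑ i, vecMulVec (a i) (a i)
  ext x y
  simp only [Matrix.smul_apply, Matrix.sub_apply, smul_eq_mul, ← Nat.cast_smul_eq_nsmul ℝ,
    Nat.cast_sub S.card_le_univ]
  field_simp
  ring

/-- The moments of the deviation for sampling without replacement. -/
def devMoment (a : ι → m → ℝ) (s q : ℕ) : ℝ :=
  ∑ S ∈ Finset.powersetCard s (Finset.univ : Finset ι), trace (covDev a S ^ (2 * q))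

theorem trace_even_nonneg {X : Matrix m m ℝ} (hX : X.IsSymm) (q : ℕ) :
    0 ≤ trace (X ^ (2 * q)) := by
  have := trace_sq_mul_sq_nonneg (isSymm_one (n := m) (α := ℝ)) (isSymm_pow hX q)
  rwa [one_pow, one_mul, ← pow_mul, mul_comm] at this

theorem devMoment_nonneg (a : ι → m → ℝ) (s q : ℕ) : 0 ≤ devMoment a s q :=
  Finset.sum_nonneg fun _ _ => trace_even_nonneg (isSymm_covDev _ _) _

/-- One factor of X^(2k+2) is replaced by its increments X - X'. Exchangeability turns the sum into
half the sum of tr((X - X')(X^(2k+1) - X'^(2k+1))), the mean value trace inequality applies, and its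
two terms contribute equally, again by exchangeability. -/
theorem card_mul_devMoment_le (a : ι → m → ℝ) {s : ℕ} (hs : 0 < s) (k : ℕ) :
    (Fintype.card ι : ℝ) * devMoment a s (k + 1) ≤
      (2 * k + 1) / 2 * ∑ S ∈ Finset.powersetCard s (Finset.univ : Finset ι), ∑ i ∈ S, ∑ j ∈ Sᶜ,
        trace ((covDev a S - covDev a (insert j (S.erase i))) ^ 2 * covDev a S ^ (2 * k)) := by
  have h1 : (Fintype.card ι : ℝ) * devMoment a s (k + 1) =
      ∑ S ∈ Finset.powersetCard s (Finset.univ : Finset ι), ∑ i ∈ S, ∑ j ∈ Sᶜ,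
        trace ((covDev a S - covDev a (insert j (S.erase i))) * covDev a S ^ (2 * k + 1)) := by
    rw [devMoment, Finset.mul_sum]
    refine Finset.sum_congr rfl fun S hS => ?_
    have hc : S.card = s := (Finset.mem_powersetCard.1 hS).2
    have := sum_covDev_sub_swap a (S := S) (by omega)
    simp only [← trace_sum, ← Finset.sum_mul]
    rw [this, smul_mul_assoc, trace_smul, smul_eq_mul, ← pow_succ', mul_add]
  have h2 := sum_swap s (fun S S' _ _ : _ => trace ((covDev a S - covDev a S') *
    covDev a S ^ (2 * k + 1)))
  have h3 := sum_swap s (fun S S' _ _ : _ => trace ((covDev a S - covDev a S') ^ 2 *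
    covDev a S ^ (2 * k)))
  have h4 : ∑ S ∈ Finset.powersetCard s (Finset.univ : Finset ι), ∑ i ∈ S, ∑ j ∈ Sᶜ,
      trace ((covDev a S - covDev a (insert j (S.erase i))) *
        (covDev a S ^ (2 * k + 1) - covDev a (insert j (S.erase i)) ^ (2 * k + 1))) ≤
      ∑ S ∈ Finset.powersetCard s (Finset.univ : Finset ι), ∑ i ∈ S, ∑ j ∈ Sᶜ,
      (2 * (k : ℝ) + 1) / 2 * (trace ((covDev a S - covDev a (insert j (S.erase i))) ^ 2 *
        covDev a S ^ (2 * k)) + trace ((covDev a S - covDev a (insert j (S.erase i))) ^ 2 *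
        covDev a (insert j (S.erase i)) ^ (2 * k))) :=
    Finset.sum_le_sum fun S _ => Finset.sum_le_sum fun i _ => Finset.sum_le_sum fun j _ =>
      trace_sub_mul_pow_sub_pow_le (isSymm_covDev _ _) (isSymm_covDev _ _) k
  have e5 : ∀ (S T : Finset ι) (i j : ι),
      trace ((covDev a (insert j (S.erase i)) - covDev a T) *
          covDev a (insert j (S.erase i)) ^ (2 * k + 1)) =
        - trace ((covDev a T - covDev a (insert j (S.erase i))) *
          covDev a (insert j (S.erase i)) ^ (2 * k + 1)) := fun S T i j => by
    rw [← trace_neg, ← neg_mul, neg_sub]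
  have e6 : ∀ S T : Finset ι, trace ((covDev a T - covDev a S) ^ 2 * covDev a T ^ (2 * k)) =
      trace ((covDev a S - covDev a T) ^ 2 * covDev a T ^ (2 * k)) := fun S T => by
    rw [← neg_sub, neg_sq]
  simp only [e5] at h2
  simp only [e6] at h3
  simp only [Matrix.mul_sub, trace_sub, ← Finset.mul_sum, Finset.sum_add_distrib,
    Finset.sum_sub_distrib] at h4
  simp only [Finset.sum_neg_distrib] at h2
  rw [← h3] at h4
  rw [h1]
  linarith

omit [DecidableEq ι] [Fintype m] [DecidableEq m] in
theorem sum_vecMulVec_eq_covDev (a : ι → m → ℝ) {S : Finset ι} (hS : 0 < S.card) :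
    ∑ i ∈ S, vecMulVec (a i) (a i) = (S.card : ℝ) • (covDev a S +
      (Fintype.card ι : ℝ)⁻¹ • ∑ i, vecMulVec (a i) (a i)) := by
  have hs : (S.card : ℝ) ≠ 0 := by positivity
  rw [covDev, sub_add_cancel, smul_smul, mul_inv_cancel₀ hs, one_smul]

/-- In (A - B)² = 2A² + 2B² - (A + B)² the last square is dropped, and (aaᵀ)² = |a|² aaᵀ is linear
in aaᵀ up to the factor R. -/
theorem trace_sq_swap_le (a : ι → m → ℝ) {R : ℝ} (hR : ∀ i, a i ⬝ᵥ a i ≤ R) {S : Finset ι}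
    {i j : ι} (hi : i ∈ S) (hj : j ∉ S) {Z : Matrix m m ℝ} (hZ : Z.IsSymm) :
    trace ((covDev a S - covDev a (insert j (S.erase i))) ^ 2 * Z ^ 2) ≤
      2 * R / (S.card : ℝ) ^ 2 *
        (trace (vecMulVec (a i) (a i) * Z ^ 2) + trace (vecMulVec (a j) (a j) * Z ^ 2)) := by
  rw [covDev_sub_swap a hi hj, smul_pow, smul_mul_assoc, trace_smul, smul_eq_mul]
  have h1 := trace_sq_mul_sq_nonneg ((isSymm_vecMulVec (a i)).add (isSymm_vecMulVec (a j))) hZ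
  set A := vecMulVec (a i) (a i)
  set B := vecMulVec (a j) (a j)
  have e : (A - B) ^ 2 * Z ^ 2 = (2 : ℝ) • (A ^ 2 * Z ^ 2) + (2 : ℝ) • (B ^ 2 * Z ^ 2)
      - (A + B) ^ 2 * Z ^ 2 := by
    rw [two_smul, two_smul]; noncomm_ring
  have hb : ∀ v : m → ℝ, v ⬝ᵥ v ≤ R → trace (vecMulVec v v ^ 2 * Z ^ 2) ≤
      R * trace (vecMulVec v v * Z ^ 2) := fun v hv => by
    rw [vecMulVec_sq, smul_mul_assoc, trace_smul, smul_eq_mul]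
    refine mul_le_mul_of_nonneg_right hv ?_
    rw [trace_vecMulVec_mul_sq v hZ]
    exact Finset.sum_nonneg fun x _ => mul_self_nonneg _
  have h2 := hb (a i) (hR i)
  have h3 := hb (a j) (hR j)
  have h4 : trace ((A - B) ^ 2 * Z ^ 2) ≤ 2 * R * (trace (A * Z ^ 2) + trace (B * Z ^ 2)) := by
    rw [e, trace_sub, trace_add, trace_smul, trace_smul, smul_eq_mul, smul_eq_mul]
    linarith
  calc _ ≤ ((S.card : ℝ)⁻¹) ^ 2 * _ := mul_le_mul_of_nonneg_left h4 (by positivity)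
    _ = _ := by rw [inv_pow]; ring

/-- A self-bounding property: the sum of aᵢaᵢᵀ over S equals s(X + Q) with Q ≤ 1, so the variance of
a swap is controlled by the deviation X, which enters linearly. The odd trace that results is split
between the two neighbouring even moments. -/
theorem sum_trace_sq_swap_le (a : ι → m → ℝ) {R : ℝ} (hR0 : 0 ≤ R) (hR : ∀ i, a i ⬝ᵥ a i ≤ R)
    (hA : (1 - (Fintype.card ι : ℝ)⁻¹ • ∑ i, vecMulVec (a i) (a i)).PosSemidef)
    {S : Finset ι} (hS : 0 < S.card) (k : ℕ) :
    ∑ i ∈ S, ∑ j ∈ Sᶜ,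
        trace ((covDev a S - covDev a (insert j (S.erase i))) ^ 2 * covDev a S ^ (2 * k)) ≤
      R * (Fintype.card ι : ℝ) / S.card *
        (5 * trace (covDev a S ^ (2 * k)) + trace (covDev a S ^ (2 * (k + 1)))) := by
  have hZ := isSymm_pow (isSymm_covDev a S) k
  have e : covDev a S ^ (2 * k) = (covDev a S ^ k) ^ 2 := by rw [← pow_mul, mul_comm]
  have hX := abs_le.1 (abs_trace_odd_le (isSymm_covDev a S) k)
  have hP := trace_mul_sq_le hA hZ
  have hT := trace_even_nonneg (isSymm_covDev a S) k
  have hT' := trace_even_nonneg (isSymm_covDev a S) (k + 1)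
  have hsum := sum_vecMulVec_eq_covDev a hS
  have hcomp := sum_compl_vecMulVec a S
  have hs : (0 : ℝ) < S.card := by exact_mod_cast hS
  have hsn : (S.card : ℝ) ≤ Fintype.card ι := by exact_mod_cast S.card_le_univ
  have hn : (0 : ℝ) < Fintype.card ι := hs.trans_le hsn
  rw [← e] at hP
  have h1 : ∑ i ∈ S, ∑ j ∈ Sᶜ,
        trace ((covDev a S - covDev a (insert j (S.erase i))) ^ 2 * covDev a S ^ (2 * k)) ≤
      ∑ i ∈ S, ∑ j ∈ Sᶜ, 2 * R / (S.card : ℝ) ^ 2 *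
        (trace (vecMulVec (a i) (a i) * covDev a S ^ (2 * k)) +
          trace (vecMulVec (a j) (a j) * covDev a S ^ (2 * k))) := by
    refine Finset.sum_le_sum fun i hi => Finset.sum_le_sum fun j hj => ?_
    rw [e]
    exact trace_sq_swap_le a hR hi (by simpa using hj) hZ
  refine h1.trans ?_
  simp only [← Finset.mul_sum, Finset.sum_add_distrib, Finset.sum_const, ← trace_sum,
    ← Finset.sum_mul, Finset.card_compl]
  rw [hcomp, hsum]
  simp only [← Nat.cast_smul_eq_nsmul ℝ, Nat.cast_sub S.card_le_univ,
    smul_eq_mul, ← Finset.mul_sum, ← trace_sum, ← Finset.sum_mul, hsum]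
  have hQ : ∑ i, vecMulVec (a i) (a i) = (Fintype.card ι : ℝ) •
      ((Fintype.card ι : ℝ)⁻¹ • ∑ i, vecMulVec (a i) (a i)) := by
    rw [smul_smul, mul_inv_cancel₀ hn.ne', one_smul]
  set Q := (Fintype.card ι : ℝ)⁻¹ • ∑ i, vecMulVec (a i) (a i)
  rw [hQ]
  simp only [Matrix.sub_mul, Matrix.add_mul, smul_mul_assoc, trace_sub, trace_add, trace_smul,
    smul_eq_mul]
  set x := trace (covDev a S * covDev a S ^ (2 * k))
  set y := trace (Q * covDev a S ^ (2 * k))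
  set z := trace (covDev a S ^ (2 * k))
  set z' := trace (covDev a S ^ (2 * (k + 1)))
  set c : ℝ := (S.card : ℝ)
  set N : ℝ := (Fintype.card ι : ℝ)
  have h2 : 2 * R / c ^ 2 * ((N - c) * (c * (x + y)) + c * (N * y - c * (x + y)))
      = R / c * (2 * (2 * (N - c) * y + (N - 2 * c) * x)) := by
    field_simp; ring
  -- N - 2c can have either sign, so both halves of the bound for the odd trace are used.
  have h3 : (N - 2 * c) * x ≤ N * ((z + z') / 2) := by
    rcases le_total 0 (N - 2 * c) with h | h
    · nlinarith [hX.2]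
    · nlinarith [hX.1]
  have h4 : (N - c) * y ≤ N * z := by nlinarith
  rw [h2]
  calc R / c * (2 * (2 * (N - c) * y + (N - 2 * c) * x)) ≤ R / c * (N * (5 * z + z')) :=
        mul_le_mul_of_nonneg_left (by linarith) (div_nonneg hR0 hs.le)
    _ = _ := by ring

/-- The bound for the moment contains the moment itself with coefficient at most β/2 ≤ 1/2.
Absorbing it on the left at most doubles the remaining factor 5β/2. -/
theorem devMoment_succ_le (a : ι → m → ℝ) {R : ℝ} (hR0 : 0 ≤ R) (hR : ∀ i, a i ⬝ᵥ a i ≤ R)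
    (hA : (1 - (Fintype.card ι : ℝ)⁻¹ • ∑ i, vecMulVec (a i) (a i)).PosSemidef)
    {s : ℕ} (hs : 0 < s) (hsn : s ≤ Fintype.card ι) (k : ℕ) {β : ℝ} (hβ : β ≤ 1)
    (hk : (2 * k + 1) * R / s ≤ β) :
    devMoment a s (k + 1) ≤ 5 * β * devMoment a s k := by
  have h1 := card_mul_devMoment_le a hs k
  have h2 : ∑ S ∈ Finset.powersetCard s (Finset.univ : Finset ι), ∑ i ∈ S, ∑ j ∈ Sᶜ,
        trace ((covDev a S - covDev a (insert j (S.erase i))) ^ 2 * covDev a S ^ (2 * k)) ≤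
      R * (Fintype.card ι : ℝ) / s * (5 * devMoment a s k + devMoment a s (k + 1)) := by
    rw [devMoment, devMoment, Finset.mul_sum, ← Finset.sum_add_distrib, Finset.mul_sum]
    refine Finset.sum_le_sum fun S hS => ?_
    have hc : S.card = s := (Finset.mem_powersetCard.1 hS).2
    have := sum_trace_sq_swap_le a hR0 hR hA (S := S) (by omega) k
    rwa [hc] at this
  have hs' : (0 : ℝ) < s := by exact_mod_cast hs
  have hn : (0 : ℝ) < Fintype.card ι := by exact_mod_cast hs.trans_le hsn
  have h3 := h1.trans (mul_le_mul_of_nonneg_left h2 (by positivity))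
  have hM := devMoment_nonneg a s k
  have hM' := devMoment_nonneg a s (k + 1)
  set M := devMoment a s k
  set M' := devMoment a s (k + 1)
  have h4 : M' ≤ (2 * k + 1) * R / s / 2 * (5 * M + M') := by
    refine le_of_mul_le_mul_left ?_ hn
    calc _ ≤ _ := h3
      _ = _ := by ring
  have h5 : (2 * k + 1) * R / s / 2 * (5 * M + M') ≤ β / 2 * (5 * M + M') :=
    mul_le_mul_of_nonneg_right (by linarith) (by positivity)
  nlinarith

/-- The recursion starts here and not at the zeroth moment, whose trace is the dimension. The
squared Frobenius norm of a swap increment is at most 2R²/s², whatever the dimension. -/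
theorem devMoment_one_le (a : ι → m → ℝ) {R : ℝ} (hR : ∀ i, a i ⬝ᵥ a i ≤ R)
    {s : ℕ} (hs : 0 < s) (hsn : s ≤ Fintype.card ι) :
    devMoment a s 1 ≤ R ^ 2 / s *
      (Finset.powersetCard s (Finset.univ : Finset ι)).card := by
  have h1 := card_mul_devMoment_le a hs 0
  have hs' : (0 : ℝ) < s := by exact_mod_cast hs
  have hn : (0 : ℝ) < Fintype.card ι := by exact_mod_cast hs.trans_le hsn
  have h2 : ∑ S ∈ Finset.powersetCard s (Finset.univ : Finset ι), ∑ i ∈ S, ∑ j ∈ Sᶜ,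
        trace ((covDev a S - covDev a (insert j (S.erase i))) ^ 2 * covDev a S ^ (2 * 0)) ≤
      ∑ S ∈ Finset.powersetCard s (Finset.univ : Finset ι),
        2 * R ^ 2 * (Fintype.card ι : ℝ) / s := by
    refine Finset.sum_le_sum fun S hS => ?_
    have hc : S.card = s := (Finset.mem_powersetCard.1 hS).2
    calc _ ≤ ∑ i ∈ S, ∑ j ∈ Sᶜ, (2 * R ^ 2) / (s : ℝ) ^ 2 := by
          refine Finset.sum_le_sum fun i hi => Finset.sum_le_sum fun j hj => ?_
          rw [covDev_sub_swap a hi (by simpa using hj), hc, mul_zero, pow_zero, mul_one, smul_pow,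
            trace_smul, smul_eq_mul, inv_pow, inv_mul_eq_div]
          refine div_le_div_of_nonneg_right ?_ (by positivity)
          have e : (vecMulVec (a i) (a i) - vecMulVec (a j) (a j)) ^ 2 =
              vecMulVec (a i) (a i) ^ 2 + vecMulVec (a j) (a j) ^ 2
              - vecMulVec (a i) (a i) * vecMulVec (a j) (a j)
              - vecMulVec (a j) (a j) * vecMulVec (a i) (a i) := by noncomm_ring
          have hb : ∀ v w : m → ℝ, trace (vecMulVec v v * vecMulVec w w) = (v ⬝ᵥ w) ^ 2 :=
            fun v w => by
              rw [vecMulVec_mul_vecMulVec, vecMulVec_smul, trace_smul, trace_vecMulVec, smul_eq_mul,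
                pow_two]
          have hnn : ∀ v : m → ℝ, 0 ≤ v ⬝ᵥ v := fun v =>
            Finset.sum_nonneg fun x _ => mul_self_nonneg _
          rw [e, trace_sub, trace_sub, trace_add, pow_two, pow_two, hb, hb, hb, hb]
          have := pow_le_pow_left₀ (hnn _) (hR i) 2
          have := pow_le_pow_left₀ (hnn _) (hR j) 2
          nlinarith [sq_nonneg (a i ⬝ᵥ a j), sq_nonneg (a j ⬝ᵥ a i)]
      _ ≤ _ := by
          simp only [Finset.sum_const, Finset.card_compl, hc, nsmul_eq_mul, Nat.cast_sub hsn]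
          have : (s : ℝ) * (((Fintype.card ι : ℝ) - s) * (2 * R ^ 2 / (s : ℝ) ^ 2)) =
            2 * R ^ 2 * ((Fintype.card ι : ℝ) - s) / s := by field_simp
          rw [this]
          gcongr
          linarith
  have h3 := h1.trans (mul_le_mul_of_nonneg_left h2 (by positivity))
  rw [Finset.sum_const, nsmul_eq_mul, zero_add] at h3
  refine le_of_mul_le_mul_left ?_ hn
  calc _ ≤ _ := h3
    _ = _ := by push_cast; ring

theorem devMoment_le (a : ι → m → ℝ) {R : ℝ} (hR0 : 0 ≤ R) (hR : ∀ i, a i ⬝ᵥ a i ≤ R)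
    (hA : (1 - (Fintype.card ι : ℝ)⁻¹ • ∑ i, vecMulVec (a i) (a i)).PosSemidef)
    {s : ℕ} (hs : 0 < s) (hsn : s ≤ Fintype.card ι) {β : ℝ} (hβ0 : 0 ≤ β) (hβ : β ≤ 1)
    (q : ℕ) (hq : (2 * q + 1) * R / s ≤ β) :
    devMoment a s (q + 1) ≤ (5 * β) ^ q * (R ^ 2 / s *
      (Finset.powersetCard s (Finset.univ : Finset ι)).card) := by
  induction q with
  | zero => simpa using devMoment_one_le a hR hs hsn
  | succ q ih =>
    have hs' : (0 : ℝ) < s := by exact_mod_cast hs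
    have h1 : (2 * (q : ℝ) + 1) * R / s ≤ β := by
      refine le_trans ?_ hq
      push_cast
      gcongr
      linarith
    refine (devMoment_succ_le a hR0 hR hA hs hsn (q + 1) hβ hq).trans ?_
    refine (mul_le_mul_of_nonneg_left (ih h1) (by positivity : 0 ≤ 5 * β)).trans (le_of_eq ?_)
    rw [pow_succ]; ring

/-- Concentration of the average over a random subset: the number of subsets of size `s` for which
the quadratic form of the deviation exceeds `δ` times the squared norm somewhere. -/
theorem card_bad_subsets_le (a : ι → m → ℝ) {R : ℝ} (hR0 : 0 ≤ R) (hR : ∀ i, a i ⬝ᵥ a i ≤ R)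
    (hA : (1 - (Fintype.card ι : ℝ)⁻¹ • ∑ i, vecMulVec (a i) (a i)).PosSemidef)
    {s : ℕ} (hs : 0 < s) (hsn : s ≤ Fintype.card ι) {β : ℝ} (hβ0 : 0 ≤ β) (hβ : β ≤ 1)
    (q : ℕ) (hq : (2 * q + 1) * R / s ≤ β) {δ : ℝ} (hδ : 0 < δ) (B : Finset (Finset ι))
    (hB : B ⊆ Finset.powersetCard s Finset.univ)
    (hbad : ∀ S ∈ B, ∃ u : m → ℝ, δ * (u ⬝ᵥ u) < |u ⬝ᵥ covDev a S *ᵥ u|) :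
    (B.card : ℝ) ≤ (5 * β) ^ q / δ ^ (2 * (q + 1)) * (R ^ 2 / s) *
      (Finset.powersetCard s (Finset.univ : Finset ι)).card := by
  -- Markov's inequality for the moment of order 2(q + 1).
  have h1 : (B.card : ℝ) * δ ^ (2 * (q + 1)) ≤ devMoment a s (q + 1) := by
    rw [← nsmul_eq_mul, ← Finset.sum_const, devMoment]
    refine (Finset.sum_le_sum fun S hS => ?_).trans
      (Finset.sum_le_sum_of_subset_of_nonneg hB fun S _ _ =>
        trace_even_nonneg (isSymm_covDev a S) _)
    obtain ⟨u, hu⟩ := hbad S hS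
    exact pow_le_trace_pow (isSymm_covDev a S) hδ.le hu _
  have h2 := h1.trans (devMoment_le a hR0 hR hA hs hsn hβ0 hβ q hq)
  calc (B.card : ℝ) ≤ _ / δ ^ (2 * (q + 1)) := (le_div_iff₀ (by positivity)).2 h2
    _ = _ := by ring

end Moments


end

end HSDMPG

namespace HSDMPG

noncomputable section

open Matrix

/-! ### Preconditioned steps in the energy norm. -/

section Diagonalization

variable {m : Type*} [Fintype m] [DecidableEq m]

omit [DecidableEq m] in
theorem dotProduct_conj (V M : Matrix m m ℝ) (u v : m → ℝ) :
    (V *ᵥ u) ⬝ᵥ M *ᵥ (V *ᵥ v) = u ⬝ᵥ (Vᵀ * M * V) *ᵥ v := by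
  rw [← mulVec_mulVec, ← mulVec_mulVec, dotProduct_mulVec u, vecMul_transpose]

theorem exists_transpose_mul_self {G : Matrix m m ℝ} (hG : G.PosDef) :
    ∃ B C : Matrix m m ℝ, G = Bᵀ * B ∧ B * C = 1 ∧ C * B = 1 := by
  have hGs : G.IsSymm := by
    have := hG.isHermitian
    rwa [Matrix.IsHermitian, conjTranspose_eq_transpose_of_trivial] at this
  obtain ⟨U, α, hU, hU', hα⟩ := exists_orthogonal_diagonalization hGs
  have hpos : ∀ a, 0 < α a := fun a => by
    have hne : U *ᵥ Pi.single a 1 ≠ 0 := fun h => by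
      have h2 : Uᵀ *ᵥ (U *ᵥ Pi.single a 1) = Pi.single a (1 : ℝ) := by
        rw [mulVec_mulVec, hU, one_mulVec]
      rw [h, mulVec_zero] at h2
      simpa using congrFun h2 a
    have h1 := hG.dotProduct_mulVec_pos hne
    have h2 : Uᵀ * G * U = diagonal α := by
      rw [hα]
      calc Uᵀ * (U * diagonal α * Uᵀ) * U = (Uᵀ * U) * diagonal α * (Uᵀ * U) := by
            simp only [Matrix.mul_assoc]
        _ = _ := by rw [hU, Matrix.one_mul, Matrix.mul_one]
    have h3 : (U *ᵥ Pi.single a 1) ⬝ᵥ G *ᵥ (U *ᵥ Pi.single a 1) = α a := by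
      rw [dotProduct_conj, h2]
      simp
    rwa [star_trivial, h3] at h1
  have hd : ∀ f g : m → ℝ, (∀ a, f a * g a = 1) → diagonal f * diagonal g = 1 := fun f g h => by
    rw [diagonal_mul_diagonal, ← diagonal_one]
    exact congrArg diagonal (funext h)
  have hs : ∀ a, √(α a) ≠ 0 := fun a => (Real.sqrt_pos.2 (hpos a)).ne'
  have hBC : (diagonal fun a => √(α a)) * Uᵀ * (U * diagonal fun a => (√(α a))⁻¹) = 1 := by
    calc _ = (diagonal fun a => √(α a)) * (Uᵀ * U) * diagonal fun a => (√(α a))⁻¹ := by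
          simp only [Matrix.mul_assoc]
      _ = 1 := by rw [hU, Matrix.mul_one, hd _ _ fun a => mul_inv_cancel₀ (hs a)]
  refine ⟨_, _, ?_, hBC, mul_eq_one_comm.1 hBC⟩
  rw [transpose_mul, transpose_transpose, diagonal_transpose, hα]
  calc U * diagonal α * Uᵀ
      = U * ((diagonal fun a => √(α a)) * diagonal fun a => √(α a)) * Uᵀ := by
        rw [diagonal_mul_diagonal]
        congr 3
        ext a
        rw [Real.mul_self_sqrt (hpos a).le]
    _ = _ := by simp only [Matrix.mul_assoc]

/-- Congruence rather than similarity: after G is reduced to the identity, an orthogonal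
diagonalization of the transformed H leaves G untouched. The last two identities say that V and VᵀG
are inverse to each other; they serve to change coordinates. -/
theorem exists_simultaneous_diagonalization {G H : Matrix m m ℝ} (hG : G.PosDef)
    (hH : H.IsSymm) : ∃ (V : Matrix m m ℝ) (h : m → ℝ), Vᵀ * G * V = 1 ∧
      Vᵀ * H * V = diagonal h ∧ V * (Vᵀ * G) = 1 ∧ G * V * Vᵀ = 1 := by
  obtain ⟨B, C, hB, hBC, hCB⟩ := exists_transpose_mul_self hG
  have hsymm : (Cᵀ * H * C).IsSymm := by
    rw [Matrix.IsSymm, transpose_mul, transpose_mul, transpose_transpose, hH.eq, Matrix.mul_assoc]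
  obtain ⟨U, α, hU, hU', hα⟩ := exists_orthogonal_diagonalization hsymm
  have hCt : Cᵀ * Bᵀ = 1 := by rw [← transpose_mul, hBC, transpose_one]
  have h1 : (C * U)ᵀ * G * (C * U) = 1 := by
    calc (C * U)ᵀ * G * (C * U) = Uᵀ * ((Cᵀ * Bᵀ) * (B * C)) * U := by
          rw [hB, transpose_mul]; simp only [Matrix.mul_assoc]
      _ = 1 := by rw [hCt, hBC, Matrix.mul_one, Matrix.mul_one, hU]
  have h3 : (C * U) * ((C * U)ᵀ * G) = 1 := mul_eq_one_comm.1 h1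
  refine ⟨C * U, α, h1, ?_, h3, ?_⟩
  · calc (C * U)ᵀ * H * (C * U) = Uᵀ * (Cᵀ * H * C) * U := by
          rw [transpose_mul]; simp only [Matrix.mul_assoc]
      _ = (Uᵀ * U) * diagonal α * (Uᵀ * U) := by rw [hα]; simp only [Matrix.mul_assoc]
      _ = _ := by rw [hU, Matrix.one_mul, Matrix.mul_one]
  · have hGs : Gᵀ = G := by rw [hB, transpose_mul, transpose_transpose]
    have := congrArg transpose h3
    simpa only [transpose_mul, transpose_transpose, hGs, transpose_one, Matrix.mul_assoc] using this

/-- One step of preconditioned gradient descent, perturbed by `b`. -/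
theorem precond_step_le {G H : Matrix m m ℝ} (hG : G.PosDef) (hH : H.PosDef) {lo hi lam : ℝ}
    (hlo0 : 0 ≤ hi)
    (hlo : ∀ v, lo * (v ⬝ᵥ G *ᵥ v) ≤ v ⬝ᵥ H *ᵥ v) (hhi : ∀ v, v ⬝ᵥ H *ᵥ v ≤ hi * (v ⬝ᵥ G *ᵥ v))
    (h1 : 1 - lo ≤ lam) (h2 : hi - 1 ≤ lam) {e e' b : m → ℝ}
    (he : G *ᵥ e' = G *ᵥ e - H *ᵥ e - b) :
    √(e' ⬝ᵥ H *ᵥ e') ≤ lam * √(e ⬝ᵥ H *ᵥ e) + hi * √(b ⬝ᵥ H⁻¹ *ᵥ b) := by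
  have hHs : H.IsSymm := by
    have := hH.isHermitian
    rwa [Matrix.IsHermitian, conjTranspose_eq_transpose_of_trivial] at this
  obtain ⟨V, h, hVG, hVH, hV1, hV2⟩ := exists_simultaneous_diagonalization hG hHs
  have hform : ∀ a, h a = (V *ᵥ Pi.single a 1) ⬝ᵥ H *ᵥ (V *ᵥ Pi.single a 1) := fun a => by
    rw [dotProduct_conj, hVH]
    simp
  have hformG : ∀ a, (V *ᵥ Pi.single a 1) ⬝ᵥ G *ᵥ (V *ᵥ Pi.single a 1) = 1 := fun a => by
    rw [dotProduct_conj, hVG]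
    simp
  have hhlo : ∀ a, lo ≤ h a := fun a => by
    have := hlo (V *ᵥ Pi.single a 1)
    rwa [hformG, mul_one, ← hform] at this
  have hhhi : ∀ a, h a ≤ hi := fun a => by
    have := hhi (V *ᵥ Pi.single a 1)
    rwa [hformG, mul_one, ← hform] at this
  have hpos : ∀ a, 0 < h a := fun a => by
    rw [hform]
    have hne : V *ᵥ Pi.single a 1 ≠ 0 := fun h0 => by
      have := hformG a
      rw [h0] at this
      simp at this
    simpa using hH.dotProduct_mulVec_pos hne
  have hquad : ∀ v, v ⬝ᵥ H *ᵥ v = ∑ a, (√(h a) * ((Vᵀ * G) *ᵥ v) a) ^ 2 := fun v => by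
    have hv : v = V *ᵥ ((Vᵀ * G) *ᵥ v) := by rw [mulVec_mulVec, hV1, one_mulVec]
    conv_lhs => rw [hv, dotProduct_conj, hVH]
    simp only [dotProduct, mulVec_diagonal]
    refine Finset.sum_congr rfl fun a _ => ?_
    rw [mul_pow, Real.sq_sqrt (hpos a).le]
    ring
  have hb : b ⬝ᵥ H⁻¹ *ᵥ b = ∑ a, ((Vᵀ *ᵥ b) a / √(h a)) ^ 2 := by
    have hinv : H⁻¹ *ᵥ b = V *ᵥ fun a => (Vᵀ *ᵥ b) a / h a := by
      have hdet : IsUnit H.det := isUnit_iff_ne_zero.2 hH.det_pos.ne'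
      have : H *ᵥ (V *ᵥ fun a => (Vᵀ *ᵥ b) a / h a) = b := by
        calc H *ᵥ (V *ᵥ fun a => (Vᵀ *ᵥ b) a / h a)
            = (G * V * Vᵀ) *ᵥ (H *ᵥ (V *ᵥ fun a => (Vᵀ *ᵥ b) a / h a)) := by
              rw [hV2, one_mulVec]
          _ = (G * V) *ᵥ ((Vᵀ * H * V) *ᵥ fun a => (Vᵀ *ᵥ b) a / h a) := by
              simp only [mulVec_mulVec, Matrix.mul_assoc]
          _ = (G * V) *ᵥ (Vᵀ *ᵥ b) := by
              rw [hVH]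
              congr 1
              ext a
              rw [mulVec_diagonal, mul_div_cancel₀ _ (hpos a).ne']
          _ = b := by rw [mulVec_mulVec, hV2, one_mulVec]
      conv_lhs => rw [← this]
      rw [mulVec_mulVec, nonsing_inv_mul H hdet, one_mulVec]
    rw [hinv, dotProduct_mulVec, ← mulVec_transpose]
    simp only [dotProduct]
    refine Finset.sum_congr rfl fun a _ => ?_
    rw [div_pow, Real.sq_sqrt (hpos a).le]
    ring
  -- In the coordinates VᵀG e the operator 1 - G⁻¹H is diagonal with entries 1 - h a.
  have hcoord : ∀ a, ((Vᵀ * G) *ᵥ e') a = (1 - h a) * ((Vᵀ * G) *ᵥ e) a - (Vᵀ *ᵥ b) a := by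
    intro a
    have h3 : (Vᵀ * G) *ᵥ e' = (Vᵀ * G) *ᵥ e - diagonal h *ᵥ ((Vᵀ * G) *ᵥ e) - Vᵀ *ᵥ b := by
      rw [← mulVec_mulVec, he, mulVec_sub, mulVec_sub, mulVec_mulVec, ← hVH]
      congr 2
      calc Vᵀ *ᵥ (H *ᵥ e) = Vᵀ *ᵥ (H *ᵥ ((V * (Vᵀ * G)) *ᵥ e)) := by rw [hV1, one_mulVec]
        _ = _ := by simp only [mulVec_mulVec, Matrix.mul_assoc]
    rw [h3]
    simp only [Pi.sub_apply, mulVec_diagonal]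
    ring
  -- `lo ≤ h a ≤ hi` at any index gives 2 lam ≥ hi - lo ≥ 0. In dimension zero there is no index,
  -- and all forms vanish.
  have hlam : 0 ≤ lam ∨ IsEmpty m := by
    by_cases hm : IsEmpty m
    · exact Or.inr hm
    · rw [not_isEmpty_iff] at hm
      obtain ⟨a⟩ := hm
      left
      have := hhlo a
      have := hhhi a
      linarith
  rcases hlam with hlam | hm
  swap
  · simp
  rw [hquad e', hquad e, hb]
  have hmink := norm_sub_le (E := EuclideanSpace ℝ m)
    (WithLp.toLp 2 fun a => √(h a) * ((1 - h a) * ((Vᵀ * G) *ᵥ e) a))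
    (WithLp.toLp 2 fun a => √(h a) * (Vᵀ *ᵥ b) a)
  simp only [EuclideanSpace.norm_eq, PiLp.sub_apply, Real.norm_eq_abs, sq_abs] at hmink
  have e1 : √(∑ a, (√(h a) * ((Vᵀ * G) *ᵥ e') a) ^ 2) ≤
      √(∑ a, (√(h a) * ((1 - h a) * ((Vᵀ * G) *ᵥ e) a)) ^ 2) +
      √(∑ a, (√(h a) * (Vᵀ *ᵥ b) a) ^ 2) := by
    refine le_trans (le_of_eq ?_) hmink
    congr 1
    refine Finset.sum_congr rfl fun a _ => ?_
    rw [hcoord]; ring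
  refine e1.trans (add_le_add ?_ ?_)
  · rw [← Real.sqrt_sq hlam, ← Real.sqrt_mul (sq_nonneg lam), Finset.mul_sum]
    refine Real.sqrt_le_sqrt (Finset.sum_le_sum fun a _ => ?_)
    have h4 : (1 - h a) ^ 2 ≤ lam ^ 2 := by
      refine sq_le_sq' ?_ ?_
      · have := hhhi a; linarith
      · have := hhlo a; linarith
    calc _ = (1 - h a) ^ 2 * (√(h a) * ((Vᵀ * G) *ᵥ e) a) ^ 2 := by ring
      _ ≤ _ := mul_le_mul_of_nonneg_right h4 (sq_nonneg _)
  · rw [← Real.sqrt_sq hlo0, ← Real.sqrt_mul (sq_nonneg hi), Finset.mul_sum]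
    refine Real.sqrt_le_sqrt (Finset.sum_le_sum fun a _ => ?_)
    have h5 : √(h a) * (Vᵀ *ᵥ b) a = h a * ((Vᵀ *ᵥ b) a / √(h a)) := by
      have hs := Real.sqrt_pos.2 (hpos a)
      field_simp
      rw [Real.sq_sqrt (hpos a).le, mul_comm]
    rw [h5, mul_pow]
    exact mul_le_mul_of_nonneg_right (pow_le_pow_left₀ (hpos a).le (hhhi a) 2) (sq_nonneg _)

/-- On the eigenvalues this is h² ≤ c h for 0 ≤ h ≤ c. It plays the role of co-coercivity for the
gradients of quadratics. -/
theorem sq_mulVec_le {M : Matrix m m ℝ} (hM : M.PosSemidef) {c : ℝ}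
    (hc : ∀ v, v ⬝ᵥ M *ᵥ v ≤ c * (v ⬝ᵥ v)) (v : m → ℝ) :
    (M *ᵥ v) ⬝ᵥ (M *ᵥ v) ≤ c * (v ⬝ᵥ M *ᵥ v) := by
  have hMs : M.IsSymm := by
    have := hM.isHermitian
    rwa [Matrix.IsHermitian, conjTranspose_eq_transpose_of_trivial] at this
  obtain ⟨V, h, hVG, hVH, hV1, hV2⟩ := exists_simultaneous_diagonalization (PosDef.one (n := m)) hMs
  rw [Matrix.mul_one] at hVG
  have hform : ∀ a, h a = (V *ᵥ Pi.single a 1) ⬝ᵥ M *ᵥ (V *ᵥ Pi.single a 1) := fun a => by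
    rw [dotProduct_conj, hVH]
    simp
  have hone : ∀ a, (V *ᵥ Pi.single a 1) ⬝ᵥ (V *ᵥ Pi.single a 1) = 1 := fun a => by
    have := dotProduct_conj V 1 (Pi.single a 1) (Pi.single a 1)
    rw [one_mulVec, Matrix.mul_one, hVG] at this
    rw [this]
    simp
  have hpos : ∀ a, 0 ≤ h a := fun a => by
    rw [hform]
    have := hM.dotProduct_mulVec_nonneg (V *ᵥ Pi.single a 1)
    rwa [star_trivial] at this
  have hle : ∀ a, h a ≤ c := fun a => by
    have := hc (V *ᵥ Pi.single a 1)
    rwa [hone, mul_one, ← hform] at this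
  have hv : v = V *ᵥ (Vᵀ *ᵥ v) := by rw [mulVec_mulVec, mul_eq_one_comm.1 hVG, one_mulVec]
  set w := Vᵀ *ᵥ v with hw
  have h2 : v ⬝ᵥ M *ᵥ v = ∑ a, h a * w a ^ 2 := by
    rw [hv, dotProduct_conj, hVH]
    simp only [dotProduct, mulVec_diagonal]
    exact Finset.sum_congr rfl fun a _ => by ring
  have h1 : (M *ᵥ v) ⬝ᵥ (M *ᵥ v) = ∑ a, (h a) ^ 2 * w a ^ 2 := by
    have e : (M *ᵥ v) ⬝ᵥ (M *ᵥ v) = v ⬝ᵥ (M * M) *ᵥ v := by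
      rw [dotProduct_mulVec, ← mulVec_transpose, hMs.eq, mulVec_mulVec, dotProduct_comm]
    have e2 : Vᵀ * (M * M) * V = diagonal fun a => h a ^ 2 := by
      calc Vᵀ * (M * M) * V = Vᵀ * (M * (V * Vᵀ) * M) * V := by
            rw [mul_eq_one_comm.1 hVG, Matrix.mul_one]
        _ = (Vᵀ * M * V) * (Vᵀ * M * V) := by simp only [Matrix.mul_assoc]
        _ = _ := by
          rw [hVH, diagonal_mul_diagonal]
          congr 1; ext a; rw [pow_two]
    rw [e, hv, dotProduct_conj, e2]
    simp only [dotProduct, mulVec_diagonal]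
    exact Finset.sum_congr rfl fun a _ => by ring
  rw [h1, h2, Finset.mul_sum]
  refine Finset.sum_le_sum fun a _ => ?_
  rw [pow_two (h a), mul_assoc]
  exact mul_le_mul_of_nonneg_right (hle a) (mul_nonneg (hpos a) (sq_nonneg _))

theorem inv_form_le {M : Matrix m m ℝ} (hM : M.PosDef) {c : ℝ} (hc0 : 0 < c)
    (hc : ∀ v, c * (v ⬝ᵥ v) ≤ v ⬝ᵥ M *ᵥ v) (v : m → ℝ) :
    v ⬝ᵥ M⁻¹ *ᵥ v ≤ (v ⬝ᵥ v) / c := by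
  have hdet : IsUnit M.det := isUnit_iff_ne_zero.2 hM.det_pos.ne'
  set u := M⁻¹ *ᵥ v with hu
  have hMu : M *ᵥ u = v := by rw [hu, mulVec_mulVec, mul_nonsing_inv M hdet, one_mulVec]
  have h1 := hc u
  rw [hMu] at h1
  have h2 : 0 ≤ (v - c • u) ⬝ᵥ (v - c • u) := Finset.sum_nonneg fun x _ => mul_self_nonneg _
  simp only [sub_dotProduct, dotProduct_sub, smul_dotProduct, dotProduct_smul, smul_eq_mul] at h2
  rw [dotProduct_comm u v] at h1 h2
  rw [le_div_iff₀ hc0]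
  nlinarith

end Diagonalization

/-! ### Batches that are spectrally close to the full sample. -/

namespace ERM

variable {n d : ℕ} {Y : Type*} (p : ERM n d Y)

/-- The data part `L/|S| ∑ xᵢ xᵢᵀ` of the Hessian over the batch `S`. -/
def gram (S : Finset (Fin n)) : Matrix (Fin d) (Fin d) ℝ :=
  (p.L / S.card) • ∑ i ∈ S, Matrix.vecMulVec (p.x i).ofLp (p.x i).ofLp

/-- The Hessian of the proximal objective. -/
def precond (γ : ℝ) (S : Finset (Fin n)) : Matrix (Fin d) (Fin d) ℝ :=
  p.gram S + (p.μ + γ) • (1 : Matrix (Fin d) (Fin d) ℝ)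

theorem hessianBound_eq : p.hessianBound = p.precond 0 Finset.univ := by
  simp [hessianBound, precond, gram]

theorem gram_form (S : Finset (Fin n)) (v : Fin d → ℝ) :
    v ⬝ᵥ p.gram S *ᵥ v = p.L / S.card * ∑ i ∈ S, ((p.x i).ofLp ⬝ᵥ v) ^ 2 := by
  rw [gram, smul_mulVec, dotProduct_smul, sum_mulVec, dotProduct_sum, smul_eq_mul]
  congr 1
  refine Finset.sum_congr rfl fun i _ => ?_
  rw [vecMulVec_mulVec, op_smul_eq_smul, dotProduct_smul, dotProduct_comm v, smul_eq_mul, pow_two]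

theorem precond_form (γ : ℝ) (S : Finset (Fin n)) (v : Fin d → ℝ) :
    v ⬝ᵥ p.precond γ S *ᵥ v = v ⬝ᵥ p.gram S *ᵥ v + (p.μ + γ) * (v ⬝ᵥ v) := by
  rw [precond, add_mulVec, dotProduct_add, smul_mulVec, one_mulVec, dotProduct_smul, smul_eq_mul]

theorem hessianBound_form (v : Fin d → ℝ) :
    v ⬝ᵥ p.hessianBound *ᵥ v = v ⬝ᵥ p.gram Finset.univ *ᵥ v + p.μ * (v ⬝ᵥ v) := by
  rw [hessianBound_eq, precond_form, add_zero]

theorem gram_isSymm (S : Finset (Fin n)) : (p.gram S).IsSymm :=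
  (isSymm_sum_vecMulVec _ _).smul _

theorem precond_isSymm (γ : ℝ) (S : Finset (Fin n)) : (p.precond γ S).IsSymm :=
  (p.gram_isSymm S).add (isSymm_one.smul _)

theorem dotProduct_self_nonneg' (v : Fin d → ℝ) : 0 ≤ v ⬝ᵥ v :=
  Finset.sum_nonneg fun _ _ => mul_self_nonneg _

theorem dotProduct_eq_inner (u v : E d) : u.ofLp ⬝ᵥ v.ofLp = inner ℝ u v := by
  rw [dotProduct_comm]; rfl

variable {p}

theorem gram_form_nonneg (hL : 0 ≤ p.L) (S : Finset (Fin n)) (v : Fin d → ℝ) :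
    0 ≤ v ⬝ᵥ p.gram S *ᵥ v := by
  rw [gram_form]
  positivity

theorem gram_form_le {r : ℝ} (hL : 0 ≤ p.L) (hx : ∀ i, ‖p.x i‖ ≤ r) (S : Finset (Fin n))
    (v : Fin d → ℝ) : v ⬝ᵥ p.gram S *ᵥ v ≤ p.L * r ^ 2 * (v ⬝ᵥ v) := by
  rw [gram_form]
  have h1 : ∀ i ∈ S, ((p.x i).ofLp ⬝ᵥ v) ^ 2 ≤ r ^ 2 * (v ⬝ᵥ v) := fun i _ => by
    have h2 := abs_real_inner_le_norm (p.x i) (WithLp.toLp 2 v)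
    have h3 : v ⬝ᵥ v = ‖(WithLp.toLp 2 v : E d)‖ ^ 2 := by
      rw [← real_inner_self_eq_norm_sq, ← dotProduct_eq_inner]
    have h4 : (p.x i).ofLp ⬝ᵥ v = inner ℝ (p.x i) (WithLp.toLp 2 v) := by
      rw [← dotProduct_eq_inner]
    rw [h3, h4, ← mul_pow, ← sq_abs]
    exact pow_le_pow_left₀ (abs_nonneg _)
      (h2.trans (mul_le_mul_of_nonneg_right (hx i) (norm_nonneg _))) 2
  have hv := dotProduct_self_nonneg' v
  rcases S.eq_empty_or_nonempty with rfl | hS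
  · simp only [Finset.sum_empty, mul_zero]; positivity
  have hc : (0 : ℝ) < S.card := by exact_mod_cast hS.card_pos
  calc p.L / S.card * ∑ i ∈ S, ((p.x i).ofLp ⬝ᵥ v) ^ 2
      ≤ p.L / S.card * ∑ i ∈ S, r ^ 2 * (v ⬝ᵥ v) :=
        mul_le_mul_of_nonneg_left (Finset.sum_le_sum h1) (by positivity)
    _ = _ := by rw [Finset.sum_const, nsmul_eq_mul]; field_simp

theorem precond_posDef (hL : 0 ≤ p.L) (hμ : 0 < p.μ) {γ : ℝ} (hγ : 0 ≤ γ) (S : Finset (Fin n)) :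
    (p.precond γ S).PosDef := by
  refine Matrix.PosDef.of_dotProduct_mulVec_pos ?_ fun v hv => ?_
  · rw [Matrix.IsHermitian, conjTranspose_eq_transpose_of_trivial]
    exact p.precond_isSymm γ S
  · rw [star_trivial, precond_form]
    have h1 := gram_form_nonneg hL S v
    have h2 : 0 < v ⬝ᵥ v :=
      lt_of_le_of_ne (dotProduct_self_nonneg' v) (Ne.symm (dotProduct_self_eq_zero.not.2 hv))
    positivity

theorem hessianBound_posDef (hL : 0 ≤ p.L) (hμ : 0 < p.μ) : p.hessianBound.PosDef := by
  rw [hessianBound_eq]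
  exact precond_posDef hL hμ le_rfl _

variable (p) in
/-- A batch whose Hessian is spectrally close to the Hessian of the quadratic model. -/
def IsGood (γ : ℝ) (S : Finset (Fin n)) : Prop :=
  ∀ v : Fin d → ℝ, |v ⬝ᵥ p.gram S *ᵥ v - v ⬝ᵥ p.gram Finset.univ *ᵥ v| ≤
    1 / 5 * (v ⬝ᵥ p.precond γ Finset.univ *ᵥ v)

theorem IsGood.step_le (hL : 0 ≤ p.L) (hμ : 0 < p.μ) {γ : ℝ} (hγ : 0 ≤ γ) {S : Finset (Fin n)}
    (hS : p.IsGood γ S) {e e' b : Fin d → ℝ}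
    (he : p.precond γ S *ᵥ e' = p.precond γ S *ᵥ e - p.hessianBound *ᵥ e - b) :
    √(e' ⬝ᵥ p.hessianBound *ᵥ e') ≤
      (1 - 3 / 4 * (p.μ / (p.μ + 2 * γ))) * √(e ⬝ᵥ p.hessianBound *ᵥ e)
        + 5 / 4 * √(b ⬝ᵥ p.hessianBound⁻¹ *ᵥ b) := by
  have hρ0 : 0 < p.μ / (p.μ + 2 * γ) := by positivity
  have hρ1 : p.μ / (p.μ + 2 * γ) ≤ 1 := (div_le_one (by positivity)).2 (by linarith)
  -- With ρ = μ/(μ + 2γ), relative error 1/5 gives (5/6)ρ G ≤ H ≤ (5/4) G. As ρ ≤ 1, both 1 - 5ρ/6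
  -- and 5/4 - 1 are at most 1 - 3ρ/4.
  refine precond_step_le (precond_posDef hL hμ hγ S) (hessianBound_posDef hL hμ)
    (lo := 5 / 6 * (p.μ / (p.μ + 2 * γ))) (by norm_num) (fun v => ?_) (fun v => ?_)
    (by linarith) (by linarith) he
  · have h1 := (abs_le.1 (hS v)).2
    have h2 := gram_form_nonneg hL (Finset.univ) v
    have h3 := dotProduct_self_nonneg' v
    rw [precond_form] at h1 ⊢
    rw [hessianBound_form]
    have hρ : p.μ / (p.μ + 2 * γ) * (p.μ + γ) ≤ p.μ := by
      rw [div_mul_eq_mul_div, div_le_iff₀ (by positivity)]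
      nlinarith [mul_nonneg hμ.le hγ]
    set ρ := p.μ / (p.μ + 2 * γ)
    have h4 : v ⬝ᵥ p.gram S *ᵥ v + (p.μ + γ) * (v ⬝ᵥ v) ≤
        6 / 5 * (v ⬝ᵥ p.gram Finset.univ *ᵥ v + (p.μ + γ) * (v ⬝ᵥ v)) := by linarith
    have h5 := mul_le_mul_of_nonneg_left h4 hρ0.le
    have h6 := mul_le_mul_of_nonneg_right hρ h3
    have h7 := mul_le_mul_of_nonneg_right hρ1 h2
    linarith
  · have h1 := (abs_le.1 (hS v)).1
    have h2 := gram_form_nonneg hL (Finset.univ) v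
    have h3 := dotProduct_self_nonneg' v
    rw [precond_form] at h1 ⊢
    rw [hessianBound_form]
    nlinarith [mul_nonneg hγ h3]

/-- For an arbitrary batch only 0 ≤ H ≤ cG is left. The step may then expand the error, but by no
more than c; this controls the bad batches. -/
theorem step_le {r : ℝ} (hL : 0 ≤ p.L) (hμ : 0 < p.μ) (hx : ∀ i, ‖p.x i‖ ≤ r) {γ : ℝ}
    (hγ : 0 ≤ γ) (S : Finset (Fin n)) {c : ℝ} (hc1 : 1 ≤ c)
    (hc : p.L * r ^ 2 + p.μ ≤ c * (p.μ + γ)) {e e' b : Fin d → ℝ}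
    (he : p.precond γ S *ᵥ e' = p.precond γ S *ᵥ e - p.hessianBound *ᵥ e - b) :
    √(e' ⬝ᵥ p.hessianBound *ᵥ e') ≤
      c * √(e ⬝ᵥ p.hessianBound *ᵥ e) + c * √(b ⬝ᵥ p.hessianBound⁻¹ *ᵥ b) := by
  refine precond_step_le (precond_posDef hL hμ hγ S) (hessianBound_posDef hL hμ)
    (lo := 0) (by linarith) (fun v => ?_) (fun v => ?_) (by linarith) (by linarith) he
  · have h2 := gram_form_nonneg hL (Finset.univ) v
    have h3 := dotProduct_self_nonneg' v
    rw [hessianBound_form, zero_mul]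
    positivity
  · have h1 := gram_form_le hL hx Finset.univ v
    have h2 := gram_form_nonneg hL S v
    have h3 := dotProduct_self_nonneg' v
    rw [precond_form, hessianBound_form]
    nlinarith

theorem card_not_isGood_le {r : ℝ} (hL : 0 ≤ p.L) (hμ : 0 < p.μ) (hx : ∀ i, ‖p.x i‖ ≤ r) {γ : ℝ}
    (hγ : 0 ≤ γ) {s : ℕ} (hs : 0 < s) (hsn : s ≤ n) {β : ℝ} (hβ0 : 0 ≤ β) (hβ : β ≤ 1) (q : ℕ)
    (hq : (2 * q + 1) * (p.L * r ^ 2 / (p.μ + γ)) / s ≤ β) (D : Finset (Finset (Fin n)))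
    (hD : ∀ S ∈ D, S.card = s ∧ ¬ p.IsGood γ S) :
    (D.card : ℝ) ≤ (5 * β) ^ q * 25 ^ (q + 1) * ((p.L * r ^ 2 / (p.μ + γ)) ^ 2 / s) *
      (Finset.powersetCard s (Finset.univ : Finset (Fin n))).card := by
  have hG := precond_posDef hL hμ hγ (Finset.univ : Finset (Fin n))
  obtain ⟨B, C, hB, hBC, hCB⟩ := exists_transpose_mul_self hG
  have hinv : (p.precond γ Finset.univ)⁻¹ = C * Cᵀ := by
    refine inv_eq_right_inv ?_
    calc p.precond γ Finset.univ * (C * Cᵀ) = Bᵀ * (B * C) * Cᵀ := by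
          rw [hB]; simp only [Matrix.mul_assoc]
      _ = 1 := by rw [hBC, Matrix.mul_one, ← transpose_mul, hCB, transpose_one]
  -- Whitening by the full proximal Hessian BᵀB, with C = B⁻¹. Relative spectral closeness becomes
  -- closeness in absolute terms, the mean of aᵢaᵢᵀ is at most 1, and |aᵢ|² ≤ Lr²/(μ + γ).
  set a : Fin n → Fin d → ℝ := fun i => √p.L • (Cᵀ *ᵥ (p.x i).ofLp) with ha
  have hau : ∀ i u, a i ⬝ᵥ u = √p.L * ((p.x i).ofLp ⬝ᵥ C *ᵥ u) := fun i u => by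
    rw [ha, smul_dotProduct, smul_eq_mul, dotProduct_mulVec, mulVec_transpose]
  have hsq : ∀ i u, (a i ⬝ᵥ u) ^ 2 = p.L * ((p.x i).ofLp ⬝ᵥ C *ᵥ u) ^ 2 := fun i u => by
    rw [hau, mul_pow, Real.sq_sqrt hL]
  have hform : ∀ (S : Finset (Fin n)) (u : Fin d → ℝ),
      u ⬝ᵥ ((S.card : ℝ)⁻¹ • ∑ i ∈ S, vecMulVec (a i) (a i)) *ᵥ u =
        (C *ᵥ u) ⬝ᵥ p.gram S *ᵥ (C *ᵥ u) := fun S u => by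
    rw [gram_form, smul_mulVec, dotProduct_smul, sum_mulVec, dotProduct_sum, smul_eq_mul,
      div_eq_inv_mul, mul_assoc]
    congr 1
    rw [Finset.mul_sum]
    refine Finset.sum_congr rfl fun i _ => ?_
    rw [vecMulVec_mulVec, op_smul_eq_smul, dotProduct_smul, dotProduct_comm u, smul_eq_mul,
      ← pow_two, hsq i u]
  have hnorm : ∀ u : Fin d → ℝ, u ⬝ᵥ u =
      (C *ᵥ u) ⬝ᵥ p.precond γ Finset.univ *ᵥ (C *ᵥ u) := fun u => by
    have e : Cᵀ * p.precond γ Finset.univ * C = 1 := by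
      calc Cᵀ * p.precond γ Finset.univ * C = (Cᵀ * Bᵀ) * (B * C) := by
            rw [hB]; simp only [Matrix.mul_assoc]
        _ = 1 := by rw [hBC, Matrix.mul_one, ← transpose_mul, hBC, transpose_one]
    rw [dotProduct_conj, e, one_mulVec]
  have hcard : (Fintype.card (Fin n) : ℝ) = ((Finset.univ : Finset (Fin n)).card : ℝ) := rfl
  have hR : ∀ i, a i ⬝ᵥ a i ≤ p.L * r ^ 2 / (p.μ + γ) := fun i => by
    have h1 : a i ⬝ᵥ a i = p.L * ((p.x i).ofLp ⬝ᵥ (p.precond γ Finset.univ)⁻¹ *ᵥ (p.x i).ofLp) := by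
      rw [hau, ha, mulVec_smul, dotProduct_smul, smul_eq_mul, ← mul_assoc, Real.mul_self_sqrt hL,
        mulVec_mulVec, hinv]
    have h2 := inv_form_le hG (c := p.μ + γ) (by positivity) (fun v => by
      rw [precond_form]
      have := gram_form_nonneg hL Finset.univ v
      linarith) (p.x i).ofLp
    have h3 : (p.x i).ofLp ⬝ᵥ (p.x i).ofLp ≤ r ^ 2 := by
      rw [dotProduct_eq_inner, real_inner_self_eq_norm_sq]
      exact pow_le_pow_left₀ (norm_nonneg _) (hx i) 2
    rw [h1, mul_div_assoc]
    refine mul_le_mul_of_nonneg_left (h2.trans ?_) hL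
    gcongr
  have hA : (1 - (Fintype.card (Fin n) : ℝ)⁻¹ • ∑ i : Fin n, vecMulVec (a i) (a i)).PosSemidef := by
    refine Matrix.PosSemidef.of_dotProduct_mulVec_nonneg ?_ fun u => ?_
    · rw [Matrix.IsHermitian, conjTranspose_eq_transpose_of_trivial]
      exact isSymm_one.sub ((isSymm_sum_vecMulVec a Finset.univ).smul _)
    · rw [star_trivial, sub_mulVec, dotProduct_sub, one_mulVec, hcard, hform, hnorm u, precond_form]
      have := dotProduct_self_nonneg' (C *ᵥ u)
      have : 0 ≤ (p.μ + γ) * ((C *ᵥ u) ⬝ᵥ (C *ᵥ u)) := by positivity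
      linarith
  have key := card_bad_subsets_le a (R := p.L * r ^ 2 / (p.μ + γ)) (by positivity) hR hA hs
    (by simpa using hsn) hβ0 hβ q hq (δ := 1 / 5) (by norm_num) D (fun S hS => by
      rw [Finset.mem_powersetCard]
      exact ⟨Finset.subset_univ _, (hD S hS).1⟩) (fun S hS => by
      have h1 := (hD S hS).2
      rw [IsGood] at h1
      push Not at h1
      obtain ⟨v, hv⟩ := h1
      have hCBv : C *ᵥ (B *ᵥ v) = v := by rw [mulVec_mulVec, hCB, one_mulVec]
      refine ⟨B *ᵥ v, ?_⟩
      rw [covDev, hcard, sub_mulVec, dotProduct_sub, hform, hform, hnorm (B *ᵥ v), hCBv]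
      exact hv)
  refine key.trans (le_of_eq ?_)
  rw [one_div, inv_pow, div_inv_eq_mul, pow_mul]
  norm_num

end ERM

end

end HSDMPG

namespace HSDMPG

noncomputable section

open Matrix

/-! ### Gradients of the models and of the proximal objective. -/

section Gradient

variable {n d : ℕ}

/-- The operator on `ℝᵈ` with matrix `M`. -/
abbrev op (M : Matrix (Fin d) (Fin d) ℝ) : E d →L[ℝ] E d :=
  Matrix.toEuclideanCLM (n := Fin d) (𝕜 := ℝ) M

theorem inner_op (M : Matrix (Fin d) (Fin d) ℝ) (u v : E d) :
    inner ℝ u (op M v) = u.ofLp ⬝ᵥ M *ᵥ v.ofLp := by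
  rw [← ERM.dotProduct_eq_inner]; rfl

theorem hasGradientAt_half_mul_norm_sq (c : ℝ) (w θ : E d) :
    HasGradientAt (fun θ : E d => c / 2 * ‖θ - w‖ ^ 2) (c • (θ - w)) θ := by
  rw [hasGradientAt_iff_hasFDerivAt]
  have h := (((hasFDerivAt_id (𝕜 := ℝ) θ).sub_const w).norm_sq).const_mul (c / 2)
  refine h.congr_fderiv ?_
  ext v
  simp
  ring

theorem hasGradientAt_inner (g : E d) (w θ : E d) :
    HasGradientAt (fun θ : E d => inner ℝ g (θ - w)) g θ := by
  rw [hasGradientAt_iff_hasFDerivAt]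
  have h := ((InnerProductSpace.toDual ℝ (E d) g).hasFDerivAt (x := θ - w)).comp θ
    ((hasFDerivAt_id (𝕜 := ℝ) θ).sub_const w)
  exact h

theorem hasGradientAt_half_mul_inner_sq (c : ℝ) (x w θ : E d) :
    HasGradientAt (fun θ : E d => c / 2 * (inner ℝ x (θ - w)) ^ 2)
      ((c * inner ℝ x (θ - w)) • x) θ := by
  have h := hasGradientAt_iff_hasFDerivAt.1 (hasGradientAt_inner x w θ)
  rw [hasGradientAt_iff_hasFDerivAt]
  refine ((h.pow 2).const_mul (c / 2)).congr_fderiv ?_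
  ext v
  simp
  ring

theorem hasGradientAt_add {f g : E d → ℝ} {u v θ : E d} (hf : HasGradientAt f u θ)
    (hg : HasGradientAt g v θ) : HasGradientAt (fun θ => f θ + g θ) (u + v) θ := by
  rw [hasGradientAt_iff_hasFDerivAt] at *
  rw [map_add]
  exact hf.add hg

theorem hasGradientAt_avg {f : Fin n → E d → ℝ} {g : Fin n → E d} {θ : E d} (S : Finset (Fin n))
    (hf : ∀ i, HasGradientAt (f i) (g i) θ) :
    HasGradientAt (avg f S) ((S.card : ℝ)⁻¹ • ∑ i ∈ S, g i) θ := by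
  rw [hasGradientAt_iff_hasFDerivAt]
  have h := (HasFDerivAt.fun_sum (u := S) fun i _ =>
    hasGradientAt_iff_hasFDerivAt.1 (hf i)).const_mul ((S.card : ℝ)⁻¹)
  refine h.congr_fderiv ?_
  rw [map_smulₛₗ, map_sum]
  rfl

theorem hasGradientAt_quadratic_form {M : Matrix (Fin d) (Fin d) ℝ} (hM : M.IsSymm) (w θ : E d) :
    HasGradientAt (fun θ : E d => 1 / 2 * ((θ - w).ofLp ⬝ᵥ M *ᵥ (θ - w).ofLp)) (op M (θ - w)) θ := by
  rw [hasGradientAt_iff_hasFDerivAt]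
  have h1 : HasFDerivAt (fun θ : E d => θ - w) (ContinuousLinearMap.id ℝ (E d)) θ :=
    (hasFDerivAt_id (𝕜 := ℝ) θ).sub_const w
  have h2 : HasFDerivAt (fun θ : E d => op M (θ - w)) (op M) θ := by
    have := HasFDerivAt.comp θ ((op M).hasFDerivAt (x := θ - w)) h1
    rwa [ContinuousLinearMap.comp_id] at this
  have h3 := (h1.inner ℝ h2).const_mul (1 / 2)
  have e : (fun θ : E d => 1 / 2 * ((θ - w).ofLp ⬝ᵥ M *ᵥ (θ - w).ofLp)) =
      fun θ => 1 / 2 * inner ℝ (θ - w) (op M (θ - w)) := by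
    ext θ; rw [inner_op]
  rw [e]
  refine h3.congr_fderiv ?_
  ext v
  have hs : inner ℝ (θ - w) (op M v) = inner ℝ v (op M (θ - w)) := by
    rw [inner_op, inner_op, dotProduct_mulVec, ← mulVec_transpose, hM.eq, dotProduct_comm]
  simp only [_root_.smul_apply, ContinuousLinearMap.comp_apply,
    ContinuousLinearMap.prod_apply, fderivInnerCLM_apply, ContinuousLinearMap.id_apply,
    InnerProductSpace.toDual_apply_apply, smul_eq_mul]
  rw [hs, real_inner_comm v]
  ring

end Gradient

namespace ERM

variable {n d : ℕ} {Y : Type*} (p : ERM n d Y)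

theorem op_gram (S : Finset (Fin n)) (v : E d) :
    op (p.gram S) v = (S.card : ℝ)⁻¹ • ∑ i ∈ S, (p.L * inner ℝ (p.x i) v) • p.x i := by
  apply WithLp.ofLp_injective
  rw [ofLp_toEuclideanCLM, gram, smul_mulVec, sum_mulVec, WithLp.ofLp_smul, WithLp.ofLp_sum,
    div_eq_inv_mul, mul_smul, Finset.smul_sum]
  congr 1
  refine Finset.sum_congr rfl fun i _ => ?_
  rw [vecMulVec_mulVec, op_smul_eq_smul, WithLp.ofLp_smul, smul_smul, dotProduct_eq_inner]

theorem op_precond (γ : ℝ) (S : Finset (Fin n)) (v : E d) :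
    op (p.precond γ S) v = op (p.gram S) v + (p.μ + γ) • v := by
  simp only [precond, map_add, map_smul, map_one, _root_.add_apply,
    _root_.smul_apply, one_apply_eq_self]

theorem op_hessianBound (v : E d) :
    op p.hessianBound v = op (p.gram Finset.univ) v + p.μ • v := by
  rw [hessianBound_eq, op_precond, add_zero]

/-- The average over `S` of the gradients of the components at `w`. -/
def avgGrad (w : E d) (S : Finset (Fin n)) : E d :=
  (S.card : ℝ)⁻¹ • ∑ i ∈ S, gradient (p.component i) w

/-- The gradient of the average over `S` of the quadratic models at `w`. -/
def qGrad (w : E d) (S : Finset (Fin n)) (θ : E d) : E d :=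
  p.avgGrad w S + op (p.precond 0 S) (θ - w)

theorem hasGradientAt_qComponent (w : E d) (i : Fin n) (θ : E d) :
    HasGradientAt (p.qComponent w i) (p.qGrad w {i} θ) θ := by
  have h := hasGradientAt_add (hasGradientAt_add
    ((hasGradientAt_const θ (p.component i w)))
    (hasGradientAt_inner (gradient (p.component i) w) w θ))
    (hasGradientAt_add (hasGradientAt_half_mul_inner_sq p.L (p.x i) w θ)
      (hasGradientAt_half_mul_norm_sq p.μ w θ))
  have e : p.qGrad w {i} θ = 0 + gradient (p.component i) w +
      ((p.L * inner ℝ (p.x i) (θ - w)) • p.x i + p.μ • (θ - w)) := by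
    rw [qGrad, avgGrad, op_precond, op_gram]
    simp
  rw [e]
  exact h

theorem avg_qGrad_singleton (w : E d) {S : Finset (Fin n)} (hS : S.Nonempty) (θ : E d) :
    (S.card : ℝ)⁻¹ • ∑ i ∈ S, p.qGrad w {i} θ = p.qGrad w S θ := by
  have hc : (S.card : ℝ) ≠ 0 := by exact_mod_cast hS.card_pos.ne'
  simp only [qGrad, avgGrad, op_precond, op_gram, Finset.card_singleton, Nat.cast_one, inv_one,
    one_smul, Finset.sum_singleton, Finset.sum_add_distrib, Finset.sum_const, smul_add]
  rw [← Nat.cast_smul_eq_nsmul ℝ, smul_smul, inv_mul_cancel₀ hc, one_smul]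

theorem gradient_avg_qComponent (w : E d) {S : Finset (Fin n)} (hS : S.Nonempty) (θ : E d) :
    gradient (avg (p.qComponent w) S) θ = p.qGrad w S θ := by
  rw [(hasGradientAt_avg S fun i => p.hasGradientAt_qComponent w i θ).gradient,
    p.avg_qGrad_singleton w hS]

theorem hasGradientAt_proxComponent (w : E d) {S S' : Finset (Fin n)} (hS : S.Nonempty)
    (hS' : S'.Nonempty) (γ : ℝ) (u : E d) (i : Fin n) (θ : E d) :
    HasGradientAt (proxComponent (p.qComponent w) S S' γ u i)
      (p.qGrad w {i} θ + (p.qGrad w S' u - p.qGrad w S u) + γ • (θ - u)) θ := by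
  have h := hasGradientAt_add (hasGradientAt_add (p.hasGradientAt_qComponent w i θ)
    (hasGradientAt_inner (p.qGrad w S' u - p.qGrad w S u) 0 θ))
    (hasGradientAt_half_mul_norm_sq γ u θ)
  simp only [sub_zero] at h
  simp only [← p.gradient_avg_qComponent w hS, ← p.gradient_avg_qComponent w hS'] at h ⊢
  exact h

/-- The linear correction cancels the batch gradient at the centre u, so the batch enters only
through its Hessian, and at u the gradient is that of the minibatch. -/
theorem gradient_avg_prox (w : E d) {S S' : Finset (Fin n)} (hS : S.Nonempty)
    (hS' : S'.Nonempty) (γ : ℝ) (u θ : E d) :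
    gradient (avg (proxComponent (p.qComponent w) S S' γ u) S) θ =
      op (p.precond γ S) (θ - u) + p.qGrad w S' u := by
  rw [(hasGradientAt_avg S fun i => p.hasGradientAt_proxComponent w hS hS' γ u i θ).gradient]
  have hc : (S.card : ℝ) ≠ 0 := by exact_mod_cast hS.card_pos.ne'
  simp only [Finset.sum_add_distrib, Finset.sum_const, smul_add, p.avg_qGrad_singleton w hS]
  simp only [← Nat.cast_smul_eq_nsmul ℝ, smul_smul, inv_mul_cancel₀ hc, one_smul]
  simp only [qGrad, op_precond, map_sub, inv_mul_cancel_left₀ hc]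
  module

/-- The inner step of SVRG on the proximal objective. -/
theorem svrgInner_prox_succ (w : E d) {S S' : Finset (Fin n)} (hS : S.Nonempty)
    (hS' : S'.Nonempty) (γ η : ℝ) (u x : E d) (c : ℕ → Fin n) (i : ℕ) :
    svrgInner (proxComponent (p.qComponent w) S S' γ u) S η x c (i + 1) =
      svrgInner (proxComponent (p.qComponent w) S S' γ u) S η x c i -
        η • (op (p.precond γ {c i})
          (svrgInner (proxComponent (p.qComponent w) S S' γ u) S η x c i - x)
          + (op (p.precond γ S) (x - u) + p.qGrad w S' u)) := by
  rw [svrgInner, p.gradient_avg_prox w hS hS',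
    (p.hasGradientAt_proxComponent w hS hS' γ u (c i) _).gradient,
    (p.hasGradientAt_proxComponent w hS hS' γ u (c i) _).gradient]
  congr 2
  simp only [qGrad, op_precond, map_sub]
  module

theorem hasGradientAt_quadModel (w θ : E d) :
    HasGradientAt (p.quadModel w) (gradient p.risk w + op p.hessianBound (θ - w)) θ := by
  have hs : p.hessianBound.IsSymm := by
    rw [hessianBound_eq]; exact p.precond_isSymm _ _
  have h := hasGradientAt_add (hasGradientAt_add
    ((hasGradientAt_const θ (p.risk w)))
    (hasGradientAt_inner (gradient p.risk w) w θ)) (hasGradientAt_quadratic_form hs w θ)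
  rw [zero_add] at h
  exact h

variable {p}

theorem hasGradientAt_component {i : Fin n} (hd : Differentiable ℝ fun u => p.ℓ u (p.y i))
    (w : E d) : HasGradientAt (p.component i)
      (deriv (fun u => p.ℓ u (p.y i)) (inner ℝ w (p.x i)) • p.x i + p.μ • w) w := by
  have h1 := hasGradientAt_half_mul_norm_sq p.μ 0 w
  simp only [sub_zero] at h1
  refine hasGradientAt_add ?_ h1
  rw [hasGradientAt_iff_hasFDerivAt]
  have h2 := hasGradientAt_iff_hasFDerivAt.1 (hasGradientAt_inner (p.x i) 0 w)
  simp only [sub_zero] at h2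
  have h3 := ((hd (inner ℝ w (p.x i))).hasDerivAt)
  have e : (fun θ : E d => p.ℓ (inner ℝ θ (p.x i)) (p.y i)) =
      (fun u => p.ℓ u (p.y i)) ∘ fun θ : E d => inner ℝ (p.x i) θ := by
    ext θ; rw [Function.comp_apply, real_inner_comm]
  rw [e]
  rw [real_inner_comm] at h3 ⊢
  refine (h3.comp_hasFDerivAt w h2).congr_fderiv ?_
  rw [map_smulₛₗ]
  rfl

theorem risk_eq_avg (hn : 0 < n) : p.risk = avg p.component Finset.univ := by
  ext θ
  have : (n : ℝ) ≠ 0 := by positivity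
  simp only [risk, avg, component, Finset.sum_add_distrib, Finset.sum_const, Finset.card_univ,
    Fintype.card_fin, nsmul_eq_mul]
  field_simp

theorem gradient_risk (hn : 0 < n) (hd : ∀ i, Differentiable ℝ fun u => p.ℓ u (p.y i)) (w : E d) :
    gradient p.risk w = p.avgGrad w Finset.univ := by
  rw [risk_eq_avg hn, (hasGradientAt_avg Finset.univ fun i =>
    hasGradientAt_component (hd i) w).gradient, avgGrad]
  congr 1
  exact Finset.sum_congr rfl fun i _ => ((hasGradientAt_component (hd i) w).gradient).symm

theorem gradient_quadModel (hn : 0 < n) (hd : ∀ i, Differentiable ℝ fun u => p.ℓ u (p.y i))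
    (w θ : E d) : gradient (p.quadModel w) θ = p.qGrad w Finset.univ θ := by
  rw [(p.hasGradientAt_quadModel w θ).gradient, gradient_risk hn hd, qGrad, hessianBound_eq]

theorem gradVariance_eq (hn : 0 < n) (hd : ∀ i, Differentiable ℝ fun u => p.ℓ u (p.y i))
    (w θ : E d) : p.gradVariance w θ =
      (n : ℝ)⁻¹ * ∑ i, p.invHessianSq (p.qGrad w Finset.univ θ - p.qGrad w {i} θ) := by
  rw [gradVariance, one_div]
  congr 1
  refine Finset.sum_congr rfl fun i _ => ?_
  rw [gradient_quadModel hn hd, (p.hasGradientAt_qComponent w i θ).gradient]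

theorem measurable_gradient_component {i : Fin n} (hd : Differentiable ℝ fun u => p.ℓ u (p.y i)) :
    Measurable (gradient (p.component i)) := by
  have e : gradient (p.component i) = fun w =>
      deriv (fun u => p.ℓ u (p.y i)) (inner ℝ w (p.x i)) • p.x i + p.μ • w :=
    funext fun w => (hasGradientAt_component hd w).gradient
  rw [e]
  have h1 : Measurable fun w : E d => inner ℝ w (p.x i) :=
    (continuous_id.inner continuous_const).measurable
  exact (((measurable_deriv _).comp h1).smul_const _).add (measurable_id.const_smul p.μ)

end ERM

end

end HSDMPG

namespace HSDMPG

noncomputable section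

open Matrix MeasureTheory
open scoped ENNReal

/-! ### The variance of a sum over a random subset. -/

section Subsets

variable {ι m : Type*} [Fintype ι] [DecidableEq ι] [Fintype m]

omit [Fintype ι] [Fintype m] in
theorem sum_sub_sum_swap (y : ι → m → ℝ) {S : Finset ι} {i j : ι} (hi : i ∈ S) (hj : j ∉ S) :
    ∑ l ∈ S, y l - ∑ l ∈ insert j (S.erase i), y l = y i - y j := by
  rw [Finset.sum_insert (by simp [hj]), ← Finset.add_sum_erase S _ hi]
  abel

-- The regression property of swaps once more, now for centred vectors.
omit [Fintype m] in
theorem sum_sum_sub_sum_swap (y : ι → m → ℝ) (hy : ∑ i, y i = 0) (S : Finset ι) :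
    ∑ i ∈ S, ∑ j ∈ Sᶜ, (∑ l ∈ S, y l - ∑ l ∈ insert j (S.erase i), y l) =
      (Fintype.card ι : ℝ) • ∑ l ∈ S, y l := by
  have h1 : ∑ i ∈ S, ∑ j ∈ Sᶜ, (∑ l ∈ S, y l - ∑ l ∈ insert j (S.erase i), y l) =
      ∑ i ∈ S, ∑ j ∈ Sᶜ, (y i - y j) :=
    Finset.sum_congr rfl fun i hi => Finset.sum_congr rfl fun j hj =>
      sum_sub_sum_swap y hi (by simpa using hj)
  have h2 : ∑ j ∈ Sᶜ, y j = - ∑ i ∈ S, y i := by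
    rw [eq_neg_iff_add_eq_zero, add_comm, Finset.sum_add_sum_compl, hy]
  rw [h1]
  simp only [Finset.sum_sub_distrib, Finset.sum_const, Finset.card_compl, h2,
    ← Nat.cast_smul_eq_nsmul ℝ, ← Finset.smul_sum, Nat.cast_sub S.card_le_univ]
  module

/-- For centred values the sum over all swaps of the increments is a multiple of the total, and it
is antisymmetric under the exchange of the pair; hence the total vanishes. -/
theorem sum_powersetCard_sum_eq (b : ℕ) (f : ι → ℝ) :
    (Fintype.card ι : ℝ) * ∑ S ∈ Finset.powersetCard b (Finset.univ : Finset ι), ∑ i ∈ S, f i =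
      (Finset.powersetCard b (Finset.univ : Finset ι)).card * b * ∑ i, f i := by
  rcases isEmpty_or_nonempty ι with hι | hι
  · simp
  have hn : (Fintype.card ι : ℝ) ≠ 0 := by exact_mod_cast Fintype.card_ne_zero
  set y : ι → Unit → ℝ := fun i _ => f i - (Fintype.card ι : ℝ)⁻¹ * ∑ l, f l with hy
  have hy0 : ∑ i, y i = 0 := by
    ext u
    simp only [hy, Finset.sum_apply, Finset.sum_sub_distrib, Finset.sum_const, Finset.card_univ,
      nsmul_eq_mul, Pi.zero_apply]
    rw [mul_inv_cancel_left₀ hn, sub_self]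
  have h1 := sum_swap b (fun S S' _ _ : _ => ∑ l ∈ S, y l () - ∑ l ∈ S', y l ())
  have h2 : ∀ S : Finset ι, ∑ i ∈ S, ∑ j ∈ Sᶜ,
      (∑ l ∈ S, y l () - ∑ l ∈ insert j (S.erase i), y l ()) =
      (Fintype.card ι : ℝ) * ∑ l ∈ S, y l () := fun S => by
    have := congrFun (sum_sum_sub_sum_swap y hy0 S) ()
    simpa only [Finset.sum_apply, Pi.sub_apply, Pi.smul_apply, smul_eq_mul] using this
  have h3 : ∀ S : Finset ι, ∑ i ∈ S, ∑ j ∈ Sᶜ,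
      (∑ l ∈ insert j (S.erase i), y l () - ∑ l ∈ S, y l ()) =
      - ((Fintype.card ι : ℝ) * ∑ l ∈ S, y l ()) := fun S => by
    rw [← h2, ← Finset.sum_neg_distrib]
    refine Finset.sum_congr rfl fun i _ => ?_
    rw [← Finset.sum_neg_distrib]
    exact Finset.sum_congr rfl fun j _ => by ring
  simp only [h2, h3, Finset.sum_neg_distrib, ← Finset.mul_sum] at h1
  have h4 : ∑ S ∈ Finset.powersetCard b (Finset.univ : Finset ι), ∑ l ∈ S, y l () = 0 := by
    rcases mul_eq_zero.1 (by linarith : (Fintype.card ι : ℝ) *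
      ∑ S ∈ Finset.powersetCard b (Finset.univ : Finset ι), ∑ l ∈ S, y l () = 0) with h | h
    · exact absurd h hn
    · exact h
  have h5 : ∑ S ∈ Finset.powersetCard b (Finset.univ : Finset ι), ∑ l ∈ S, y l () =
      ∑ S ∈ Finset.powersetCard b (Finset.univ : Finset ι), ∑ i ∈ S, f i -
        (Finset.powersetCard b (Finset.univ : Finset ι)).card *
          (b * ((Fintype.card ι : ℝ)⁻¹ * ∑ l, f l)) := by
    rw [← nsmul_eq_mul, ← Finset.sum_const, ← Finset.sum_sub_distrib]
    refine Finset.sum_congr rfl fun S hS => ?_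
    rw [hy, Finset.sum_sub_distrib, Finset.sum_const, (Finset.mem_powersetCard.1 hS).2,
      nsmul_eq_mul]
  rw [h5, sub_eq_zero] at h4
  rw [h4]
  field_simp

/-- The variance of the sum over a uniformly random subset. -/
theorem sum_subset_form_le [DecidableEq m] {M : Matrix m m ℝ} (hM : M.PosSemidef) (y : ι → m → ℝ)
    (hy : ∑ i, y i = 0) {b : ℕ} (hb : b ≤ Fintype.card ι) :
    (Fintype.card ι : ℝ) ^ 2 * ∑ S ∈ Finset.powersetCard b (Finset.univ : Finset ι),
      (∑ i ∈ S, y i) ⬝ᵥ M *ᵥ (∑ i ∈ S, y i) ≤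
      2 * b * ((Fintype.card ι : ℝ) - b) *
        (Finset.powersetCard b (Finset.univ : Finset ι)).card * ∑ i, y i ⬝ᵥ M *ᵥ y i := by
  have hMs : M.IsSymm := by
    have := hM.isHermitian
    rwa [Matrix.IsHermitian, conjTranspose_eq_transpose_of_trivial] at this
  have hcomm : ∀ u v : m → ℝ, u ⬝ᵥ M *ᵥ v = v ⬝ᵥ M *ᵥ u := fun u v => by
    rw [dotProduct_mulVec, ← mulVec_transpose, hMs.eq, dotProduct_comm]
  have hnn : ∀ u : m → ℝ, 0 ≤ u ⬝ᵥ M *ᵥ u := fun u => by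
    have := hM.dotProduct_mulVec_nonneg u
    rwa [star_trivial] at this
  set P := Finset.powersetCard b (Finset.univ : Finset ι)
  set D : Finset ι → m → ℝ := fun S => ∑ i ∈ S, y i with hD
  set q : (m → ℝ) → ℝ := fun u => u ⬝ᵥ M *ᵥ u with hq
  have h1 : ∀ S : Finset ι, (Fintype.card ι : ℝ) * q (D S) =
      ∑ i ∈ S, ∑ j ∈ Sᶜ, (D S - D (insert j (S.erase i))) ⬝ᵥ M *ᵥ D S := fun S => by
    have := sum_sum_sub_sum_swap y hy S
    simp only [← sum_dotProduct]
    rw [this, smul_dotProduct, smul_eq_mul]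
  have h2 := sum_swap b (fun S S' _ _ : _ => (D S - D S') ⬝ᵥ M *ᵥ D S)
  have h3 : ∑ S ∈ P, ∑ i ∈ S, ∑ j ∈ Sᶜ, q (D S - D (insert j (S.erase i))) =
      2 * ∑ S ∈ P, (Fintype.card ι : ℝ) * q (D S) := by
    have e : ∀ u v : m → ℝ, q (u - v) = (u - v) ⬝ᵥ M *ᵥ u + (v - u) ⬝ᵥ M *ᵥ v := fun u v => by
      simp only [hq, mulVec_sub, sub_dotProduct, dotProduct_sub]
      ring
    simp only [e, Finset.sum_add_distrib]
    rw [← h2, ← two_mul]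
    simp only [h1]
  -- Here the factor 2 of the statement is lost, by q(u - v) ≤ 2q(u) + 2q(v). The finite-population
  -- factor n - b survives, which matters for minibatches that are the full sample.
  have h4 : ∀ S ∈ P, ∑ i ∈ S, ∑ j ∈ Sᶜ, q (D S - D (insert j (S.erase i))) ≤
      2 * (((Fintype.card ι : ℝ) - b) * ∑ i ∈ S, q (y i) + b * ∑ j ∈ Sᶜ, q (y j)) := fun S hS => by
    have hc : S.card = b := (Finset.mem_powersetCard.1 hS).2
    calc ∑ i ∈ S, ∑ j ∈ Sᶜ, q (D S - D (insert j (S.erase i)))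
        ≤ ∑ i ∈ S, ∑ j ∈ Sᶜ, 2 * (q (y i) + q (y j)) := by
          refine Finset.sum_le_sum fun i hi => Finset.sum_le_sum fun j hj => ?_
          rw [hD, sum_sub_sum_swap y hi (by simpa using hj)]
          have := hnn (y i + y j)
          simp only [mulVec_add, add_dotProduct, dotProduct_add] at this
          simp only [hq, mulVec_sub, sub_dotProduct, dotProduct_sub]
          linarith
      _ = _ := by
          simp only [← Finset.mul_sum, Finset.sum_add_distrib, Finset.sum_const, Finset.card_compl,
            nsmul_eq_mul, hc, Nat.cast_sub hb]
  have h5 := Finset.sum_le_sum h4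
  rw [h3] at h5
  have h6 : ∀ S : Finset ι, ∑ j ∈ Sᶜ, q (y j) = ∑ j, q (y j) - ∑ j ∈ S, q (y j) := fun S => by
    rw [← Finset.sum_add_sum_compl S]; ring
  simp only [h6, ← Finset.mul_sum, Finset.sum_add_distrib, Finset.sum_sub_distrib,
    Finset.sum_const, nsmul_eq_mul] at h5
  have h7 := sum_powersetCard_sum_eq b (fun i => q (y i))
  have hn : (0 : ℝ) ≤ Fintype.card ι := by positivity
  have h8 := mul_le_mul_of_nonneg_left h5 hn
  change (Fintype.card ι : ℝ) ^ 2 * ∑ S ∈ P, q (D S) ≤ _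
  change _ ≤ 2 * (b : ℝ) * ((Fintype.card ι : ℝ) - b) * (P.card : ℝ) * ∑ i, q (y i)
  change (Fintype.card ι : ℝ) * ∑ S ∈ P, ∑ i ∈ S, q (y i) = P.card * b * ∑ i, q (y i) at h7
  linear_combination (1 / 2) * h8 + ((Fintype.card ι : ℝ) - 2 * b) * h7

end Subsets

instance : DecidableEq Draw := Classical.decEq _

/-! ### Redrawing one coordinate of the product law. -/

section Law

variable {n : ℕ} (z : Sizes n)

instance (a : Draw) : IsProbabilityMeasure (PMF.uniformOfFintype (a.Val z)).toMeasure :=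
  PMF.toMeasure.isProbabilityMeasure _

instance : IsProbabilityMeasure (law z) := by
  unfold law; infer_instance

/-- A product measure is determined by finite boxes. In a box either the coordinate `a` is
constrained and factors off as the fresh draw, or it is free and the update is invisible. -/
theorem map_update_law (a : Draw) :
    ((law z).prod (PMF.uniformOfFintype (a.Val z)).toMeasure).map
      (fun q : Outcome z × a.Val z => Function.update q.1 a q.2) = law z := by
  refine Measure.eq_infinitePi _ fun s t ht => ?_
  have hm : Measurable (fun q : Outcome z × a.Val z => Function.update q.1 a q.2) :=
    measurable_update'
  rw [Measure.map_apply hm (MeasurableSet.pi s.countable_toSet fun i _ => ht i)]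
  by_cases ha : a ∈ s
  · have e : (fun q : Outcome z × a.Val z => Function.update q.1 a q.2) ⁻¹'
        (Set.pi (s : Set Draw) t) = (Set.pi ((s.erase a : Finset Draw) : Set Draw) t) ×ˢ t a := by
      ext ⟨ω, v⟩
      simp only [Set.mem_preimage, Set.mem_pi, Finset.mem_coe, Set.mem_prod, Finset.mem_erase]
      constructor
      · intro h
        refine ⟨fun i hi => ?_, ?_⟩
        · have := h i hi.2
          rwa [Function.update_of_ne hi.1] at this
        · have := h a ha
          rwa [Function.update_self] at this
      · rintro ⟨h1, h2⟩ i hi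
        by_cases hia : i = a
        · subst hia; rwa [Function.update_self]
        · rw [Function.update_of_ne hia]; exact h1 i ⟨hia, hi⟩
    rw [e, Measure.prod_prod, law, Measure.infinitePi_pi _ fun i _ => ht i,
      ← Finset.prod_erase_mul s _ ha]
  · have e : (fun q : Outcome z × a.Val z => Function.update q.1 a q.2) ⁻¹'
        (Set.pi (s : Set Draw) t) = (Set.pi (s : Set Draw) t) ×ˢ Set.univ := by
      ext ⟨ω, v⟩
      simp only [Set.mem_preimage, Set.mem_pi, Finset.mem_coe, Set.mem_prod, Set.mem_univ, and_true]
      refine forall₂_congr fun i hi => ?_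
      rw [Function.update_of_ne (by rintro rfl; exact ha hi)]
    rw [e, Measure.prod_prod, measure_univ, mul_one, law, Measure.infinitePi_pi _ fun i _ => ht i]

variable {z}

/-- Redrawing one of the draws does not change the law. -/
theorem lintegral_resample (a : Draw) {f : Outcome z → ℝ≥0∞} (hf : Measurable f) :
    ∫⁻ ω, f ω ∂law z = ∫⁻ ω, (Fintype.card (a.Val z) : ℝ≥0∞)⁻¹ *
      ∑ v, f (Function.update ω a v) ∂law z := by
  conv_lhs => rw [← map_update_law z a]
  have hm : Measurable (fun q : Outcome z × a.Val z => Function.update q.1 a q.2) :=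
    measurable_update'
  rw [lintegral_map hf hm, lintegral_prod (fun q : Outcome z × a.Val z => f (Function.update q.1 a q.2))
    (hf.comp hm).aemeasurable]
  refine lintegral_congr fun ω => ?_
  rw [lintegral_fintype, Finset.mul_sum]
  refine Finset.sum_congr rfl fun v _ => ?_
  rw [PMF.toMeasure_apply_singleton _ _ (measurableSet_singleton v), PMF.uniformOfFintype_apply,
    mul_comm]

/-- A substitute for conditional expectation: a bound for the average over a single draw, with all
other draws frozen, integrates to a bound in expectation. -/
theorem lintegral_ofReal_le_of_resample (a : Draw) {F G : Outcome z → ℝ} (hF : Measurable F)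
    (hF0 : ∀ ω, 0 ≤ F ω)
    (h : ∀ ω, (Fintype.card (a.Val z) : ℝ)⁻¹ * ∑ v, F (Function.update ω a v) ≤ G ω) :
    ∫⁻ ω, ENNReal.ofReal (F ω) ∂law z ≤ ∫⁻ ω, ENNReal.ofReal (G ω) ∂law z := by
  rw [lintegral_resample a hF.ennreal_ofReal]
  refine lintegral_mono fun ω => ?_
  have hc : (0 : ℝ) < Fintype.card (a.Val z) := by exact_mod_cast Fintype.card_pos
  rw [← ENNReal.ofReal_sum_of_nonneg fun v _ => hF0 _, ← ENNReal.ofReal_natCast,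
    ← ENNReal.ofReal_inv_of_pos hc, ← ENNReal.ofReal_mul (by positivity)]
  exact ENNReal.ofReal_le_ofReal (h ω)

end Law

end

end HSDMPG

namespace HSDMPG

noncomputable section

open Matrix MeasureTheory
open scoped ENNReal

/-! ### Which draws the iterates depend on. -/

section Congruence

variable {n d : ℕ}

theorem svrgInner_congr (p : Fin n → E d → ℝ) (S : Finset (Fin n)) (η : ℝ) (x : E d)
    {c c' : ℕ → Fin n} (i : ℕ) (h : ∀ l < i, c l = c' l) :
    svrgInner p S η x c i = svrgInner p S η x c' i := by
  induction i with
  | zero => rfl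
  | succ i ih =>
    rw [svrgInner, svrgInner, ih fun l hl => h l (by omega), h i (by omega)]

theorem svrgSnapshot_congr (p : Fin n → E d → ℝ) (S : Finset (Fin n)) (η : ℝ) (x : E d)
    {c c' : ℕ → ℕ → Fin n} {pick pick' : ℕ → ℕ} (j : ℕ) (h : ∀ l < j, c l = c' l)
    (h' : ∀ l < j, pick l = pick' l) :
    svrgSnapshot p S η x c pick j = svrgSnapshot p S η x c' pick' j := by
  induction j with
  | zero => rfl
  | succ j ih =>
    rw [svrgSnapshot, svrgSnapshot, ih (fun l hl => h l (by omega)) fun l hl => h' l (by omega),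
      h j (by omega), h' j (by omega)]

theorem innerIter_congr (f : Fin n → E d → ℝ) (S : Finset (Fin n))
    {mini mini' : ℕ → Finset (Fin n)} (γ η : ℝ) (ε : ℕ → ℝ) {c c' : ℕ → ℕ → ℕ → Fin n}
    {pick pick' : ℕ → ℕ → ℕ} (x : E d) (k : ℕ) (h1 : ∀ l ≤ k, mini l = mini' l)
    (h2 : ∀ l ≤ k, c l = c' l) (h3 : ∀ l ≤ k, pick l = pick' l) :
    innerIter f S mini γ η ε c pick x k = innerIter f S mini' γ η ε c' pick' x k := by
  induction k with
  | zero => rfl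
  | succ k ih =>
    rw [innerIter, innerIter, ih (fun l hl => h1 l (by omega)) (fun l hl => h2 l (by omega))
      fun l hl => h3 l (by omega), h1 _ le_rfl, h2 _ le_rfl, h3 _ le_rfl]

/-- The outer iteration in which a draw is made. -/
def Draw.time : Draw → ℕ
  | .batch t => t
  | .mini t _ => t
  | .comp t _ _ _ => t
  | .pick t _ _ => t

/-- The inner iteration in which a draw is made; the batch is drawn in inner iteration `0`. -/
def Draw.stage : Draw → ℕ
  | .batch _ => 0
  | .mini _ k => k
  | .comp _ k _ _ => k
  | .pick _ k _ => k

variable {Y : Type*} {z : Sizes n}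

theorem batch_congr {ω ω' : Outcome z} {t : ℕ} (h : ω (.batch t) = ω' (.batch t)) :
    batch ω t = batch ω' t := by
  rw [batch, batch, h]

theorem minibatch_congr {ω ω' : Outcome z} {t k : ℕ} (h : ω (.mini t k) = ω' (.mini t k)) :
    minibatch ω t k = minibatch ω' t k := by
  rw [minibatch, minibatch, h]

theorem sampled_congr {ω ω' : Outcome z} {t k j i : ℕ} (h : ω (.batch t) = ω' (.batch t))
    (h' : ω (.comp t k j i) = ω' (.comp t k j i)) : sampled ω t k j i = sampled ω' t k j i := by
  unfold sampled
  rw [h']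
  congr 1
  have := batch_congr h
  congr!

theorem picked_congr {ω ω' : Outcome z} {t k j : ℕ} (h : ω (.pick t k j) = ω' (.pick t k j)) :
    picked ω t k j = picked ω' t k j := by
  unfold picked
  rw [h]

variable (p : ERM n d Y) (τ : Tuning) (θ₀ : E d)

theorem innerRun_congr {ω ω' : Outcome z} {t k : ℕ}
    (h : ∀ a : Draw, a.time = t → a.stage ≤ k → ω a = ω' a) (w : E d) :
    innerRun p z τ ω t w k = innerRun p z τ ω' t w k := by
  have hb : ω (.batch t) = ω' (.batch t) := h _ rfl (Nat.zero_le _)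
  rw [innerRun, innerRun, batch_congr hb]
  refine innerIter_congr _ _ _ _ _ _ _ (fun l hl => ?_) (fun l hl => ?_) fun l hl => ?_
  · exact minibatch_congr (h _ rfl hl)
  · funext j i; exact sampled_congr hb (h _ rfl hl)
  · funext j; exact picked_congr (h _ rfl hl)

theorem outerRun_congr {ω ω' : Outcome z} {t : ℕ} (h : ∀ a : Draw, a.time ≤ t → ω a = ω' a) :
    outerRun p z τ θ₀ ω t = outerRun p z τ θ₀ ω' t := by
  induction t with
  | zero => rfl
  | succ t ih =>
    rw [outerRun, outerRun, ih fun a ha => h a (by omega)]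
    exact innerRun_congr p τ (fun a ha _ => h a ha.le) _

end Congruence

section Run

variable {n d : ℕ} {Y : Type*} (p : ERM n d Y) (z : Sizes n) (τ : Tuning) (θ₀ : E d)

/-- The iterate `k` of outer iteration `t + 1`. -/
def iter (ω : Outcome z) (t k : ℕ) : E d :=
  innerRun p z τ ω (t + 1) (outerRun p z τ θ₀ ω t) k

/-- The components of the proximal objective of inner iteration `k + 1`. -/
def prox (ω : Outcome z) (t k : ℕ) : Fin n → E d → ℝ :=
  proxComponent (p.qComponent (outerRun p z τ θ₀ ω t)) (batch ω (t + 1))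
    (minibatch ω (t + 1) (k + 1)) τ.γ (iter p z τ θ₀ ω t k)

/-- The snapshots of SVRG in inner iteration `k + 1`. -/
def snap (ω : Outcome z) (t k j : ℕ) : E d :=
  svrgSnapshot (prox p z τ θ₀ ω t k) (batch ω (t + 1)) τ.η (iter p z τ θ₀ ω t k)
    (sampled ω (t + 1) (k + 1)) (picked ω (t + 1) (k + 1)) j

/-- The inner iterates of epoch `j` of SVRG in inner iteration `k + 1`. -/
def innerStep (ω : Outcome z) (t k j i : ℕ) : E d :=
  svrgInner (prox p z τ θ₀ ω t k) (batch ω (t + 1)) τ.η (snap p z τ θ₀ ω t k j)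
    (sampled ω (t + 1) (k + 1) j) i

/-- The number of epochs of SVRG in inner iteration `k + 1`. -/
def epochs (ω : Outcome z) (t k : ℕ) : ℕ∞ :=
  svrgEpochs (prox p z τ θ₀ ω t k) (batch ω (t + 1)) τ.η (τ.ε (k + 1)) (iter p z τ θ₀ ω t k)
    (sampled ω (t + 1) (k + 1)) (picked ω (t + 1) (k + 1))

/-- The gradient of the proximal objective of inner iteration `k + 1`. -/
def proxGrad (ω : Outcome z) (t k : ℕ) (θ : E d) : E d :=
  op (p.precond τ.γ (batch ω (t + 1))) (θ - iter p z τ θ₀ ω t k) +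
    p.qGrad (outerRun p z τ θ₀ ω t) (minibatch ω (t + 1) (k + 1)) (iter p z τ θ₀ ω t k)

variable {z}

theorem iter_zero (ω : Outcome z) (t : ℕ) : iter p z τ θ₀ ω t 0 = outerRun p z τ θ₀ ω t := rfl

theorem outerRun_succ (ω : Outcome z) (t : ℕ) :
    outerRun p z τ θ₀ ω (t + 1) = iter p z τ θ₀ ω t (τ.K (t + 1)) := rfl

theorem iter_succ (ω : Outcome z) (t k : ℕ) :
    iter p z τ θ₀ ω t (k + 1) = snap p z τ θ₀ ω t k (epochs p z τ θ₀ ω t k).toNat := rfl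

theorem snap_zero (ω : Outcome z) (t k : ℕ) :
    snap p z τ θ₀ ω t k 0 = iter p z τ θ₀ ω t k := rfl

theorem snap_succ (ω : Outcome z) (t k j : ℕ) :
    snap p z τ θ₀ ω t k (j + 1) =
      innerStep p z τ θ₀ ω t k j (picked ω (t + 1) (k + 1) j) := rfl

theorem inner_zero (ω : Outcome z) (t k j : ℕ) :
    innerStep p z τ θ₀ ω t k j 0 = snap p z τ θ₀ ω t k j := rfl

theorem batch_nonempty (ω : Outcome z) (t : ℕ) : (batch ω t).Nonempty := by
  rw [← Finset.card_pos, batch_card]; exact z.s_pos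

theorem minibatch_card (ω : Outcome z) (t k : ℕ) : (minibatch ω t k).card = z.b k :=
  Subtype.property (p := fun S : Finset (Fin n) => S.card = z.b k) (ω (.mini t k))

theorem minibatch_nonempty (hb : ∀ k, 0 < z.b k) (ω : Outcome z) (t k : ℕ) :
    (minibatch ω t k).Nonempty := by
  rw [← Finset.card_pos, minibatch_card]; exact hb k

theorem gradient_avg_prox_eq (hb : ∀ k, 0 < z.b k) (ω : Outcome z) (t k : ℕ) (θ : E d) :
    gradient (avg (prox p z τ θ₀ ω t k) (batch ω (t + 1))) θ = proxGrad p z τ θ₀ ω t k θ :=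
  p.gradient_avg_prox _ (batch_nonempty ω _) (minibatch_nonempty hb ω _ _) _ _ _

theorem inner_succ (hb : ∀ k, 0 < z.b k) (ω : Outcome z) (t k j i : ℕ) :
    innerStep p z τ θ₀ ω t k j (i + 1) = innerStep p z τ θ₀ ω t k j i -
      τ.η • (op (p.precond τ.γ {sampled ω (t + 1) (k + 1) j i})
        (innerStep p z τ θ₀ ω t k j i - snap p z τ θ₀ ω t k j)
          + proxGrad p z τ θ₀ ω t k (snap p z τ θ₀ ω t k j)) :=
  p.svrgInner_prox_succ _ (batch_nonempty ω _) (minibatch_nonempty hb ω _ _) _ _ _ _ _ _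

theorem oracleCalls_eq (ω : Outcome z) (T : ℕ) :
    oracleCalls p z τ θ₀ ω T = ∑ t ∈ Finset.range T, ∑ k ∈ Finset.range (τ.K (t + 1)),
      ((z.b (k + 1) : ℕ∞) + (epochs p z τ θ₀ ω t k + 1) * (z.s : ℕ∞) +
        epochs p z τ θ₀ ω t k * (2 * (z.m : ℕ∞))) := by
  rw [oracleCalls]
  refine Finset.sum_congr rfl fun t _ => Finset.sum_congr rfl fun k _ => ?_
  rw [← minibatch_card ω (t + 1) (k + 1), ← batch_card ω (t + 1)]
  rfl

/-! ### Independence of later draws -/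

theorem outerRun_update (ω : Outcome z) {t : ℕ} {a : Draw} (ha : t < a.time) (v : a.Val z) :
    outerRun p z τ θ₀ (Function.update ω a v) t = outerRun p z τ θ₀ ω t :=
  outerRun_congr p τ θ₀ fun b hb => Function.update_of_ne (by rintro rfl; omega) _ _

/-- Within an outer iteration, iterate k uses only draws of stage at most k, the batch having stage
0. The minibatch and the SVRG draws of inner iteration k + 1 are therefore fresh. -/
theorem iter_update (ω : Outcome z) {t k : ℕ} {a : Draw} (ha : a.time = t + 1)
    (hk : k < a.stage) (v : a.Val z) :
    iter p z τ θ₀ (Function.update ω a v) t k = iter p z τ θ₀ ω t k := by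
  rw [iter, iter, outerRun_update p τ θ₀ ω (by omega)]
  exact innerRun_congr p τ
    (fun b _ hb' => Function.update_of_ne (by rintro rfl; omega) _ _) _

theorem batch_update (ω : Outcome z) (t : ℕ) {a : Draw} (ha : a ≠ .batch t) (v : a.Val z) :
    batch (Function.update ω a v) t = batch ω t :=
  batch_congr (Function.update_of_ne ha.symm _ _)

theorem minibatch_update (ω : Outcome z) (t k : ℕ) {a : Draw} (ha : a ≠ .mini t k)
    (v : a.Val z) : minibatch (Function.update ω a v) t k = minibatch ω t k :=
  minibatch_congr (Function.update_of_ne ha.symm _ _)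

theorem batch_update_self (ω : Outcome z) (t : ℕ) (v : (Draw.batch t).Val z) :
    batch (Function.update ω (.batch t) v) t =
      Subtype.val (p := fun S : Finset (Fin n) => S.card = z.s) v := by
  rw [batch, Function.update_self]

theorem minibatch_update_self (ω : Outcome z) (t k : ℕ) (v : (Draw.mini t k).Val z) :
    minibatch (Function.update ω (.mini t k) v) t k =
      Subtype.val (p := fun S : Finset (Fin n) => S.card = z.b k) v := by
  rw [minibatch, Function.update_self]

theorem picked_update_self (ω : Outcome z) (t k j : ℕ) (v : (Draw.pick t k j).Val z) :
    picked (Function.update ω (.pick t k j) v) t k j = Fin.val (show Fin z.m from v) := by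
  rw [picked, Function.update_self]

theorem sampled_update_self (ω : Outcome z) (t k j i : ℕ) (v : (Draw.comp t k j i).Val z) :
    sampled (Function.update ω (.comp t k j i) v) t k j i =
      (batch ω t).orderEmbOfFin (batch_card ω t) (show Fin z.s from v) := by
  have h := batch_update ω t (a := .comp t k j i) (by simp) v
  unfold sampled
  rw [Function.update_self]
  congr 1
  congr!

section Later

variable (ω : Outcome z) (t k : ℕ) {a : Draw} (ha : a.time = t + 1) (hk : a.stage = k + 1)
  (hm : a ≠ .mini (t + 1) (k + 1)) (v : a.Val z)

include ha hk

theorem batch_update_later : batch (Function.update ω a v) (t + 1) = batch ω (t + 1) :=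
  batch_update ω _ (by rintro rfl; simp [Draw.stage] at hk) v

include hm

theorem prox_update : prox p z τ θ₀ (Function.update ω a v) t k = prox p z τ θ₀ ω t k := by
  rw [prox, prox, outerRun_update p τ θ₀ ω (by omega), iter_update p τ θ₀ ω ha (by omega),
    minibatch_update ω _ _ hm, batch_update_later ω t k ha hk]

theorem proxGrad_update :
    proxGrad p z τ θ₀ (Function.update ω a v) t k = proxGrad p z τ θ₀ ω t k := by
  funext θ
  rw [proxGrad, proxGrad, outerRun_update p τ θ₀ ω (by omega),
    iter_update p τ θ₀ ω ha (by omega), minibatch_update ω _ _ hm, batch_update_later ω t k ha hk]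

theorem snap_update {j : ℕ} (hc : ∀ l < j, ∀ i, a ≠ .comp (t + 1) (k + 1) l i)
    (hp : ∀ l < j, a ≠ .pick (t + 1) (k + 1) l) :
    snap p z τ θ₀ (Function.update ω a v) t k j = snap p z τ θ₀ ω t k j := by
  rw [snap, snap, prox_update p τ θ₀ ω t k ha hk hm, iter_update p τ θ₀ ω ha (by omega),
    batch_update_later ω t k ha hk]
  have hb : (Function.update ω a v) (.batch (t + 1)) = ω (.batch (t + 1)) :=
    Function.update_of_ne (by rintro rfl; simp [Draw.stage] at hk) _ _
  refine svrgSnapshot_congr _ _ _ _ _ (fun l hl => ?_) fun l hl => ?_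
  · funext i
    exact sampled_congr hb (Function.update_of_ne (hc l hl i).symm _ _)
  · exact picked_congr (Function.update_of_ne (hp l hl).symm _ _)

theorem inner_update {j i : ℕ} (hc : ∀ l < j, ∀ i, a ≠ .comp (t + 1) (k + 1) l i)
    (hp : ∀ l < j, a ≠ .pick (t + 1) (k + 1) l)
    (hi : ∀ l < i, a ≠ .comp (t + 1) (k + 1) j l) :
    innerStep p z τ θ₀ (Function.update ω a v) t k j i = innerStep p z τ θ₀ ω t k j i := by
  rw [innerStep, innerStep, prox_update p τ θ₀ ω t k ha hk hm, snap_update p τ θ₀ ω t k ha hk hm v hc hp,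
    batch_update_later ω t k ha hk]
  have hb : (Function.update ω a v) (.batch (t + 1)) = ω (.batch (t + 1)) :=
    Function.update_of_ne (by rintro rfl; simp [Draw.stage] at hk) _ _
  exact svrgInner_congr _ _ _ _ _ fun l hl =>
    sampled_congr hb (Function.update_of_ne (hi l hl).symm _ _)

end Later

end Run

end

end HSDMPG

namespace HSDMPG

noncomputable section

open Matrix MeasureTheory
open scoped ENNReal

/-! ### Measurability of the iterates and of the stopping time. -/

section Measurability

/-- Batches, sampled components, picks and epoch numbers are random but take countably many values,
so it suffices to treat each fixed value. -/
theorem measurable_of_countable_index {Ω ι β : Type*} [MeasurableSpace Ω] [MeasurableSpace ι]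
    [MeasurableSpace β] [Countable ι] [MeasurableSingletonClass ι] {I : Ω → ι} (hI : Measurable I)
    {F : ι → Ω → β} (hF : ∀ i, Measurable (F i)) : Measurable fun ω => F (I ω) ω := by
  have h : Measurable (fun q : ι × Ω => F q.1 q.2) := measurable_from_prod_countable_right hF
  exact h.comp (hI.prodMk measurable_id)

instance {n : ℕ} : MeasurableSpace (Finset (Fin n)) := ⊤

instance {n : ℕ} : MeasurableSingletonClass (Finset (Fin n)) := ⟨fun _ => trivial⟩

variable {n d : ℕ} {Y : Type*} {z : Sizes n}

theorem measurable_draw (a : Draw) : Measurable fun ω : Outcome z => ω a := measurable_pi_apply a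

theorem measurable_batch (t : ℕ) : Measurable fun ω : Outcome z => batch ω t :=
  (Measurable.of_discrete (f := fun v : (Draw.batch t).Val z =>
    Subtype.val (p := fun S : Finset (Fin n) => S.card = z.s) v)).comp (measurable_draw (.batch t))

theorem measurable_minibatch (t k : ℕ) : Measurable fun ω : Outcome z => minibatch ω t k :=
  (Measurable.of_discrete (f := fun v : (Draw.mini t k).Val z =>
    Subtype.val (p := fun S : Finset (Fin n) => S.card = z.b k) v)).comp
      (measurable_draw (.mini t k))

theorem measurable_picked (t k j : ℕ) : Measurable fun ω : Outcome z => picked ω t k j :=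
  (Measurable.of_discrete (f := fun v : (Draw.pick t k j).Val z =>
    Fin.val (show Fin z.m from v))).comp (measurable_draw (.pick t k j))

theorem measurable_sampled (t k j i : ℕ) : Measurable fun ω : Outcome z => sampled ω t k j i := by
  have hg : ∀ g : (Draw.batch t).Val z → (Draw.comp t k j i).Val z → Fin n,
      Measurable fun ω : Outcome z => g (ω (.batch t)) (ω (.comp t k j i)) := fun g =>
    measurable_of_countable_index (measurable_draw (.batch t))
      (F := fun v ω => g v (ω (.comp t k j i))) fun v =>
      (Measurable.of_discrete (f := g v)).comp (measurable_draw (.comp t k j i))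
  exact hg fun v v' => (Subtype.val (p := fun S : Finset (Fin n) => S.card = z.s) v).orderEmbOfFin
    (Subtype.property (p := fun S : Finset (Fin n) => S.card = z.s) v) (show Fin z.s from v')

variable {p : ERM n d Y} {τ : Tuning} {θ₀ : E d}

theorem measurable_qGrad (hd : ∀ i, Differentiable ℝ fun u => p.ℓ u (p.y i)) (S : Finset (Fin n))
    {w θ : Outcome z → E d} (hw : Measurable w) (hθ : Measurable θ) :
    Measurable fun ω => p.qGrad (w ω) S (θ ω) := by
  unfold ERM.qGrad ERM.avgGrad
  refine Measurable.add ?_ ((op _).continuous.measurable.comp (hθ.sub hw))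
  refine Measurable.const_smul (c := (S.card : ℝ)⁻¹) ?_
  exact Finset.measurable_sum _ fun i _ =>
    (ERM.measurable_gradient_component (hd i)).comp hw

theorem measurable_op_comp (M : Matrix (Fin d) (Fin d) ℝ) {θ : Outcome z → E d}
    (hθ : Measurable θ) : Measurable fun ω => op M (θ ω) :=
  (op M).continuous.measurable.comp hθ

section Step

variable (hd : ∀ i, Differentiable ℝ fun u => p.ℓ u (p.y i)) (hb : ∀ k, 0 < z.b k)
  {t k : ℕ} (hw : Measurable fun ω : Outcome z => outerRun p z τ θ₀ ω t)
  (hu : Measurable fun ω : Outcome z => iter p z τ θ₀ ω t k)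

include hd hw hu

theorem measurable_proxGrad {θ : Outcome z → E d} (hθ : Measurable θ) :
    Measurable fun ω => proxGrad p z τ θ₀ ω t k (θ ω) := by
  unfold proxGrad
  refine Measurable.add ?_ ?_
  · exact measurable_of_countable_index (measurable_batch (t + 1))
      (F := fun S ω => op (p.precond τ.γ S) (θ ω - iter p z τ θ₀ ω t k))
      fun S => measurable_op_comp _ (hθ.sub hu)
  · exact measurable_of_countable_index (measurable_minibatch (t + 1) (k + 1))
      (F := fun S ω => p.qGrad (outerRun p z τ θ₀ ω t) S (iter p z τ θ₀ ω t k))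
      fun S => measurable_qGrad hd S hw hu

include hb

theorem measurable_inner_of_snap {j : ℕ}
    (hs : Measurable fun ω : Outcome z => snap p z τ θ₀ ω t k j) (i : ℕ) :
    Measurable fun ω : Outcome z => innerStep p z τ θ₀ ω t k j i := by
  induction i with
  | zero => exact hs
  | succ i ih =>
    simp only [inner_succ p τ θ₀ hb]
    refine ih.sub (Measurable.const_smul (c := τ.η) (Measurable.add ?_ ?_))
    · exact measurable_of_countable_index (measurable_sampled (t + 1) (k + 1) j i)
        (F := fun l ω => op (p.precond τ.γ {l})
          (innerStep p z τ θ₀ ω t k j i - snap p z τ θ₀ ω t k j))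
        fun l => measurable_op_comp _ (ih.sub hs)
    · exact measurable_proxGrad hd hw hu hs

theorem measurable_snap_of_iter (j : ℕ) :
    Measurable fun ω : Outcome z => snap p z τ θ₀ ω t k j := by
  induction j with
  | zero => exact hu
  | succ j ih =>
    simp only [snap_succ]
    exact measurable_of_countable_index (measurable_picked (t + 1) (k + 1) j)
      (F := fun i ω => innerStep p z τ θ₀ ω t k j i)
      fun i => measurable_inner_of_snap hd hb hw hu ih i

end Step

theorem epochs_eq_iInf (hb : ∀ k, 0 < z.b k) (ω : Outcome z) (t k : ℕ) :
    epochs p z τ θ₀ ω t k = sInf ((fun j : ℕ => (j : ℕ∞)) ''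
      {j : ℕ | ‖proxGrad p z τ θ₀ ω t k (snap p z τ θ₀ ω t k j)‖ ≤ τ.ε (k + 1)}) := by
  rw [epochs, svrgEpochs]
  congr 2
  ext j
  rw [Set.mem_ofPred_eq, Set.mem_ofPred_eq, gradient_avg_prox_eq p τ θ₀ hb]
  rfl

theorem epochs_le_iff (hb : ∀ k, 0 < z.b k) (ω : Outcome z) (t k j : ℕ) :
    epochs p z τ θ₀ ω t k ≤ j ↔
      ∃ l ≤ j, ‖proxGrad p z τ θ₀ ω t k (snap p z τ θ₀ ω t k l)‖ ≤ τ.ε (k + 1) := by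
  rw [epochs_eq_iInf hb]
  constructor
  · intro h
    have hne : ((fun j : ℕ => (j : ℕ∞)) ''
      {j : ℕ | ‖proxGrad p z τ θ₀ ω t k (snap p z τ θ₀ ω t k j)‖ ≤ τ.ε (k + 1)}).Nonempty := by
      by_contra hne
      rw [Set.not_nonempty_iff_eq_empty] at hne
      rw [hne, sInf_empty, top_le_iff] at h
      exact ENat.natCast_ne_top j h
    obtain ⟨l, hl, he⟩ := csInf_mem hne
    rw [← he] at h
    exact ⟨l, by simpa using h, hl⟩
  · rintro ⟨l, hl, h⟩
    exact le_trans (sInf_le (Set.mem_image_of_mem (fun j : ℕ => (j : ℕ∞)) h))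
      (Nat.cast_le.2 hl)

/-- Finiteness cannot be dropped: if no snapshot is accurate, `toNat` sends ⊤ to 0 and the output is
the starting point. -/
theorem norm_proxGrad_iter_succ_le (hb : ∀ k, 0 < z.b k) (ω : Outcome z) (t k : ℕ)
    (h : epochs p z τ θ₀ ω t k ≠ ⊤) :
    ‖proxGrad p z τ θ₀ ω t k (iter p z τ θ₀ ω t (k + 1))‖ ≤ τ.ε (k + 1) := by
  set J := (epochs p z τ θ₀ ω t k).toNat with hJ
  have hJ' : epochs p z τ θ₀ ω t k = J := (ENat.natCast_toNat h).symm
  obtain ⟨l, hl, hle⟩ := (epochs_le_iff hb ω t k J).1 hJ'.le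
  have : (J : ℕ∞) ≤ l := by rw [← hJ']; exact (epochs_le_iff hb ω t k l).2 ⟨l, le_rfl, hle⟩
  have hlJ : l = J := le_antisymm hl (by exact_mod_cast this)
  rw [iter_succ, ← hJ, ← hlJ]
  exact hle

/-- The number of epochs is at most the number of snapshots that are not accurate enough. -/
theorem epochs_le_tsum (hb : ∀ k, 0 < z.b k) (ω : Outcome z) (t k : ℕ) :
    ((epochs p z τ θ₀ ω t k : ℕ∞) : ℝ≥0∞) ≤ ∑' j : ℕ,
      Set.indicator {ω : Outcome z | τ.ε (k + 1) <
        ‖proxGrad p z τ θ₀ ω t k (snap p z τ θ₀ ω t k j)‖} 1 ω := by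
  -- All snapshots before the stopping one are inaccurate. Testing the finite lower bounds N also
  -- covers an infinite number of epochs.
  have key : ∀ N : ℕ, (N : ℕ∞) ≤ epochs p z τ θ₀ ω t k → (N : ℝ≥0∞) ≤ ∑' j : ℕ,
      Set.indicator {ω : Outcome z | τ.ε (k + 1) <
        ‖proxGrad p z τ θ₀ ω t k (snap p z τ θ₀ ω t k j)‖} 1 ω := by
    intro N hN
    refine le_trans (le_of_eq ?_) (ENNReal.sum_le_tsum (Finset.range N))
    have : ∀ j ∈ Finset.range N, Set.indicator {ω : Outcome z | τ.ε (k + 1) <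
        ‖proxGrad p z τ θ₀ ω t k (snap p z τ θ₀ ω t k j)‖} (1 : Outcome z → ℝ≥0∞) ω = 1 := by
      intro j hj
      refine Set.indicator_of_mem ?_ _
      rw [Set.mem_ofPred_eq]
      by_contra hcon
      have h1 := (epochs_le_iff hb ω t k j).2 ⟨j, le_rfl, not_lt.1 hcon⟩
      have h2 : N ≤ j := by exact_mod_cast hN.trans h1
      rw [Finset.mem_range] at hj
      omega
    rw [Finset.sum_congr rfl this]
    simp
  by_cases h : epochs p z τ θ₀ ω t k = ⊤
  · rw [h]
    simp only [ENat.toENNReal_top]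
    refine le_of_forall_lt fun c hc => ?_
    obtain ⟨N, hN⟩ := ENNReal.exists_nat_gt hc.ne
    exact hN.trans_le (key N (by rw [h]; exact le_top))
  · obtain ⟨N, hN⟩ := ENat.ne_top_iff_exists.1 h
    have := key N hN.le
    rw [← hN]
    simpa using this

theorem measurable_epochs_of_iter (hd : ∀ i, Differentiable ℝ fun u => p.ℓ u (p.y i))
    (hb : ∀ k, 0 < z.b k) {t k : ℕ}
    (hw : Measurable fun ω : Outcome z => outerRun p z τ θ₀ ω t)
    (hu : Measurable fun ω : Outcome z => iter p z τ θ₀ ω t k) :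
    Measurable fun ω : Outcome z => epochs p z τ θ₀ ω t k := by
  have hle : ∀ j : ℕ, MeasurableSet {ω : Outcome z | epochs p z τ θ₀ ω t k ≤ j} := fun j => by
    have e : {ω : Outcome z | epochs p z τ θ₀ ω t k ≤ j} = ⋃ l ∈ Finset.range (j + 1),
        {ω | ‖proxGrad p z τ θ₀ ω t k (snap p z τ θ₀ ω t k l)‖ ≤ τ.ε (k + 1)} := by
      ext ω
      simp only [Set.mem_ofPred_eq, epochs_le_iff hb, Set.mem_iUnion, Finset.mem_range,
        Nat.lt_succ_iff, exists_prop]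
    rw [e]
    exact Finset.measurableSet_biUnion _ fun l _ => measurableSet_le
      (measurable_proxGrad hd hw hu (measurable_snap_of_iter hd hb hw hu l)).norm measurable_const
  refine measurable_to_countable' fun x => ?_
  induction x using ENat.recTopCoe with
  | top =>
    have e : (fun ω : Outcome z => epochs p z τ θ₀ ω t k) ⁻¹' {⊤} =
        ⋂ j : ℕ, {ω : Outcome z | epochs p z τ θ₀ ω t k ≤ j}ᶜ := by
      ext ω
      simp only [Set.mem_preimage, Set.mem_singleton_iff, Set.mem_iInter, Set.mem_compl_iff,
        Set.mem_ofPred_eq, not_le]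
      constructor
      · intro h j; rw [h]; exact ENat.natCast_lt_top j
      · intro h
        by_contra hne
        obtain ⟨N, hN⟩ := ENat.ne_top_iff_exists.1 hne
        have := h N
        rw [hN] at this
        exact lt_irrefl _ this
    rw [e]
    exact MeasurableSet.iInter fun j => (hle j).compl
  | coe N =>
    have e : (fun ω : Outcome z => epochs p z τ θ₀ ω t k) ⁻¹' {(N : ℕ∞)} =
        {ω : Outcome z | epochs p z τ θ₀ ω t k ≤ N} \
          ⋃ j ∈ Finset.range N, {ω : Outcome z | epochs p z τ θ₀ ω t k ≤ j} := by
      ext ω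
      simp only [Set.mem_preimage, Set.mem_singleton_iff, Set.mem_sdiff, Set.mem_iUnion,
        Finset.mem_range, Set.mem_ofPred_eq, exists_prop, not_exists, not_and, not_le]
      constructor
      · intro h
        rw [h]
        exact ⟨le_rfl, fun j hj => by exact_mod_cast hj⟩
      · rintro ⟨h1, h2⟩
        obtain ⟨M, hM⟩ := ENat.ne_top_iff_exists.1 (ne_top_of_le_ne_top (ENat.natCast_ne_top N) h1)
        rw [← hM] at h1 h2 ⊢
        have h3 : M ≤ N := by exact_mod_cast h1
        rcases h3.lt_or_eq with h4 | h4
        · exact absurd (h2 M h4) (lt_irrefl _)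
        · rw [h4]
    rw [e]
    exact (hle N).diff (Finset.measurableSet_biUnion _ fun j _ => hle j)

/-- Iterate k + 1 is a snapshot evaluated at the random number of epochs, and both depend on iterate
k. The preceding lemmas take measurability of that iterate as a hypothesis, and the induction is
closed here. -/
theorem measurable_iter_of_outerRun (hd : ∀ i, Differentiable ℝ fun u => p.ℓ u (p.y i))
    (hb : ∀ k, 0 < z.b k) {t : ℕ}
    (hw : Measurable fun ω : Outcome z => outerRun p z τ θ₀ ω t) (k : ℕ) :
    Measurable fun ω : Outcome z => iter p z τ θ₀ ω t k := by
  induction k with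
  | zero => exact hw
  | succ k ih =>
    simp only [iter_succ]
    exact measurable_of_countable_index
      ((Measurable.of_discrete (f := ENat.toNat)).comp (measurable_epochs_of_iter hd hb hw ih))
      (F := fun j ω => snap p z τ θ₀ ω t k j) fun j => measurable_snap_of_iter hd hb hw ih j

theorem measurable_outerRun (hd : ∀ i, Differentiable ℝ fun u => p.ℓ u (p.y i))
    (hb : ∀ k, 0 < z.b k) (t : ℕ) : Measurable fun ω : Outcome z => outerRun p z τ θ₀ ω t := by
  induction t with
  | zero => exact measurable_const
  | succ t ih =>
    simp only [outerRun_succ]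
    exact measurable_iter_of_outerRun hd hb ih _

theorem measurable_iter (hd : ∀ i, Differentiable ℝ fun u => p.ℓ u (p.y i))
    (hb : ∀ k, 0 < z.b k) (t k : ℕ) : Measurable fun ω : Outcome z => iter p z τ θ₀ ω t k :=
  measurable_iter_of_outerRun hd hb (measurable_outerRun hd hb t) k

theorem measurable_snap (hd : ∀ i, Differentiable ℝ fun u => p.ℓ u (p.y i))
    (hb : ∀ k, 0 < z.b k) (t k j : ℕ) : Measurable fun ω : Outcome z => snap p z τ θ₀ ω t k j :=
  measurable_snap_of_iter hd hb (measurable_outerRun hd hb t) (measurable_iter hd hb t k) j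

theorem measurable_inner (hd : ∀ i, Differentiable ℝ fun u => p.ℓ u (p.y i))
    (hb : ∀ k, 0 < z.b k) (t k j i : ℕ) :
    Measurable fun ω : Outcome z => innerStep p z τ θ₀ ω t k j i :=
  measurable_inner_of_snap hd hb (measurable_outerRun hd hb t) (measurable_iter hd hb t k)
    (measurable_snap hd hb t k j) i

theorem measurable_epochs (hd : ∀ i, Differentiable ℝ fun u => p.ℓ u (p.y i))
    (hb : ∀ k, 0 < z.b k) (t k : ℕ) : Measurable fun ω : Outcome z => epochs p z τ θ₀ ω t k :=
  measurable_epochs_of_iter hd hb (measurable_outerRun hd hb t) (measurable_iter hd hb t k)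

end Measurability

end

end HSDMPG

namespace HSDMPG

noncomputable section

open Matrix MeasureTheory
open scoped ENNReal

/-! ### Convergence of SVRG on the proximal objective. -/

namespace ERM

variable {n d : ℕ} {Y : Type*} {p : ERM n d Y}

theorem avg_op_precond (γ : ℝ) {S : Finset (Fin n)} (hS : S.Nonempty) (v : E d) :
    (S.card : ℝ)⁻¹ • ∑ i ∈ S, op (p.precond γ {i}) v = op (p.precond γ S) v := by
  have hc : (S.card : ℝ) ≠ 0 := by exact_mod_cast hS.card_pos.ne'
  simp only [op_precond, op_gram, Finset.card_singleton, Nat.cast_one, inv_one,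
    one_smul, Finset.sum_singleton, Finset.sum_add_distrib, Finset.sum_const, smul_add]
  rw [← Nat.cast_smul_eq_nsmul ℝ, smul_smul, inv_mul_cancel₀ hc, one_smul]

theorem norm_sq_eq_dotProduct (v : E d) : ‖v‖ ^ 2 = v.ofLp ⬝ᵥ v.ofLp := by
  rw [dotProduct_eq_inner, real_inner_self_eq_norm_sq]

theorem norm_op_precond_sq_le {r : ℝ} (hL : 0 ≤ p.L) (hμ : 0 < p.μ) (hx : ∀ i, ‖p.x i‖ ≤ r)
    {γ : ℝ} (hγ : 0 ≤ γ) (S : Finset (Fin n)) (v : E d) :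
    ‖op (p.precond γ S) v‖ ^ 2 ≤
      (p.L * r ^ 2 + p.μ + γ) * inner ℝ v (op (p.precond γ S) v) := by
  rw [norm_sq_eq_dotProduct, inner_op, ofLp_toEuclideanCLM]
  refine sq_mulVec_le (precond_posDef hL hμ hγ S).posSemidef (fun u => ?_) _
  rw [precond_form]
  have := gram_form_le hL hx S u
  linarith

theorem norm_sq_le_precond {γ : ℝ} (hL : 0 ≤ p.L) (S : Finset (Fin n)) (v : E d) :
    (p.μ + γ) * ‖v‖ ^ 2 ≤ inner ℝ v (op (p.precond γ S) v) := by
  rw [norm_sq_eq_dotProduct, inner_op, precond_form]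
  have := gram_form_nonneg hL S v.ofLp
  linarith

/-- One step of SVRG in expectation. -/
theorem svrg_step {r : ℝ} (hL : 0 ≤ p.L) (hμ : 0 < p.μ) (hx : ∀ i, ‖p.x i‖ ≤ r) {γ : ℝ}
    (hγ : 0 ≤ γ) {S : Finset (Fin n)} (hS : S.Nonempty) (η : ℝ) (e f : E d) :
    (S.card : ℝ)⁻¹ * ∑ i ∈ S,
        ‖e - η • (op (p.precond γ {i}) (e - f) + op (p.precond γ S) f)‖ ^ 2 ≤
      ‖e‖ ^ 2 - 2 * η * inner ℝ e (op (p.precond γ S) e) +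
        2 * η ^ 2 * (p.L * r ^ 2 + p.μ + γ) *
          (inner ℝ e (op (p.precond γ S) e) + inner ℝ f (op (p.precond γ S) f)) := by
  have hc : (0 : ℝ) < S.card := by exact_mod_cast hS.card_pos
  set ℒ := p.L * r ^ 2 + p.μ + γ with hℒ
  set A : Fin n → E d →L[ℝ] E d := fun i => op (p.precond γ {i}) with hA
  set G := op (p.precond γ S) with hG
  have hav : ∀ v : E d, ∑ i ∈ S, A i v = (S.card : ℝ) • G v := fun v => by
    rw [hG, ← avg_op_precond γ hS v, smul_smul, mul_inv_cancel₀ hc.ne', one_smul]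
  have hin : ∀ u v : E d, ∑ i ∈ S, inner ℝ u (A i v) = S.card * inner ℝ u (G v) := fun u v => by
    rw [← inner_sum, hav, inner_smul_right]
  have hsq : ∀ v : E d, ∑ i ∈ S, ‖A i v‖ ^ 2 ≤ S.card * (ℒ * inner ℝ v (G v)) := fun v => by
    calc ∑ i ∈ S, ‖A i v‖ ^ 2 ≤ ∑ i ∈ S, ℒ * inner ℝ v (A i v) :=
          Finset.sum_le_sum fun i _ => norm_op_precond_sq_le hL hμ hx hγ {i} v
      _ = _ := by rw [← Finset.mul_sum, hin]; ring
  have hvar : ∑ i ∈ S, ‖A i f - G f‖ ^ 2 ≤ S.card * (ℒ * inner ℝ f (G f)) := by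
    refine le_trans ?_ (hsq f)
    have : ∀ i, ‖A i f - G f‖ ^ 2 = ‖A i f‖ ^ 2 - 2 * inner ℝ (G f) (A i f) + ‖G f‖ ^ 2 := fun i => by
      rw [norm_sub_sq_real, real_inner_comm]
    simp only [this, Finset.sum_add_distrib, Finset.sum_sub_distrib, ← Finset.mul_sum, hin,
      Finset.sum_const, nsmul_eq_mul, real_inner_self_eq_norm_sq]
    nlinarith [sq_nonneg ‖G f‖]
  have hterm : ∀ i ∈ S, ‖e - η • (A i (e - f) + G f)‖ ^ 2 ≤ ‖e‖ ^ 2 -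
      2 * η * (inner ℝ e (A i (e - f)) + inner ℝ e (G f)) +
      η ^ 2 * (2 * ‖A i e‖ ^ 2 + 2 * ‖A i f - G f‖ ^ 2) := fun i _ => by
    rw [norm_sub_sq_real, inner_smul_right, inner_add_right, norm_smul, mul_pow, Real.norm_eq_abs,
      sq_abs]
    -- The direction is Aᵢe - (Aᵢf - Gf). The first part is controlled by the current error, and the
    -- second is centred noise that is controlled by the error of the snapshot.
    have h1 : ‖A i (e - f) + G f‖ ^ 2 ≤ 2 * ‖A i e‖ ^ 2 + 2 * ‖A i f - G f‖ ^ 2 := by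
      have e1 : A i (e - f) + G f = A i e - (A i f - G f) := by rw [map_sub]; abel
      have h2 := norm_add_sq_real (A i e) (A i f - G f)
      have h3 := norm_sub_sq_real (A i e) (A i f - G f)
      rw [e1]
      nlinarith [sq_nonneg ‖A i e + (A i f - G f)‖]
    have := mul_le_mul_of_nonneg_left h1 (sq_nonneg η)
    linarith
  have hsum := Finset.sum_le_sum hterm
  simp only [Finset.sum_add_distrib, Finset.sum_sub_distrib, ← Finset.mul_sum, hin,
    Finset.sum_const, nsmul_eq_mul] at hsum
  rw [map_sub, inner_sub_right] at hsum
  rw [inv_mul_le_iff₀ hc]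
  refine hsum.trans ?_
  have h4 := mul_le_mul_of_nonneg_left (hsq e) (sq_nonneg η)
  have h5 := mul_le_mul_of_nonneg_left hvar (sq_nonneg η)
  linarith

end ERM

section SVRG

variable {n d : ℕ} {Y : Type*} (p : ERM n d Y) (z : Sizes n) (τ : Tuning) (θ₀ : E d)

/-- The distance vector from the minimizer of the proximal objective. -/
def minErr (ω : Outcome z) (t k : ℕ) (θ : E d) : E d :=
  op (p.precond τ.γ (batch ω (t + 1)))⁻¹ (proxGrad p z τ θ₀ ω t k θ)

/-- The suboptimality of the proximal objective. -/
def proxGap (ω : Outcome z) (t k : ℕ) (θ : E d) : ℝ :=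
  1 / 2 * inner ℝ (minErr p z τ θ₀ ω t k θ) (proxGrad p z τ θ₀ ω t k θ)

variable {p z τ θ₀}

theorem op_inv_op {M : Matrix (Fin d) (Fin d) ℝ} (hM : M.PosDef) (v : E d) :
    op M⁻¹ (op M v) = v := by
  have hdet : IsUnit M.det := isUnit_iff_ne_zero.2 hM.det_pos.ne'
  have : op M⁻¹ (op M v) = (op M⁻¹ * op M) v := rfl
  rw [this, ← map_mul, nonsing_inv_mul M hdet, map_one, one_apply_eq_self]

theorem op_op_inv {M : Matrix (Fin d) (Fin d) ℝ} (hM : M.PosDef) (v : E d) :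
    op M (op M⁻¹ v) = v := by
  have hdet : IsUnit M.det := isUnit_iff_ne_zero.2 hM.det_pos.ne'
  have : op M (op M⁻¹ v) = (op M * op M⁻¹) v := rfl
  rw [this, ← map_mul, mul_nonsing_inv M hdet, map_one, one_apply_eq_self]

variable (hL : 0 ≤ p.L) (hμ : 0 < p.μ) (hγ : 0 ≤ τ.γ)

include hL hμ hγ

theorem op_minErr (ω : Outcome z) (t k : ℕ) (θ : E d) :
    op (p.precond τ.γ (batch ω (t + 1))) (minErr p z τ θ₀ ω t k θ) =
      proxGrad p z τ θ₀ ω t k θ :=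
  op_op_inv (ERM.precond_posDef hL hμ hγ _) _

theorem minErr_sub (ω : Outcome z) (t k : ℕ) (θ v : E d) :
    minErr p z τ θ₀ ω t k (θ - v) = minErr p z τ θ₀ ω t k θ - v := by
  have : proxGrad p z τ θ₀ ω t k (θ - v) =
      proxGrad p z τ θ₀ ω t k θ - op (p.precond τ.γ (batch ω (t + 1))) v := by
    simp only [proxGrad, map_sub]; abel
  rw [minErr, minErr, this, map_sub, op_inv_op (ERM.precond_posDef hL hμ hγ _)]

theorem minErr_sub_minErr (ω : Outcome z) (t k : ℕ) (θ θ' : E d) :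
    minErr p z τ θ₀ ω t k θ - minErr p z τ θ₀ ω t k θ' = θ - θ' := by
  have := minErr_sub (θ₀ := θ₀) hL hμ hγ ω t k θ (θ - θ')
  rw [sub_sub_cancel] at this
  rw [this]; abel

theorem proxGap_eq (ω : Outcome z) (t k : ℕ) (θ : E d) :
    proxGap p z τ θ₀ ω t k θ = 1 / 2 * inner ℝ (minErr p z τ θ₀ ω t k θ)
      (op (p.precond τ.γ (batch ω (t + 1))) (minErr p z τ θ₀ ω t k θ)) := by
  rw [op_minErr hL hμ hγ, proxGap]

theorem norm_minErr_sq_le (ω : Outcome z) (t k : ℕ) (θ : E d) :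
    (p.μ + τ.γ) * ‖minErr p z τ θ₀ ω t k θ‖ ^ 2 ≤ 2 * proxGap p z τ θ₀ ω t k θ := by
  rw [proxGap_eq hL hμ hγ]
  have := ERM.norm_sq_le_precond (γ := τ.γ) hL (batch ω (t + 1)) (minErr p z τ θ₀ ω t k θ)
  linarith

theorem proxGap_nonneg (ω : Outcome z) (t k : ℕ) (θ : E d) : 0 ≤ proxGap p z τ θ₀ ω t k θ := by
  have := norm_minErr_sq_le (θ₀ := θ₀) hL hμ hγ ω t k θ
  have : 0 ≤ (p.μ + τ.γ) * ‖minErr p z τ θ₀ ω t k θ‖ ^ 2 := by positivity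
  linarith

theorem norm_proxGrad_sq_le {r : ℝ} (hx : ∀ i, ‖p.x i‖ ≤ r) (ω : Outcome z) (t k : ℕ) (θ : E d) :
    ‖proxGrad p z τ θ₀ ω t k θ‖ ^ 2 ≤
      2 * (p.L * r ^ 2 + p.μ + τ.γ) * proxGap p z τ θ₀ ω t k θ := by
  have := ERM.norm_op_precond_sq_le hL hμ hx hγ (batch ω (t + 1)) (minErr p z τ θ₀ ω t k θ)
  rw [op_minErr hL hμ hγ] at this
  rw [proxGap]
  linarith

theorem proxGap_le (ω : Outcome z) (t k : ℕ) (θ : E d) :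
    proxGap p z τ θ₀ ω t k θ ≤ ‖proxGrad p z τ θ₀ ω t k θ‖ ^ 2 / (2 * (p.μ + τ.γ)) := by
  have h := inv_form_le (ERM.precond_posDef hL hμ hγ (batch ω (t + 1))) (c := p.μ + τ.γ)
    (by positivity) (fun v => by
      rw [ERM.precond_form]
      have := ERM.gram_form_nonneg hL (batch ω (t + 1)) v
      linarith) (proxGrad p z τ θ₀ ω t k θ).ofLp
  rw [proxGap, minErr, real_inner_comm, inner_op]
  rw [← ERM.norm_sq_eq_dotProduct] at h
  have e : ‖proxGrad p z τ θ₀ ω t k θ‖ ^ 2 / (2 * (p.μ + τ.γ)) =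
    1 / 2 * (‖proxGrad p z τ θ₀ ω t k θ‖ ^ 2 / (p.μ + τ.γ)) := by
    field_simp
  rw [e]
  linarith

omit hL hμ hγ in
theorem sum_sampled {ω : Outcome z} {t k j i : ℕ} (g : Fin n → ℝ) :
    (Fintype.card ((Draw.comp t k j i).Val z) : ℝ)⁻¹ *
      ∑ v : (Draw.comp t k j i).Val z,
        g ((batch ω t).orderEmbOfFin (batch_card ω t) (show Fin z.s from v)) =
      ((batch ω t).card : ℝ)⁻¹ * ∑ i ∈ batch ω t, g i := by
  have h1 : (Fintype.card ((Draw.comp t k j i).Val z) : ℝ) = (batch ω t).card := by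
    rw [batch_card]
    exact_mod_cast Fintype.card_fin z.s
  have h2 : ∑ i ∈ batch ω t, g i =
      ∑ v : Fin z.s, g ((batch ω t).orderEmbOfFin (batch_card ω t) v) := by
    conv_lhs => rw [← Finset.image_orderEmbOfFin_univ (batch ω t) (batch_card ω t)]
    rw [Finset.sum_image]
    exact fun a _ b _ h => (Finset.orderEmbOfFin _ _).injective h
  rw [h1, h2]
  rfl

variable {r : ℝ} (hx : ∀ i, ‖p.x i‖ ≤ r)
  (hd : ∀ i, Differentiable ℝ fun u => p.ℓ u (p.y i)) (hb : ∀ k, 0 < z.b k)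

omit hL hμ hγ in
theorem measurable_minErr (hd : ∀ i, Differentiable ℝ fun u => p.ℓ u (p.y i))
    (hb : ∀ k, 0 < z.b k) (t k : ℕ) {θ : Outcome z → E d} (hθ : Measurable θ) :
    Measurable fun ω => minErr p z τ θ₀ ω t k (θ ω) :=
  measurable_of_countable_index (measurable_batch (t + 1))
    (F := fun S ω => op (p.precond τ.γ S)⁻¹ (proxGrad p z τ θ₀ ω t k (θ ω)))
    fun _ => measurable_op_comp _ (measurable_proxGrad hd (measurable_outerRun hd hb t)
      (measurable_iter hd hb t k) hθ)

omit hL hμ hγ in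
theorem measurable_proxGap (hd : ∀ i, Differentiable ℝ fun u => p.ℓ u (p.y i))
    (hb : ∀ k, 0 < z.b k) (t k : ℕ) {θ : Outcome z → E d} (hθ : Measurable θ) :
    Measurable fun ω => proxGap p z τ θ₀ ω t k (θ ω) :=
  ((measurable_minErr hd hb t k hθ).inner (measurable_proxGrad hd (measurable_outerRun hd hb t)
      (measurable_iter hd hb t k) hθ)).const_mul _

include hx hd hb

/-- The gap is half the energy. With η = 1/(10ℒ), ℒ being the smoothness constant, the second-order
term is η/5 times the two energies, so the decrease 4η of the current gap becomes 4η - 2η/5 = 18η/5,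
and 2η/5 is charged to the snapshot. -/
theorem lintegral_inner_succ_le (hη : τ.η = 1 / (10 * (p.L * r ^ 2 + p.μ + τ.γ)))
    (t k j i : ℕ) :
    ∫⁻ ω, ENNReal.ofReal (‖minErr p z τ θ₀ ω t k (innerStep p z τ θ₀ ω t k j (i + 1))‖ ^ 2 +
        18 / 5 * τ.η * proxGap p z τ θ₀ ω t k (innerStep p z τ θ₀ ω t k j i)) ∂law z ≤
      ∫⁻ ω, ENNReal.ofReal (‖minErr p z τ θ₀ ω t k (innerStep p z τ θ₀ ω t k j i)‖ ^ 2 +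
        2 / 5 * τ.η * proxGap p z τ θ₀ ω t k (snap p z τ θ₀ ω t k j)) ∂law z := by
  have hℒ : 0 < p.L * r ^ 2 + p.μ + τ.γ := by positivity
  have hη0 : 0 < τ.η := by rw [hη]; positivity
  refine lintegral_ofReal_le_of_resample (.comp (t + 1) (k + 1) j i) ?_ (fun ω => ?_) fun ω => ?_
  · exact ((measurable_minErr hd hb t k (measurable_inner hd hb t k j (i + 1))).norm.pow_const 2).add
      ((measurable_proxGap hd hb t k (measurable_inner hd hb t k j i)).const_mul _)
  · have := proxGap_nonneg (θ₀ := θ₀) hL hμ hγ ω t k (innerStep p z τ θ₀ ω t k j i)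
    positivity
  · set a : Draw := .comp (t + 1) (k + 1) j i with ha
    have h1 : ∀ v : a.Val z, proxGrad p z τ θ₀ (Function.update ω a v) t k =
        proxGrad p z τ θ₀ ω t k := fun v =>
      proxGrad_update p τ θ₀ ω t k rfl rfl (by simp [ha]) v
    have h2 : ∀ v : a.Val z, batch (Function.update ω a v) (t + 1) = batch ω (t + 1) := fun v =>
      batch_update_later ω t k rfl rfl v
    have h3 : ∀ v : a.Val z, snap p z τ θ₀ (Function.update ω a v) t k j =
        snap p z τ θ₀ ω t k j := fun v =>
      snap_update p τ θ₀ ω t k rfl rfl (by simp [ha]) v (fun l hl i' h => by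
        simp only [ha, Draw.comp.injEq] at h; omega) (by simp [ha])
    have h4 : ∀ v : a.Val z, innerStep p z τ θ₀ (Function.update ω a v) t k j i =
        innerStep p z τ θ₀ ω t k j i := fun v =>
      inner_update p τ θ₀ ω t k rfl rfl (by simp [ha]) v (fun l hl i' h => by
        simp only [ha, Draw.comp.injEq] at h; omega) (by simp [ha]) (fun l hl h => by
        simp only [ha, Draw.comp.injEq] at h; omega)
    have h5 : ∀ (v : a.Val z) θ, minErr p z τ θ₀ (Function.update ω a v) t k θ =
        minErr p z τ θ₀ ω t k θ := fun v θ => by rw [minErr, minErr, h1, h2]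
    have h6 : ∀ (v : a.Val z) θ, proxGap p z τ θ₀ (Function.update ω a v) t k θ =
        proxGap p z τ θ₀ ω t k θ := fun v θ => by rw [proxGap, proxGap, h1, h5]
    set e := minErr p z τ θ₀ ω t k (innerStep p z τ θ₀ ω t k j i) with he
    set f := minErr p z τ θ₀ ω t k (snap p z τ θ₀ ω t k j) with hf
    have h7 : ∀ v : a.Val z, minErr p z τ θ₀ (Function.update ω a v) t k
        (innerStep p z τ θ₀ (Function.update ω a v) t k j (i + 1)) =
        e - τ.η • (op (p.precond τ.γ {(batch ω (t + 1)).orderEmbOfFin (batch_card ω (t + 1))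
          (show Fin z.s from v)}) (e - f) + op (p.precond τ.γ (batch ω (t + 1))) f) := fun v => by
      rw [h5, inner_succ p τ θ₀ hb, h1, h3, h4, sampled_update_self, minErr_sub hL hμ hγ,
        he, hf, minErr_sub_minErr hL hμ hγ, op_minErr hL hμ hγ]
    simp only [h7, h6, h4]
    rw [Finset.sum_add_distrib, mul_add, sum_sampled (ω := ω) (fun l => ‖e - τ.η •
      (op (p.precond τ.γ {l}) (e - f) + op (p.precond τ.γ (batch ω (t + 1))) f)‖ ^ 2),
      Finset.sum_const, Finset.card_univ, nsmul_eq_mul, inv_mul_cancel_left₀ (by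
        exact_mod_cast Fintype.card_ne_zero)]
    have hs := ERM.svrg_step hL hμ hx hγ (batch_nonempty ω (t + 1)) τ.η e f
    have hq1 := proxGap_eq (θ₀ := θ₀) hL hμ hγ ω t k (innerStep p z τ θ₀ ω t k j i)
    have hq2 := proxGap_eq (θ₀ := θ₀) hL hμ hγ ω t k (snap p z τ θ₀ ω t k j)
    rw [← he] at hq1
    rw [← hf] at hq2
    rw [hq1, hq2]
    have hηℒ : τ.η ^ 2 * (p.L * r ^ 2 + p.μ + τ.γ) = τ.η / 10 := by
      rw [hη]; field_simp
    set q1 := inner ℝ e (op (p.precond τ.γ (batch ω (t + 1))) e)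
    set q2 := inner ℝ f (op (p.precond τ.γ (batch ω (t + 1))) f)
    have e3 : 2 * τ.η ^ 2 * (p.L * r ^ 2 + p.μ + τ.γ) * (q1 + q2) = τ.η / 5 * (q1 + q2) := by
      linear_combination 2 * (q1 + q2) * hηℒ
    rw [e3] at hs
    linarith

end SVRG

end

end HSDMPG

namespace HSDMPG

noncomputable section

open Matrix MeasureTheory
open scoped ENNReal

section SVRG

variable {n d : ℕ} {Y : Type*} {p : ERM n d Y} {z : Sizes n} {τ : Tuning} {θ₀ : E d}

variable (hL : 0 ≤ p.L) (hμ : 0 < p.μ) (hγ : 0 ≤ τ.γ) {r : ℝ} (hx : ∀ i, ‖p.x i‖ ≤ r)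
  (hd : ∀ i, Differentiable ℝ fun u => p.ℓ u (p.y i)) (hb : ∀ k, 0 < z.b k)
  (hη : τ.η = 1 / (10 * (p.L * r ^ 2 + p.μ + τ.γ)))

include hL hμ hγ hx hd hb hη

/-- The squared distances telescope over an epoch, and strong convexity bounds the initial one by
2/(μ + γ) times the gap of the snapshot. -/
theorem sum_lintegral_proxGap_inner_le (t k j m : ℕ) :
    ENNReal.ofReal (18 / 5 * τ.η) * ∑ i ∈ Finset.range m,
        ∫⁻ ω, ENNReal.ofReal (proxGap p z τ θ₀ ω t k (innerStep p z τ θ₀ ω t k j i)) ∂law z ≤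
      ENNReal.ofReal (2 / (p.μ + τ.γ) + 2 / 5 * τ.η * m) *
        ∫⁻ ω, ENNReal.ofReal (proxGap p z τ θ₀ ω t k (snap p z τ θ₀ ω t k j)) ∂law z := by
  have hη0 : 0 < τ.η := by rw [hη]; positivity
  set a : ℕ → ℝ≥0∞ := fun i =>
    ∫⁻ ω, ENNReal.ofReal (‖minErr p z τ θ₀ ω t k (innerStep p z τ θ₀ ω t k j i)‖ ^ 2) ∂law z with ha
  set b : ℕ → ℝ≥0∞ := fun i =>
    ∫⁻ ω, ENNReal.ofReal (proxGap p z τ θ₀ ω t k (innerStep p z τ θ₀ ω t k j i)) ∂law z with hbdef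
  set D := ∫⁻ ω, ENNReal.ofReal (proxGap p z τ θ₀ ω t k (snap p z τ θ₀ ω t k j)) ∂law z with hD
  have hgm : ∀ {θ : Outcome z → E d}, Measurable θ →
      Measurable fun ω => ENNReal.ofReal (proxGap p z τ θ₀ ω t k (θ ω)) := fun hθ =>
    (measurable_proxGap hd hb t k hθ).ennreal_ofReal
  have hsplit : ∀ (c : ℝ), 0 ≤ c → ∀ (u θ : Outcome z → E d), Measurable θ →
      ∫⁻ ω, ENNReal.ofReal (‖u ω‖ ^ 2 + c * proxGap p z τ θ₀ ω t k (θ ω)) ∂law z =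
        ∫⁻ ω, ENNReal.ofReal (‖u ω‖ ^ 2) ∂law z +
          ENNReal.ofReal c * ∫⁻ ω, ENNReal.ofReal (proxGap p z τ θ₀ ω t k (θ ω)) ∂law z := by
    intro c hc u θ hθ
    rw [← lintegral_const_mul _ (hgm hθ), ← lintegral_add_right _ ((hgm hθ).const_mul _)]
    refine lintegral_congr fun ω => ?_
    rw [ENNReal.ofReal_add (by positivity)
      (mul_nonneg hc (proxGap_nonneg hL hμ hγ ω t k _)), ENNReal.ofReal_mul hc]
  have hstep : ∀ i, a (i + 1) + ENNReal.ofReal (18 / 5 * τ.η) * b i ≤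
      a i + ENNReal.ofReal (2 / 5 * τ.η) * D := fun i => by
    have h := lintegral_inner_succ_le (θ₀ := θ₀) hL hμ hγ hx hd hb hη t k j i
    rwa [hsplit _ (by positivity) _ _ (measurable_inner hd hb t k j i),
      hsplit _ (by positivity) _ _ (measurable_snap hd hb t k j)] at h
  have hsum : ∀ m : ℕ, a m + ENNReal.ofReal (18 / 5 * τ.η) * ∑ i ∈ Finset.range m, b i ≤
      a 0 + m * (ENNReal.ofReal (2 / 5 * τ.η) * D) := by
    intro m
    induction m with
    | zero => simp
    | succ m ih =>
      rw [Finset.sum_range_succ, mul_add]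
      calc a (m + 1) + (ENNReal.ofReal (18 / 5 * τ.η) * ∑ i ∈ Finset.range m, b i +
            ENNReal.ofReal (18 / 5 * τ.η) * b m)
          = (a (m + 1) + ENNReal.ofReal (18 / 5 * τ.η) * b m) +
            ENNReal.ofReal (18 / 5 * τ.η) * ∑ i ∈ Finset.range m, b i := by ring
        _ ≤ (a m + ENNReal.ofReal (2 / 5 * τ.η) * D) +
            ENNReal.ofReal (18 / 5 * τ.η) * ∑ i ∈ Finset.range m, b i :=
            add_le_add (hstep m) le_rfl
        _ = (a m + ENNReal.ofReal (18 / 5 * τ.η) * ∑ i ∈ Finset.range m, b i) +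
            ENNReal.ofReal (2 / 5 * τ.η) * D := by ring
        _ ≤ (a 0 + m * (ENNReal.ofReal (2 / 5 * τ.η) * D)) +
            ENNReal.ofReal (2 / 5 * τ.η) * D := by gcongr
        _ = _ := by push_cast; ring
  have ha0 : a 0 ≤ ENNReal.ofReal (2 / (p.μ + τ.γ)) * D := by
    rw [hD, ← lintegral_const_mul _ (hgm (measurable_snap hd hb t k j))]
    refine lintegral_mono fun ω => ?_
    rw [← ENNReal.ofReal_mul (by positivity)]
    refine ENNReal.ofReal_le_ofReal ?_
    rw [inner_zero, div_mul_eq_mul_div, le_div_iff₀ (by positivity), mul_comm]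
    exact norm_minErr_sq_le hL hμ hγ ω t k _
  calc _ ≤ a m + ENNReal.ofReal (18 / 5 * τ.η) * ∑ i ∈ Finset.range m, b i := le_add_self
    _ ≤ a 0 + m * (ENNReal.ofReal (2 / 5 * τ.η) * D) := hsum m
    _ ≤ ENNReal.ofReal (2 / (p.μ + τ.γ)) * D + m * (ENNReal.ofReal (2 / 5 * τ.η) * D) := by gcongr
    _ = _ := by
      rw [ENNReal.ofReal_add (by positivity) (by positivity),
        ENNReal.ofReal_mul (q := (m : ℝ)) (by positivity), ENNReal.ofReal_natCast]
      ring

/-- The next snapshot is a uniformly random inner iterate, so its expected gap is the average over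
the epoch. The epoch length gives ηm ≥ 5/(μ + γ), which makes the initial distance cost at most
2ηm/5. The total 4ηm/5 is below 9ηm/5, the amount that corresponds to halving. -/
theorem lintegral_proxGap_snap_succ_le
    (hm : 50 * (p.L * r ^ 2 + p.μ + τ.γ) / (p.μ + τ.γ) ≤ z.m) (t k j : ℕ) :
    ∫⁻ ω, ENNReal.ofReal (proxGap p z τ θ₀ ω t k (snap p z τ θ₀ ω t k (j + 1))) ∂law z ≤
      2⁻¹ * ∫⁻ ω, ENNReal.ofReal (proxGap p z τ θ₀ ω t k (snap p z τ θ₀ ω t k j)) ∂law z := by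
  have hℒ : 0 < p.L * r ^ 2 + p.μ + τ.γ := by positivity
  have hη0 : 0 < τ.η := by rw [hη]; positivity
  have hm0 : (0 : ℝ) < z.m := by exact_mod_cast z.m_pos
  have hpick : ∫⁻ ω, ENNReal.ofReal
      (proxGap p z τ θ₀ ω t k (snap p z τ θ₀ ω t k (j + 1))) ∂law z =
      (z.m : ℝ≥0∞)⁻¹ * ∑ i ∈ Finset.range z.m, ∫⁻ ω, ENNReal.ofReal
        (proxGap p z τ θ₀ ω t k (innerStep p z τ θ₀ ω t k j i)) ∂law z := by
    rw [lintegral_resample (.pick (t + 1) (k + 1) j)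
      (measurable_proxGap hd hb t k (measurable_snap hd hb t k (j + 1))).ennreal_ofReal]
    rw [← lintegral_finsetSum _ fun i _ =>
      (measurable_proxGap hd hb t k (measurable_inner hd hb t k j i)).ennreal_ofReal,
      ← lintegral_const_mul _ (Finset.measurable_sum _ fun i _ =>
      (measurable_proxGap hd hb t k (measurable_inner hd hb t k j i)).ennreal_ofReal)]
    refine lintegral_congr fun ω => ?_
    set a : Draw := .pick (t + 1) (k + 1) j with ha
    have h1 : ∀ v : a.Val z, proxGrad p z τ θ₀ (Function.update ω a v) t k =
        proxGrad p z τ θ₀ ω t k := fun v =>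
      proxGrad_update p τ θ₀ ω t k rfl rfl (by simp [ha]) v
    have h2 : ∀ v : a.Val z, batch (Function.update ω a v) (t + 1) = batch ω (t + 1) := fun v =>
      batch_update_later ω t k rfl rfl v
    have h4 : ∀ (v : a.Val z) i, innerStep p z τ θ₀ (Function.update ω a v) t k j i =
        innerStep p z τ θ₀ ω t k j i := fun v i =>
      inner_update p τ θ₀ ω t k rfl rfl (by simp [ha]) v (by simp [ha]) (fun l hl h => by
        simp only [ha, Draw.pick.injEq] at h; omega) (by simp [ha])
    have h5 : ∀ (v : a.Val z) θ, minErr p z τ θ₀ (Function.update ω a v) t k θ =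
        minErr p z τ θ₀ ω t k θ := fun v θ => by rw [minErr, minErr, h1, h2]
    have h6 : ∀ (v : a.Val z) θ, proxGap p z τ θ₀ (Function.update ω a v) t k θ =
        proxGap p z τ θ₀ ω t k θ := fun v θ => by rw [proxGap, proxGap, h1, h5]
    have h7 : Fintype.card (a.Val z) = z.m := Fintype.card_fin z.m
    have h8 : ∀ v : a.Val z, picked (Function.update ω a v) (t + 1) (k + 1) j =
        Fin.val (show Fin z.m from v) := fun v => picked_update_self ω _ _ _ v
    simp only [snap_succ, h6, h4, h8]
    rw [h7, Finset.sum_range]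
    rfl
  rw [hpick]
  set B := ∑ i ∈ Finset.range z.m, ∫⁻ ω, ENNReal.ofReal
        (proxGap p z τ θ₀ ω t k (innerStep p z τ θ₀ ω t k j i)) ∂law z with hB
  set D := ∫⁻ ω, ENNReal.ofReal (proxGap p z τ θ₀ ω t k (snap p z τ θ₀ ω t k j)) ∂law z with hD
  have h := sum_lintegral_proxGap_inner_le (θ₀ := θ₀) hL hμ hγ hx hd hb hη t k j z.m
  rw [← hB, ← hD] at h
  have hc : 2 / (p.μ + τ.γ) + 2 / 5 * τ.η * z.m ≤ 18 / 5 * τ.η * (z.m / 2) := by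
    have h1 : 2 / (p.μ + τ.γ) ≤ 2 / 5 * τ.η * z.m := by
      have h2 : 5 / (p.μ + τ.γ) ≤ τ.η * z.m := by
        calc 5 / (p.μ + τ.γ) = τ.η * (50 * (p.L * r ^ 2 + p.μ + τ.γ) / (p.μ + τ.γ)) := by
              rw [hη]; field_simp; norm_num
          _ ≤ _ := by gcongr
      calc 2 / (p.μ + τ.γ) = 2 / 5 * (5 / (p.μ + τ.γ)) := by ring
        _ ≤ 2 / 5 * (τ.η * z.m) := by gcongr
        _ = _ := by ring
    have : 0 < τ.η * z.m := by positivity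
    linarith
  have h2 : ENNReal.ofReal (18 / 5 * τ.η) * B ≤
      ENNReal.ofReal (18 / 5 * τ.η) * (ENNReal.ofReal (z.m / 2) * D) := by
    refine h.trans ?_
    rw [← mul_assoc, ← ENNReal.ofReal_mul (by positivity)]
    gcongr
  have h3 : B ≤ ENNReal.ofReal (z.m / 2) * D :=
    (ENNReal.mul_le_mul_iff_right (by simp; positivity) ENNReal.ofReal_ne_top).1 h2
  calc (z.m : ℝ≥0∞)⁻¹ * B ≤ (z.m : ℝ≥0∞)⁻¹ * (ENNReal.ofReal (z.m / 2) * D) := by gcongr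
    _ = _ := by
      rw [← mul_assoc, ← ENNReal.ofReal_natCast, ← ENNReal.ofReal_inv_of_pos hm0,
        ← ENNReal.ofReal_mul (by positivity)]
      congr 1
      rw [show (z.m : ℝ)⁻¹ * (z.m / 2) = 2⁻¹ by field_simp,
        ENNReal.ofReal_inv_of_pos (by norm_num)]
      simp

theorem lintegral_proxGap_snap_le
    (hm : 50 * (p.L * r ^ 2 + p.μ + τ.γ) / (p.μ + τ.γ) ≤ z.m) (t k j : ℕ) :
    ∫⁻ ω, ENNReal.ofReal (proxGap p z τ θ₀ ω t k (snap p z τ θ₀ ω t k j)) ∂law z ≤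
      2⁻¹ ^ j * ∫⁻ ω, ENNReal.ofReal (proxGap p z τ θ₀ ω t k (iter p z τ θ₀ ω t k)) ∂law z := by
  induction j with
  | zero => simp [snap_zero]
  | succ j ih =>
    refine (lintegral_proxGap_snap_succ_le hL hμ hγ hx hd hb hη hm t k j).trans ?_
    rw [pow_succ', mul_assoc]
    gcongr

/-- The expected number of epochs of SVRG. -/
theorem lintegral_epochs_le
    (hm : 50 * (p.L * r ^ 2 + p.μ + τ.γ) / (p.μ + τ.γ) ≤ z.m) (t k : ℕ) {B : ℝ}
    (hε : 0 < τ.ε (k + 1))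
    (hB : ∫⁻ ω, ENNReal.ofReal (proxGap p z τ θ₀ ω t k (iter p z τ θ₀ ω t k)) ∂law z ≤
      ENNReal.ofReal B) {j₀ : ℕ}
    (hj : 2 * (p.L * r ^ 2 + p.μ + τ.γ) * B / τ.ε (k + 1) ^ 2 ≤ 2 ^ j₀) :
    ∫⁻ ω, ((epochs p z τ θ₀ ω t k : ℕ∞) : ℝ≥0∞) ∂law z ≤ (j₀ : ℝ≥0∞) + 2 := by
  set A : ℕ → Set (Outcome z) := fun j => {ω : Outcome z | τ.ε (k + 1) <
        ‖proxGrad p z τ θ₀ ω t k (snap p z τ θ₀ ω t k j)‖} with hA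
  have hmeas : ∀ j, MeasurableSet (A j) := fun j => measurableSet_lt measurable_const
    (measurable_proxGrad hd (measurable_outerRun hd hb t) (measurable_iter hd hb t k)
      (measurable_snap hd hb t k j)).norm
  have h1 : ∫⁻ ω, ((epochs p z τ θ₀ ω t k : ℕ∞) : ℝ≥0∞) ∂law z ≤ ∑' j, law z (A j) := by
    refine (lintegral_mono fun ω => epochs_le_tsum hb ω t k).trans ?_
    rw [lintegral_tsum fun j => (measurable_one.indicator (hmeas j)).aemeasurable]
    refine ENNReal.tsum_le_tsum fun j => ?_
    rw [lintegral_indicator_one (hmeas j)]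
  -- Markov's inequality for the squared gradient. After j₀ epochs its bound relative to ε² is at
  -- most 1, and every further epoch halves it; the first j₀ probabilities are bounded by 1 and the
  -- others sum to at most 2.
  have h2 : ∀ i, law z (A (i + j₀)) ≤ 2⁻¹ ^ i := fun i => by
    have h3 : law z (A (i + j₀)) ≤ ∫⁻ ω, ENNReal.ofReal
        (2 * (p.L * r ^ 2 + p.μ + τ.γ) / τ.ε (k + 1) ^ 2 *
          proxGap p z τ θ₀ ω t k (snap p z τ θ₀ ω t k (i + j₀))) ∂law z := by
      rw [← lintegral_indicator_one (hmeas _)]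
      refine lintegral_mono fun ω => ?_
      by_cases hω : ω ∈ A (i + j₀)
      swap
      · simp [Set.indicator_of_notMem hω]
      rw [Set.indicator_of_mem hω, Pi.one_apply, ← ENNReal.ofReal_one]
      refine ENNReal.ofReal_le_ofReal ?_
      have h4 := norm_proxGrad_sq_le (θ₀ := θ₀) hL hμ hγ hx ω t k (snap p z τ θ₀ ω t k (i + j₀))
      have h5 : τ.ε (k + 1) ^ 2 ≤ ‖proxGrad p z τ θ₀ ω t k (snap p z τ θ₀ ω t k (i + j₀))‖ ^ 2 :=
        pow_le_pow_left₀ hε.le (le_of_lt hω) 2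
      rw [div_mul_eq_mul_div, one_le_div (by positivity)]
      exact h5.trans h4
    refine h3.trans ?_
    have h6 : (fun ω : Outcome z => ENNReal.ofReal
        (2 * (p.L * r ^ 2 + p.μ + τ.γ) / τ.ε (k + 1) ^ 2 *
          proxGap p z τ θ₀ ω t k (snap p z τ θ₀ ω t k (i + j₀)))) = fun ω =>
        ENNReal.ofReal (2 * (p.L * r ^ 2 + p.μ + τ.γ) / τ.ε (k + 1) ^ 2) *
          ENNReal.ofReal (proxGap p z τ θ₀ ω t k (snap p z τ θ₀ ω t k (i + j₀))) := by
      funext ω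
      rw [ENNReal.ofReal_mul (by positivity)]
    rw [h6, lintegral_const_mul _
      (measurable_proxGap hd hb t k (measurable_snap hd hb t k (i + j₀))).ennreal_ofReal]
    calc _ ≤ ENNReal.ofReal (2 * (p.L * r ^ 2 + p.μ + τ.γ) / τ.ε (k + 1) ^ 2) *
          (2⁻¹ ^ (i + j₀) * ENNReal.ofReal B) := by
          gcongr
          exact (lintegral_proxGap_snap_le hL hμ hγ hx hd hb hη hm t k _).trans (by gcongr)
      _ = 2⁻¹ ^ (i + j₀) * ENNReal.ofReal
          (2 * (p.L * r ^ 2 + p.μ + τ.γ) * B / τ.ε (k + 1) ^ 2) := by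
          rw [mul_left_comm, ← ENNReal.ofReal_mul (by positivity), div_mul_eq_mul_div]
      _ ≤ 2⁻¹ ^ (i + j₀) * ENNReal.ofReal (2 ^ j₀) := by gcongr
      _ = 2⁻¹ ^ i := by
          rw [pow_add, mul_assoc, ENNReal.ofReal_pow (by norm_num), ENNReal.ofReal_ofNat,
            ← mul_pow, ENNReal.inv_mul_cancel (by norm_num) (by norm_num), one_pow, mul_one]
  refine h1.trans ?_
  rw [← ENNReal.summable.sum_add_tsum_nat_add' (k := j₀)]
  refine add_le_add ?_ ?_
  · calc ∑ i ∈ Finset.range j₀, law z (A i) ≤ ∑ i ∈ Finset.range j₀, 1 :=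
          Finset.sum_le_sum fun i _ => prob_le_one
      _ = j₀ := by simp
  · refine (ENNReal.tsum_le_tsum h2).trans ?_
    rw [ENNReal.tsum_geometric, ENNReal.one_sub_inv_two, inv_inv]

end SVRG

end

end HSDMPG

namespace HSDMPG

noncomputable section

open Matrix MeasureTheory
open scoped ENNReal

/-! ### The pathwise recursion for the inner iterates. -/

namespace ERM

variable {n d : ℕ} {Y : Type*} {p : ERM n d Y}

theorem invHessianSq_eq_inner (v : E d) :
    p.invHessianSq v = inner ℝ v (op p.hessianBound⁻¹ v) := by
  rw [inner_op]; rfl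

theorem continuous_invHessianSq : Continuous p.invHessianSq := by
  have : p.invHessianSq = fun v : E d => inner ℝ v (op p.hessianBound⁻¹ v) :=
    funext fun v => invHessianSq_eq_inner v
  rw [this]
  exact continuous_id.inner (op p.hessianBound⁻¹).continuous

variable (hL : 0 ≤ p.L) (hμ : 0 < p.μ) {r : ℝ} (hx : ∀ i, ‖p.x i‖ ≤ r)

include hL hμ

theorem invHessianSq_nonneg (v : E d) : 0 ≤ p.invHessianSq v := by
  have h := (hessianBound_posDef hL hμ).inv.posSemidef.dotProduct_mulVec_nonneg v.ofLp
  rwa [star_trivial] at h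

theorem invHessianSq_add_le (u v : E d) :
    p.invHessianSq (u + v) ≤ 2 * p.invHessianSq u + 2 * p.invHessianSq v := by
  have h := invHessianSq_nonneg hL hμ (u - v)
  simp only [invHessianSq_eq_inner, map_add, map_sub, inner_add_left, inner_add_right,
    inner_sub_left, inner_sub_right] at h ⊢
  linarith

theorem invHessianSq_sub_le (u v : E d) :
    p.invHessianSq (u - v) ≤ 2 * p.invHessianSq u + 2 * p.invHessianSq v := by
  have h := invHessianSq_nonneg hL hμ (u + v)
  simp only [invHessianSq_eq_inner, map_add, map_sub, inner_add_left, inner_add_right,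
    inner_sub_left, inner_sub_right] at h ⊢
  linarith

theorem invHessianSq_le_norm_sq_div (v : E d) : p.invHessianSq v ≤ ‖v‖ ^ 2 / p.μ := by
  rw [norm_sq_eq_dotProduct]
  refine inv_form_le (hessianBound_posDef hL hμ) hμ (fun u => ?_) v.ofLp
  rw [hessianBound_form]
  linarith [gram_form_nonneg hL Finset.univ u]

theorem invHessianSq_op_hessianBound (v : E d) :
    p.invHessianSq (op p.hessianBound v) = inner ℝ v (op p.hessianBound v) := by
  rw [invHessianSq_eq_inner, op_inv_op (hessianBound_posDef hL hμ), real_inner_comm]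

include hx

theorem norm_sq_le_invHessianSq (v : E d) :
    ‖v‖ ^ 2 ≤ (p.L * r ^ 2 + p.μ) * p.invHessianSq v := by
  have hH := hessianBound_posDef hL hμ
  have h := norm_op_precond_sq_le hL hμ hx le_rfl Finset.univ (op p.hessianBound⁻¹ v)
  rw [← hessianBound_eq, op_op_inv hH, real_inner_comm, add_zero] at h
  rwa [invHessianSq_eq_inner]

theorem norm_op_gram_sq_le (S : Finset (Fin n)) (v : E d) :
    ‖op (p.gram S) v‖ ^ 2 ≤ p.L * r ^ 2 * inner ℝ v (op (p.gram S) v) := by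
  rw [norm_sq_eq_dotProduct, inner_op]
  refine sq_mulVec_le ?_ (fun u => gram_form_le hL hx S u) v.ofLp
  refine Matrix.PosSemidef.of_dotProduct_mulVec_nonneg ?_ fun u => ?_
  · rw [IsHermitian, conjTranspose_eq_transpose_of_trivial]; exact gram_isSymm p S
  · simpa using gram_form_nonneg hL S u

/-- The variance of the component gradients grows at most quadratically. -/
theorem sum_invHessianSq_qGrad_sub_le (hn : 0 < n) (w θ : E d) :
    (n : ℝ)⁻¹ * ∑ i, p.invHessianSq (p.qGrad w Finset.univ θ - p.qGrad w {i} θ) ≤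
      2 * ((n : ℝ)⁻¹ * ∑ i, p.invHessianSq (p.qGrad w Finset.univ w - p.qGrad w {i} w)) +
        8 * (p.L * r ^ 2 / p.μ) * inner ℝ (θ - w) (op p.hessianBound (θ - w)) := by
  have hn' : (0 : ℝ) < n := by exact_mod_cast hn
  set v := θ - w with hv
  have hu : inner ℝ v (op (p.gram Finset.univ) v) ≤ inner ℝ v (op p.hessianBound v) := by
    rw [op_hessianBound, inner_add_right, inner_smul_right]
    have := mul_nonneg hμ.le (real_inner_self_nonneg (x := v))
    linarith
  have hterm : ∀ i, p.invHessianSq (p.qGrad w Finset.univ θ - p.qGrad w {i} θ) ≤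
      2 * p.invHessianSq (p.qGrad w Finset.univ w - p.qGrad w {i} w) +
        4 * (p.L * r ^ 2 / p.μ) * (inner ℝ v (op p.hessianBound v) +
          inner ℝ v (op (p.gram {i}) v)) := fun i => by
    -- The gradients are affine in θ with the same regularization part, so only the data parts of
    -- the Hessians move the difference.
    have e1 : p.qGrad w Finset.univ θ - p.qGrad w {i} θ =
        (p.qGrad w Finset.univ w - p.qGrad w {i} w) +
          (op (p.gram Finset.univ) v - op (p.gram {i}) v) := by
      simp only [qGrad, op_precond, sub_self, map_zero, add_zero, ← hv]
      abel
    have h1 := invHessianSq_add_le hL hμ (p.qGrad w Finset.univ w - p.qGrad w {i} w)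
      (op (p.gram Finset.univ) v - op (p.gram {i}) v)
    have h2 := invHessianSq_le_norm_sq_div hL hμ (op (p.gram Finset.univ) v - op (p.gram {i}) v)
    have h3 : ‖op (p.gram Finset.univ) v - op (p.gram {i}) v‖ ^ 2 ≤
        2 * (p.L * r ^ 2) * (inner ℝ v (op p.hessianBound v) +
          inner ℝ v (op (p.gram {i}) v)) := by
      have h4 := norm_op_gram_sq_le hL hμ hx Finset.univ v
      have h5 := norm_op_gram_sq_le hL hμ hx {i} v
      have h6 := norm_sub_sq_real (op (p.gram Finset.univ) v) (op (p.gram {i}) v)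
      have h7 := norm_add_sq_real (op (p.gram Finset.univ) v) (op (p.gram {i}) v)
      have h8 := sq_nonneg ‖op (p.gram Finset.univ) v + op (p.gram {i}) v‖
      have h9 := mul_le_mul_of_nonneg_left hu (show 0 ≤ p.L * r ^ 2 by positivity)
      linarith
    rw [e1]
    refine h1.trans ?_
    have h10 : ‖op (p.gram Finset.univ) v - op (p.gram {i}) v‖ ^ 2 / p.μ ≤
        2 * (p.L * r ^ 2 / p.μ) * (inner ℝ v (op p.hessianBound v) +
          inner ℝ v (op (p.gram {i}) v)) := by
      rw [div_le_iff₀ hμ]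
      refine h3.trans (le_of_eq ?_)
      field_simp
    linarith
  have hg : ∑ i, inner ℝ v (op (p.gram {i}) v) = n * inner ℝ v (op (p.gram Finset.univ) v) := by
    rw [← inner_sum, op_gram, inner_smul_right]
    simp only [op_gram, Finset.sum_singleton, Finset.card_singleton, Nat.cast_one, inv_one,
      one_smul, Finset.card_univ, Fintype.card_fin]
    rw [mul_inv_cancel_left₀ hn'.ne']
  have hs := Finset.sum_le_sum fun i (_ : i ∈ Finset.univ) => hterm i
  rw [Finset.sum_add_distrib, ← Finset.mul_sum, ← Finset.mul_sum, Finset.sum_add_distrib, hg,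
    Finset.sum_const, Finset.card_univ, Fintype.card_fin, nsmul_eq_mul] at hs
  rw [inv_mul_le_iff₀ hn']
  have h11 := mul_le_mul_of_nonneg_left hu
    (show 0 ≤ 4 * (p.L * r ^ 2 / p.μ) * n by positivity)
  calc _ ≤ _ := hs
    _ ≤ _ := by
      rw [mul_add (n : ℝ), mul_left_comm (n : ℝ) 2, mul_inv_cancel_left₀ hn'.ne']
      linarith

end ERM

section Iteration

variable {n d : ℕ} {Y : Type*} (p : ERM n d Y) (z : Sizes n) (τ : Tuning) (θ₀ : E d)

/-- The gradient of the quadratic model at the inner iterate. -/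
def modelGrad (ω : Outcome z) (t k : ℕ) : E d :=
  p.qGrad (outerRun p z τ θ₀ ω t) Finset.univ (iter p z τ θ₀ ω t k)

/-- Twice the suboptimality of the inner iterate for the quadratic model. -/
def excess (ω : Outcome z) (t k : ℕ) : ℝ := p.invHessianSq (modelGrad p z τ θ₀ ω t k)

/-- The error of the minibatch gradient. -/
def noise (ω : Outcome z) (t k : ℕ) : E d :=
  p.qGrad (outerRun p z τ θ₀ ω t) (minibatch ω (t + 1) (k + 1)) (iter p z τ θ₀ ω t k) -
    modelGrad p z τ θ₀ ω t k

/-- The variance of the component gradients at the inner iterate. -/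
def iterVar (ω : Outcome z) (t k : ℕ) : ℝ :=
  (n : ℝ)⁻¹ * ∑ i, p.invHessianSq (modelGrad p z τ θ₀ ω t k -
    p.qGrad (outerRun p z τ θ₀ ω t) {i} (iter p z τ θ₀ ω t k))

variable {p z τ θ₀}

theorem proxGrad_iter (ω : Outcome z) (t k : ℕ) :
    proxGrad p z τ θ₀ ω t k (iter p z τ θ₀ ω t k) =
      modelGrad p z τ θ₀ ω t k + noise p z τ θ₀ ω t k := by
  simp [proxGrad, noise]

theorem modelGrad_sub (ω : Outcome z) (t k l : ℕ) :
    modelGrad p z τ θ₀ ω t k - modelGrad p z τ θ₀ ω t l =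
      op p.hessianBound (iter p z τ θ₀ ω t k - iter p z τ θ₀ ω t l) := by
  simp only [modelGrad, ERM.qGrad, ← ERM.hessianBound_eq, map_sub]
  abel

variable (hL : 0 ≤ p.L) (hμ : 0 < p.μ) {r : ℝ} (hx : ∀ i, ‖p.x i‖ ≤ r)

include hL hμ

theorem excess_nonneg (ω : Outcome z) (t k : ℕ) : 0 ≤ excess p z τ θ₀ ω t k :=
  ERM.invHessianSq_nonneg hL hμ _

theorem iterVar_nonneg (ω : Outcome z) (t k : ℕ) : 0 ≤ iterVar p z τ θ₀ ω t k :=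
  mul_nonneg (by positivity) (Finset.sum_nonneg fun _ _ => ERM.invHessianSq_nonneg hL hμ _)

/-- The error of the inner iterates satisfies a perturbed preconditioned recursion. -/
theorem precond_op_inv_modelGrad (ω : Outcome z) (t k : ℕ) :
    p.precond τ.γ (batch ω (t + 1)) *ᵥ
        (op p.hessianBound⁻¹ (modelGrad p z τ θ₀ ω t (k + 1))).ofLp =
      p.precond τ.γ (batch ω (t + 1)) *ᵥ
          (op p.hessianBound⁻¹ (modelGrad p z τ θ₀ ω t k)).ofLp -
        p.hessianBound *ᵥ (op p.hessianBound⁻¹ (modelGrad p z τ θ₀ ω t k)).ofLp -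
          (noise p z τ θ₀ ω t k - proxGrad p z τ θ₀ ω t k (iter p z τ θ₀ ω t (k + 1))).ofLp := by
  have hH := ERM.hessianBound_posDef hL hμ
  -- H⁻¹ applied to the model gradient is the iterate minus the minimizer of the model, so
  -- differences of these vectors are differences of iterates.
  have h1 : op p.hessianBound⁻¹ (modelGrad p z τ θ₀ ω t (k + 1)) -
      op p.hessianBound⁻¹ (modelGrad p z τ θ₀ ω t k) =
        iter p z τ θ₀ ω t (k + 1) - iter p z τ θ₀ ω t k := by
    rw [← map_sub, modelGrad_sub, op_inv_op hH]
  have h2 : op (p.precond τ.γ (batch ω (t + 1)))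
        (op p.hessianBound⁻¹ (modelGrad p z τ θ₀ ω t (k + 1))) =
      op (p.precond τ.γ (batch ω (t + 1)))
          (op p.hessianBound⁻¹ (modelGrad p z τ θ₀ ω t k)) -
        op p.hessianBound (op p.hessianBound⁻¹ (modelGrad p z τ θ₀ ω t k)) -
          (noise p z τ θ₀ ω t k - proxGrad p z τ θ₀ ω t k (iter p z τ θ₀ ω t (k + 1))) := by
    rw [op_op_inv hH, proxGrad, ← h1, noise, map_sub]
    abel
  exact congrArg WithLp.ofLp h2

theorem excess_eq_form (ω : Outcome z) (t k : ℕ) : excess p z τ θ₀ ω t k =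
    (op p.hessianBound⁻¹ (modelGrad p z τ θ₀ ω t k)).ofLp ⬝ᵥ
      p.hessianBound *ᵥ (op p.hessianBound⁻¹ (modelGrad p z τ θ₀ ω t k)).ofLp := by
  rw [excess, ERM.invHessianSq_eq_inner, ← inner_op, op_op_inv (ERM.hessianBound_posDef hL hμ),
    real_inner_comm]

-- Young's inequality with free weight c, so that the loss 1 + c can be matched to the gap of a
-- contraction close to 1.
omit hL hμ in
theorem sq_le_of_sqrt_le {x y u a b c : ℝ} (hx : 0 ≤ x) (hy : 0 ≤ y) (hu : 0 ≤ u) (hc : 0 < c)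
    (h : √x ≤ a * √y + b * √u) : x ≤ (1 + c) * a ^ 2 * y + (1 + 1 / c) * b ^ 2 * u := by
  have h1 : x ≤ (a * √y + b * √u) ^ 2 := by
    rw [← Real.sq_sqrt hx]
    exact pow_le_pow_left₀ (Real.sqrt_nonneg _) h 2
  have h2 : (1 + c) * a ^ 2 * y + (1 + 1 / c) * b ^ 2 * u - (a * √y + b * √u) ^ 2 =
      (c * (a * √y) - b * √u) ^ 2 / c := by
    nth_rw 1 [← Real.sq_sqrt hy]
    nth_rw 1 [← Real.sq_sqrt hu]
    field_simp
    ring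
  have h3 : 0 ≤ (c * (a * √y) - b * √u) ^ 2 / c := by positivity
  linarith

theorem invHessianSq_noise_sub_le {ε : ℝ} (ω : Outcome z) (t k : ℕ)
    (hε : ‖proxGrad p z τ θ₀ ω t k (iter p z τ θ₀ ω t (k + 1))‖ ≤ ε) :
    p.invHessianSq (noise p z τ θ₀ ω t k -
        proxGrad p z τ θ₀ ω t k (iter p z τ θ₀ ω t (k + 1))) ≤
      2 * p.invHessianSq (noise p z τ θ₀ ω t k) + 2 * (ε ^ 2 / p.μ) := by
  refine (ERM.invHessianSq_sub_le hL hμ _ _).trans ?_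
  have h1 := ERM.invHessianSq_le_norm_sq_div hL hμ
    (proxGrad p z τ θ₀ ω t k (iter p z τ θ₀ ω t (k + 1)))
  have h2 : ‖proxGrad p z τ θ₀ ω t k (iter p z τ θ₀ ω t (k + 1))‖ ^ 2 / p.μ ≤ ε ^ 2 / p.μ := by
    gcongr
  linarith

/-- The weight ρ/4 costs less than the contraction 1 - 3ρ/4 gains; in return the perturbation gets a
factor of order 1/ρ. -/
theorem excess_succ_le_of_isGood (hγ : 0 ≤ τ.γ) {ε : ℝ} (ω : Outcome z) (t k : ℕ)
    (hg : p.IsGood τ.γ (batch ω (t + 1)))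
    (hε : ‖proxGrad p z τ θ₀ ω t k (iter p z τ θ₀ ω t (k + 1))‖ ≤ ε) :
    excess p z τ θ₀ ω t (k + 1) ≤
      (1 + p.μ / (p.μ + 2 * τ.γ) / 4) * (1 - 3 / 4 * (p.μ / (p.μ + 2 * τ.γ))) ^ 2 *
          excess p z τ θ₀ ω t k +
        (1 + 1 / (p.μ / (p.μ + 2 * τ.γ) / 4)) * (5 / 4) ^ 2 *
          (2 * p.invHessianSq (noise p z τ θ₀ ω t k) + 2 * (ε ^ 2 / p.μ)) := by
  have h := hg.step_le hL hμ hγ (precond_op_inv_modelGrad (θ₀ := θ₀) hL hμ ω t k)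
  rw [← excess_eq_form hL hμ, ← excess_eq_form hL hμ] at h
  have hρ1 : p.μ / (p.μ + 2 * τ.γ) ≤ 1 := by
    rw [div_le_one (by positivity)]; linarith
  have hρ0 : 0 < p.μ / (p.μ + 2 * τ.γ) := by positivity
  have h2 := sq_le_of_sqrt_le (c := p.μ / (p.μ + 2 * τ.γ) / 4) (excess_nonneg hL hμ ω t (k + 1))
    (excess_nonneg hL hμ ω t k) (ERM.invHessianSq_nonneg hL hμ _) (by positivity) h
  refine h2.trans ?_
  have := invHessianSq_noise_sub_le hL hμ ω t k hε
  gcongr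

include hx

/-- No condition on the batch is available, but H ≤ (1 + Lr²/μ) G always holds. The weight in
Young's inequality is 1, since nothing contracts. -/
theorem excess_succ_le (hγ : 0 ≤ τ.γ) {ε : ℝ} (ω : Outcome z) (t k : ℕ)
    (hε : ‖proxGrad p z τ θ₀ ω t k (iter p z τ θ₀ ω t (k + 1))‖ ≤ ε) :
    excess p z τ θ₀ ω t (k + 1) ≤
      2 * (1 + p.L * r ^ 2 / p.μ) ^ 2 * excess p z τ θ₀ ω t k +
        2 * (1 + p.L * r ^ 2 / p.μ) ^ 2 *
          (2 * p.invHessianSq (noise p z τ θ₀ ω t k) + 2 * (ε ^ 2 / p.μ)) := by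
  have hκ : 0 ≤ p.L * r ^ 2 / p.μ := by positivity
  have hc : p.L * r ^ 2 + p.μ ≤ (1 + p.L * r ^ 2 / p.μ) * (p.μ + τ.γ) := by
    have : (1 + p.L * r ^ 2 / p.μ) * p.μ = p.L * r ^ 2 + p.μ := by field_simp; ring
    nlinarith [mul_nonneg (show 0 ≤ 1 + p.L * r ^ 2 / p.μ by linarith) hγ]
  have h := ERM.step_le hL hμ hx hγ (batch ω (t + 1)) (by linarith) hc
    (precond_op_inv_modelGrad (θ₀ := θ₀) hL hμ ω t k)
  rw [← excess_eq_form hL hμ, ← excess_eq_form hL hμ] at h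
  have h2 := sq_le_of_sqrt_le (c := 1) (excess_nonneg hL hμ ω t (k + 1))
    (excess_nonneg hL hμ ω t k) (ERM.invHessianSq_nonneg hL hμ _) one_pos h
  refine h2.trans ?_
  have := invHessianSq_noise_sub_le hL hμ ω t k hε
  norm_num
  gcongr

/-- At its centre the proximal gradient is the model gradient plus the minibatch noise. This bounds
the gap from which SVRG starts. -/
theorem proxGap_iter_le (hγ : 0 ≤ τ.γ) (ω : Outcome z) (t k : ℕ) :
    proxGap p z τ θ₀ ω t k (iter p z τ θ₀ ω t k) ≤
      (1 + p.L * r ^ 2 / p.μ) *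
        (excess p z τ θ₀ ω t k + p.invHessianSq (noise p z τ θ₀ ω t k)) := by
  refine (proxGap_le hL hμ hγ ω t k _).trans ?_
  rw [proxGrad_iter, div_le_iff₀ (by positivity)]
  have h1 := ERM.norm_sq_le_invHessianSq hL hμ hx (modelGrad p z τ θ₀ ω t k + noise p z τ θ₀ ω t k)
  have h2 := ERM.invHessianSq_add_le hL hμ (modelGrad p z τ θ₀ ω t k) (noise p z τ θ₀ ω t k)
  have h3 := ERM.invHessianSq_nonneg hL hμ (noise p z τ θ₀ ω t k)
  have h4 := excess_nonneg (τ := τ) (θ₀ := θ₀) hL hμ ω t k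
  rw [← excess] at h2
  have h5 := mul_le_mul_of_nonneg_left h2 (show 0 ≤ p.L * r ^ 2 + p.μ by positivity)
  have h6 : 0 ≤ (1 + p.L * r ^ 2 / p.μ) * (excess p z τ θ₀ ω t k +
      p.invHessianSq (noise p z τ θ₀ ω t k)) * τ.γ := by positivity
  have h7 : (1 + p.L * r ^ 2 / p.μ) * p.μ = p.L * r ^ 2 + p.μ := by field_simp; ring
  nlinarith [congrArg (fun a => 2 * (excess p z τ θ₀ ω t k +
      p.invHessianSq (noise p z τ θ₀ ω t k)) * a) h7]

/-- Needed on bad batches: the assumed variance bound is an expectation over all draws and cannot be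
localized to a rare event, whereas the variance at k = 0 does not depend on the batch. -/
theorem iterVar_le (hn : 0 < n) (ω : Outcome z) (t k : ℕ) :
    iterVar p z τ θ₀ ω t k ≤ 2 * iterVar p z τ θ₀ ω t 0 +
      16 * (p.L * r ^ 2 / p.μ) * (excess p z τ θ₀ ω t k + excess p z τ θ₀ ω t 0) := by
  have h := ERM.sum_invHessianSq_qGrad_sub_le hL hμ hx hn (outerRun p z τ θ₀ ω t)
    (iter p z τ θ₀ ω t k)
  refine h.trans (add_le_add le_rfl ?_)
  have h1 := ERM.invHessianSq_sub_le hL hμ (modelGrad p z τ θ₀ ω t k) (modelGrad p z τ θ₀ ω t 0)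
  rw [modelGrad_sub, ERM.invHessianSq_op_hessianBound hL hμ, iter_zero] at h1
  have h2 := mul_le_mul_of_nonneg_left h1 (show 0 ≤ 8 * (p.L * r ^ 2 / p.μ) by positivity)
  refine h2.trans (le_of_eq ?_)
  simp only [excess]
  ring

end Iteration

end

end HSDMPG

namespace HSDMPG

noncomputable section

open Matrix MeasureTheory
open scoped ENNReal

/-! ### Expectations over batches and minibatches. -/

section Moments

variable {n d : ℕ} {Y : Type*} {p : ERM n d Y} {z : Sizes n} {τ : Tuning} {θ₀ : E d}

theorem measurableSet_batch_mem (t : ℕ) (A : Set (Finset (Fin n))) :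
    MeasurableSet {ω : Outcome z | batch ω t ∈ A} :=
  measurable_batch t (show MeasurableSet A from trivial)

theorem card_val_batch (t : ℕ) : Fintype.card ((Draw.batch t).Val z) =
    (Finset.powersetCard z.s (Finset.univ : Finset (Fin n))).card := by
  rw [← Fintype.card_coe]
  exact Fintype.card_congr (Equiv.subtypeEquivRight fun S => by simp [Finset.mem_powersetCard])

theorem sum_val_batch {R : Type*} [AddCommMonoid R] (t : ℕ) (f : Finset (Fin n) → R) :
    ∑ v : (Draw.batch t).Val z,
        f (Subtype.val (p := fun S : Finset (Fin n) => S.card = z.s) v) =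
      ∑ S ∈ Finset.powersetCard z.s (Finset.univ : Finset (Fin n)), f S :=
  (Finset.sum_subtype (p := fun S : Finset (Fin n) => S.card = z.s) _
    (fun S => by simp [Finset.mem_powersetCard]) f).symm

theorem card_val_mini (t k : ℕ) : Fintype.card ((Draw.mini t k).Val z) =
    (Finset.powersetCard (z.b k) (Finset.univ : Finset (Fin n))).card := by
  rw [← Fintype.card_coe]
  exact Fintype.card_congr (Equiv.subtypeEquivRight fun S => by simp [Finset.mem_powersetCard])

theorem sum_val_mini {R : Type*} [AddCommMonoid R] (t k : ℕ) (f : Finset (Fin n) → R) :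
    ∑ v : (Draw.mini t k).Val z,
        f (Subtype.val (p := fun S : Finset (Fin n) => S.card = z.b k) v) =
      ∑ S ∈ Finset.powersetCard (z.b k) (Finset.univ : Finset (Fin n)), f S :=
  (Finset.sum_subtype (p := fun S : Finset (Fin n) => S.card = z.b k) _
    (fun S => by simp [Finset.mem_powersetCard]) f).symm

open Classical in
/-- The batch is independent of what does not depend on it. -/
theorem setLIntegral_batch_mem (t : ℕ) (A : Set (Finset (Fin n))) {f : Outcome z → ℝ≥0∞}
    (hf : Measurable f) (h : ∀ ω v, f (Function.update ω (.batch t) v) = f ω) :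
    ∫⁻ ω in {ω : Outcome z | batch ω t ∈ A}, f ω ∂law z =
      ((Finset.powersetCard z.s (Finset.univ : Finset (Fin n))).card : ℝ≥0∞)⁻¹ *
        ({S ∈ Finset.powersetCard z.s (Finset.univ : Finset (Fin n)) | S ∈ A}.card *
          ∫⁻ ω, f ω ∂law z) := by
  rw [← lintegral_indicator (measurableSet_batch_mem t A),
    lintegral_resample (.batch t) (hf.indicator (measurableSet_batch_mem t A)),
    card_val_batch, ← lintegral_const_mul _ hf, ← lintegral_const_mul _ (hf.const_mul _)]
  refine lintegral_congr fun ω => ?_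
  have h1 : ∀ v : (Draw.batch t).Val z, Set.indicator {ω : Outcome z | batch ω t ∈ A} f
      (Function.update ω (.batch t) v) =
        if Subtype.val (p := fun S : Finset (Fin n) => S.card = z.s) v ∈ A then f ω else 0 := by
    intro v
    by_cases hv : Subtype.val (p := fun S : Finset (Fin n) => S.card = z.s) v ∈ A
    · rw [if_pos hv, Set.indicator_of_mem (by rwa [Set.mem_ofPred_eq, batch_update_self]), h]
    · rw [if_neg hv, Set.indicator_of_notMem (by rwa [Set.mem_ofPred_eq, batch_update_self])]
  simp only [h1]
  rw [sum_val_batch t (fun S => if S ∈ A then f ω else 0), ← Finset.sum_filter, Finset.sum_const,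
    nsmul_eq_mul]

open Classical in
theorem law_batch_mem (t : ℕ) (A : Set (Finset (Fin n))) :
    law z {ω : Outcome z | batch ω t ∈ A} =
      ((Finset.powersetCard z.s (Finset.univ : Finset (Fin n))).card : ℝ≥0∞)⁻¹ *
        {S ∈ Finset.powersetCard z.s (Finset.univ : Finset (Fin n)) | S ∈ A}.card := by
  have h := setLIntegral_batch_mem (z := z) t A (f := fun _ => 1) measurable_const fun _ _ => rfl
  simpa using h

/-- Independence of the batch is expressed as invariance under redrawing it. -/
theorem setLIntegral_batch_mem_eq_mul (t : ℕ) (A : Set (Finset (Fin n))) {f : Outcome z → ℝ≥0∞}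
    (hf : Measurable f) (h : ∀ ω v, f (Function.update ω (.batch t) v) = f ω) :
    ∫⁻ ω in {ω : Outcome z | batch ω t ∈ A}, f ω ∂law z =
      law z {ω : Outcome z | batch ω t ∈ A} * ∫⁻ ω, f ω ∂law z := by
  rw [law_batch_mem, setLIntegral_batch_mem t A hf h, mul_assoc]

variable (hd : ∀ i, Differentiable ℝ fun u => p.ℓ u (p.y i)) (hb : ∀ k, 0 < z.b k)

section Measurable

include hd hb

theorem measurable_modelGrad (t k : ℕ) :
    Measurable fun ω : Outcome z => modelGrad p z τ θ₀ ω t k :=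
  measurable_qGrad hd _ (measurable_outerRun hd hb t) (measurable_iter hd hb t k)

theorem measurable_excess (t k : ℕ) : Measurable fun ω : Outcome z => excess p z τ θ₀ ω t k :=
  ERM.continuous_invHessianSq.measurable.comp (measurable_modelGrad hd hb t k)

theorem measurable_noise (t k : ℕ) : Measurable fun ω : Outcome z => noise p z τ θ₀ ω t k :=
  (measurable_of_countable_index (measurable_minibatch (t + 1) (k + 1)) fun S =>
    measurable_qGrad hd S (measurable_outerRun hd hb t) (measurable_iter hd hb t k)).sub
    (measurable_modelGrad hd hb t k)

theorem measurable_invHessianSq_noise (t k : ℕ) :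
    Measurable fun ω : Outcome z => p.invHessianSq (noise p z τ θ₀ ω t k) :=
  ERM.continuous_invHessianSq.measurable.comp (measurable_noise hd hb t k)

theorem measurable_iterVar (t k : ℕ) : Measurable fun ω : Outcome z => iterVar p z τ θ₀ ω t k :=
  (Finset.measurable_sum _ fun i _ => ERM.continuous_invHessianSq.measurable.comp
    ((measurable_modelGrad hd hb t k).sub
      (measurable_qGrad hd {i} (measurable_outerRun hd hb t) (measurable_iter hd hb t k)))).const_mul
    _

end Measurable

variable (hL : 0 ≤ p.L) (hμ : 0 < p.μ)

include hL hμ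

/-- The variance of the gradient over a random minibatch. -/
theorem sum_invHessianSq_minibatch_le (hn : 0 < n) {b : ℕ} (hb0 : 0 < b) (hbn : b ≤ n)
    (w u : E d) :
    ((Finset.powersetCard b (Finset.univ : Finset (Fin n))).card : ℝ)⁻¹ *
        ∑ S ∈ Finset.powersetCard b (Finset.univ : Finset (Fin n)),
          p.invHessianSq (p.qGrad w S u - p.qGrad w Finset.univ u) ≤
      2 * ((n : ℝ) - b) / (n * b) *
        ((n : ℝ)⁻¹ * ∑ i, p.invHessianSq (p.qGrad w Finset.univ u - p.qGrad w {i} u)) := by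
  have hn' : (0 : ℝ) < n := by exact_mod_cast hn
  have hb' : (0 : ℝ) < b := by exact_mod_cast hb0
  have : Nonempty (Fin n) := ⟨⟨0, hn⟩⟩
  set y : Fin n → Fin d → ℝ := fun i => (p.qGrad w {i} u - p.qGrad w Finset.univ u).ofLp with hy
  have hN : (0 : ℝ) < (Finset.powersetCard b (Finset.univ : Finset (Fin n))).card := by
    rw [Finset.card_powersetCard, Finset.card_univ, Fintype.card_fin]
    exact_mod_cast Nat.choose_pos hbn
  have hS : ∀ S : Finset (Fin n), S.Nonempty → (p.qGrad w S u - p.qGrad w Finset.univ u).ofLp =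
      (S.card : ℝ)⁻¹ • ∑ i ∈ S, y i := fun S hS => by
    have hc : (S.card : ℝ) ≠ 0 := by exact_mod_cast hS.card_pos.ne'
    have h1 : (S.card : ℝ)⁻¹ • ∑ i ∈ S, (p.qGrad w {i} u - p.qGrad w Finset.univ u) =
        p.qGrad w S u - p.qGrad w Finset.univ u := by
      rw [Finset.sum_sub_distrib, smul_sub, p.avg_qGrad_singleton w hS, Finset.sum_const,
        ← Nat.cast_smul_eq_nsmul ℝ, smul_smul, inv_mul_cancel₀ hc, one_smul]
    rw [← h1, WithLp.ofLp_smul, WithLp.ofLp_sum]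
  have hy0 : ∑ i, y i = 0 := by
    have h1 := hS Finset.univ Finset.univ_nonempty
    rw [sub_self, WithLp.ofLp_zero, Finset.card_univ, Fintype.card_fin] at h1
    exact (smul_eq_zero.1 h1.symm).resolve_left (inv_ne_zero hn'.ne')
  have hneg : ∀ i, p.invHessianSq (p.qGrad w Finset.univ u - p.qGrad w {i} u) =
      y i ⬝ᵥ (p.hessianBound)⁻¹ *ᵥ y i := fun i => by
    rw [← neg_sub, ERM.invHessianSq_eq_inner, map_neg, inner_neg_neg, inner_op]
  have hform : ∀ S ∈ Finset.powersetCard b (Finset.univ : Finset (Fin n)),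
      p.invHessianSq (p.qGrad w S u - p.qGrad w Finset.univ u) = ((b : ℝ)⁻¹) ^ 2 *
        ((∑ i ∈ S, y i) ⬝ᵥ (p.hessianBound)⁻¹ *ᵥ (∑ i ∈ S, y i)) := fun S hSb => by
    have hc := (Finset.mem_powersetCard.1 hSb).2
    rw [ERM.invHessianSq, hS S (Finset.card_pos.1 (hc ▸ hb0)), hc, mulVec_smul, smul_dotProduct,
      dotProduct_smul, smul_eq_mul, smul_eq_mul]
    ring
  have h := sum_subset_form_le (ERM.hessianBound_posDef hL hμ).inv.posSemidef y hy0 (b := b)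
    (by simpa using hbn)
  rw [Fintype.card_fin] at h
  rw [Finset.sum_congr rfl hform, ← Finset.mul_sum, Finset.sum_congr rfl fun i _ => hneg i]
  set X := ∑ S ∈ Finset.powersetCard b (Finset.univ : Finset (Fin n)),
    (∑ i ∈ S, y i) ⬝ᵥ (p.hessianBound)⁻¹ *ᵥ (∑ i ∈ S, y i)
  set Z := ∑ i, y i ⬝ᵥ (p.hessianBound)⁻¹ *ᵥ y i
  set N : ℝ := ((Finset.powersetCard b (Finset.univ : Finset (Fin n))).card : ℝ)
  have e1 : N⁻¹ * (((b : ℝ)⁻¹) ^ 2 * X) = (n : ℝ) ^ 2 * X / (n ^ 2 * b ^ 2 * N) := by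
    field_simp
  rw [e1, div_le_iff₀ (by positivity)]
  refine h.trans (le_of_eq ?_)
  field_simp

include hd hb

/-- Redrawing the minibatch alone changes neither the iterate nor the event, so the variance bound
for a random subset applies pointwise. The event must depend on the batch only. -/
theorem setLIntegral_invHessianSq_noise_le (hn : 0 < n) (t k : ℕ) (A : Set (Finset (Fin n))) :
    ∫⁻ ω in {ω : Outcome z | batch ω (t + 1) ∈ A},
        ENNReal.ofReal (p.invHessianSq (noise p z τ θ₀ ω t k)) ∂law z ≤
      ENNReal.ofReal (2 * ((n : ℝ) - z.b (k + 1)) / (n * z.b (k + 1))) *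
        ∫⁻ ω in {ω : Outcome z | batch ω (t + 1) ∈ A},
          ENNReal.ofReal (iterVar p z τ θ₀ ω t k) ∂law z := by
  have hA := measurableSet_batch_mem (z := z) (t + 1) A
  set c : ℝ := 2 * ((n : ℝ) - z.b (k + 1)) / (n * z.b (k + 1)) with hc
  have hc0 : 0 ≤ c := by
    have : (z.b (k + 1) : ℝ) ≤ n := by exact_mod_cast z.b_le _
    exact div_nonneg (by linarith) (by positivity)
  have hind : ∀ f : Outcome z → ℝ, ∫⁻ ω in {ω : Outcome z | batch ω (t + 1) ∈ A},
      ENNReal.ofReal (f ω) ∂law z = ∫⁻ ω, ENNReal.ofReal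
        (Set.indicator {ω : Outcome z | batch ω (t + 1) ∈ A} f ω) ∂law z := fun f => by
    rw [← lintegral_indicator hA]
    refine lintegral_congr fun ω => ?_
    by_cases h : ω ∈ {ω : Outcome z | batch ω (t + 1) ∈ A}
    · rw [Set.indicator_of_mem h, Set.indicator_of_mem h]
    · rw [Set.indicator_of_notMem h, Set.indicator_of_notMem h, ENNReal.ofReal_zero]
  rw [← lintegral_const_mul _ (measurable_iterVar hd hb t k).ennreal_ofReal]
  simp only [← ENNReal.ofReal_mul hc0]
  rw [hind, hind]
  refine lintegral_ofReal_le_of_resample (.mini (t + 1) (k + 1))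
    ((measurable_invHessianSq_noise hd hb t k).indicator hA)
    (fun ω => Set.indicator_nonneg (fun ω _ => ERM.invHessianSq_nonneg hL hμ _) ω) fun ω => ?_
  have h1 : ∀ v, outerRun p z τ θ₀ (Function.update ω (.mini (t + 1) (k + 1)) v) t =
      outerRun p z τ θ₀ ω t := fun v => outerRun_update p τ θ₀ ω (by simp [Draw.time]) v
  have h2 : ∀ v, iter p z τ θ₀ (Function.update ω (.mini (t + 1) (k + 1)) v) t k =
      iter p z τ θ₀ ω t k := fun v => iter_update p τ θ₀ ω rfl (by simp [Draw.stage]) v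
  have h3 : ∀ v, batch (Function.update ω (.mini (t + 1) (k + 1)) v) (t + 1) =
      batch ω (t + 1) := fun v => batch_update ω _ (by simp) v
  have hmem : ∀ v, Function.update ω (.mini (t + 1) (k + 1)) v ∈
      {ω : Outcome z | batch ω (t + 1) ∈ A} ↔ ω ∈ {ω : Outcome z | batch ω (t + 1) ∈ A} :=
    fun v => by simp only [Set.mem_ofPred_eq, h3]
  by_cases hω : ω ∈ {ω : Outcome z | batch ω (t + 1) ∈ A}
  · simp only [Set.indicator_of_mem ((hmem _).2 hω), Set.indicator_of_mem hω]
    simp only [noise, modelGrad, h1, h2, minibatch_update_self]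
    rw [sum_val_mini (t + 1) (k + 1) (fun S => p.invHessianSq (p.qGrad (outerRun p z τ θ₀ ω t) S
      (iter p z τ θ₀ ω t k) - p.qGrad (outerRun p z τ θ₀ ω t) Finset.univ
      (iter p z τ θ₀ ω t k))), card_val_mini]
    exact sum_invHessianSq_minibatch_le hL hμ hn (hb _) (z.b_le _) _ _
  · simp only [Set.indicator_of_notMem (mt (hmem _).1 hω), Set.indicator_of_notMem hω,
      Finset.sum_const_zero, mul_zero, le_refl]

/-- One inner iteration, in expectation on an event that depends on the batch only. -/
theorem setLIntegral_excess_succ_le (hn : 0 < n) (t k : ℕ) (A : Set (Finset (Fin n))) {α β : ℝ}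
    (hα : 0 ≤ α) (hβ : 0 ≤ β)
    (hfin : ∀ᵐ ω ∂law z, epochs p z τ θ₀ ω t k ≠ ⊤)
    (hstep : ∀ ω : Outcome z, batch ω (t + 1) ∈ A →
      ‖proxGrad p z τ θ₀ ω t k (iter p z τ θ₀ ω t (k + 1))‖ ≤ τ.ε (k + 1) →
      excess p z τ θ₀ ω t (k + 1) ≤ α * excess p z τ θ₀ ω t k +
        β * (2 * p.invHessianSq (noise p z τ θ₀ ω t k) + 2 * (τ.ε (k + 1) ^ 2 / p.μ))) :
    ∫⁻ ω in {ω : Outcome z | batch ω (t + 1) ∈ A},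
        ENNReal.ofReal (excess p z τ θ₀ ω t (k + 1)) ∂law z ≤
      ENNReal.ofReal α * ∫⁻ ω in {ω : Outcome z | batch ω (t + 1) ∈ A},
          ENNReal.ofReal (excess p z τ θ₀ ω t k) ∂law z +
        ENNReal.ofReal (2 * β) *
          (ENNReal.ofReal (2 * ((n : ℝ) - z.b (k + 1)) / (n * z.b (k + 1))) *
            (∫⁻ ω in {ω : Outcome z | batch ω (t + 1) ∈ A},
              ENNReal.ofReal (iterVar p z τ θ₀ ω t k) ∂law z) +
            ENNReal.ofReal (τ.ε (k + 1) ^ 2 / p.μ) *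
              law z {ω : Outcome z | batch ω (t + 1) ∈ A}) := by
  have hA := measurableSet_batch_mem (z := z) (t + 1) A
  have hm1 := (measurable_excess (p := p) (τ := τ) (θ₀ := θ₀) hd hb t k).ennreal_ofReal
  have hm2 := (measurable_invHessianSq_noise (p := p) (τ := τ) (θ₀ := θ₀) hd hb t k).ennreal_ofReal
  calc _ ≤ ∫⁻ ω in {ω : Outcome z | batch ω (t + 1) ∈ A},
        (ENNReal.ofReal α * ENNReal.ofReal (excess p z τ θ₀ ω t k) + ENNReal.ofReal (2 * β) *
          (ENNReal.ofReal (p.invHessianSq (noise p z τ θ₀ ω t k)) +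
            ENNReal.ofReal (τ.ε (k + 1) ^ 2 / p.μ))) ∂law z := by
        -- The output of SVRG is accurate only where the number of epochs is finite, which holds
        -- almost surely.
        refine setLIntegral_mono_ae' hA (hfin.mono fun ω hω hωA => ?_)
        have h0 := ERM.invHessianSq_nonneg hL hμ (noise p z τ θ₀ ω t k)
        have h1 := excess_nonneg (τ := τ) (θ₀ := θ₀) hL hμ ω t k
        rw [← ENNReal.ofReal_mul hα, ← ENNReal.ofReal_add h0 (by positivity),
          ← ENNReal.ofReal_mul (by positivity), ← ENNReal.ofReal_add (by positivity) (by positivity)]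
        refine ENNReal.ofReal_le_ofReal ?_
        have h := hstep ω hωA (norm_proxGrad_iter_succ_le hb ω t k hω)
        linarith
    _ = ENNReal.ofReal α * ∫⁻ ω in {ω : Outcome z | batch ω (t + 1) ∈ A},
          ENNReal.ofReal (excess p z τ θ₀ ω t k) ∂law z +
        ENNReal.ofReal (2 * β) *
          (∫⁻ ω in {ω : Outcome z | batch ω (t + 1) ∈ A},
            ENNReal.ofReal (p.invHessianSq (noise p z τ θ₀ ω t k)) ∂law z +
            ENNReal.ofReal (τ.ε (k + 1) ^ 2 / p.μ) *
              law z {ω : Outcome z | batch ω (t + 1) ∈ A}) := by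
        rw [lintegral_add_left (hm1.const_mul _), lintegral_const_mul _ hm1,
          lintegral_const_mul _ (hm2.add_const _), lintegral_add_left hm2, setLIntegral_const]
    _ ≤ _ := by
        gcongr
        exact setLIntegral_invHessianSq_noise_le hd hb hL hμ hn t k A

end Moments

end

end HSDMPG

/-! ### The inner loop in expectation. -/

namespace HSDMPG

noncomputable section

open Matrix MeasureTheory
open scoped ENNReal

/-- The contraction factor on good batches. -/
theorem contraction_le_exp {ρ : ℝ} (h0 : 0 ≤ ρ) (h1 : ρ ≤ 1) :
    (1 + ρ / 4) * (1 - 3 / 4 * ρ) ^ 2 ≤ Real.exp (-ρ) * (1 - ρ / 5) := by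
  -- (1 - ρ/2)² already provides the rate exp(-ρ); the surplus factor 1 - ρ/5 is reserved for the
  -- noise.
  have h2 : (1 - ρ / 2) ^ 2 ≤ Real.exp (-ρ) := by
    have h3 : 1 - ρ / 2 ≤ Real.exp (-(ρ / 2)) := Real.one_sub_le_exp_neg _
    calc (1 - ρ / 2) ^ 2 ≤ Real.exp (-(ρ / 2)) ^ 2 := by gcongr; linarith
      _ = Real.exp (-ρ) := by rw [← Real.exp_nat_mul]; congr 1; push_cast; ring
  have h4 : (1 + ρ / 4) * (1 - 3 / 4 * ρ) ^ 2 ≤ (1 - ρ / 2) ^ 2 * (1 - ρ / 5) := by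
    have : (1 - ρ / 2) ^ 2 * (1 - ρ / 5) - (1 + ρ / 4) * (1 - 3 / 4 * ρ) ^ 2 =
        ρ * (1 / 20 + 21 / 80 * ρ - 61 / 320 * ρ ^ 2) := by ring
    have h5 : 0 ≤ 1 / 20 + 21 / 80 * ρ - 61 / 320 * ρ ^ 2 := by nlinarith
    nlinarith [mul_nonneg h0 h5]
  exact h4.trans (mul_le_mul_of_nonneg_right h2 (by linarith))

/-- The noise is of order ρ, namely ρ² times the Young factor 1/ρ, and the slack of the contraction
is Mρ/5 times exp(-ρ). The constants match from M = 25 on. -/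
theorem contraction_add_le {ρ M : ℝ} (h0 : 0 < ρ) (h1 : ρ ≤ 1) (hM : 25 ≤ M) :
    (1 + ρ / 4) * (1 - 3 / 4 * ρ) ^ 2 * M +
        2 * ((1 + 1 / (ρ / 4)) * (5 / 4) ^ 2) * (ρ ^ 2 / 8 * Real.exp (-ρ) + ρ ^ 2 / 16) ≤
      M * Real.exp (-ρ) := by
  have hq : 1 ≤ 2.72 * Real.exp (-ρ) := by
    have h2 : Real.exp ρ ≤ 2.72 := by
      calc Real.exp ρ ≤ Real.exp 1 := Real.exp_le_exp.2 h1
        _ ≤ 2.72 := by have := Real.exp_one_lt_d9; linarith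
    rw [Real.exp_neg, ← div_eq_mul_inv, le_div_iff₀ (Real.exp_pos _)]
    linarith
  have hc := mul_le_mul_of_nonneg_right (contraction_le_exp h0.le h1) (show 0 ≤ M by linarith)
  set q := Real.exp (-ρ) with hqdef
  have hq0 : 0 < q := Real.exp_pos _
  have e1 : 2 * ((1 + 1 / (ρ / 4)) * (5 / 4) ^ 2) * (ρ ^ 2 / 8 * q + ρ ^ 2 / 16) =
      25 / 8 * ((ρ + 4) * ρ) * (q / 8 + 1 / 16) := by
    field_simp; ring
  -- 0.17 = 2.72/16, because 1 ≤ 2.72 exp(-ρ).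
  have h3 : 25 / 8 * ((ρ + 4) * ρ) * (q / 8 + 1 / 16) ≤ 25 / 8 * (5 * ρ) * (q / 8 + 0.17 * q) := by
    gcongr <;> linarith
  have h4 : 0 < ρ * q := by positivity
  have h5 : 25 * (ρ * q) ≤ M * (ρ * q) := by gcongr
  rw [e1]
  linarith

section Recursion

variable {n d : ℕ} {Y : Type*} {p : ERM n d Y} {z : Sizes n} {τ : Tuning} {θ₀ : E d}
variable (hn : 0 < n) (hL : 0 ≤ p.L) (hμ : 0 < p.μ) {r : ℝ} (hx : ∀ i, ‖p.x i‖ ≤ r)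
variable (hd : ∀ i, Differentiable ℝ fun u => p.ℓ u (p.y i)) (hb : ∀ k, 0 < z.b k)
variable (hγ : 0 ≤ τ.γ) {ρ ν : ℝ} (hρ : ρ = p.μ / (p.μ + 2 * τ.γ)) (hν : 0 < ν)
  (hmini : ∀ k, z.b k < n → 16 * ν ^ 2 / ρ ^ 2 * Real.exp (ρ * k) ≤ z.b k)
  (hε : ∀ k : ℕ, τ.ε (k + 1) ^ 2 / p.μ = ρ ^ 2 / 16 * Real.exp (-(ρ * k)))

section Rate

include hμ hγ hρ

theorem rate_pos : 0 < ρ := by rw [hρ]; positivity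

theorem rate_le_one : ρ ≤ 1 := by
  rw [hρ, div_le_one (by positivity)]; linarith

end Rate

include hn hb in
theorem mini_factor_nonneg (k : ℕ) : 0 ≤ 2 * ((n : ℝ) - z.b k) / (n * z.b k) := by
  have h1 : (z.b k : ℝ) ≤ n := by exact_mod_cast z.b_le k
  have h2 : (0 : ℝ) < z.b k := by exact_mod_cast hb k
  exact div_nonneg (by linarith) (by positivity)

include hn hb in
theorem mini_factor_le_two (k : ℕ) : 2 * ((n : ℝ) - z.b k) / (n * z.b k) ≤ 2 := by
  have h2 : (1 : ℝ) ≤ z.b k := by exact_mod_cast hb k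
  have h3 : (0 : ℝ) < n := by exact_mod_cast hn
  rw [div_le_iff₀ (by positivity)]
  nlinarith

-- A minibatch that is the full sample has no sampling error, so cutting the sizes off at n is
-- harmless. Otherwise the growth of the sizes makes the variance decay at the rate of the
-- iteration.
include hn hb hμ hγ hρ hν hmini in
theorem mini_factor_mul_le (k : ℕ) : 2 * ((n : ℝ) - z.b k) / (n * z.b k) * ν ^ 2 ≤
    ρ ^ 2 / 8 * Real.exp (-(ρ * k)) := by
  have hρ0 := rate_pos hμ hγ hρ
  have h2 : (0 : ℝ) < z.b k := by exact_mod_cast hb k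
  have h3 : (0 : ℝ) < n := by exact_mod_cast hn
  rcases (z.b_le k).lt_or_eq with h | h
  · have h4 := hmini k h
    have h5 : 2 * ((n : ℝ) - z.b k) / (n * z.b k) ≤ 2 / z.b k := by
      rw [div_le_div_iff₀ (by positivity) h2]
      nlinarith [mul_pos h2 h2]
    have h6 : ν ^ 2 ≤ ρ ^ 2 / 16 * Real.exp (-(ρ * k)) * z.b k := by
      have h7 : ρ ^ 2 / 16 * Real.exp (-(ρ * k)) *
          (16 * ν ^ 2 / ρ ^ 2 * Real.exp (ρ * k)) = ν ^ 2 := by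
        rw [Real.exp_neg]
        field_simp
      rw [← h7]
      gcongr
    calc _ ≤ 2 / (z.b k : ℝ) * (ρ ^ 2 / 16 * Real.exp (-(ρ * k)) * z.b k) := by gcongr
      _ = _ := by field_simp; norm_num
  · rw [h, sub_self, mul_zero, zero_div, zero_mul]
    positivity

include hn hL hμ hd hb hγ hρ hν hmini hε

/-- Integrals over the good event are used instead of conditional expectations: the variance is
nonnegative, so its integral over the event is at most the assumed bound for the full expectation.
-/
theorem setLIntegral_excess_succ_le_of_isGood (t k : ℕ)
    (hfin : ∀ᵐ ω ∂law z, epochs p z τ θ₀ ω t k ≠ ⊤) {M : ℝ} (hM : 25 ≤ M)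
    (hV : ∫⁻ ω, ENNReal.ofReal (iterVar p z τ θ₀ ω t k) ∂law z ≤ ENNReal.ofReal (ν ^ 2))
    (hk : ∫⁻ ω in {ω : Outcome z | batch ω (t + 1) ∈ {S | p.IsGood τ.γ S}},
      ENNReal.ofReal (excess p z τ θ₀ ω t k) ∂law z ≤
        ENNReal.ofReal (M * Real.exp (-(ρ * k)))) :
    ∫⁻ ω in {ω : Outcome z | batch ω (t + 1) ∈ {S | p.IsGood τ.γ S}},
      ENNReal.ofReal (excess p z τ θ₀ ω t (k + 1)) ∂law z ≤
        ENNReal.ofReal (M * Real.exp (-(ρ * (k + 1 : ℕ)))) := by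
  have hρ0 := rate_pos hμ hγ hρ
  have hρ1 := rate_le_one hμ hγ hρ
  have hstep := setLIntegral_excess_succ_le (θ₀ := θ₀) hd hb hL hμ hn t k {S | p.IsGood τ.γ S}
    (α := (1 + ρ / 4) * (1 - 3 / 4 * ρ) ^ 2) (β := (1 + 1 / (ρ / 4)) * (5 / 4) ^ 2)
    (by positivity) (by positivity) hfin (fun ω hω h => by
      rw [hρ]; exact excess_succ_le_of_isGood hL hμ hγ ω t k hω h)
  refine hstep.trans ?_
  set c := 2 * ((n : ℝ) - z.b (k + 1)) / (n * z.b (k + 1)) with hc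
  have hc0 : 0 ≤ c := mini_factor_nonneg hn hb (k + 1)
  have hcν : c * ν ^ 2 ≤ ρ ^ 2 / 8 * Real.exp (-(ρ * (k + 1 : ℕ))) :=
    mini_factor_mul_le hn hμ hb hγ hρ hν hmini (k + 1)
  calc _ ≤ ENNReal.ofReal ((1 + ρ / 4) * (1 - 3 / 4 * ρ) ^ 2) *
          ENNReal.ofReal (M * Real.exp (-(ρ * k))) +
        ENNReal.ofReal (2 * ((1 + 1 / (ρ / 4)) * (5 / 4) ^ 2)) *
          (ENNReal.ofReal c * ENNReal.ofReal (ν ^ 2) +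
            ENNReal.ofReal (τ.ε (k + 1) ^ 2 / p.μ) * 1) := by
        gcongr
        · exact (setLIntegral_le_lintegral _ _).trans hV
        · exact prob_le_one
    _ = ENNReal.ofReal ((1 + ρ / 4) * (1 - 3 / 4 * ρ) ^ 2 * (M * Real.exp (-(ρ * k))) +
          2 * ((1 + 1 / (ρ / 4)) * (5 / 4) ^ 2) * (c * ν ^ 2 + τ.ε (k + 1) ^ 2 / p.μ)) := by
        rw [mul_one, ← ENNReal.ofReal_mul (by positivity), ← ENNReal.ofReal_mul hc0,
          ← ENNReal.ofReal_add (by positivity) (by positivity), ← ENNReal.ofReal_mul (by positivity),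
          ← ENNReal.ofReal_add (by positivity) (by positivity)]
    _ ≤ _ := by
        refine ENNReal.ofReal_le_ofReal ?_
        have h1 := contraction_add_le hρ0 hρ1 hM
        have e1 : Real.exp (-(ρ * (k + 1 : ℕ))) = Real.exp (-ρ) * Real.exp (-(ρ * k)) := by
          rw [← Real.exp_add]; congr 1; push_cast; ring
        rw [e1] at hcν ⊢
        rw [hε]
        calc _ ≤ (1 + ρ / 4) * (1 - 3 / 4 * ρ) ^ 2 * (M * Real.exp (-(ρ * k))) +
            2 * ((1 + 1 / (ρ / 4)) * (5 / 4) ^ 2) *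
              (ρ ^ 2 / 8 * (Real.exp (-ρ) * Real.exp (-(ρ * k))) +
                ρ ^ 2 / 16 * Real.exp (-(ρ * k))) := by gcongr
          _ = ((1 + ρ / 4) * (1 - 3 / 4 * ρ) ^ 2 * M +
              2 * ((1 + 1 / (ρ / 4)) * (5 / 4) ^ 2) *
                (ρ ^ 2 / 8 * Real.exp (-ρ) + ρ ^ 2 / 16)) * Real.exp (-(ρ * k)) := by ring
          _ ≤ M * Real.exp (-ρ) * Real.exp (-(ρ * k)) := by gcongr
          _ = _ := by ring

include hx

/-- Every quantity on the event carries the factor P. It enters at k = 0 through the hypotheses on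
the start and is then only propagated, with a crude growth factor. -/
theorem setLIntegral_excess_succ_le_of_any (A : Set (Finset (Fin n))) (t k : ℕ)
    (hfin : ∀ᵐ ω ∂law z, epochs p z τ θ₀ ω t k ≠ ⊤) {P D : ℝ} (hP : 0 ≤ P) (hD : 1 ≤ D)
    (hA : law z {ω : Outcome z | batch ω (t + 1) ∈ A} ≤ ENNReal.ofReal P)
    (hV : ∫⁻ ω in {ω : Outcome z | batch ω (t + 1) ∈ A},
      ENNReal.ofReal (iterVar p z τ θ₀ ω t 0) ∂law z ≤ ENNReal.ofReal (P * ν ^ 2))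
    (h0 : ∫⁻ ω in {ω : Outcome z | batch ω (t + 1) ∈ A},
      ENNReal.ofReal (excess p z τ θ₀ ω t 0) ∂law z ≤ ENNReal.ofReal (P * D))
    (hk : ∫⁻ ω in {ω : Outcome z | batch ω (t + 1) ∈ A},
      ENNReal.ofReal (excess p z τ θ₀ ω t k) ∂law z ≤
        ENNReal.ofReal (P * D * (256 * (1 + p.L * r ^ 2 / p.μ) ^ 3) ^ k)) :
    ∫⁻ ω in {ω : Outcome z | batch ω (t + 1) ∈ A},
      ENNReal.ofReal (excess p z τ θ₀ ω t (k + 1)) ∂law z ≤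
        ENNReal.ofReal (P * D * (256 * (1 + p.L * r ^ 2 / p.μ) ^ 3) ^ (k + 1)) := by
  have hρ0 := rate_pos hμ hγ hρ
  have hρ1 := rate_le_one hμ hγ hρ
  set κ := p.L * r ^ 2 / p.μ with hκ
  have hκ0 : 0 ≤ κ := by positivity
  set Γ := 256 * (1 + κ) ^ 3 with hΓ
  have hΓ1 : 1 ≤ Γ := by
    have : 1 ≤ (1 + κ) ^ 3 := one_le_pow₀ (by linarith)
    linarith
  have hstep := setLIntegral_excess_succ_le (θ₀ := θ₀) hd hb hL hμ hn t k A
    (α := 2 * (1 + κ) ^ 2) (β := 2 * (1 + κ) ^ 2)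
    (by positivity) (by positivity) hfin (fun ω _ h => excess_succ_le hL hμ hx hγ ω t k h)
  refine hstep.trans ?_
  set c := 2 * ((n : ℝ) - z.b (k + 1)) / (n * z.b (k + 1)) with hc
  have hc0 : 0 ≤ c := mini_factor_nonneg hn hb (k + 1)
  have hc2 : c ≤ 2 := mini_factor_le_two hn hb (k + 1)
  have hcν : c * ν ^ 2 ≤ 1 / 8 := by
    refine (mini_factor_mul_le hn hμ hb hγ hρ hν hmini (k + 1)).trans ?_
    have : Real.exp (-(ρ * (k + 1 : ℕ))) ≤ 1 := Real.exp_le_one_iff.2 (by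
      have : 0 ≤ ρ * (k + 1 : ℕ) := by positivity
      linarith)
    have h2 : ρ ^ 2 ≤ 1 := pow_le_one₀ hρ0.le hρ1
    calc ρ ^ 2 / 8 * Real.exp (-(ρ * (k + 1 : ℕ))) ≤ 1 / 8 * 1 := by gcongr
      _ = _ := by ring
  have hεk : τ.ε (k + 1) ^ 2 / p.μ ≤ 1 / 16 := by
    rw [hε]
    have : Real.exp (-(ρ * k)) ≤ 1 := Real.exp_le_one_iff.2 (by
      have : 0 ≤ ρ * k := by positivity
      linarith)
    have h2 : ρ ^ 2 ≤ 1 := pow_le_one₀ hρ0.le hρ1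
    calc ρ ^ 2 / 16 * Real.exp (-(ρ * k)) ≤ 1 / 16 * 1 := by gcongr
      _ = _ := by ring
  set W := P * D * Γ ^ k with hW
  have hΓk : 1 ≤ Γ ^ k := one_le_pow₀ hΓ1
  have hW1 : P * D ≤ W := le_mul_of_one_le_right (by positivity) hΓk
  have hW2 : P ≤ W := (le_mul_of_one_le_right hP hD).trans hW1
  have hW0 : 0 ≤ W := hP.trans hW2
  have hvar : ∫⁻ ω in {ω : Outcome z | batch ω (t + 1) ∈ A},
      ENNReal.ofReal (iterVar p z τ θ₀ ω t k) ∂law z ≤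
        ENNReal.ofReal (2 * (P * ν ^ 2) + 16 * κ * (W + W)) := by
    have hm := (measurable_excess (p := p) (τ := τ) (θ₀ := θ₀) hd hb t k).ennreal_ofReal
    have hm0 := (measurable_excess (p := p) (τ := τ) (θ₀ := θ₀) hd hb t 0).ennreal_ofReal
    have hmv := (measurable_iterVar (p := p) (τ := τ) (θ₀ := θ₀) hd hb t 0).ennreal_ofReal
    calc _ ≤ ∫⁻ ω in {ω : Outcome z | batch ω (t + 1) ∈ A},
          (ENNReal.ofReal 2 * ENNReal.ofReal (iterVar p z τ θ₀ ω t 0) + ENNReal.ofReal (16 * κ) *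
            (ENNReal.ofReal (excess p z τ θ₀ ω t k) +
              ENNReal.ofReal (excess p z τ θ₀ ω t 0))) ∂law z := by
          refine lintegral_mono fun ω => ?_
          have h1 := excess_nonneg (τ := τ) (θ₀ := θ₀) hL hμ ω t k
          have h2 := excess_nonneg (τ := τ) (θ₀ := θ₀) hL hμ ω t 0
          have h3 := iterVar_nonneg (τ := τ) (θ₀ := θ₀) hL hμ ω t 0
          rw [← ENNReal.ofReal_mul (by norm_num), ← ENNReal.ofReal_add h1 h2,
            ← ENNReal.ofReal_mul (by positivity), ← ENNReal.ofReal_add (by positivity)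
              (by positivity)]
          exact ENNReal.ofReal_le_ofReal (iterVar_le hL hμ hx hn ω t k)
      _ = ENNReal.ofReal 2 * (∫⁻ ω in {ω : Outcome z | batch ω (t + 1) ∈ A},
            ENNReal.ofReal (iterVar p z τ θ₀ ω t 0) ∂law z) + ENNReal.ofReal (16 * κ) *
          ((∫⁻ ω in {ω : Outcome z | batch ω (t + 1) ∈ A},
            ENNReal.ofReal (excess p z τ θ₀ ω t k) ∂law z) +
          ∫⁻ ω in {ω : Outcome z | batch ω (t + 1) ∈ A},
            ENNReal.ofReal (excess p z τ θ₀ ω t 0) ∂law z) := by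
          rw [lintegral_add_left (hmv.const_mul _), lintegral_const_mul _ hmv,
            lintegral_const_mul _ (hm.fun_add hm0), lintegral_add_left hm]
      _ ≤ ENNReal.ofReal 2 * ENNReal.ofReal (P * ν ^ 2) + ENNReal.ofReal (16 * κ) *
          (ENNReal.ofReal W + ENNReal.ofReal W) := by
          gcongr
          exact h0.trans (ENNReal.ofReal_le_ofReal hW1)
      _ = _ := by
          rw [← ENNReal.ofReal_mul (by norm_num), ← ENNReal.ofReal_add hW0 hW0,
            ← ENNReal.ofReal_mul (by positivity), ← ENNReal.ofReal_add (by positivity)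
              (by positivity)]
  calc _ ≤ ENNReal.ofReal (2 * (1 + κ) ^ 2) * ENNReal.ofReal W +
        ENNReal.ofReal (2 * (2 * (1 + κ) ^ 2)) *
          (ENNReal.ofReal c * ENNReal.ofReal (2 * (P * ν ^ 2) + 16 * κ * (W + W)) +
            ENNReal.ofReal (τ.ε (k + 1) ^ 2 / p.μ) * ENNReal.ofReal P) := by gcongr
    _ = ENNReal.ofReal (2 * (1 + κ) ^ 2 * W + 2 * (2 * (1 + κ) ^ 2) *
          (c * (2 * (P * ν ^ 2) + 16 * κ * (W + W)) + τ.ε (k + 1) ^ 2 / p.μ * P)) := by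
        rw [← ENNReal.ofReal_mul (by positivity), ← ENNReal.ofReal_mul hc0,
          ← ENNReal.ofReal_mul (by positivity),
          ← ENNReal.ofReal_add (by positivity) (by positivity), ← ENNReal.ofReal_mul (by positivity),
          ← ENNReal.ofReal_add (by positivity) (by positivity)]
    _ ≤ _ := by
        refine ENNReal.ofReal_le_ofReal ?_
        have h1 : c * (2 * (P * ν ^ 2) + 16 * κ * (W + W)) + τ.ε (k + 1) ^ 2 / p.μ * P ≤
            (1 / 4 + 64 * κ + 1 / 16) * W := by
          have h2 : c * ν ^ 2 * (2 * P) ≤ 1 / 8 * (2 * W) := by gcongr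
          have h3 : c * (16 * κ * (W + W)) ≤ 2 * (16 * κ * (W + W)) := by gcongr
          have h4 : τ.ε (k + 1) ^ 2 / p.μ * P ≤ 1 / 16 * W := by gcongr
          linarith
        have h5 : (0 : ℝ) ≤ 2 * (2 * (1 + κ) ^ 2) := by positivity
        have h6 := mul_le_mul_of_nonneg_left h1 h5
        have h7 : P * D * Γ ^ (k + 1) = Γ * W := by rw [hW, pow_succ]; ring
        -- The 256 in Γ is the coefficient of κ(1 + κ)²: the factor 4(1 + κ)² in front of the noise
        -- times c ≤ 2 times 32κ from the growth of the variance.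
        have h8 : Γ * W - (2 * (1 + κ) ^ 2 * W +
            2 * (2 * (1 + κ) ^ 2) * ((1 / 4 + 64 * κ + 1 / 16) * W)) =
            (256 - 13 / 4) * ((1 + κ) ^ 2 * W) := by rw [hΓ]; ring
        have h9 : 0 ≤ (1 + κ) ^ 2 * W := by positivity
        rw [h7]
        linarith

/-- The expected number of epochs of SVRG, from a bound for the suboptimality at the start. -/
theorem lintegral_epochs_le_of_excess (hη : τ.η = 1 / (10 * (p.L * r ^ 2 + p.μ + τ.γ)))
    (hm : 50 * (p.L * r ^ 2 + p.μ + τ.γ) / (p.μ + τ.γ) ≤ z.m) (hε0 : ∀ k, 0 < τ.ε (k + 1))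
    (t k : ℕ) {C : ℝ} (hC : 0 ≤ C)
    (hV : ∫⁻ ω, ENNReal.ofReal (iterVar p z τ θ₀ ω t k) ∂law z ≤ ENNReal.ofReal (ν ^ 2))
    (hk : ∫⁻ ω, ENNReal.ofReal (excess p z τ θ₀ ω t k) ∂law z ≤
        ENNReal.ofReal (C * Real.exp (-(ρ * k)))) {j₀ : ℕ}
    (hj : 32 * (1 + p.L * r ^ 2 / p.μ) ^ 2 * (C + 1) / ρ ^ 3 ≤ 2 ^ j₀) :
    ∫⁻ ω, ((epochs p z τ θ₀ ω t k : ℕ∞) : ℝ≥0∞) ∂law z ≤ (j₀ : ℝ≥0∞) + 2 := by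
  have hρ0 := rate_pos hμ hγ hρ
  have hρ1 := rate_le_one hμ hγ hρ
  have hmx := (measurable_excess (p := p) (τ := τ) (θ₀ := θ₀) hd hb t k).ennreal_ofReal
  have hκ : 0 ≤ p.L * r ^ 2 / p.μ := by positivity
  refine lintegral_epochs_le hL hμ hγ hx hd hb hη hm t k
    (B := (1 + p.L * r ^ 2 / p.μ) * ((C + 1) * Real.exp (-(ρ * k)))) (hε0 k) ?_ ?_
  · have hN : ∫⁻ ω, ENNReal.ofReal (p.invHessianSq (noise p z τ θ₀ ω t k)) ∂law z ≤
        ENNReal.ofReal (Real.exp (-(ρ * k))) := by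
      have h1 := setLIntegral_invHessianSq_noise_le (τ := τ) (θ₀ := θ₀) hd hb hL hμ hn t k Set.univ
      simp only [Set.mem_univ, Set.ofPred_true, setLIntegral_univ] at h1
      refine h1.trans ?_
      calc _ ≤ ENNReal.ofReal (2 * ((n : ℝ) - z.b (k + 1)) / (n * z.b (k + 1))) *
            ENNReal.ofReal (ν ^ 2) := by gcongr
        _ ≤ _ := by
          rw [← ENNReal.ofReal_mul (mini_factor_nonneg hn hb (k + 1))]
          refine ENNReal.ofReal_le_ofReal
            ((mini_factor_mul_le hn hμ hb hγ hρ hν hmini (k + 1)).trans ?_)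
          have h2 : ρ ^ 2 / 8 ≤ 1 := by nlinarith
          have h3 : Real.exp (-(ρ * (k + 1 : ℕ))) ≤ Real.exp (-(ρ * k)) := by
            refine Real.exp_le_exp.2 (neg_le_neg (mul_le_mul_of_nonneg_left ?_ hρ0.le))
            push_cast; linarith
          calc _ ≤ 1 * Real.exp (-(ρ * k)) := by gcongr
            _ = _ := one_mul _
    calc _ ≤ ∫⁻ ω, ENNReal.ofReal (1 + p.L * r ^ 2 / p.μ) *
          (ENNReal.ofReal (excess p z τ θ₀ ω t k) +
            ENNReal.ofReal (p.invHessianSq (noise p z τ θ₀ ω t k))) ∂law z := by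
          refine lintegral_mono fun ω => ?_
          rw [← ENNReal.ofReal_add (excess_nonneg hL hμ ω t k)
            (ERM.invHessianSq_nonneg hL hμ _), ← ENNReal.ofReal_mul (by positivity)]
          exact ENNReal.ofReal_le_ofReal (proxGap_iter_le hL hμ hx hγ ω t k)
      _ = ENNReal.ofReal (1 + p.L * r ^ 2 / p.μ) *
          ((∫⁻ ω, ENNReal.ofReal (excess p z τ θ₀ ω t k) ∂law z) +
            ∫⁻ ω, ENNReal.ofReal (p.invHessianSq (noise p z τ θ₀ ω t k)) ∂law z) := by
          rw [lintegral_const_mul _ (hmx.fun_add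
            (measurable_invHessianSq_noise hd hb t k).ennreal_ofReal), lintegral_add_left hmx]
      _ ≤ ENNReal.ofReal (1 + p.L * r ^ 2 / p.μ) *
          (ENNReal.ofReal (C * Real.exp (-(ρ * k))) + ENNReal.ofReal (Real.exp (-(ρ * k)))) := by
          gcongr
      _ = _ := by
          rw [← ENNReal.ofReal_add (by positivity) (by positivity),
            ← ENNReal.ofReal_mul (by positivity)]
          congr 1; ring
  -- The bound for the starting gap and the squared accuracy both decay like exp(-ρk), so the
  -- required number of epochs does not depend on k.
  · refine le_trans ?_ hj
    have h1 : τ.ε (k + 1) ^ 2 = p.μ * (ρ ^ 2 / 16 * Real.exp (-(ρ * k))) := by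
      rw [← hε k]; field_simp
    have h2 : p.L * r ^ 2 + p.μ + τ.γ ≤ p.μ * ((1 + p.L * r ^ 2 / p.μ) / ρ) := by
      have h3 : p.μ * ((1 + p.L * r ^ 2 / p.μ) / ρ) =
          (1 + p.L * r ^ 2 / p.μ) * (p.μ + 2 * τ.γ) := by rw [hρ]; field_simp
      have h4 : (1 + p.L * r ^ 2 / p.μ) * p.μ = p.L * r ^ 2 + p.μ := by field_simp; ring
      rw [h3]
      nlinarith [mul_nonneg hκ hγ]
    have he := Real.exp_pos (-(ρ * k))
    rw [h1, div_le_iff₀ (by positivity)]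
    calc _ ≤ 2 * (p.μ * ((1 + p.L * r ^ 2 / p.μ) / ρ)) *
          ((1 + p.L * r ^ 2 / p.μ) * ((C + 1) * Real.exp (-(ρ * k)))) := by gcongr
      _ = _ := by field_simp; ring

/-- The inner iterates converge linearly in expectation, and SVRG needs few epochs. -/
theorem lintegral_excess_le (hη : τ.η = 1 / (10 * (p.L * r ^ 2 + p.μ + τ.γ)))
    (hm : 50 * (p.L * r ^ 2 + p.μ + τ.γ) / (p.μ + τ.γ) ≤ z.m) (hε0 : ∀ k, 0 < τ.ε (k + 1))
    (t K : ℕ) (hK : 0 < K) {P M : ℝ} (hP : 0 ≤ P) (hM : 0 ≤ M)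
    (hbad : ∀ t, law z {ω : Outcome z | batch ω t ∈ {S | ¬ p.IsGood τ.γ S}} ≤ ENNReal.ofReal P)
    (hPK : P * (M + 1) * (3 * (256 * (1 + p.L * r ^ 2 / p.μ) ^ 3)) ^ K ≤ 1)
    (hV : ∀ k < K, ∫⁻ ω, ENNReal.ofReal (iterVar p z τ θ₀ ω t k) ∂law z ≤ ENNReal.ofReal (ν ^ 2))
    (h0 : ∫⁻ ω, ENNReal.ofReal (excess p z τ θ₀ ω t 0) ∂law z ≤ ENNReal.ofReal M) :
    (∀ k ≤ K, ∫⁻ ω, ENNReal.ofReal (excess p z τ θ₀ ω t k) ∂law z ≤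
        ENNReal.ofReal ((M + 26) * Real.exp (-(ρ * k)))) ∧
      ∀ j₀ : ℕ, 32 * (1 + p.L * r ^ 2 / p.μ) ^ 2 * (M + 27) / ρ ^ 3 ≤ 2 ^ j₀ →
        ∀ k < K, ∫⁻ ω, ((epochs p z τ θ₀ ω t k : ℕ∞) : ℝ≥0∞) ∂law z ≤ (j₀ : ℝ≥0∞) + 2 := by
  have hρ0 := rate_pos hμ hγ hρ
  have hρ1 := rate_le_one hμ hγ hρ
  set A : Set (Finset (Fin n)) := {S | p.IsGood τ.γ S} with hA
  set B : Set (Finset (Fin n)) := {S | ¬ p.IsGood τ.γ S} with hB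
  set Γ := 256 * (1 + p.L * r ^ 2 / p.μ) ^ 3 with hΓ
  have hΓ1 : 1 ≤ Γ := by
    have hκ : 0 ≤ p.L * r ^ 2 / p.μ := by positivity
    have : 1 ≤ (1 + p.L * r ^ 2 / p.μ) ^ 3 := one_le_pow₀ (by linarith)
    linarith
  have hcompl : {ω : Outcome z | batch ω (t + 1) ∈ B} =
      {ω : Outcome z | batch ω (t + 1) ∈ A}ᶜ := rfl
  have hinv : ∀ ω v, outerRun p z τ θ₀ (Function.update ω (.batch (t + 1)) v) t =
      outerRun p z τ θ₀ ω t := fun ω v => outerRun_update p τ θ₀ ω (by simp [Draw.time]) v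
  -- At k = 0 the iterate is θ_t, determined by draws made before the batch, so the probability of a
  -- bad batch factors out.
  have hB0 : ∫⁻ ω in {ω : Outcome z | batch ω (t + 1) ∈ B},
      ENNReal.ofReal (excess p z τ θ₀ ω t 0) ∂law z ≤ ENNReal.ofReal (P * (M + 1)) := by
    rw [setLIntegral_batch_mem_eq_mul _ _ (measurable_excess hd hb t 0).ennreal_ofReal
      (fun ω v => by simp only [excess, modelGrad, iter_zero, hinv]), ENNReal.ofReal_mul hP]
    gcongr
    · exact hbad _
    · exact h0.trans (ENNReal.ofReal_le_ofReal (by linarith))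
  have hBV : ∫⁻ ω in {ω : Outcome z | batch ω (t + 1) ∈ B},
      ENNReal.ofReal (iterVar p z τ θ₀ ω t 0) ∂law z ≤ ENNReal.ofReal (P * ν ^ 2) := by
    rw [setLIntegral_batch_mem_eq_mul _ _ (measurable_iterVar hd hb t 0).ennreal_ofReal
      (fun ω v => by simp only [iterVar, modelGrad, iter_zero, hinv]), ENNReal.ofReal_mul hP]
    gcongr
    · exact hbad _
    · exact hV 0 hK
  have htotal : ∀ k ≤ K,
      ∫⁻ ω in {ω : Outcome z | batch ω (t + 1) ∈ A},
        ENNReal.ofReal (excess p z τ θ₀ ω t k) ∂law z ≤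
          ENNReal.ofReal ((M + 25) * Real.exp (-(ρ * k))) →
      ∫⁻ ω in {ω : Outcome z | batch ω (t + 1) ∈ B},
        ENNReal.ofReal (excess p z τ θ₀ ω t k) ∂law z ≤ ENNReal.ofReal (P * (M + 1) * Γ ^ k) →
      ∫⁻ ω, ENNReal.ofReal (excess p z τ θ₀ ω t k) ∂law z ≤
        ENNReal.ofReal ((M + 26) * Real.exp (-(ρ * k))) := by
    intro k hk h1 h2
    rw [← lintegral_add_compl _ (measurableSet_batch_mem (t + 1) A), ← hcompl]
    refine (add_le_add h1 h2).trans ?_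
    rw [← ENNReal.ofReal_add (by positivity) (by positivity)]
    refine ENNReal.ofReal_le_ofReal ?_
    -- Since exp ρ ≤ 3, the smallness condition with base 3Γ makes the bad part at most exp(-ρk) for
    -- all k ≤ K. It raises the constant from M + 25 to M + 26.
    have h3 : P * (M + 1) * Γ ^ k ≤ Real.exp (-(ρ * k)) := by
      rw [Real.exp_neg, ← one_div, le_div_iff₀ (Real.exp_pos _)]
      calc P * (M + 1) * Γ ^ k * Real.exp (ρ * k)
          ≤ P * (M + 1) * Γ ^ k * 3 ^ k := by
            gcongr
            rw [mul_comm, Real.exp_nat_mul]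
            gcongr
            calc Real.exp ρ ≤ Real.exp 1 := Real.exp_le_exp.2 hρ1
              _ ≤ 3 := by have := Real.exp_one_lt_d9; linarith
        _ = P * (M + 1) * (3 * Γ) ^ k := by
          rw [mul_pow 3 Γ k]; generalize Γ ^ k = u; ring
        _ ≤ P * (M + 1) * (3 * Γ) ^ K := by
            gcongr
            linarith
        _ ≤ 1 := hPK
    linarith
  have hep : ∀ j₀ : ℕ, 32 * (1 + p.L * r ^ 2 / p.μ) ^ 2 * (M + 27) / ρ ^ 3 ≤ 2 ^ j₀ →
      ∀ k < K, ∫⁻ ω, ENNReal.ofReal (excess p z τ θ₀ ω t k) ∂law z ≤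
        ENNReal.ofReal ((M + 26) * Real.exp (-(ρ * k))) →
        ∫⁻ ω, ((epochs p z τ θ₀ ω t k : ℕ∞) : ℝ≥0∞) ∂law z ≤ (j₀ : ℝ≥0∞) + 2 :=
    fun j₀ hj k hkK hk => lintegral_epochs_le_of_excess hn hL hμ hx hd hb hγ hρ hν hmini hε hη hm
      hε0 t k (by positivity) (hV k hkK) hk (by rwa [show M + 26 + 1 = M + 27 by ring])
  -- Any finite exponent will do: in the induction below, the epoch bound only has to show that SVRG
  -- stops almost surely in iteration k before the bounds at k + 1 can be derived.
  obtain ⟨j₁, hj₁⟩ := pow_unbounded_of_one_lt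
    (32 * (1 + p.L * r ^ 2 / p.μ) ^ 2 * (M + 27) / ρ ^ 3) (one_lt_two (α := ℝ))
  have hmain : ∀ k ≤ K,
      ∫⁻ ω in {ω : Outcome z | batch ω (t + 1) ∈ A},
        ENNReal.ofReal (excess p z τ θ₀ ω t k) ∂law z ≤
          ENNReal.ofReal ((M + 25) * Real.exp (-(ρ * k))) ∧
      ∫⁻ ω in {ω : Outcome z | batch ω (t + 1) ∈ B},
        ENNReal.ofReal (excess p z τ θ₀ ω t k) ∂law z ≤
          ENNReal.ofReal (P * (M + 1) * Γ ^ k) := by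
    intro k
    induction k with
    | zero =>
      intro _
      refine ⟨(setLIntegral_le_lintegral _ _).trans (h0.trans (ENNReal.ofReal_le_ofReal ?_)), ?_⟩
      · simp
      · simpa using hB0
    | succ k ih =>
      intro hk
      obtain ⟨h1, h2⟩ := ih (by omega)
      have h3 := hep j₁ hj₁.le k (by omega) (htotal k (by omega) h1 h2)
      have hfin : ∀ᵐ ω ∂law z, epochs p z τ θ₀ ω t k ≠ ⊤ := by
        have hmeas : Measurable fun ω : Outcome z =>
            ((epochs p z τ θ₀ ω t k : ℕ∞) : ℝ≥0∞) :=
          (measurable_from_top (f := fun a : ℕ∞ => (a : ℝ≥0∞))).comp (measurable_epochs hd hb t k)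
        refine (ae_lt_top hmeas (h3.trans_lt (by finiteness)).ne).mono fun ω hω h => ?_
        simp [h] at hω
      exact ⟨setLIntegral_excess_succ_le_of_isGood hn hL hμ hd hb hγ hρ hν hmini hε t k hfin
          (by linarith) (hV k (by omega)) h1,
        setLIntegral_excess_succ_le_of_any hn hL hμ hx hd hb hγ hρ hν hmini hε B t k hfin hP
          (by linarith) (hbad _) hBV hB0 h2⟩
  exact ⟨fun k hk => htotal k hk (hmain k hk).1 (hmain k hk).2, fun j₀ hj k hk =>
    hep j₀ hj k hk (htotal k hk.le (hmain k hk.le).1 (hmain k hk.le).2)⟩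

end Recursion

end

end HSDMPG

/-! ### The quadratic models and the outer loop. -/

namespace HSDMPG

noncomputable section

open Matrix MeasureTheory
open scoped ENNReal

theorem inner_op_comm {d : ℕ} {M : Matrix (Fin d) (Fin d) ℝ} (hM : M.IsSymm) (u v : E d) :
    inner ℝ u (op M v) = inner ℝ v (op M u) := by
  rw [inner_op, inner_op, dotProduct_mulVec, ← mulVec_transpose, hM.eq, dotProduct_comm]

theorem StronglyConvexSmooth.le {σ L : ℝ} {g : ℝ → ℝ} (h : StronglyConvexSmooth σ L g) :
    σ ≤ L := by
  have := h.2 1 0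
  linarith [this.1.trans this.2]

namespace ERM

variable {n d : ℕ} {Y : Type*} {p : ERM n d Y}

theorem hessianBound_isSymm : p.hessianBound.IsSymm := by
  rw [hessianBound_eq]; exact precond_isSymm p 0 _

variable (hn : 0 < n) (hd : ∀ i, Differentiable ℝ fun u => p.ℓ u (p.y i))

include hn hd

theorem quadModel_eq (w θ θ' : E d) : p.quadModel w θ' = p.quadModel w θ +
    inner ℝ (p.qGrad w Finset.univ θ) (θ' - θ) +
      1 / 2 * inner ℝ (θ' - θ) (op p.hessianBound (θ' - θ)) := by
  have e1 : θ' - w = (θ' - θ) + (θ - w) := by abel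
  have h1 : ∀ v : E d, v.ofLp ⬝ᵥ p.hessianBound *ᵥ v.ofLp = inner ℝ v (op p.hessianBound v) :=
    fun v => (inner_op _ _ _).symm
  have h2 := inner_op_comm (hessianBound_isSymm (p := p)) (θ' - θ) (θ - w)
  have h3 := real_inner_comm (op p.hessianBound (θ - w)) (θ' - θ)
  simp only [quadModel, qGrad, ← hessianBound_eq, gradient_risk hn hd, h1]
  rw [e1]
  simp only [map_add, inner_add_left, inner_add_right]
  linarith

theorem quadModel_sub_half_le (hL : 0 ≤ p.L) (hμ : 0 < p.μ) (w θ θ' : E d) :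
    p.quadModel w θ - 1 / 2 * p.invHessianSq (p.qGrad w Finset.univ θ) ≤ p.quadModel w θ' := by
  have hH := hessianBound_posDef hL hμ
  rw [quadModel_eq hn hd w θ θ']
  have h := invHessianSq_nonneg hL hμ (p.qGrad w Finset.univ θ + op p.hessianBound (θ' - θ))
  simp only [invHessianSq_eq_inner, map_add, inner_add_left, inner_add_right,
    op_inv_op hH] at h ⊢
  have h2 := inner_op_comm (hessianBound_isSymm (p := p)) (θ' - θ)
    (op p.hessianBound⁻¹ (p.qGrad w Finset.univ θ))
  rw [op_op_inv hH] at h2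
  have h3 := real_inner_comm (op p.hessianBound (θ' - θ))
    (op p.hessianBound⁻¹ (p.qGrad w Finset.univ θ))
  have h4 := real_inner_comm (θ' - θ) (p.qGrad w Finset.univ θ)
  have h5 := real_inner_comm (op p.hessianBound (θ' - θ)) (θ' - θ)
  linarith

/-- The minimum of the quadratic model. -/
theorem iInf_quadModel (hL : 0 ≤ p.L) (hμ : 0 < p.μ) (w θ : E d) :
    ⨅ θ', p.quadModel w θ' =
      p.quadModel w θ - 1 / 2 * p.invHessianSq (p.qGrad w Finset.univ θ) := by
  have hH := hessianBound_posDef hL hμ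
  have hle := quadModel_sub_half_le hn hd hL hμ w θ
  refine le_antisymm ?_ (le_ciInf hle)
  refine (ciInf_le ⟨_, Set.forall_mem_range.2 hle⟩
    (θ - op p.hessianBound⁻¹ (p.qGrad w Finset.univ θ))).trans (le_of_eq ?_)
  rw [quadModel_eq hn hd w θ, sub_sub_cancel_left, map_neg, op_op_inv hH, inner_neg_neg,
    inner_neg_right, invHessianSq_eq_inner, real_inner_comm (op p.hessianBound⁻¹ _)]
  ring

omit hd in
/-- The divergence of the risk is the average of the divergences of the losses. -/
theorem risk_sub_eq (hd : ∀ i, Differentiable ℝ fun u => p.ℓ u (p.y i)) (w θ : E d) :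
    p.risk θ - p.risk w - inner ℝ (gradient p.risk w) (θ - w) =
      (n : ℝ)⁻¹ * ∑ i, (p.ℓ (inner ℝ θ (p.x i)) (p.y i) - p.ℓ (inner ℝ w (p.x i)) (p.y i) -
        deriv (fun u => p.ℓ u (p.y i)) (inner ℝ w (p.x i)) *
          (inner ℝ θ (p.x i) - inner ℝ w (p.x i))) + p.μ / 2 * ‖θ - w‖ ^ 2 := by
  have hn' : (n : ℝ) ≠ 0 := by exact_mod_cast hn.ne'
  have h1 : inner ℝ (gradient p.risk w) (θ - w) = (n : ℝ)⁻¹ * ∑ i,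
      (deriv (fun u => p.ℓ u (p.y i)) (inner ℝ w (p.x i)) *
          (inner ℝ θ (p.x i) - inner ℝ w (p.x i))) + p.μ * inner ℝ w (θ - w) := by
    rw [gradient_risk hn hd, avgGrad, inner_smul_left, sum_inner, Finset.card_univ,
      Fintype.card_fin]
    simp only [(hasGradientAt_component (hd _) w).gradient, inner_add_left, inner_smul_left,
      Finset.sum_add_distrib, Finset.sum_const, Finset.card_univ, Fintype.card_fin, nsmul_eq_mul,
      mul_add, conj_trivial]
    rw [inv_mul_cancel_left₀ hn']
    congr 3
    funext i
    rw [inner_sub_right, real_inner_comm θ (p.x i), real_inner_comm w (p.x i)]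
  have h2 : ‖θ‖ ^ 2 = ‖w‖ ^ 2 + 2 * inner ℝ w (θ - w) + ‖θ - w‖ ^ 2 := by
    rw [← norm_add_sq_real, add_sub_cancel]
  simp only [h1, risk, Finset.sum_sub_distrib, h2]
  ring

omit hn hd in
theorem form_hessianBound (v : E d) : inner ℝ v (op p.hessianBound v) =
    p.L * ((n : ℝ)⁻¹ * ∑ i, (inner ℝ v (p.x i)) ^ 2) + p.μ * ‖v‖ ^ 2 := by
  rw [inner_op, hessianBound_form, gram_form, norm_sq_eq_dotProduct, Finset.card_univ,
    Fintype.card_fin]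
  simp only [dotProduct_eq_inner, real_inner_comm v]
  ring

variable {σ : ℝ} (hμ : 0 < p.μ) (hℓ : ∀ i, StronglyConvexSmooth σ p.L fun u => p.ℓ u (p.y i))

omit hd
include hℓ

/-- Smoothness of each loss bounds its divergence by the corresponding part of H̄, and the
regularizer is its own quadratic model. -/
theorem risk_le_quadModel (w θ : E d) : p.risk θ ≤ p.quadModel w θ := by
  have hd : ∀ i, Differentiable ℝ fun u => p.ℓ u (p.y i) := fun i => (hℓ i).1
  have h1 := risk_sub_eq hn hd w θ
  have h2 : ∑ i, (p.ℓ (inner ℝ θ (p.x i)) (p.y i) - p.ℓ (inner ℝ w (p.x i)) (p.y i) -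
        deriv (fun u => p.ℓ u (p.y i)) (inner ℝ w (p.x i)) *
          (inner ℝ θ (p.x i) - inner ℝ w (p.x i))) ≤
      ∑ i, p.L / 2 * (inner ℝ (θ - w) (p.x i)) ^ 2 :=
    Finset.sum_le_sum fun i _ => by rw [inner_sub_left]; exact ((hℓ i).2 _ _).2
  have h3 := mul_le_mul_of_nonneg_left h2 (show 0 ≤ (n : ℝ)⁻¹ by positivity)
  rw [← Finset.mul_sum] at h3
  rw [quadModel, ← inner_op, form_hessianBound]
  linarith

-- The curvature of the regularizer is scaled down by σ/L ≤ 1 as well, so that the minorant has a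
-- multiple of the same form H̄ as the majorant.
include hμ in
theorem risk_ge (hL : 0 < p.L) (hσL : σ ≤ p.L) (w θ : E d) :
    p.risk w + inner ℝ (gradient p.risk w) (θ - w) +
      σ / p.L * (1 / 2 * inner ℝ (θ - w) (op p.hessianBound (θ - w))) ≤ p.risk θ := by
  have hd : ∀ i, Differentiable ℝ fun u => p.ℓ u (p.y i) := fun i => (hℓ i).1
  have h1 := risk_sub_eq hn hd w θ
  have h2 : ∑ i, σ / 2 * (inner ℝ (θ - w) (p.x i)) ^ 2 ≤
      ∑ i, (p.ℓ (inner ℝ θ (p.x i)) (p.y i) - p.ℓ (inner ℝ w (p.x i)) (p.y i) -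
        deriv (fun u => p.ℓ u (p.y i)) (inner ℝ w (p.x i)) *
          (inner ℝ θ (p.x i) - inner ℝ w (p.x i))) :=
    Finset.sum_le_sum fun i _ => by rw [inner_sub_left]; exact ((hℓ i).2 _ _).1
  have h3 := mul_le_mul_of_nonneg_left h2 (show 0 ≤ (n : ℝ)⁻¹ by positivity)
  rw [← Finset.mul_sum] at h3
  have h4 : σ / p.L * (1 / 2 * inner ℝ (θ - w) (op p.hessianBound (θ - w))) =
      (n : ℝ)⁻¹ * (σ / 2 * ∑ i, (inner ℝ (θ - w) (p.x i)) ^ 2) +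
        σ / p.L * (p.μ / 2 * ‖θ - w‖ ^ 2) := by
    rw [form_hessianBound]
    field_simp
  have h5 : σ / p.L * (p.μ / 2 * ‖θ - w‖ ^ 2) ≤ 1 * (p.μ / 2 * ‖θ - w‖ ^ 2) := by
    gcongr
    exact (div_le_one hL).2 hσL
  linarith

variable (hL : 0 < p.L) {θstar : E d} (hmin : ∀ θ, p.risk θstar ≤ p.risk θ)

include hμ hL hmin

/-- The left side is twice the gap of Q_w at w, and min Q_w is at least the minimal risk because Q_w
majorizes the risk. -/
theorem invHessianSq_qGrad_self_le (w : E d) :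
    p.invHessianSq (p.qGrad w Finset.univ w) ≤ 2 * (p.risk w - p.risk θstar) := by
  have hd : ∀ i, Differentiable ℝ fun u => p.ℓ u (p.y i) := fun i => (hℓ i).1
  have h1 := iInf_quadModel hn hd hL.le hμ w w
  have h2 : p.risk θstar ≤ ⨅ θ', p.quadModel w θ' :=
    le_ciInf fun θ => (hmin θ).trans (risk_le_quadModel hn hℓ w θ)
  have h3 : p.quadModel w w = p.risk w := by simp [quadModel]
  linarith

/-- The decrease of the risk by an approximate minimization of the quadratic model. -/
theorem risk_sub_le (hσ : 0 ≤ σ) (hσL : σ ≤ p.L) (w θ : E d) :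
    p.risk θ - p.risk θstar ≤ (1 - σ / p.L) * (p.risk w - p.risk θstar) +
      1 / 2 * p.invHessianSq (p.qGrad w Finset.univ θ) := by
  have hd : ∀ i, Differentiable ℝ fun u => p.ℓ u (p.y i) := fun i => (hℓ i).1
  -- The comparison point is a step of length a = σ/L towards θ*. The linear term is scaled by a and
  -- the quadratic one by a², and together they are a times the minorant at θ*.
  have h1 := quadModel_sub_half_le hn hd hL.le hμ w θ (w + (σ / p.L) • (θstar - w))
  have h2 := risk_ge hn hμ hℓ hL hσL w θstar
  have h3 := risk_le_quadModel hn hℓ w θ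
  have h4 : p.quadModel w (w + (σ / p.L) • (θstar - w)) = p.risk w +
      σ / p.L * inner ℝ (gradient p.risk w) (θstar - w) + σ / p.L * (σ / p.L *
        (1 / 2 * inner ℝ (θstar - w) (op p.hessianBound (θstar - w)))) := by
    rw [quadModel, ← inner_op, add_sub_cancel_left, map_smul, inner_smul_right, inner_smul_right,
      inner_smul_left]
    simp only [conj_trivial]
    ring
  have h5 := mul_le_mul_of_nonneg_left h2 (show 0 ≤ σ / p.L by positivity)
  linarith

end ERM

/-- The recursion of the outer iteration. -/
theorem outer_contraction_le {a M x : ℝ} (ha0 : 0 ≤ a) (ha1 : a ≤ 1) (hM : 1 ≤ M) :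
    (1 - a) * (M * Real.exp (-(a * x / 2))) + a / 2 * Real.exp (-(a * (x + 1) / 2)) ≤
      M * Real.exp (-(a * (x + 1) / 2)) := by
  have h1 : Real.exp (-(a * (x + 1) / 2)) =
      Real.exp (-(a / 2)) * Real.exp (-(a * x / 2)) := by
    rw [← Real.exp_add]; congr 1; ring
  have h2 : 1 - a / 2 ≤ Real.exp (-(a / 2)) := Real.one_sub_le_exp_neg _
  -- Only half of the contraction a is claimed as rate; the other half pays for the model error.
  have h3 : (1 - a) * M + a / 2 * Real.exp (-(a / 2)) ≤ M * Real.exp (-(a / 2)) := by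
    nlinarith [mul_le_mul_of_nonneg_left h2 (show 0 ≤ M - a / 2 by linarith),
      mul_nonneg ha0 (show 0 ≤ M - 1 by linarith), sq_nonneg a]
  have h4 := mul_le_mul_of_nonneg_right h3 (Real.exp_pos (-(a * x / 2))).le
  rw [h1]
  linarith

section Outer

variable {n d : ℕ} {Y : Type*} {p : ERM n d Y} {z : Sizes n} {τ : Tuning} {θ₀ : E d}
variable (hn : 0 < n) (hb : ∀ k, 0 < z.b k) {σ : ℝ} (hσ : 0 < σ) (hL : 0 < p.L) (hσL : σ ≤ p.L)
  (hμ : 0 < p.μ) (hℓ : ∀ i, StronglyConvexSmooth σ p.L fun u => p.ℓ u (p.y i))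
  {θstar : E d} (hmin : ∀ θ, p.risk θstar ≤ p.risk θ)

include hn hb hσ hL hσL hμ hℓ hmin

theorem lintegral_excess_zero_le {t : ℕ} {D : ℝ}
    (h : ∫⁻ ω, ENNReal.ofReal (p.risk (outerRun p z τ θ₀ ω t) - p.risk θstar) ∂law z ≤
      ENNReal.ofReal D) :
    ∫⁻ ω, ENNReal.ofReal (excess p z τ θ₀ ω t 0) ∂law z ≤ ENNReal.ofReal (2 * D) := by
  calc _ ≤ ∫⁻ ω, ENNReal.ofReal 2 *
        ENNReal.ofReal (p.risk (outerRun p z τ θ₀ ω t) - p.risk θstar) ∂law z := by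
        refine lintegral_mono fun ω => ?_
        rw [← ENNReal.ofReal_mul (by norm_num)]
        exact ENNReal.ofReal_le_ofReal
          (ERM.invHessianSq_qGrad_self_le hn hμ hℓ hL hmin (outerRun p z τ θ₀ ω t))
    _ = ENNReal.ofReal 2 * ∫⁻ ω,
        ENNReal.ofReal (p.risk (outerRun p z τ θ₀ ω t) - p.risk θstar) ∂law z :=
        lintegral_const_mul' _ _ ENNReal.ofReal_ne_top
    _ ≤ _ := by
        rw [ENNReal.ofReal_mul (by norm_num)]
        gcongr

/-- The inner loop needs only a bound for its initial excess that is uniform in t. The decaying risk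
bound supplies 2(1 + Δ), so the accuracy of each model may be assumed conditionally on it. -/
theorem lintegral_risk_outerRun_le {T : ℕ} {Δ : ℝ} (hΔ : 0 ≤ Δ)
    (h0 : p.risk θ₀ - p.risk θstar ≤ Δ)
    (h : ∀ t < T, ∫⁻ ω, ENNReal.ofReal (excess p z τ θ₀ ω t 0) ∂law z ≤
        ENNReal.ofReal (2 * (1 + Δ)) →
      ∫⁻ ω, ENNReal.ofReal (excess p z τ θ₀ ω t (τ.K (t + 1))) ∂law z ≤
        ENNReal.ofReal (2 * modelAccuracy σ p.L (t + 1))) :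
    ∀ t ≤ T, ∫⁻ ω, ENNReal.ofReal (p.risk (outerRun p z τ θ₀ ω t) - p.risk θstar) ∂law z ≤
        ENNReal.ofReal ((1 + Δ) * Real.exp (-(σ / p.L * t / 2))) ∧
      ∫⁻ ω, ENNReal.ofReal (excess p z τ θ₀ ω t 0) ∂law z ≤ ENNReal.ofReal (2 * (1 + Δ)) := by
  have ha0 : 0 ≤ σ / p.L := by positivity
  have ha1 : σ / p.L ≤ 1 := (div_le_one hL).2 hσL
  have hsnd : ∀ t : ℕ,
      ∫⁻ ω, ENNReal.ofReal (p.risk (outerRun p z τ θ₀ ω t) - p.risk θstar) ∂law z ≤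
        ENNReal.ofReal ((1 + Δ) * Real.exp (-(σ / p.L * t / 2))) →
      ∫⁻ ω, ENNReal.ofReal (excess p z τ θ₀ ω t 0) ∂law z ≤ ENNReal.ofReal (2 * (1 + Δ)) :=
    fun t ht => lintegral_excess_zero_le hn hb hσ hL hσL hμ hℓ hmin
      (ht.trans (ENNReal.ofReal_le_ofReal (mul_le_of_le_one_right (by positivity)
        (Real.exp_le_one_iff.2 (by
          have : 0 ≤ σ / p.L * t / 2 := by positivity
          linarith)))))
  intro t
  induction t with
  | zero =>
    intro _
    refine ⟨?_, hsnd 0 ?_⟩ <;>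
    · simp only [outerRun, lintegral_const, measure_univ, mul_one]
      exact ENNReal.ofReal_le_ofReal (by simp; linarith)
  | succ t ih =>
    intro ht
    obtain ⟨h1, h2⟩ := ih (by omega)
    have h3 := h t (by omega) h2
    have hd : ∀ i, Differentiable ℝ fun u => p.ℓ u (p.y i) := fun i => (hℓ i).1
    have hm := (measurable_excess (p := p) (τ := τ) (θ₀ := θ₀) hd hb t
      (τ.K (t + 1))).ennreal_ofReal
    have h4 : ∫⁻ ω, ENNReal.ofReal (p.risk (outerRun p z τ θ₀ ω (t + 1)) - p.risk θstar) ∂law z ≤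
        ENNReal.ofReal ((1 + Δ) * Real.exp (-(σ / p.L * (t + 1 : ℕ) / 2))) := by
      calc _ ≤ ∫⁻ ω, (ENNReal.ofReal (1 - σ / p.L) *
              ENNReal.ofReal (p.risk (outerRun p z τ θ₀ ω t) - p.risk θstar) +
            ENNReal.ofReal (1 / 2) *
              ENNReal.ofReal (excess p z τ θ₀ ω t (τ.K (t + 1)))) ∂law z := by
            refine lintegral_mono fun ω => ?_
            have h5 : 0 ≤ p.risk (outerRun p z τ θ₀ ω t) - p.risk θstar := by
              linarith [hmin (outerRun p z τ θ₀ ω t)]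
            have h6 := excess_nonneg (τ := τ) (θ₀ := θ₀) hL.le hμ ω t (τ.K (t + 1))
            rw [← ENNReal.ofReal_mul (by linarith), ← ENNReal.ofReal_mul (by norm_num),
              ← ENNReal.ofReal_add (mul_nonneg (by linarith) h5) (by positivity)]
            exact ENNReal.ofReal_le_ofReal (ERM.risk_sub_le hn hμ hℓ hL hmin hσ.le hσL
              (outerRun p z τ θ₀ ω t) (outerRun p z τ θ₀ ω (t + 1)))
        _ = ENNReal.ofReal (1 - σ / p.L) * (∫⁻ ω,
              ENNReal.ofReal (p.risk (outerRun p z τ θ₀ ω t) - p.risk θstar) ∂law z) +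
            ENNReal.ofReal (1 / 2) *
              ∫⁻ ω, ENNReal.ofReal (excess p z τ θ₀ ω t (τ.K (t + 1))) ∂law z := by
            rw [lintegral_add_right _ (hm.const_mul _), lintegral_const_mul _ hm,
              lintegral_const_mul' _ _ ENNReal.ofReal_ne_top]
        _ ≤ ENNReal.ofReal (1 - σ / p.L) *
              ENNReal.ofReal ((1 + Δ) * Real.exp (-(σ / p.L * t / 2))) +
            ENNReal.ofReal (1 / 2) * ENNReal.ofReal (2 * modelAccuracy σ p.L (t + 1)) := by
            gcongr
        _ ≤ _ := by
            rw [← ENNReal.ofReal_mul (by linarith), ← ENNReal.ofReal_mul (by norm_num),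
              ← ENNReal.ofReal_add (mul_nonneg (by linarith) (by positivity))
                (by rw [modelAccuracy]; positivity)]
            refine ENNReal.ofReal_le_ofReal (le_trans (le_of_eq ?_)
              (le_of_le_of_eq (outer_contraction_le (x := t) ha0 ha1
                (show 1 ≤ 1 + Δ by linarith)) ?_))
            · rw [modelAccuracy]
              have e1 : σ * ((t + 1 : ℕ) : ℝ) / (2 * p.L) = σ / p.L * ((t : ℝ) + 1) / 2 := by
                push_cast; field_simp
              rw [e1]
              ring
            · push_cast; ring_nf
    exact ⟨h4, hsnd _ h4⟩

end Outer

end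

end HSDMPG

namespace HSDMPG

noncomputable section

open Matrix MeasureTheory
open scoped ENNReal

/-! ### Error bounds for the tuned parameters. -/

section Tuned

variable {n d : ℕ} {Y : Type*} {p : ERM n d Y} {z : Sizes n}

/-- A batch is spectrally close to the full sample with high probability. -/
theorem law_not_isGood_le {r γ : ℝ} (hL : 0 ≤ p.L) (hμ : 0 < p.μ) (hx : ∀ i, ‖p.x i‖ ≤ r)
    (hγ : 0 ≤ γ) (q : ℕ)
    (hq : (2 * q + 1) * (p.L * r ^ 2 / (p.μ + γ)) / z.s ≤ 1 / 375)
    (hR : (p.L * r ^ 2 / (p.μ + γ)) ^ 2 / z.s ≤ 1) (t : ℕ) :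
    law z {ω : Outcome z | batch ω t ∈ {S | ¬ p.IsGood γ S}} ≤
      ENNReal.ofReal (25 * (1 / 3) ^ q) := by
  classical
  rw [law_batch_mem]
  set N := (Finset.powersetCard z.s (Finset.univ : Finset (Fin n))).card with hN
  obtain ⟨D, hD⟩ : ∃ D, D = @Finset.filter _ (fun S => S ∈ {S | ¬ p.IsGood γ S})
    (fun _ => Classical.propDecidable _)
    (Finset.powersetCard z.s (Finset.univ : Finset (Fin n))) := ⟨_, rfl⟩
  rw [← hD]
  have hN0 : (0 : ℝ) < N := by
    rw [hN, Finset.card_powersetCard, Finset.card_univ, Fintype.card_fin]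
    exact_mod_cast Nat.choose_pos z.s_le
  have h := ERM.card_not_isGood_le hL hμ hx hγ z.s_pos z.s_le (by norm_num) (by norm_num) q hq D
    fun S hS => by
      rw [hD] at hS
      obtain ⟨h1, h2⟩ := (@Finset.mem_filter _ _ (fun _ => Classical.propDecidable _) _ _).1 hS
      exact ⟨(Finset.mem_powersetCard.1 h1).2, h2⟩
  have h2 : (D.card : ℝ) ≤ 25 * (1 / 3) ^ q * N := by
    refine h.trans (mul_le_mul_of_nonneg_right ?_ hN0.le)
    -- With β = 1/375 and δ = 1/5 each moment gains the factor 5β/δ² = 1/3.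
    calc (5 * (1 / 375 : ℝ)) ^ q * 25 ^ (q + 1) * ((p.L * r ^ 2 / (p.μ + γ)) ^ 2 / z.s)
        ≤ (5 * (1 / 375 : ℝ)) ^ q * 25 ^ (q + 1) * 1 := by gcongr
      _ = 25 * (1 / 3) ^ q := by
        rw [pow_succ, mul_one, ← mul_assoc, ← mul_pow, mul_comm]
        norm_num
  rw [← ENNReal.ofReal_natCast N, ← ENNReal.ofReal_natCast D.card,
    ← ENNReal.ofReal_inv_of_pos hN0, ← ENNReal.ofReal_mul (by positivity)]
  refine ENNReal.ofReal_le_ofReal ?_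
  rw [inv_mul_le_iff₀ hN0]
  linarith

theorem modelAccuracy_pos {σ L : ℝ} (hσ : 0 < σ) (hL : 0 < L) (t : ℕ) :
    0 < modelAccuracy σ L t := by
  rw [modelAccuracy]; positivity

theorem modelAccuracy_le {σ L : ℝ} (hσ : 0 < σ) (hL : 0 < L) (hσL : σ ≤ L) (t : ℕ) :
    modelAccuracy σ L t ≤ 1 / 2 := by
  have h1 : σ / (2 * L) ≤ 1 / 2 := by
    rw [div_le_div_iff₀ (by positivity) (by norm_num)]; linarith
  have h2 : Real.exp (-(σ * t / (2 * L))) ≤ 1 := Real.exp_le_one_iff.2 (by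
    have : 0 ≤ σ * t / (2 * L) := by positivity
    linarith)
  calc modelAccuracy σ L t ≤ 1 / 2 * 1 := by rw [modelAccuracy]; gcongr
    _ = _ := by ring

/-- The number of inner iterations suffices for the accuracy of the quadratic model. -/
theorem exp_neg_innerCount_le {σ L μ γ ζ : ℝ} (hσ : 0 < σ) (hL : 0 < L) (hμ : 0 < μ)
    (hγ : 0 ≤ γ) (hζ : 0 < ζ) (t : ℕ) :
    Real.exp (-(μ / (μ + 2 * γ) * innerCount σ L μ γ ζ t)) ≤ modelAccuracy σ L t / ζ := by
  have hε := modelAccuracy_pos hσ hL t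
  have h1 : (μ + 2 * γ) / μ * Real.log (ζ / modelAccuracy σ L t) ≤ innerCount σ L μ γ ζ t :=
    Nat.le_ceil _
  have h2 : Real.log (ζ / modelAccuracy σ L t) ≤ μ / (μ + 2 * γ) * innerCount σ L μ γ ζ t := by
    calc Real.log (ζ / modelAccuracy σ L t) = μ / (μ + 2 * γ) *
          ((μ + 2 * γ) / μ * Real.log (ζ / modelAccuracy σ L t)) := by field_simp
      _ ≤ _ := by gcongr
  calc _ ≤ Real.exp (-Real.log (ζ / modelAccuracy σ L t)) := Real.exp_le_exp.2 (neg_le_neg h2)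
    _ = _ := by rw [Real.exp_neg, Real.exp_log (by positivity), inv_div]

theorem innerCount_pos {σ L μ γ ζ : ℝ} (hσ : 0 < σ) (hL : 0 < L) (hσL : σ ≤ L) (hμ : 0 < μ)
    (hγ : 0 ≤ γ) (hζ : 1 ≤ ζ) (t : ℕ) : 0 < innerCount σ L μ γ ζ t := by
  have hε := modelAccuracy_pos hσ hL t
  have hε2 := modelAccuracy_le hσ hL hσL t
  refine Nat.ceil_pos.2 (mul_pos (by positivity) (Real.log_pos ?_))
  rw [lt_div_iff₀ hε]
  linarith

theorem proxAccuracy_sq_div {μ γ : ℝ} (hμ : 0 < μ) (k : ℕ) :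
    proxAccuracy μ γ (k + 1) ^ 2 / μ =
      (μ / (μ + 2 * γ)) ^ 2 / 16 * Real.exp (-(μ / (μ + 2 * γ) * k)) := by
  have h1 : (μ ^ (3 / 2 : ℝ)) ^ 2 = μ ^ 3 := by
    rw [← Real.rpow_natCast, ← Real.rpow_mul hμ.le, ← Real.rpow_natCast]; norm_num
  have h2 : Real.exp (-(μ * (((k + 1 : ℕ) : ℝ) - 1) / (2 * (μ + 2 * γ)))) ^ 2 =
      Real.exp (-(μ / (μ + 2 * γ) * k)) := by
    rw [← Real.exp_nat_mul]
    congr 1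
    push_cast
    by_cases h : μ + 2 * γ = 0
    · simp [h]
    · field_simp; ring
  rw [proxAccuracy, mul_pow, div_pow, h1, h2]
  by_cases h : μ + 2 * γ = 0
  · simp [h]
  · field_simp; norm_num

variable {r : ℝ} {ν σ Δ ζ : ℝ} {θ₀ θstar : E d}

/-- Accuracy and epoch counts are reduced to the single condition that the probability P of a bad
batch beats the growth on bad batches; the choice of s enters only later, to verify it. -/
theorem tuned_bounds (hn : 0 < n) (hL : 0 < p.L) (hσ : 0 < σ) (hμ : 0 < p.μ)
    (hx : ∀ i, ‖p.x i‖ ≤ r) (hℓ : ∀ i, StronglyConvexSmooth σ p.L fun u => p.ℓ u (p.y i))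
    (hmin : ∀ θ, p.risk θstar ≤ p.risk θ) (hΔ : 0 ≤ Δ) (h0 : p.risk θ₀ - p.risk θstar ≤ Δ)
    (hν : 0 < ν) (hz : IsTunedSizes z d p.L r p.μ ν) (hζ : 28 + 2 * Δ ≤ ζ)
    {τ : Tuning} (hτ : τ = tuning z.s d σ p.L r p.μ ζ) {T : ℕ} (hT : T = outerCount n σ p.L Δ)
    (hvar : ∀ t < T, ∀ k < τ.K (t + 1), ∫⁻ ω, ENNReal.ofReal
      (p.gradVariance (outerRun p z τ θ₀ ω t)
        (innerRun p z τ ω (t + 1) (outerRun p z τ θ₀ ω t) k)) ∂law z ≤ ENNReal.ofReal (ν ^ 2))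
    {P : ℝ} (hP : 0 ≤ P)
    (hbad : ∀ t, law z {ω : Outcome z | batch ω t ∈ {S | ¬ p.IsGood τ.γ S}} ≤ ENNReal.ofReal P)
    (hPK : ∀ t < T, P * (2 * (1 + Δ) + 1) *
      (3 * (256 * (1 + p.L * r ^ 2 / p.μ) ^ 3)) ^ τ.K (t + 1) ≤ 1) :
    (∀ t < T, ∫⁻ ω, ENNReal.ofReal (p.quadModel (outerRun p z τ θ₀ ω t)
          (outerRun p z τ θ₀ ω (t + 1)) - ⨅ θ', p.quadModel (outerRun p z τ θ₀ ω t) θ') ∂law z ≤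
        ENNReal.ofReal (modelAccuracy σ p.L (t + 1))) ∧
      ∫⁻ ω, ENNReal.ofReal (p.risk (outerRun p z τ θ₀ ω T) - p.risk θstar) ∂law z ≤
        ENNReal.ofReal (1 / √(n : ℝ)) ∧
      ∀ j₀ : ℕ, 32 * (1 + p.L * r ^ 2 / p.μ) ^ 2 * (2 * (1 + Δ) + 27) /
          (p.μ / (p.μ + 2 * τ.γ)) ^ 3 ≤ 2 ^ j₀ → ∀ t < T, ∀ k < τ.K (t + 1),
        ∫⁻ ω, ((epochs p z τ θ₀ ω t k : ℕ∞) : ℝ≥0∞) ∂law z ≤ (j₀ : ℝ≥0∞) + 2 := by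
  have hd : ∀ i, Differentiable ℝ fun u => p.ℓ u (p.y i) := fun i => (hℓ i).1
  have hσL : σ ≤ p.L := (hℓ ⟨0, hn⟩).le
  have hζ0 : 0 < ζ := by linarith
  have hn' : (0 : ℝ) < n := by exact_mod_cast hn
  have hγdef : τ.γ = proxWeight d z.s p.L r := by rw [hτ]; rfl
  have hγ : 0 ≤ τ.γ := by rw [hγdef, proxWeight]; positivity
  have hε' : ∀ k, τ.ε k = proxAccuracy p.μ τ.γ k := fun k => by rw [hτ]; rfl
  have hK : ∀ t, τ.K t = innerCount σ p.L p.μ τ.γ ζ t := fun t => by rw [hτ]; rfl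
  have hη : τ.η = 1 / (10 * (p.L * r ^ 2 + p.μ + τ.γ)) := by rw [hτ]; rfl
  obtain ⟨-, hzb, hzm⟩ := hz
  have hbsize : ∀ k, z.b k = min ⌈16 * ν ^ 2 * (p.μ + 2 * τ.γ) ^ 2 / p.μ ^ 2 *
      Real.exp (p.μ * k / (p.μ + 2 * τ.γ))⌉₊ n := fun k => by rw [hzb, hγdef]; rfl
  have hb : ∀ k, 0 < z.b k := fun k => by
    rw [hbsize]
    exact lt_min (Nat.ceil_pos.2 (by positivity)) hn
  have hm : 50 * (p.L * r ^ 2 + p.μ + τ.γ) / (p.μ + τ.γ) ≤ z.m := by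
    rw [hzm, hγdef]; exact Nat.le_ceil _
  have hmini : ∀ k, z.b k < n → 16 * ν ^ 2 / (p.μ / (p.μ + 2 * τ.γ)) ^ 2 *
      Real.exp (p.μ / (p.μ + 2 * τ.γ) * k) ≤ z.b k := fun k hk => by
    have h1 : z.b k = ⌈16 * ν ^ 2 * (p.μ + 2 * τ.γ) ^ 2 / p.μ ^ 2 *
      Real.exp (p.μ * k / (p.μ + 2 * τ.γ))⌉₊ := by
      have := hbsize k
      omega
    rw [h1]
    refine le_trans (le_of_eq ?_) (Nat.le_ceil _)
    rw [div_mul_eq_mul_div p.μ]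
    congr 1
    field_simp
  have hε : ∀ k : ℕ, τ.ε (k + 1) ^ 2 / p.μ = (p.μ / (p.μ + 2 * τ.γ)) ^ 2 / 16 *
      Real.exp (-(p.μ / (p.μ + 2 * τ.γ) * k)) := fun k => by
    rw [hε', proxAccuracy_sq_div hμ]
  have hε0 : ∀ k, 0 < τ.ε (k + 1) := fun k => by
    rw [hε', proxAccuracy]; positivity
  have hV : ∀ t < T, ∀ k < τ.K (t + 1),
      ∫⁻ ω, ENNReal.ofReal (iterVar p z τ θ₀ ω t k) ∂law z ≤ ENNReal.ofReal (ν ^ 2) := by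
    intro t ht k hk
    refine le_of_eq_of_le (lintegral_congr fun ω => ?_) (hvar t ht k hk)
    rw [ERM.gradVariance_eq hn hd]
    rfl
  have hinner : ∀ t < T, ∫⁻ ω, ENNReal.ofReal (excess p z τ θ₀ ω t 0) ∂law z ≤
        ENNReal.ofReal (2 * (1 + Δ)) → _ := fun t ht h =>
    lintegral_excess_le hn hL.le hμ hx hd hb hγ rfl hν hmini hε hη hm hε0 t (τ.K (t + 1))
      (by rw [hK]; exact innerCount_pos hσ hL hσL hμ hγ (by linarith) _) hP (by positivity)
      hbad (hPK t ht) (hV t ht) h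
  have hexc : ∀ t < T, ∫⁻ ω, ENNReal.ofReal (excess p z τ θ₀ ω t 0) ∂law z ≤
        ENNReal.ofReal (2 * (1 + Δ)) →
      ∫⁻ ω, ENNReal.ofReal (excess p z τ θ₀ ω t (τ.K (t + 1))) ∂law z ≤
        ENNReal.ofReal (2 * modelAccuracy σ p.L (t + 1)) := by
    intro t ht h
    refine ((hinner t ht h).1 _ le_rfl).trans (ENNReal.ofReal_le_ofReal ?_)
    have h1 := exp_neg_innerCount_le hσ hL hμ hγ hζ0 (t + 1)
    rw [← hK] at h1
    have h2 := modelAccuracy_pos hσ hL (t + 1)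
    -- With initial excess M = 2(1 + Δ) the constant M + 26 equals 28 + 2Δ, the threshold for ζ.
    calc _ ≤ (2 * (1 + Δ) + 26) * (modelAccuracy σ p.L (t + 1) / ζ) := by gcongr
      _ ≤ ζ * (modelAccuracy σ p.L (t + 1) / ζ) := by gcongr; linarith
      _ = modelAccuracy σ p.L (t + 1) := by field_simp
      _ ≤ _ := by linarith
  have hrisk := lintegral_risk_outerRun_le hn hb hσ hL hσL hμ hℓ hmin hΔ h0 hexc
  refine ⟨fun t ht => ?_, ?_, fun j₀ hj t ht => (hinner t ht (hrisk t ht.le).2).2 j₀ hj⟩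
  · have h1 := hexc t ht (hrisk t ht.le).2
    have e1 : ∀ ω, ENNReal.ofReal (p.quadModel (outerRun p z τ θ₀ ω t)
        (outerRun p z τ θ₀ ω (t + 1)) - ⨅ θ', p.quadModel (outerRun p z τ θ₀ ω t) θ') =
        ENNReal.ofReal (1 / 2) *
          ENNReal.ofReal (excess p z τ θ₀ ω t (τ.K (t + 1))) := fun ω => by
      rw [ERM.iInf_quadModel hn hd hL.le hμ _ (outerRun p z τ θ₀ ω (t + 1)), sub_sub_cancel,
        ← ENNReal.ofReal_mul (by norm_num)]
      rfl
    simp only [e1]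
    rw [lintegral_const_mul' _ _ ENNReal.ofReal_ne_top]
    calc _ ≤ ENNReal.ofReal (1 / 2) * ENNReal.ofReal (2 * modelAccuracy σ p.L (t + 1)) := by
          gcongr
      _ = _ := by rw [← ENNReal.ofReal_mul (by norm_num)]; congr 1; ring
  · refine ((hrisk T le_rfl).1).trans (ENNReal.ofReal_le_ofReal ?_)
    have h1 : 2 * p.L / σ * Real.log ((1 + Δ) * √(n : ℝ)) ≤ T := by
      rw [hT]; exact Nat.le_ceil _
    have h2 : Real.log ((1 + Δ) * √(n : ℝ)) ≤ σ / p.L * T / 2 := by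
      calc Real.log ((1 + Δ) * √(n : ℝ)) =
            σ / p.L * (2 * p.L / σ * Real.log ((1 + Δ) * √(n : ℝ))) / 2 := by field_simp
        _ ≤ _ := by gcongr
    have h3 : 0 < (1 + Δ) * √(n : ℝ) := by positivity
    calc (1 + Δ) * Real.exp (-(σ / p.L * T / 2))
        ≤ (1 + Δ) * Real.exp (-Real.log ((1 + Δ) * √(n : ℝ))) := by gcongr
      _ = _ := by
        rw [Real.exp_neg, Real.exp_log h3]
        field_simp

end Tuned

end

end HSDMPG

/-! ### Iteration counts, growth of the minibatches and the size scale. -/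

namespace HSDMPG

noncomputable section

/-- By 1 + ρ ≤ exp ρ, a geometric sum is at most 1/ρ times its next term. -/
theorem sum_exp_le {ρ : ℝ} (hρ : 0 < ρ) (K : ℕ) :
    ∑ k ∈ Finset.range K, Real.exp (ρ * (k + 1 : ℕ)) ≤ ρ⁻¹ * Real.exp (ρ * (K + 1 : ℕ)) := by
  induction K with
  | zero => simp; positivity
  | succ K ih =>
    rw [Finset.sum_range_succ]
    have h1 : Real.exp (ρ * (K + 1 + 1 : ℕ)) = Real.exp ρ * Real.exp (ρ * (K + 1 : ℕ)) := by
      rw [← Real.exp_add]; congr 1; push_cast; ring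
    have h2 := Real.add_one_le_exp ρ
    rw [h1]
    set x := Real.exp (ρ * (K + 1 : ℕ)) with hx
    have hx0 : 0 < x := Real.exp_pos _
    calc _ ≤ ρ⁻¹ * x + x := by gcongr
      _ = ρ⁻¹ * ((ρ + 1) * x) := by field_simp; ring
      _ ≤ _ := by gcongr

section Counts

variable {n : ℕ} {σ L μ γ ζ Δ : ℝ} (hσ : 0 < σ) (hσL : σ ≤ L) (hΔ : 0 ≤ Δ) (hζ : 1 ≤ ζ)

include hσ hσL in
theorem div_modelAccuracy (t : ℕ) :
    ζ / modelAccuracy σ L t = ζ * (2 * L / σ) * Real.exp (σ / L / 2 * t) := by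
  have hL : 0 < L := hσ.trans_le hσL
  rw [modelAccuracy, Real.exp_neg]
  have e1 : σ * t / (2 * L) = σ / L / 2 * t := by field_simp
  rw [e1]
  field_simp

include hσ hσL hΔ in
theorem half_mul_outerCount_le (hn : 3 ≤ n) :
    σ / L / 2 * outerCount n σ L Δ ≤ Real.log ((1 + Δ) * √(n : ℝ)) + 1 / 2 := by
  have hL : 0 < L := hσ.trans_le hσL
  have hn1 : (1 : ℝ) ≤ n := by exact_mod_cast (by omega : 1 ≤ n)
  have h0 : 0 ≤ Real.log ((1 + Δ) * √(n : ℝ)) := Real.log_nonneg (by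
    have : 1 ≤ √(n : ℝ) := Real.one_le_sqrt.2 hn1
    nlinarith)
  have h1 := (Nat.ceil_lt_add_one (show 0 ≤ 2 * L / σ * Real.log ((1 + Δ) * √(n : ℝ)) by
    positivity)).le
  have h2 : σ / L ≤ 1 := (div_le_one hL).2 hσL
  calc σ / L / 2 * outerCount n σ L Δ ≤
        σ / L / 2 * (2 * L / σ * Real.log ((1 + Δ) * √(n : ℝ)) + 1) := by
        rw [outerCount]; gcongr
    _ = Real.log ((1 + Δ) * √(n : ℝ)) + σ / L / 2 := by field_simp
    _ ≤ _ := by linarith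

theorem one_le_log {n : ℕ} (hn : 3 ≤ n) : 1 ≤ Real.log n := by
  rw [Real.le_log_iff_exp_le (by exact_mod_cast (by omega : 0 < n))]
  have h1 : (3 : ℝ) ≤ n := by exact_mod_cast hn
  have := Real.exp_one_lt_d9
  linarith

include hΔ in
theorem log_one_add_mul_sqrt (hn : 3 ≤ n) :
    Real.log ((1 + Δ) * √(n : ℝ)) = Real.log (1 + Δ) + Real.log n / 2 := by
  have hn1 : (0 : ℝ) < n := by exact_mod_cast (by omega : 0 < n)
  rw [Real.log_mul (by positivity) (by positivity), Real.log_sqrt hn1.le]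

include hσ hσL hΔ in
theorem outerCount_le (hn : 3 ≤ n) :
    (outerCount n σ L Δ : ℝ) ≤ (2 * L / σ * (Real.log (1 + Δ) + 1) + 1) * Real.log n := by
  have hL : 0 < L := hσ.trans_le hσL
  have hℓ := one_le_log hn
  have hΔ1 : 0 ≤ Real.log (1 + Δ) := Real.log_nonneg (by linarith)
  rw [outerCount, log_one_add_mul_sqrt hΔ hn]
  have h1 := (Nat.ceil_lt_add_one (show 0 ≤ 2 * L / σ * (Real.log (1 + Δ) + Real.log n / 2) by
    positivity)).le
  have h2 : Real.log (1 + Δ) ≤ Real.log (1 + Δ) * Real.log n := le_mul_of_one_le_right hΔ1 hℓ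
  calc _ ≤ 2 * L / σ * (Real.log (1 + Δ) + Real.log n / 2) + 1 := h1
    _ ≤ 2 * L / σ * (Real.log (1 + Δ) * Real.log n + Real.log n) + Real.log n := by
        gcongr; linarith
    _ = _ := by ring

include hσ hσL hζ in
theorem log_div_modelAccuracy_nonneg (t : ℕ) : 0 ≤ Real.log (ζ / modelAccuracy σ L t) := by
  have hL : 0 < L := hσ.trans_le hσL
  have h1 := modelAccuracy_le hσ hL hσL t
  have h2 := modelAccuracy_pos hσ hL t
  exact Real.log_nonneg ((one_le_div h2).2 (by linarith))

include hσ hσL hΔ hζ in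
theorem log_div_modelAccuracy_le (hn : 3 ≤ n) {t : ℕ} (ht : t ≤ outerCount n σ L Δ) :
    Real.log (ζ / modelAccuracy σ L t) ≤
      (Real.log (ζ * (2 * L / σ)) + Real.log (1 + Δ) + 1) * Real.log n := by
  have hL : 0 < L := hσ.trans_le hσL
  have hℓ := one_le_log hn
  have hΔ1 : 0 ≤ Real.log (1 + Δ) := Real.log_nonneg (by linarith)
  have hσ1 : 1 ≤ 2 * L / σ := by rw [one_le_div hσ]; linarith
  have hζ1 : 0 ≤ Real.log (ζ * (2 * L / σ)) := Real.log_nonneg (by nlinarith)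
  have h1 := half_mul_outerCount_le hσ hσL hΔ hn
  rw [log_one_add_mul_sqrt hΔ hn] at h1
  have h2 : σ / L / 2 * (t : ℝ) ≤ σ / L / 2 * outerCount n σ L Δ := by gcongr
  rw [div_modelAccuracy hσ hσL, Real.log_mul (by positivity) (Real.exp_pos _).ne', Real.log_exp]
  have h3 : Real.log (1 + Δ) ≤ Real.log (1 + Δ) * Real.log n := le_mul_of_one_le_right hΔ1 hℓ
  have h4 : Real.log (ζ * (2 * L / σ)) ≤ Real.log (ζ * (2 * L / σ)) * Real.log n :=
    le_mul_of_one_le_right hζ1 hℓ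
  linarith

variable (hμ : 0 < μ) (hγ : 0 ≤ γ)

include hσ hσL hΔ hζ hμ hγ in
theorem innerCount_le (hn : 3 ≤ n) {t : ℕ} (ht : t ≤ outerCount n σ L Δ) :
    (innerCount σ L μ γ ζ t : ℝ) ≤ (μ + 2 * γ) / μ *
      ((Real.log (ζ * (2 * L / σ)) + Real.log (1 + Δ) + 1) * Real.log n) + 1 := by
  have h0 := log_div_modelAccuracy_nonneg hσ hσL hζ t
  have h1 := log_div_modelAccuracy_le hσ hσL hΔ hζ hn ht
  refine (Nat.ceil_lt_add_one (by positivity)).le.trans ?_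
  gcongr

-- Rounding up and the shift by one cost at most exp(2ρ) ≤ exp 2 ≤ 9.
include hσ hσL hζ hμ hγ in
theorem exp_innerCount_le (t : ℕ) :
    Real.exp (μ / (μ + 2 * γ) * (innerCount σ L μ γ ζ t + 1 : ℕ)) ≤
      9 * (ζ / modelAccuracy σ L t) := by
  have hL : 0 < L := hσ.trans_le hσL
  have h0 := log_div_modelAccuracy_nonneg hσ hσL hζ t
  have h1 := (Nat.ceil_lt_add_one (show 0 ≤ (μ + 2 * γ) / μ *
    Real.log (ζ / modelAccuracy σ L t) by positivity)).le
  have hρ1 : μ / (μ + 2 * γ) ≤ 1 := by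
    rw [div_le_one (by positivity)]; linarith
  have h2 : μ / (μ + 2 * γ) * (innerCount σ L μ γ ζ t + 1 : ℕ) ≤
      Real.log (ζ / modelAccuracy σ L t) + 2 := by
    calc _ ≤ μ / (μ + 2 * γ) *
          ((μ + 2 * γ) / μ * Real.log (ζ / modelAccuracy σ L t) + 1 + 1) := by
          push_cast
          rw [innerCount]
          gcongr
      _ = Real.log (ζ / modelAccuracy σ L t) + μ / (μ + 2 * γ) * 2 := by field_simp; ring
      _ ≤ _ := by linarith
  have h3 : 0 < ζ / modelAccuracy σ L t := div_pos (by linarith) (modelAccuracy_pos hσ hL t)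
  have h4 : Real.exp 2 ≤ 9 := by
    have h5 : Real.exp 2 = Real.exp 1 ^ 2 := by rw [← Real.exp_nat_mul]; norm_num
    rw [h5]
    nlinarith [Real.exp_one_lt_d9, Real.exp_pos 1]
  calc _ ≤ Real.exp (Real.log (ζ / modelAccuracy σ L t) + 2) := Real.exp_le_exp.2 h2
    _ = ζ / modelAccuracy σ L t * Real.exp 2 := by rw [Real.exp_add, Real.exp_log h3]
    _ ≤ ζ / modelAccuracy σ L t * 9 := by gcongr
    _ = _ := mul_comm _ _

include hσ hσL hΔ hζ hμ hγ in
/-- The total growth of the minibatches. -/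
theorem sum_sum_exp_le (hn : 3 ≤ n) :
    ∑ t ∈ Finset.range (outerCount n σ L Δ),
      ∑ k ∈ Finset.range (innerCount σ L μ γ ζ (t + 1)),
        Real.exp (μ / (μ + 2 * γ) * (k + 1 : ℕ)) ≤
      27 * ζ * (2 * L / σ) ^ 2 * (1 + Δ) * ((μ + 2 * γ) / μ * √(n : ℝ)) := by
  have hL : 0 < L := hσ.trans_le hσL
  have hn1 : (0 : ℝ) < n := by exact_mod_cast (by omega : 0 < n)
  have ha1 : σ / L ≤ 1 := (div_le_one hL).2 hσL
  -- Both sums are geometric and dominated by their ends. In t the growth is that of 1/ε'_t, which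
  -- stops at the order (1 + Δ)√n; this is the source of the factor √n.
  have h3 : Real.exp (σ / L / 2 * (outerCount n σ L Δ + 1 : ℕ)) ≤ 3 * ((1 + Δ) * √(n : ℝ)) := by
    have h4 : σ / L / 2 * (outerCount n σ L Δ + 1 : ℕ) ≤ Real.log ((1 + Δ) * √(n : ℝ)) + 1 := by
      have := half_mul_outerCount_le hσ hσL hΔ hn
      push_cast
      linarith
    have h5 : 0 < (1 + Δ) * √(n : ℝ) := by positivity
    calc _ ≤ Real.exp (Real.log ((1 + Δ) * √(n : ℝ)) + 1) := Real.exp_le_exp.2 h4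
      _ = (1 + Δ) * √(n : ℝ) * Real.exp 1 := by rw [Real.exp_add, Real.exp_log h5]
      _ ≤ (1 + Δ) * √(n : ℝ) * 3 := by
        gcongr
        have := Real.exp_one_lt_d9
        linarith
      _ = _ := mul_comm _ _
  calc _ ≤ ∑ t ∈ Finset.range (outerCount n σ L Δ), (μ / (μ + 2 * γ))⁻¹ *
        (9 * (ζ * (2 * L / σ) * Real.exp (σ / L / 2 * (t + 1 : ℕ)))) := by
        refine Finset.sum_le_sum fun t _ => (sum_exp_le (by positivity) _).trans ?_
        have h1 := exp_innerCount_le hσ hσL hζ hμ hγ (t + 1)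
        rw [div_modelAccuracy hσ hσL] at h1
        gcongr
    _ = (μ / (μ + 2 * γ))⁻¹ * (9 * (ζ * (2 * L / σ) *
        ∑ t ∈ Finset.range (outerCount n σ L Δ), Real.exp (σ / L / 2 * (t + 1 : ℕ)))) := by
        simp only [Finset.mul_sum]
    _ ≤ (μ / (μ + 2 * γ))⁻¹ * (9 * (ζ * (2 * L / σ) *
        ((σ / L / 2)⁻¹ * (3 * ((1 + Δ) * √(n : ℝ)))))) := by
        gcongr
        exact (sum_exp_le (by positivity) _).trans (by gcongr)
    _ = _ := by field_simp; ring

end Counts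

/-- The order `ν n^{3/4} log^{1/2} d / log^{3/2} n` of the batch size. -/
def sizeScale (n d : ℕ) (ν : ℝ) : ℝ :=
  ν * (n : ℝ) ^ (3 / 4 : ℝ) * √(Real.log d) / Real.log n ^ (3 / 2 : ℝ)

theorem rpow_sq {a : ℝ} (ha : 0 ≤ a) (x : ℝ) : (a ^ x) ^ 2 = a ^ (x * 2) := by
  rw [← Real.rpow_natCast, ← Real.rpow_mul ha]; norm_num

/-- The defining relation of the scale X: it equates X h log³ n, the cost of the batches, with ν² √n
h³, the cost of the minibatches, where h² = n log d / X. -/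
theorem sizeScale_sq_mul {n d : ℕ} {ν : ℝ} (hn : 3 ≤ n) :
    sizeScale n d ν ^ 2 * Real.log n ^ 3 =
      ν ^ 2 * √(n : ℝ) ^ 3 * √(Real.log d) ^ 2 := by
  have hℓ := one_le_log hn
  have hn0 : (0 : ℝ) ≤ n := by positivity
  have h1 : ((n : ℝ) ^ (3 / 4 : ℝ)) ^ 2 = √(n : ℝ) ^ 3 := by
    rw [rpow_sq hn0, Real.sqrt_eq_rpow, ← Real.rpow_natCast, ← Real.rpow_mul hn0]; norm_num
  have h2 : (Real.log n ^ (3 / 2 : ℝ)) ^ 2 = Real.log n ^ 3 := by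
    rw [rpow_sq (by linarith), ← Real.rpow_natCast]; norm_num
  rw [sizeScale, div_pow, mul_pow, mul_pow, h1, h2]
  have : Real.log n ^ 3 ≠ 0 := by positivity
  field_simp

/-- The first term is s h log³ n at s = X, where h = √(n log d / s). The fractional exponents come
from √X and are compared after squaring. -/
theorem callOrder_ge {n d : ℕ} {ν : ℝ} (hn : 3 ≤ n) (hν : 0 < ν) (hd : 1 ≤ d) :
    √(n : ℝ) * √(Real.log d) * Real.log n ^ 3 * √(sizeScale n d ν) + ν ^ 2 * √(n : ℝ) =
      callOrder n d ν := by
  have hℓ : 0 < Real.log n := by linarith [one_le_log hn]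
  have hn0 : (0 : ℝ) < n := by exact_mod_cast (by omega : 0 < n)
  have hΛ : 0 ≤ Real.log d := Real.log_nonneg (by exact_mod_cast hd)
  have hX : 0 ≤ sizeScale n d ν := by rw [sizeScale]; positivity
  have hsq : (√(n : ℝ) * √(Real.log d) * Real.log n ^ 3 * √(sizeScale n d ν)) ^ 2 =
      (ν ^ (0.5 : ℝ) * (n : ℝ) ^ (0.875 : ℝ) * Real.log d ^ (0.75 : ℝ) *
        Real.log n ^ (2.25 : ℝ)) ^ 2 := by
    simp only [mul_pow]
    rw [Real.sq_sqrt hn0.le, Real.sq_sqrt hΛ, Real.sq_sqrt hX, rpow_sq hν.le, rpow_sq hn0.le,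
      rpow_sq hΛ, rpow_sq hℓ.le, sizeScale]
    have e1 : (n : ℝ) ^ ((0.875 : ℝ) * 2) = n * (n : ℝ) ^ (3 / 4 : ℝ) := by
      nth_rw 2 [← Real.rpow_one (n : ℝ)]
      rw [← Real.rpow_add hn0]; norm_num
    have e2 : Real.log d ^ ((0.75 : ℝ) * 2) = Real.log d * √(Real.log d) := by
      rcases hΛ.eq_or_lt with h | h
      · rw [← h]; norm_num
      · nth_rw 2 [← Real.rpow_one (Real.log d)]
        rw [Real.sqrt_eq_rpow, ← Real.rpow_add h]; norm_num
    have e3 : Real.log n ^ ((2.25 : ℝ) * 2) = (Real.log n ^ 3) ^ 2 / Real.log n ^ (3 / 2 : ℝ) := by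
      rw [eq_div_iff (by positivity), ← Real.rpow_add hℓ, ← pow_mul, ← Real.rpow_natCast]
      norm_num
    have e4 : ν ^ ((0.5 : ℝ) * 2) = ν := by norm_num
    rw [e1, e2, e3, e4]
    ring
  have h := (pow_left_inj₀ (by positivity) (by positivity) two_ne_zero).1 hsq
  rw [callOrder, h, Real.sqrt_eq_rpow]
  norm_num

/-- Either the cap is inactive and rounding costs a factor 2, because X ≥ 1, or the batch is the
full sample. -/
theorem batchSize_cases {n d : ℕ} {ν : ℝ} (hX : 1 ≤ sizeScale n d ν) :
    (sizeScale n d ν ≤ batchSize n d ν ∧ (batchSize n d ν : ℝ) ≤ 2 * sizeScale n d ν) ∨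
      (batchSize n d ν = n ∧ (n : ℝ) ≤ sizeScale n d ν) := by
  have hb : batchSize n d ν = min ⌈sizeScale n d ν⌉₊ n := rfl
  rcases le_or_gt ⌈sizeScale n d ν⌉₊ n with h | h
  · left
    rw [hb, min_eq_left h]
    exact ⟨Nat.le_ceil _, (Nat.ceil_lt_add_one (by linarith)).le.trans (by linarith)⟩
  · right
    rw [hb, min_eq_right h.le]
    exact ⟨rfl, (Nat.lt_ceil.1 h).le⟩

end

end HSDMPG

/-! ### Condition numbers and the number of epochs. -/

namespace HSDMPG

noncomputable section

theorem half_le_log {d : ℕ} (hd : 2 ≤ d) : 1 / 2 ≤ Real.log d := by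
  have h1 : Real.log 2 ≤ Real.log d := Real.log_le_log (by norm_num) (by exact_mod_cast hd)
  linarith [Real.log_two_gt_d9]

theorem sqrt_two_le {d : ℕ} (hd : 2 ≤ d) : √2 ≤ 2 * √(Real.log d) := by
  have h := half_le_log hd
  have h2 : (2 : ℝ) * √(Real.log d) = √(4 * Real.log d) := by
    rw [Real.sqrt_mul (by norm_num)]
    congr 1
    rw [show (4 : ℝ) = 2 ^ 2 by norm_num, Real.sqrt_sq (by norm_num)]
  rw [h2]
  exact Real.sqrt_le_sqrt (by linarith)

theorem half_le_sqrt_log {d : ℕ} (hd : 2 ≤ d) : 1 / 2 ≤ √(Real.log d) := by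
  refine Real.le_sqrt_of_sq_le ?_
  have h := half_le_log hd
  linarith

/-- The order `√(n log d / s)` of the condition number of the preconditioned problem. -/
def condScale (n d s : ℕ) : ℝ := √(n : ℝ) * √(Real.log d) / √(s : ℝ)

section Rate

variable {n d s : ℕ} {L r μ κ₀ : ℝ} (hd : 2 ≤ d) (hs : 0 < s) (hsn : s ≤ n) (hL : 0 < L)
  (hr : 0 < r) (hμ : 0 < μ) (hκ₀ : 0 < κ₀) (hκ : L / μ ≤ κ₀ * √(n : ℝ))

include hd hs hsn

theorem sqrt_log_le_condScale : √(Real.log d) ≤ condScale n d s := by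
  have hs0 : (0 : ℝ) < s := by exact_mod_cast hs
  rw [condScale, le_div_iff₀ (by positivity), mul_comm]
  gcongr

theorem one_le_two_mul_condScale : 1 ≤ 2 * condScale n d s := by
  have h1 := sqrt_log_le_condScale hd hs hsn
  have h2 := half_le_sqrt_log hd
  linarith

include hL hμ hκ hκ₀

omit hsn in
theorem rate_inv_le : (μ + 2 * proxWeight d s L r) / μ ≤
    1 + 6 * (κ₀ * r ^ 2) * condScale n d s := by
  have hs0 : (0 : ℝ) < s := by exact_mod_cast hs
  have h1 := sqrt_two_le hd
  have e1 : (μ + 2 * proxWeight d s L r) / μ =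
      1 + 2 * (√(Real.log d) + √2) * (L / μ) * r ^ 2 / √(s : ℝ) := by
    rw [proxWeight]; field_simp
  rw [e1]
  calc 1 + 2 * (√(Real.log d) + √2) * (L / μ) * r ^ 2 / √(s : ℝ)
      ≤ 1 + 2 * (√(Real.log d) + 2 * √(Real.log d)) * (κ₀ * √(n : ℝ)) * r ^ 2 / √(s : ℝ) := by
        gcongr
    _ = _ := by rw [condScale]; ring

theorem rate_inv_le_mul : (μ + 2 * proxWeight d s L r) / μ ≤
    (2 + 6 * (κ₀ * r ^ 2)) * condScale n d s := by
  have h1 := rate_inv_le (r := r) hd hs hL hμ hκ₀ hκ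
  have h2 := one_le_two_mul_condScale hd hs hsn
  linarith

include hr

omit hκ hκ₀ in
/-- The smoothness of the components relative to the convexity of the proximal objective. -/
theorem smoothness_ratio_le : L * r ^ 2 / (μ + proxWeight d s L r) ≤
    √(s : ℝ) / (√(Real.log d) + √2) := by
  have hs0 : (0 : ℝ) < s := by exact_mod_cast hs
  have hq : 0 < proxWeight d s L r := by rw [proxWeight]; positivity
  calc L * r ^ 2 / (μ + proxWeight d s L r) ≤ L * r ^ 2 / proxWeight d s L r := by
        gcongr; linarith
    _ = _ := by rw [proxWeight]; field_simp

omit hκ hκ₀ in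
theorem smoothness_ratio_sq_div_le :
    (L * r ^ 2 / (μ + proxWeight d s L r)) ^ 2 / s ≤ 1 := by
  have hs0 : (0 : ℝ) < s := by exact_mod_cast hs
  have hq : 0 ≤ proxWeight d s L r := by rw [proxWeight]; positivity
  have h1 := smoothness_ratio_le hd hs hsn hL hr hμ
  have h2 : √(s : ℝ) / (√(Real.log d) + √2) ≤ √(s : ℝ) := by
    refine div_le_self (Real.sqrt_nonneg _) ?_
    have : 1 ≤ √2 := Real.one_le_sqrt.2 (by norm_num)
    linarith [Real.sqrt_nonneg (Real.log d)]
  rw [div_le_one hs0]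
  calc _ ≤ √(s : ℝ) ^ 2 := by gcongr; exact h1.trans h2
    _ = s := Real.sq_sqrt hs0.le

-- The choice of γ keeps the condition number Lr²/(μ + γ) below √s, so an epoch costs no more than a
-- multiple of a batch gradient.
omit hκ hκ₀ in
theorem epoch_length_le :
    (⌈50 * (L * r ^ 2 + μ + proxWeight d s L r) / (μ + proxWeight d s L r)⌉₊ : ℝ) ≤ 101 * s := by
  have hs0 : (1 : ℝ) ≤ s := by exact_mod_cast hs
  have hq : 0 ≤ proxWeight d s L r := by rw [proxWeight]; positivity
  have h1 := smoothness_ratio_sq_div_le hd hs hsn hL hr hμ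
  rw [div_le_one (by linarith)] at h1
  have h2 : L * r ^ 2 / (μ + proxWeight d s L r) ≤ s := by
    exact (Real.le_sqrt_of_sq_le h1).trans (Real.sqrt_le_iff.2 ⟨by linarith, by nlinarith⟩)
  have e1 : 50 * (L * r ^ 2 + μ + proxWeight d s L r) / (μ + proxWeight d s L r) =
      50 * (L * r ^ 2 / (μ + proxWeight d s L r)) + 50 := by
    field_simp; ring
  rw [e1]
  refine (Nat.ceil_lt_add_one (by positivity)).le.trans ?_
  linarith

-- The hypothesis of the concentration bound with x = 2q + 1: since Lr²/(μ + γ) ≤ √(s / log d),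
-- about √(s log d) moments are available.
omit hκ hκ₀ in
theorem mul_smoothness_ratio_div_le {x : ℝ} (hx0 : 0 ≤ x)
    (hx : 375 * x ≤ √(s : ℝ) * √(Real.log d)) :
    x * (L * r ^ 2 / (μ + proxWeight d s L r)) / s ≤ 1 / 375 := by
  have hs0 : (0 : ℝ) < s := by exact_mod_cast hs
  have hΛ : 0 < √(Real.log d) := by linarith [half_le_sqrt_log hd]
  have h1 := smoothness_ratio_le hd hs hsn hL hr hμ
  have h2 : √(s : ℝ) / (√(Real.log d) + √2) ≤ √(s : ℝ) / √(Real.log d) := by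
    gcongr
    linarith [Real.sqrt_nonneg 2]
  have h3 := h1.trans h2
  rw [div_le_div_iff₀ hs0 (by norm_num), one_mul]
  generalize L * r ^ 2 / (μ + proxWeight d s L r) = R at *
  calc _ ≤ x * (√(s : ℝ) / √(Real.log d)) * 375 := by gcongr
    _ = 375 * x * (√(s : ℝ) / √(Real.log d)) := by ring
    _ ≤ √(s : ℝ) * √(Real.log d) * (√(s : ℝ) / √(Real.log d)) := by gcongr
    _ = √(s : ℝ) ^ 2 := by field_simp
    _ = s := Real.sq_sqrt hs0.le

end Rate

theorem log_le_two_mul_sqrt {y : ℝ} (hy : 0 < y) : Real.log y ≤ 2 * √y := by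
  have h1 := Real.log_le_sub_one_of_pos (Real.sqrt_pos.2 hy)
  rw [Real.log_sqrt hy.le] at h1
  linarith

section Scale

variable {n d : ℕ} {ν ν₀ : ℝ} (hn : 3 ≤ n) (hν₀ : 0 < ν₀) (hν : ν₀ ≤ ν)

include hn hν₀ hν

/-- The dimension is not bounded in terms of n, so log d has to be measured by the scale X, in which
it is contained. -/
theorem sqrt_log_le_sizeScale : √(Real.log d) ≤ 3 / ν₀ * sizeScale n d ν := by
  have hℓ := one_le_log hn
  have hν' : 0 < ν := hν₀.trans_le hν
  have hn0 : (0 : ℝ) < n := by exact_mod_cast (by omega : 0 < n)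
  have hX : 0 ≤ sizeScale n d ν := by rw [sizeScale]; positivity
  have h1 := sizeScale_sq_mul (d := d) (ν := ν) hn
  have h2 : Real.log n ≤ 2 * √(n : ℝ) := log_le_two_mul_sqrt hn0
  have h3 : Real.log n ^ 3 ≤ (2 * √(n : ℝ)) ^ 3 := pow_le_pow_left₀ (by linarith) h2 3
  have h4 : ν₀ ^ 2 * √(Real.log d) ^ 2 ≤ 8 * sizeScale n d ν ^ 2 := by
    have h5 : 0 < √(n : ℝ) ^ 3 := by positivity
    have h6 : ν₀ ^ 2 * √(Real.log d) ^ 2 * √(n : ℝ) ^ 3 ≤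
        8 * sizeScale n d ν ^ 2 * √(n : ℝ) ^ 3 := by
      calc ν₀ ^ 2 * √(Real.log d) ^ 2 * √(n : ℝ) ^ 3
          ≤ ν ^ 2 * √(Real.log d) ^ 2 * √(n : ℝ) ^ 3 := by gcongr
        _ = sizeScale n d ν ^ 2 * Real.log n ^ 3 := by rw [h1]; ring
        _ ≤ sizeScale n d ν ^ 2 * (2 * √(n : ℝ)) ^ 3 := by gcongr
        _ = _ := by ring
    exact le_of_mul_le_mul_right h6 h5
  have h7 : ν₀ * √(Real.log d) ≤ 3 * sizeScale n d ν := by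
    refine abs_le_of_sq_le_sq' ?_ (by positivity) |>.2
    nlinarith [sq_nonneg (sizeScale n d ν)]
  rw [div_mul_eq_mul_div, le_div_iff₀ hν₀]
  linarith

/-- Logarithmically many epochs suffice. -/
theorem exists_epoch_bound {s : ℕ} {L r μ κ₀ M : ℝ} (hd : 2 ≤ d) (hs : 0 < s) (hsn : s ≤ n)
    (hL : 0 < L) (hμ : 0 < μ) (hκ₀ : 0 < κ₀) (hκ : L / μ ≤ κ₀ * √(n : ℝ)) (hM : 0 ≤ M) :
    ∃ j₀ : ℕ, 32 * (1 + L * r ^ 2 / μ) ^ 2 * (M + 27) / (μ / (μ + 2 * proxWeight d s L r)) ^ 3 ≤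
        2 ^ j₀ ∧
      (j₀ : ℝ) + 3 ≤ (2 * Real.log (max 1 (32 * (1 + κ₀ * r ^ 2) ^ 2 * (M + 27) *
        ((2 + 6 * (κ₀ * r ^ 2)) * (3 / ν₀)) ^ 3)) + 32) *
          (Real.log n * √(1 + sizeScale n d ν / n)) := by
  have hℓ := one_le_log hn
  have hν' : 0 < ν := hν₀.trans_le hν
  have hn0 : (1 : ℝ) ≤ n := by exact_mod_cast (by omega : 1 ≤ n)
  have hs0 : (1 : ℝ) ≤ s := by exact_mod_cast hs
  have hX : 0 ≤ sizeScale n d ν := by rw [sizeScale]; positivity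
  have hrn : √(n : ℝ) ≤ n := by
    rw [Real.sqrt_le_left (by linarith)]; nlinarith
  -- y measures how strongly the batch size is cut off at n. Its logarithm is bounded by 2√y, and √y
  -- is absorbed in the cost through s y ≤ 4X.
  set y := 1 + sizeScale n d ν / n with hy
  have hy1 : 1 ≤ y := by rw [hy]; linarith [show 0 ≤ sizeScale n d ν / n by positivity]
  have hXy : sizeScale n d ν ≤ n * y := by
    rw [hy, mul_add, mul_div_cancel₀ _ (by positivity)]; linarith
  set C := max 1 (32 * (1 + κ₀ * r ^ 2) ^ 2 * (M + 27) *
        ((2 + 6 * (κ₀ * r ^ 2)) * (3 / ν₀)) ^ 3) with hC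
  have hC1 : 1 ≤ C := le_max_left _ _
  have hγ : 0 ≤ proxWeight d s L r := by rw [proxWeight]; positivity
  have hg : (μ + 2 * proxWeight d s L r) / μ ≤
      (2 + 6 * (κ₀ * r ^ 2)) * (3 / ν₀) * (n ^ 2 * y) := by
    have h1 := rate_inv_le_mul (r := r) hd hs hsn hL hμ hκ₀ hκ
    have h2 : condScale n d s ≤ n * (3 / ν₀ * (n * y)) := by
      calc condScale n d s ≤ √(n : ℝ) * √(Real.log d) := by
            rw [condScale]
            exact div_le_self (by positivity) (Real.one_le_sqrt.2 hs0)
        _ ≤ n * (3 / ν₀ * (n * y)) := by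
            gcongr
            exact (sqrt_log_le_sizeScale hn hν₀ hν).trans (by gcongr)
    calc _ ≤ _ := h1
      _ ≤ (2 + 6 * (κ₀ * r ^ 2)) * (n * (3 / ν₀ * (n * y))) := by gcongr
      _ = _ := by ring
  have hκ' : 1 + L * r ^ 2 / μ ≤ (1 + κ₀ * r ^ 2) * n := by
    calc 1 + L * r ^ 2 / μ = 1 + L / μ * r ^ 2 := by ring
      _ ≤ n + κ₀ * n * r ^ 2 := by
        gcongr
        exact hκ.trans (by gcongr)
      _ = _ := by ring
  -- n⁸ collects n² from (1 + Lr²/μ)² and n⁶ from the cube of the bound n² y for 1/ρ.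
  have hA : 32 * (1 + L * r ^ 2 / μ) ^ 2 * (M + 27) / (μ / (μ + 2 * proxWeight d s L r)) ^ 3 ≤
      C * (n ^ 8 * y ^ 3) := by
    calc _ = 32 * (1 + L * r ^ 2 / μ) ^ 2 * (M + 27) *
          ((μ + 2 * proxWeight d s L r) / μ) ^ 3 := by
          rw [div_eq_mul_inv, ← inv_pow, inv_div]
      _ ≤ 32 * ((1 + κ₀ * r ^ 2) * n) ^ 2 * (M + 27) *
          ((2 + 6 * (κ₀ * r ^ 2)) * (3 / ν₀) * (n ^ 2 * y)) ^ 3 := by gcongr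
      _ = 32 * (1 + κ₀ * r ^ 2) ^ 2 * (M + 27) *
        ((2 + 6 * (κ₀ * r ^ 2)) * (3 / ν₀)) ^ 3 * (n ^ 8 * y ^ 3) := by ring
      _ ≤ _ := by gcongr; exact le_max_right _ _
  have hlog0 : 0 ≤ Real.log (C * (n ^ 8 * y ^ 3)) := Real.log_nonneg (by
    have h1 : (1 : ℝ) ≤ n ^ 8 := one_le_pow₀ hn0
    have h2 : 1 ≤ y ^ 3 := one_le_pow₀ hy1
    exact one_le_mul_of_one_le_of_one_le hC1 (one_le_mul_of_one_le_of_one_le h1 h2))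
  refine ⟨⌈2 * Real.log (C * (n ^ 8 * y ^ 3))⌉₊, hA.trans ?_, ?_⟩
  · have h1 : 0 < C * ((n : ℝ) ^ 8 * y ^ 3) := by positivity
    have h2 : 2 * Real.log (C * (n ^ 8 * y ^ 3)) ≤ ⌈2 * Real.log (C * (n ^ 8 * y ^ 3))⌉₊ :=
      Nat.le_ceil _
    rw [← Real.log_le_log_iff h1 (by positivity), Real.log_pow]
    nlinarith [Real.log_two_gt_d9]
  · have h1 := (Nat.ceil_lt_add_one (show 0 ≤ 2 * Real.log (C * (n ^ 8 * y ^ 3)) by positivity)).le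
    have e1 : Real.log (C * (n ^ 8 * y ^ 3)) = Real.log C + (8 * Real.log n + 3 * Real.log y) := by
      rw [Real.log_mul (by positivity) (by positivity), Real.log_mul (by positivity) (by positivity),
        Real.log_pow, Real.log_pow]
      norm_num
    have h2 := log_le_two_mul_sqrt (show 0 < y by linarith)
    have h3 : 1 ≤ √y := Real.one_le_sqrt.2 hy1
    have h4 : 0 ≤ Real.log C := Real.log_nonneg hC1
    have h5 : Real.log n ≤ Real.log n * √y := le_mul_of_one_le_right (by linarith) h3
    have h6 : √y ≤ Real.log n * √y := le_mul_of_one_le_left (by linarith) hℓ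
    have h7 : Real.log C ≤ Real.log C * (Real.log n * √y) :=
      le_mul_of_one_le_right h4 (by linarith)
    rw [e1] at h1 ⊢
    linarith

end Scale

end

end HSDMPG

namespace HSDMPG

noncomputable section

/-! ### The moment order that makes bad batches harmless. -/

section Count

variable {n d s : ℕ} {σ L r μ κ₀ ζ Δ : ℝ} (hn : 3 ≤ n) (hd : 2 ≤ d) (hs : 0 < s) (hsn : s ≤ n)
  (hσ : 0 < σ) (hσL : σ ≤ L) (hμ : 0 < μ) (hκ₀ : 0 < κ₀) (hκ : L / μ ≤ κ₀ * √(n : ℝ))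
  (hΔ : 0 ≤ Δ) (hζ : 1 ≤ ζ)

/-- The factor of `log n` in the bound for `log (ζ / ε'_t)`. -/
def logFactor (σ L ζ Δ : ℝ) : ℝ := Real.log (ζ * (2 * L / σ)) + Real.log (1 + Δ) + 1

include hσ hσL hΔ hζ in
theorem one_le_logFactor : 1 ≤ logFactor σ L ζ Δ := by
  have hσ1 : 1 ≤ 2 * L / σ := by rw [one_le_div hσ]; linarith
  have h1 : 0 ≤ Real.log (ζ * (2 * L / σ)) := Real.log_nonneg (by nlinarith)
  have h2 : 0 ≤ Real.log (1 + Δ) := Real.log_nonneg (by linarith)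
  rw [logFactor]
  linarith

include hn hd hs hsn hσ hσL hμ hκ₀ hκ hΔ hζ in
theorem innerCount_le_mul {t : ℕ} (ht : t ≤ outerCount n σ L Δ) :
    (innerCount σ L μ (proxWeight d s L r) ζ t : ℝ) ≤
      ((2 + 6 * (κ₀ * r ^ 2)) * logFactor σ L ζ Δ + 2) * (condScale n d s * Real.log n) := by
  have hL : 0 < L := hσ.trans_le hσL
  have hγ : 0 ≤ proxWeight d s L r := by rw [proxWeight]; positivity
  have hℓ := one_le_log hn
  have hC := one_le_logFactor hσ hσL hΔ hζ
  have h1 : (innerCount σ L μ (proxWeight d s L r) ζ t : ℝ) ≤ (μ + 2 * proxWeight d s L r) / μ *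
      (logFactor σ L ζ Δ * Real.log n) + 1 := innerCount_le hσ hσL hΔ hζ hμ hγ hn ht
  have h2 := rate_inv_le_mul (r := r) hd hs hsn hL hμ hκ₀ hκ
  have h3 := one_le_two_mul_condScale hd hs hsn
  have hh0 : 0 < condScale n d s := by linarith
  have h4 : 0 ≤ logFactor σ L ζ Δ * Real.log n := by positivity
  have h5 : 2 * condScale n d s ≤ 2 * condScale n d s * Real.log n :=
    le_mul_of_one_le_right (by linarith) hℓ
  calc _ ≤ _ := h1
    _ ≤ (2 + 6 * (κ₀ * r ^ 2)) * condScale n d s * (logFactor σ L ζ Δ * Real.log n) +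
        2 * condScale n d s * Real.log n := by
        gcongr
        linarith
    _ = _ := by ring

/-- The factor in the condition under which all batches are good with high probability. -/
def goodFactor (σ L r κ₀ ζ Δ : ℝ) : ℝ :=
  4 * Real.log (25 * (2 * (1 + Δ) + 1)) + 2 * ((2 + 6 * (κ₀ * r ^ 2)) * logFactor σ L ζ Δ + 2) *
    (Real.log 768 + 3 * Real.log (1 + κ₀ * r ^ 2) + 3) + 6

-- The exponent must exceed K log(3Γ) up to a constant, for 3^(-q) to beat the growth on bad
-- batches, and must stay below a multiple of √(s log d). As K is of order √(n log d / s) log n and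
-- log(3Γ) of order log n, log d cancels and s ≥ C √n log² n remains.
include hn hd hs hsn hσ hσL hμ hκ₀ hκ hΔ hζ in
theorem exists_exponent (hbig : 375 * goodFactor σ L r κ₀ ζ Δ * (√(n : ℝ) * Real.log n ^ 2) ≤ s) :
    ∃ q : ℕ, 375 * (2 * (q : ℝ) + 1) ≤ √(s : ℝ) * √(Real.log d) ∧
      ∀ t ≤ outerCount n σ L Δ, 25 * (1 / 3) ^ q * (2 * (1 + Δ) + 1) *
        (3 * (256 * (1 + L * r ^ 2 / μ) ^ 3)) ^ innerCount σ L μ (proxWeight d s L r) ζ t ≤ 1 := by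
  have hL : 0 < L := hσ.trans_le hσL
  have hℓ := one_le_log hn
  have hn0 : (1 : ℝ) ≤ n := by exact_mod_cast (by omega : 1 ≤ n)
  have hs0 : (0 : ℝ) < s := by exact_mod_cast hs
  have hC := one_le_logFactor hσ hσL hΔ hζ
  have hh := one_le_two_mul_condScale hd hs hsn
  set a := Real.log (25 * (2 * (1 + Δ) + 1)) with ha
  set B := (2 + 6 * (κ₀ * r ^ 2)) * logFactor σ L ζ Δ + 2 with hB
  set c := Real.log 768 + 3 * Real.log (1 + κ₀ * r ^ 2) + 3 with hc
  set h := condScale n d s with hhdef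
  have hh0 : 0 < h := by linarith
  have h768 : 0 ≤ Real.log 768 := Real.log_nonneg (by norm_num)
  have ha0 : 0 ≤ a := Real.log_nonneg (by linarith)
  have hB0 : 0 ≤ B := by positivity
  have hκ1 : 0 ≤ Real.log (1 + κ₀ * r ^ 2) := Real.log_nonneg (by
    linarith [show 0 ≤ κ₀ * r ^ 2 by positivity])
  have hc0 : 0 ≤ c := by linarith
  have hκ' : 1 + L * r ^ 2 / μ ≤ (1 + κ₀ * r ^ 2) * n := by
    have hrn : √(n : ℝ) ≤ n := by
      rw [Real.sqrt_le_left (by linarith)]; nlinarith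
    calc 1 + L * r ^ 2 / μ = 1 + L / μ * r ^ 2 := by ring
      _ ≤ n + κ₀ * n * r ^ 2 := by
        gcongr
        exact hκ.trans (by gcongr)
      _ = _ := by ring
  have hΓ : Real.log (3 * (256 * (1 + L * r ^ 2 / μ) ^ 3)) ≤ c * Real.log n := by
    have h1 : Real.log (3 * (256 * (1 + L * r ^ 2 / μ) ^ 3)) ≤
        Real.log (768 * ((1 + κ₀ * r ^ 2) * n) ^ 3) := by
      refine Real.log_le_log (by positivity) ?_
      calc _ = 768 * (1 + L * r ^ 2 / μ) ^ 3 := by ring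
        _ ≤ _ := by gcongr
    have h2 : Real.log (768 * ((1 + κ₀ * r ^ 2) * n) ^ 3) =
        Real.log 768 + 3 * (Real.log (1 + κ₀ * r ^ 2) + Real.log n) := by
      rw [Real.log_mul (by norm_num) (by positivity), Real.log_pow,
        Real.log_mul (by positivity) (by positivity)]
      norm_num
    have h3 : Real.log 768 + 3 * Real.log (1 + κ₀ * r ^ 2) ≤
        (Real.log 768 + 3 * Real.log (1 + κ₀ * r ^ 2)) * Real.log n :=
      le_mul_of_one_le_right (by linarith) hℓ
    rw [h2] at h1
    rw [hc]
    linarith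
  have hx0 : 0 ≤ a + B * (h * Real.log n) * (c * Real.log n) := by positivity
  refine ⟨⌈a + B * (h * Real.log n) * (c * Real.log n)⌉₊, ?_, fun t ht => ?_⟩
  · have h1 := (Nat.ceil_lt_add_one hx0).le
    have h2 : 1 ≤ 2 * h * Real.log n ^ 2 :=
      one_le_mul_of_one_le_of_one_le hh (one_le_pow₀ hℓ)
    have h3 : a ≤ a * (2 * h * Real.log n ^ 2) := le_mul_of_one_le_right ha0 h2
    have h4 : 2 * (⌈a + B * (h * Real.log n) * (c * Real.log n)⌉₊ : ℝ) + 1 ≤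
        goodFactor σ L r κ₀ ζ Δ * (h * Real.log n ^ 2) := by
      rw [goodFactor]
      linarith
    have h5 : h = √(n : ℝ) * √(Real.log d) / √(s : ℝ) := rfl
    calc _ ≤ 375 * (goodFactor σ L r κ₀ ζ Δ * (h * Real.log n ^ 2)) := by gcongr
      _ = 375 * goodFactor σ L r κ₀ ζ Δ * (√(n : ℝ) * Real.log n ^ 2) *
          (√(Real.log d) / √(s : ℝ)) := by rw [h5]; ring
      _ ≤ s * (√(Real.log d) / √(s : ℝ)) := by gcongr
      _ = √(s : ℝ) ^ 2 * (√(Real.log d) / √(s : ℝ)) := by rw [Real.sq_sqrt hs0.le]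
      _ = _ := by field_simp
  · set q := ⌈a + B * (h * Real.log n) * (c * Real.log n)⌉₊ with hq
    have h1 : a + B * (h * Real.log n) * (c * Real.log n) ≤ q := Nat.le_ceil _
    have hK := innerCount_le_mul (r := r) hn hd hs hsn hσ hσL hμ hκ₀ hκ hΔ hζ ht
    set K := innerCount σ L μ (proxWeight d s L r) ζ t
    have h2 : a + K * Real.log (3 * (256 * (1 + L * r ^ 2 / μ) ^ 3)) ≤ q := by
      refine le_trans ?_ h1
      calc _ ≤ a + K * (c * Real.log n) := by gcongr
        _ ≤ _ := by gcongr
    have h3 : 25 * (2 * (1 + Δ) + 1) * (3 * (256 * (1 + L * r ^ 2 / μ) ^ 3)) ^ K ≤ Real.exp q := by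
      rw [← Real.log_le_iff_le_exp (by positivity), Real.log_mul (by positivity) (by positivity),
        Real.log_pow]
      exact h2
    have h4 : Real.exp q ≤ 3 ^ q := by
      rw [← mul_one (q : ℝ), Real.exp_nat_mul]
      have := Real.exp_one_lt_d9
      gcongr
      linarith
    calc 25 * (1 / 3) ^ q * (2 * (1 + Δ) + 1) * (3 * (256 * (1 + L * r ^ 2 / μ) ^ 3)) ^ K
        = (1 / 3) ^ q * (25 * (2 * (1 + Δ) + 1) * (3 * (256 * (1 + L * r ^ 2 / μ) ^ 3)) ^ K) := by
          ring
      _ ≤ (1 / 3) ^ q * 3 ^ q := by gcongr; exact h3.trans h4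
      _ = 1 := by rw [← mul_pow]; norm_num

end Count

/-! ### The total number of oracle calls. -/

section Cost

variable {n d s : ℕ} {σ L r μ κ₀ ν ζ Δ : ℝ} (hn : 3 ≤ n) (hd : 2 ≤ d) (hs : 0 < s) (hsn : s ≤ n)
  (hσ : 0 < σ) (hσL : σ ≤ L) (hr : 0 < r) (hμ : 0 < μ) (hκ₀ : 0 < κ₀)
  (hκ : L / μ ≤ κ₀ * √(n : ℝ)) (hΔ : 0 ≤ Δ) (hζ : 1 ≤ ζ) (hν : 0 < ν)
  (hX : 1 ≤ sizeScale n d ν) (hsize : s = batchSize n d ν)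

include hX hsize

theorem batch_mul_le :
    (s : ℝ) * (1 + sizeScale n d ν / n) ≤ 4 * sizeScale n d ν := by
  have hX0 : 0 < sizeScale n d ν := by linarith
  rcases batchSize_cases hX with ⟨h1, h2⟩ | ⟨h1, h2⟩
  · rw [← hsize] at h1 h2
    have h3 : (s : ℝ) ≤ n := by
      rw [hsize]; exact_mod_cast (min_le_right _ _ : batchSize n d ν ≤ n)
    have h4 : (s : ℝ) * (sizeScale n d ν / n) ≤ sizeScale n d ν := by
      rcases (Nat.cast_nonneg (α := ℝ) n).eq_or_lt with h | h
      · rw [← h]; simp; linarith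
      · rw [mul_div_assoc', div_le_iff₀ h]; nlinarith
    linarith
  · rw [← hsize] at h1
    have h4 : (s : ℝ) * (sizeScale n d ν / n) ≤ sizeScale n d ν := by
      rw [h1]
      rcases (Nat.cast_nonneg (α := ℝ) n).eq_or_lt with h | h
      · rw [← h]; simp; linarith
      · rw [mul_div_cancel₀ _ h.ne']
    rw [h1] at h4 ⊢
    linarith

-- The number of inner iterations falls like s^(-1/2), so the batch cost is of order √s. The
-- remaining √(s y), with y = 1 + X/n, is at most 2√X in both regimes of the batch size.
include hs in
theorem condScale_mul_le : condScale n d s * ((s : ℝ) * √(1 + sizeScale n d ν / n)) ≤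
    2 * (√(n : ℝ) * √(Real.log d) * √(sizeScale n d ν)) := by
  have hs0 : (0 : ℝ) < s := by exact_mod_cast hs
  have h1 := Real.sqrt_le_sqrt (batch_mul_le hX hsize)
  rw [Real.sqrt_mul hs0.le, Real.sqrt_mul (by norm_num), show (4 : ℝ) = 2 ^ 2 by norm_num,
    Real.sqrt_sq (by norm_num)] at h1
  calc condScale n d s * ((s : ℝ) * √(1 + sizeScale n d ν / n))
      = condScale n d s * (√(s : ℝ) ^ 2 * √(1 + sizeScale n d ν / n)) := by
        rw [Real.sq_sqrt hs0.le]
    _ = √(n : ℝ) * √(Real.log d) * (√(s : ℝ) * √(1 + sizeScale n d ν / n)) := by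
        rw [condScale]; field_simp
    _ ≤ √(n : ℝ) * √(Real.log d) * (2 * √(sizeScale n d ν)) := by gcongr
    _ = _ := by ring

-- The relation X² log³ n = ν² n^(3/2) log d turns the left side into √(n log d) log³ n ·
-- X²/s^(3/2), and X ≤ s.
include hn hs hd hν in
omit hsize in
theorem sq_mul_condScale_cube_le (hXs : sizeScale n d ν ≤ s) :
    ν ^ 2 * √(n : ℝ) * condScale n d s ^ 3 ≤ callOrder n d ν := by
  have hs0 : (0 : ℝ) < s := by exact_mod_cast hs
  have hℓ := one_le_log hn
  have hX0 : 0 < sizeScale n d ν := by linarith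
  have h1 := sizeScale_sq_mul (d := d) (ν := ν) hn
  have h2 : √(sizeScale n d ν) ^ 3 ≤ √(s : ℝ) ^ 3 := by gcongr
  have hX4 : sizeScale n d ν ^ 2 = √(sizeScale n d ν) * √(sizeScale n d ν) ^ 3 := by
    nth_rw 1 [← Real.sq_sqrt hX0.le]; ring
  rw [← callOrder_ge hn hν (by omega)]
  have hs3 : 0 < √(s : ℝ) ^ 3 := by positivity
  calc ν ^ 2 * √(n : ℝ) * condScale n d s ^ 3 =
        ν ^ 2 * √(n : ℝ) ^ 3 * √(Real.log d) ^ 2 * (√(n : ℝ) * √(Real.log d)) / √(s : ℝ) ^ 3 := by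
        rw [condScale]; ring
    _ = √(sizeScale n d ν) * √(sizeScale n d ν) ^ 3 * Real.log n ^ 3 *
        (√(n : ℝ) * √(Real.log d)) / √(s : ℝ) ^ 3 := by rw [← h1, hX4]
    _ ≤ √(sizeScale n d ν) * √(s : ℝ) ^ 3 * Real.log n ^ 3 *
        (√(n : ℝ) * √(Real.log d)) / √(s : ℝ) ^ 3 := by gcongr
    _ = √(n : ℝ) * √(Real.log d) * Real.log n ^ 3 * √(sizeScale n d ν) := by field_simp
    _ ≤ _ := by linarith [show 0 ≤ ν ^ 2 * √(n : ℝ) by positivity]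

omit hX hsize in
theorem miniSize_le (hγ : 0 ≤ proxWeight d s L r) (hμ : 0 < μ) (k : ℕ) :
    (miniSize n ν μ (proxWeight d s L r) k : ℝ) ≤
      16 * ν ^ 2 * ((μ + 2 * proxWeight d s L r) / μ) ^ 2 *
        Real.exp (μ / (μ + 2 * proxWeight d s L r) * k) + 1 := by
  have h1 : (miniSize n ν μ (proxWeight d s L r) k : ℝ) ≤
      ⌈16 * ν ^ 2 * (μ + 2 * proxWeight d s L r) ^ 2 / μ ^ 2 *
        Real.exp (μ * k / (μ + 2 * proxWeight d s L r))⌉₊ := by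
    exact_mod_cast min_le_left _ _
  refine h1.trans ((Nat.ceil_lt_add_one (by positivity)).le.trans (le_of_eq ?_))
  rw [div_pow, mul_div_assoc', div_mul_eq_mul_div μ]

include hn hd hs hσ hσL hμ hκ₀ hκ hΔ hζ hν in
/-- The total size of the minibatches, up to a multiple of the batch size. -/
theorem sum_miniSize_le :
    ∑ t ∈ Finset.range (outerCount n σ L Δ),
      ∑ k ∈ Finset.range (innerCount σ L μ (proxWeight d s L r) ζ (t + 1)),
        (miniSize n ν μ (proxWeight d s L r) (k + 1) : ℝ) ≤
      ∑ t ∈ Finset.range (outerCount n σ L Δ),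
        ∑ _k ∈ Finset.range (innerCount σ L μ (proxWeight d s L r) ζ (t + 1)), (s : ℝ) +
      16 * (27 * ζ * (2 * L / σ) ^ 2 * (1 + Δ)) * (4 * (1 + (6 * (κ₀ * r ^ 2)) ^ 3)) *
        callOrder n d ν := by
  have hL : 0 < L := hσ.trans_le hσL
  have hs0 : (1 : ℝ) ≤ s := by exact_mod_cast hs
  have hγ : 0 ≤ proxWeight d s L r := by rw [proxWeight]; positivity
  have hO : 0 ≤ callOrder n d ν := by
    have h1 : 0 ≤ Real.log d := Real.log_natCast_nonneg _
    have h2 : 0 ≤ Real.log n := Real.log_natCast_nonneg _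
    rw [callOrder]; positivity
  -- If the cap is inactive, then X ≤ s and the growing sizes are summed; the +1 from rounding is
  -- covered by s. If s = n, every minibatch is at most a batch.
  rcases batchSize_cases hX with ⟨h1, -⟩ | ⟨h1, -⟩
  · rw [← hsize] at h1
    set g := (μ + 2 * proxWeight d s L r) / μ with hg
    set S := ∑ t ∈ Finset.range (outerCount n σ L Δ),
      ∑ k ∈ Finset.range (innerCount σ L μ (proxWeight d s L r) ζ (t + 1)),
        Real.exp (μ / (μ + 2 * proxWeight d s L r) * (k + 1 : ℕ)) with hS
    have hg0 : 0 ≤ g := by positivity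
    have hSle : S ≤ 27 * ζ * (2 * L / σ) ^ 2 * (1 + Δ) * (g * √(n : ℝ)) :=
      sum_sum_exp_le hσ hσL hΔ hζ hμ hγ hn
    have hsum : ∑ t ∈ Finset.range (outerCount n σ L Δ),
        ∑ k ∈ Finset.range (innerCount σ L μ (proxWeight d s L r) ζ (t + 1)),
          (miniSize n ν μ (proxWeight d s L r) (k + 1) : ℝ) ≤
        ∑ t ∈ Finset.range (outerCount n σ L Δ),
          ∑ _k ∈ Finset.range (innerCount σ L μ (proxWeight d s L r) ζ (t + 1)), (s : ℝ) +
          16 * ν ^ 2 * g ^ 2 * S := by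
      simp only [hS, Finset.mul_sum]
      rw [← Finset.sum_add_distrib]
      refine Finset.sum_le_sum fun t _ => ?_
      rw [← Finset.sum_add_distrib]
      refine Finset.sum_le_sum fun k _ => ?_
      have := miniSize_le (n := n) (ν := ν) hγ hμ (k + 1)
      linarith
    refine hsum.trans (add_le_add le_rfl ?_)
    have hg1 : g ≤ 1 + 6 * (κ₀ * r ^ 2) * condScale n d s := rate_inv_le hd hs hL hμ hκ₀ hκ
    have hh0 : 0 ≤ condScale n d s := by rw [condScale]; positivity
    have hg3 : g ^ 3 ≤ 4 * (1 + (6 * (κ₀ * r ^ 2)) ^ 3 * condScale n d s ^ 3) := by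
      have h2 : (1 + 6 * (κ₀ * r ^ 2) * condScale n d s) ^ 3 ≤
          4 * (1 + (6 * (κ₀ * r ^ 2) * condScale n d s) ^ 3) := by
        have := add_pow_le (a := (1 : ℝ)) (b := 6 * (κ₀ * r ^ 2) * condScale n d s) (by norm_num)
          (by positivity) 3
        norm_num at this
        linarith
      calc g ^ 3 ≤ (1 + 6 * (κ₀ * r ^ 2) * condScale n d s) ^ 3 := by gcongr
        _ ≤ _ := h2
        _ = _ := by ring
    have hν2 : ν ^ 2 * √(n : ℝ) ≤ callOrder n d ν := by
      rw [← callOrder_ge hn hν (by omega)]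
      have h2 : 0 ≤ Real.log n := Real.log_natCast_nonneg _
      linarith [show 0 ≤ √(n : ℝ) * √(Real.log d) * Real.log n ^ 3 * √(sizeScale n d ν) by
        positivity]
    have h3 := sq_mul_condScale_cube_le hn hd hs hν hX h1
    calc 16 * ν ^ 2 * g ^ 2 * S ≤
          16 * ν ^ 2 * g ^ 2 * (27 * ζ * (2 * L / σ) ^ 2 * (1 + Δ) * (g * √(n : ℝ))) := by gcongr
      _ = 16 * (27 * ζ * (2 * L / σ) ^ 2 * (1 + Δ)) * (g ^ 3 * (ν ^ 2 * √(n : ℝ))) := by ring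
      _ ≤ 16 * (27 * ζ * (2 * L / σ) ^ 2 * (1 + Δ)) *
          (4 * (1 + (6 * (κ₀ * r ^ 2)) ^ 3 * condScale n d s ^ 3) * (ν ^ 2 * √(n : ℝ))) := by
          gcongr
      _ = 16 * (27 * ζ * (2 * L / σ) ^ 2 * (1 + Δ)) *
          (4 * (ν ^ 2 * √(n : ℝ) + (6 * (κ₀ * r ^ 2)) ^ 3 *
            (ν ^ 2 * √(n : ℝ) * condScale n d s ^ 3))) := by ring
      _ ≤ 16 * (27 * ζ * (2 * L / σ) ^ 2 * (1 + Δ)) *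
          (4 * (callOrder n d ν + (6 * (κ₀ * r ^ 2)) ^ 3 * callOrder n d ν)) := by gcongr
      _ = _ := by ring
  · rw [← hsize] at h1
    have h2 : ∀ k : ℕ, (miniSize n ν μ (proxWeight d s L r) k : ℝ) ≤ s := fun k => by
      rw [h1]; exact_mod_cast min_le_right _ _
    refine le_trans (Finset.sum_le_sum fun t _ => Finset.sum_le_sum fun k _ => h2 _) ?_
    exact le_add_of_nonneg_right (by positivity)

/-- The factor of `callOrder` in the bound for the number of oracle calls, for epoch counts
`J ≤ CJ √(1 + X / n) log n`. -/
def costFactor (σ L r κ₀ ζ Δ CJ : ℝ) : ℝ :=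
  (2 * L / σ * (Real.log (1 + Δ) + 1) + 1) *
      ((2 + 6 * (κ₀ * r ^ 2)) * logFactor σ L ζ Δ + 2) * (204 * CJ) * 2 +
    16 * (27 * ζ * (2 * L / σ) ^ 2 * (1 + Δ)) * (4 * (1 + (6 * (κ₀ * r ^ 2)) ^ 3))

include hn hd hs hsn hσ hσL hr hμ hκ₀ hκ hΔ hζ hν in
theorem sum_cost_le {J CJ : ℝ} (hJ1 : 1 ≤ J)
    (hJ : J ≤ CJ * (Real.log n * √(1 + sizeScale n d ν / n))) {m : ℕ}
    (hm : m = ⌈50 * (L * r ^ 2 + μ + proxWeight d s L r) / (μ + proxWeight d s L r)⌉₊) :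
    ∑ t ∈ Finset.range (outerCount n σ L Δ),
      ∑ k ∈ Finset.range (innerCount σ L μ (proxWeight d s L r) ζ (t + 1)),
        ((miniSize n ν μ (proxWeight d s L r) (k + 1) : ℝ) + J * (s + 2 * m)) ≤
      costFactor σ L r κ₀ ζ Δ CJ * callOrder n d ν := by
  have hL : 0 < L := hσ.trans_le hσL
  have hs0 : (1 : ℝ) ≤ s := by exact_mod_cast hs
  have hℓ := one_le_log hn
  have hX0 : 0 < sizeScale n d ν := by linarith
  have hm1 : (m : ℝ) ≤ 101 * s := by rw [hm]; exact epoch_length_le hd hs hsn hL hr hμ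
  have hC := one_le_logFactor hσ hσL hΔ hζ
  have hΔ1 : 0 ≤ Real.log (1 + Δ) := Real.log_nonneg (by linarith)
  have hh := one_le_two_mul_condScale hd hs hsn
  have hh0 : 0 < condScale n d s := by linarith
  have hCJ : 0 ≤ CJ := by
    by_contra hneg
    have : 0 < Real.log n * √(1 + sizeScale n d ν / n) := by positivity
    nlinarith
  have hT := outerCount_le (n := n) hσ hσL hΔ hn
  have h1 := sum_miniSize_le (r := r) hn hd hs hσ hσL hμ hκ₀ hκ hΔ hζ hν hX hsize
  have h2 : ∑ t ∈ Finset.range (outerCount n σ L Δ),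
      ∑ k ∈ Finset.range (innerCount σ L μ (proxWeight d s L r) ζ (t + 1)),
        (s + J * (s + 2 * m)) ≤
      (2 * L / σ * (Real.log (1 + Δ) + 1) + 1) *
        ((2 + 6 * (κ₀ * r ^ 2)) * logFactor σ L ζ Δ + 2) * (204 * CJ) * 2 * callOrder n d ν := by
    -- 204 = 1 + 1 + 2·101: the s that covers the minibatch, the gradient over the batch, and the
    -- inner steps with m ≤ 101 s.
    have hterm : (s : ℝ) + J * (s + 2 * m) ≤
        204 * (CJ * (Real.log n * √(1 + sizeScale n d ν / n))) * s := by
      calc (s : ℝ) + J * (s + 2 * m) ≤ J * s + J * (s + 2 * (101 * s)) := by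
            gcongr
            exact le_mul_of_one_le_left (by linarith) hJ1
        _ = 204 * J * s := by ring
        _ ≤ _ := by gcongr
    have hsum : ∀ t ∈ Finset.range (outerCount n σ L Δ),
        ∑ k ∈ Finset.range (innerCount σ L μ (proxWeight d s L r) ζ (t + 1)),
          ((s : ℝ) + J * (s + 2 * m)) ≤
        ((2 + 6 * (κ₀ * r ^ 2)) * logFactor σ L ζ Δ + 2) * (condScale n d s * Real.log n) *
          (204 * (CJ * (Real.log n * √(1 + sizeScale n d ν / n))) * s) := fun t ht => by
      rw [Finset.sum_const, Finset.card_range, nsmul_eq_mul]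
      have hK := innerCount_le_mul (r := r) (t := t + 1) hn hd hs hsn hσ hσL hμ hκ₀ hκ hΔ hζ
        (Finset.mem_range.1 ht)
      gcongr
    refine (Finset.sum_le_sum hsum).trans ?_
    rw [Finset.sum_const, Finset.card_range, nsmul_eq_mul]
    have h3 := condScale_mul_le (n := n) (d := d) hs hX hsize
    have h4 : √(n : ℝ) * √(Real.log d) * Real.log n ^ 3 * √(sizeScale n d ν) ≤
        callOrder n d ν := by
      rw [← callOrder_ge hn hν (by omega)]
      linarith [show 0 ≤ ν ^ 2 * √(n : ℝ) by positivity]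
    have hB0 : 0 ≤ (2 + 6 * (κ₀ * r ^ 2)) * logFactor σ L ζ Δ + 2 := by positivity
    have hT0 : 0 ≤ 2 * L / σ * (Real.log (1 + Δ) + 1) + 1 := by positivity
    set A := 2 * L / σ * (Real.log (1 + Δ) + 1) + 1
    set B := (2 + 6 * (κ₀ * r ^ 2)) * logFactor σ L ζ Δ + 2
    calc _ ≤ A * Real.log n * (B * (condScale n d s * Real.log n) *
          (204 * (CJ * (Real.log n * √(1 + sizeScale n d ν / n))) * s)) := by
          gcongr
      _ = A * B * (204 * CJ) * (Real.log n ^ 3 *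
          (condScale n d s * (s * √(1 + sizeScale n d ν / n)))) := by ring
      _ ≤ A * B * (204 * CJ) * (Real.log n ^ 3 *
          (2 * (√(n : ℝ) * √(Real.log d) * √(sizeScale n d ν)))) := by gcongr
      _ = A * B * (204 * CJ) * 2 *
          (√(n : ℝ) * √(Real.log d) * Real.log n ^ 3 * √(sizeScale n d ν)) := by ring
      _ ≤ _ := by gcongr
  simp only [Finset.sum_add_distrib] at h1 h2 ⊢
  rw [costFactor, add_mul]
  linarith

end Cost

-- Both claims follow from log^(7/2) n = o(n^(1/4)), where 7/2 = 2 + 3/2 joins the required log² n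
-- to the logarithm in the batch size. They correspond to the two regimes: full sample, and uncapped
-- batch.
open Filter Asymptotics in
theorem exists_threshold {A c : ℝ} (hA : 0 < A) (hc : 0 < c) : ∃ n₀ : ℕ, ∀ n : ℕ, n₀ ≤ n →
    3 ≤ n ∧ A * (√(n : ℝ) * Real.log n ^ 2) ≤ n ∧
      A * (√(n : ℝ) * Real.log n ^ 2) ≤ c * (n : ℝ) ^ (3 / 4 : ℝ) / Real.log n ^ (3 / 2 : ℝ) := by
  have h := (isLittleO_log_rpow_rpow_atTop (7 / 2) (show (0 : ℝ) < 1 / 4 by norm_num)).bound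
    (show 0 < min 1 c / A by positivity)
  obtain ⟨n₀, hn₀⟩ := eventually_atTop.1 (tendsto_natCast_atTop_atTop.eventually h)
  refine ⟨max n₀ 3, fun n hn => ?_⟩
  have hn3 : 3 ≤ n := (le_max_right _ _).trans hn
  have hn0 : (1 : ℝ) ≤ n := by exact_mod_cast (by omega : 1 ≤ n)
  have hℓ := one_le_log hn3
  have h1 := hn₀ n ((le_max_left _ _).trans hn)
  rw [Real.norm_of_nonneg (by positivity), Real.norm_of_nonneg (by positivity)] at h1
  have e1 : Real.log n ^ (7 / 2 : ℝ) = Real.log n ^ 2 * Real.log n ^ (3 / 2 : ℝ) := by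
    rw [← Real.rpow_natCast, ← Real.rpow_add (by linarith)]; norm_num
  have e2 : (n : ℝ) ^ (3 / 4 : ℝ) = √(n : ℝ) * (n : ℝ) ^ (1 / 4 : ℝ) := by
    rw [Real.sqrt_eq_rpow, ← Real.rpow_add (by linarith)]; norm_num
  have h2 : A * Real.log n ^ (7 / 2 : ℝ) ≤ min 1 c * (n : ℝ) ^ (1 / 4 : ℝ) := by
    have := mul_le_mul_of_nonneg_left h1 hA.le
    rwa [← mul_assoc, mul_div_cancel₀ _ hA.ne'] at this
  have h3 : 1 ≤ Real.log n ^ (3 / 2 : ℝ) := Real.one_le_rpow hℓ (by norm_num)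
  refine ⟨hn3, ?_, ?_⟩
  · have h4 : A * Real.log n ^ 2 ≤ √(n : ℝ) := by
      calc A * Real.log n ^ 2 ≤ A * Real.log n ^ (7 / 2 : ℝ) := by
            rw [e1]
            gcongr
            exact le_mul_of_one_le_right (by positivity) h3
        _ ≤ min 1 c * (n : ℝ) ^ (1 / 4 : ℝ) := h2
        _ ≤ 1 * (n : ℝ) ^ (1 / 2 : ℝ) := by
            gcongr
            · exact min_le_left _ _
            · norm_num
        _ = _ := by rw [one_mul, Real.sqrt_eq_rpow]
    calc A * (√(n : ℝ) * Real.log n ^ 2) = √(n : ℝ) * (A * Real.log n ^ 2) := by ring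
      _ ≤ √(n : ℝ) * √(n : ℝ) := by gcongr
      _ = n := Real.mul_self_sqrt (by linarith)
  · rw [le_div_iff₀ (by positivity)]
    calc _ = √(n : ℝ) * (A * Real.log n ^ (7 / 2 : ℝ)) := by rw [e1]; ring
      _ ≤ √(n : ℝ) * (min 1 c * (n : ℝ) ^ (1 / 4 : ℝ)) := by gcongr
      _ ≤ √(n : ℝ) * (c * (n : ℝ) ^ (1 / 4 : ℝ)) := by gcongr; exact min_le_right _ _
      _ = _ := by rw [e2]; ring

end

end HSDMPG

namespace HSDMPG

noncomputable section

open MeasureTheory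
open scoped ENNReal

/-! ### Assembly. -/

section Main

variable {n d : ℕ} {Y : Type*} {p : ERM n d Y} {z : Sizes n} {τ : Tuning} {θ₀ : E d}

/-- The expected number of oracle calls, from bounds for the expected numbers of SVRG epochs. -/
theorem lintegral_oracleCalls_le (hd : ∀ i, Differentiable ℝ fun u => p.ℓ u (p.y i))
    (hb : ∀ k, 0 < z.b k) {T j₀ : ℕ}
    (h : ∀ t < T, ∀ k < τ.K (t + 1),
      ∫⁻ ω, ((epochs p z τ θ₀ ω t k : ℕ∞) : ℝ≥0∞) ∂law z ≤ (j₀ : ℝ≥0∞) + 2) :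
    ∫⁻ ω, (oracleCalls p z τ θ₀ ω T : ℝ≥0∞) ∂law z ≤
      ENNReal.ofReal (∑ t ∈ Finset.range T, ∑ k ∈ Finset.range (τ.K (t + 1)),
        ((z.b (k + 1) : ℝ) + ((j₀ : ℝ) + 3) * (z.s + 2 * z.m))) := by
  have hm : ∀ t k, Measurable fun ω : Outcome z => ((epochs p z τ θ₀ ω t k : ℕ∞) : ℝ≥0∞) :=
    fun t k => (measurable_from_top (f := fun a : ℕ∞ => (a : ℝ≥0∞))).comp
      (measurable_epochs hd hb t k)
  have e : ∀ ω : Outcome z, (oracleCalls p z τ θ₀ ω T : ℝ≥0∞) =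
      ∑ t ∈ Finset.range T, ∑ k ∈ Finset.range (τ.K (t + 1)),
        (((z.b (k + 1) : ℝ≥0∞) + z.s) +
          ((z.s : ℝ≥0∞) + 2 * z.m) * ((epochs p z τ θ₀ ω t k : ℕ∞) : ℝ≥0∞)) := fun ω => by
    rw [oracleCalls_eq, ← ENat.toENNRealRingHom_apply, map_sum]
    refine Finset.sum_congr rfl fun t _ => ?_
    rw [map_sum]
    refine Finset.sum_congr rfl fun k _ => ?_
    simp only [map_add, map_mul, map_one, map_natCast, map_ofNat, ENat.toENNRealRingHom_apply]
    ring
  simp only [e]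
  rw [lintegral_finsetSum _ fun t _ => by fun_prop,
    ENNReal.ofReal_sum_of_nonneg fun t _ => by positivity]
  refine Finset.sum_le_sum fun t ht => ?_
  rw [lintegral_finsetSum _ fun k _ => by fun_prop,
    ENNReal.ofReal_sum_of_nonneg fun k _ => by positivity]
  refine Finset.sum_le_sum fun k hk => ?_
  rw [lintegral_add_left measurable_const, lintegral_const_mul _ (hm t k)]
  -- The gradient over the batch is evaluated once more than there are epochs, whence j₀ + 3 in
  -- place of j₀ + 2.
  have h1 := h t (Finset.mem_range.1 ht) k (Finset.mem_range.1 hk)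
  calc _ ≤ ((z.b (k + 1) : ℝ≥0∞) + z.s) + ((z.s : ℝ≥0∞) + 2 * z.m) * ((j₀ : ℝ≥0∞) + 2) := by
        rw [lintegral_const, measure_univ, mul_one]
        gcongr
    _ ≤ (z.b (k + 1) : ℝ≥0∞) + ((j₀ : ℝ≥0∞) + 3) * (z.s + 2 * z.m) := by
        have : (((z.b (k + 1) + z.s) + (z.s + 2 * z.m) * (j₀ + 2) : ℕ) : ℝ≥0∞) ≤
            ((z.b (k + 1) + (j₀ + 3) * (z.s + 2 * z.m) : ℕ) : ℝ≥0∞) := by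
          exact_mod_cast (by nlinarith : (z.b (k + 1) + z.s) + (z.s + 2 * z.m) * (j₀ + 2) ≤
            z.b (k + 1) + (j₀ + 3) * (z.s + 2 * z.m))
        push_cast at this
        exact this
    _ = _ := by
        rw [← ENNReal.ofReal_natCast, ← ENNReal.ofReal_natCast, ← ENNReal.ofReal_natCast,
          ← ENNReal.ofReal_natCast, ← ENNReal.ofReal_ofNat 3, ← ENNReal.ofReal_ofNat 2,
          ← ENNReal.ofReal_add (by positivity) (by positivity),
          ← ENNReal.ofReal_mul (by positivity), ← ENNReal.ofReal_add (by positivity) (by positivity),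
          ← ENNReal.ofReal_mul (by positivity), ← ENNReal.ofReal_add (by positivity) (by positivity)]

/-- The size of the batches, for large samples. -/
theorem le_sizeScale {A ν ν₀ : ℝ} (hd : 2 ≤ d) (hν : ν₀ ≤ ν) (hν₀ : 0 ≤ ν₀)
    (h : A ≤ ν₀ * √(Real.log 2) * (n : ℝ) ^ (3 / 4 : ℝ) / Real.log n ^ (3 / 2 : ℝ)) :
    A ≤ sizeScale n d ν := by
  have hd2 : (2 : ℝ) ≤ d := by exact_mod_cast hd
  have hl : 0 ≤ Real.log n := Real.log_natCast_nonneg n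
  have hν' : 0 ≤ ν := hν₀.trans hν
  refine h.trans ?_
  calc _ = ν₀ * (n : ℝ) ^ (3 / 4 : ℝ) * √(Real.log 2) / Real.log n ^ (3 / 2 : ℝ) := by ring
    _ ≤ sizeScale n d ν := by rw [sizeScale]; gcongr

end Main

end

end HSDMPG

theorem corollary3 (L σ r κ₀ ν₀ Δ : ℝ) (hL : 0 < L) (hσ : 0 < σ) (hr : 0 < r) (hκ₀ : 0 < κ₀)
    (hν₀ : 0 < ν₀) (hΔ : 0 ≤ Δ) :
    ∃ ζ₀ : ℝ, 0 < ζ₀ ∧ ∀ ζ : ℝ, ζ₀ ≤ ζ → ∃ (C : ℝ) (n₀ : ℕ),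
      ∀ (n d : ℕ), n₀ ≤ n → 2 ≤ n → 2 ≤ d →
      ∀ (Y : Type*) (p : HSDMPG.ERM n d Y), p.L = L → 0 < p.μ → L / p.μ ≤ κ₀ * √(n : ℝ) →
      (∀ i, ‖p.x i‖ ≤ r) →
      (∀ i, HSDMPG.StronglyConvexSmooth σ L (fun u => p.ℓ u (p.y i))) →
      ∀ (θ₀ θstar : HSDMPG.E d), (∀ θ, p.risk θstar ≤ p.risk θ) →
      p.risk θ₀ - p.risk θstar ≤ Δ →
      ∀ (ν : ℝ), ν₀ ≤ ν →
      ∀ (z : HSDMPG.Sizes n), HSDMPG.IsTunedSizes z d L r p.μ ν →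
      ∀ (τ : HSDMPG.Tuning), τ = HSDMPG.tuning z.s d σ L r p.μ ζ →
      ∀ (T : ℕ), T = HSDMPG.outerCount n σ L Δ →
      ∀ (θ : HSDMPG.Outcome z → ℕ → HSDMPG.E d), θ = HSDMPG.outerRun p z τ θ₀ →
      (∀ t < T, ∀ k < τ.K (t + 1),
        ∫⁻ ω, ENNReal.ofReal
          (p.gradVariance (θ ω t) (HSDMPG.innerRun p z τ ω (t + 1) (θ ω t) k)) ∂HSDMPG.law z
            ≤ ENNReal.ofReal (ν ^ 2)) →
      (∀ t < T,
        ∫⁻ ω, ENNReal.ofReal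
          (p.quadModel (θ ω t) (θ ω (t + 1)) - ⨅ θ', p.quadModel (θ ω t) θ') ∂HSDMPG.law z
            ≤ ENNReal.ofReal (HSDMPG.modelAccuracy σ L (t + 1))) ∧
      ∫⁻ ω, ENNReal.ofReal (p.risk (θ ω T) - p.risk θstar) ∂HSDMPG.law z
        ≤ ENNReal.ofReal (1 / √(n : ℝ)) ∧
      ∫⁻ ω, (HSDMPG.oracleCalls p z τ θ₀ ω T : ENNReal) ∂HSDMPG.law z
        ≤ ENNReal.ofReal (C * HSDMPG.callOrder n d ν) := by
  -- The constant M + 26 of the inner loop for the initial excess M = 2(1 + Δ).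
  refine ⟨28 + 2 * Δ, by linarith, fun ζ hζ => ?_⟩
  -- The maximum with 1 secures X ≥ 1 besides the size condition on s. The constant ν₀√(log 2)
  -- bounds ν√(log d) from below, so n₀ depends on neither ν nor d.
  obtain ⟨n₀, hn₀⟩ := HSDMPG.exists_threshold
    (A := max (375 * HSDMPG.goodFactor σ L r κ₀ ζ Δ) 1) (c := ν₀ * √(Real.log 2))
    (lt_max_of_lt_right one_pos) (mul_pos hν₀ (Real.sqrt_pos.2 (Real.log_pos one_lt_two)))
  refine ⟨HSDMPG.costFactor σ L r κ₀ ζ Δ (2 * Real.log (max 1 (32 * (1 + κ₀ * r ^ 2) ^ 2 *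
    (2 * (1 + Δ) + 27) * ((2 + 6 * (κ₀ * r ^ 2)) * (3 / ν₀)) ^ 3)) + 32), n₀, ?_⟩
  rintro n d hn - hd Y p rfl hμ hκ hx hℓ θ₀ θstar hmin h0 ν hν z hz τ hτ T hT θ rfl hvar
  obtain ⟨hn3, hAn, hAX⟩ := hn₀ n hn
  have hσL : σ ≤ p.L := (hℓ ⟨0, by omega⟩).le
  have hdiff : ∀ i, Differentiable ℝ fun u => p.ℓ u (p.y i) := fun i => (hℓ i).1
  have hν' : 0 < ν := hν₀.trans_le hν
  have hζ1 : 1 ≤ ζ := by linarith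
  have hlog := HSDMPG.one_le_log hn3
  have hn1 : (1 : ℝ) ≤ n := by exact_mod_cast (by omega : 1 ≤ n)
  have hs := z.s_pos
  have hsn := z.s_le
  obtain ⟨hzs, hzb, hzm⟩ := id hz
  have hAX' := HSDMPG.le_sizeScale hd hν hν₀.le hAX
  have hX : 1 ≤ HSDMPG.sizeScale n d ν := by
    refine le_trans ?_ hAX'
    exact one_le_mul_of_one_le_of_one_le (le_max_right _ _)
      (one_le_mul_of_one_le_of_one_le (Real.one_le_sqrt.2 hn1) (one_le_pow₀ hlog))
  have hbig : 375 * HSDMPG.goodFactor σ p.L r κ₀ ζ Δ * (√(n : ℝ) * Real.log n ^ 2) ≤ z.s := by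
    refine (mul_le_mul_of_nonneg_right (le_max_left _ 1) (by positivity)).trans ?_
    rw [hzs]
    rcases HSDMPG.batchSize_cases hX with ⟨h1, -⟩ | ⟨h1, -⟩
    · exact hAX'.trans h1
    · rw [h1]; exact hAn
  have hγ : τ.γ = HSDMPG.proxWeight d z.s p.L r := by rw [hτ]; rfl
  have hK : ∀ t, τ.K t = HSDMPG.innerCount σ p.L p.μ (HSDMPG.proxWeight d z.s p.L r) ζ t :=
    fun t => by rw [hτ]; rfl
  have hγ0 : 0 ≤ τ.γ := by rw [hγ, HSDMPG.proxWeight]; positivity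
  obtain ⟨q, hq, hqK⟩ := HSDMPG.exists_exponent (r := r) (ζ := ζ) hn3 hd hs hsn hσ hσL hμ hκ₀ hκ
    hΔ hζ1 hbig
  obtain ⟨j₀, hj₀, hJ⟩ := HSDMPG.exists_epoch_bound (r := r) (M := 2 * (1 + Δ)) hn3 hν₀ hν hd hs
    hsn hL hμ hκ₀ hκ (by positivity)
  have hbad := HSDMPG.law_not_isGood_le (z := z) (γ := τ.γ) hL.le hμ hx hγ0 q
    (by rw [hγ]; exact HSDMPG.mul_smoothness_ratio_div_le hd hs hsn hL hr hμ (by positivity) hq)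
    (by rw [hγ]; exact HSDMPG.smoothness_ratio_sq_div_le hd hs hsn hL hr hμ)
  obtain ⟨hmodel, hrisk, hepochs⟩ := HSDMPG.tuned_bounds (by omega) hL hσ hμ hx hℓ hmin hΔ h0 hν'
    hz hζ hτ hT hvar (P := 25 * (1 / 3) ^ q) (by positivity) hbad
    (fun t ht => by rw [hK]; exact hqK _ (by omega))
  refine ⟨hmodel, hrisk, ?_⟩
  have hb : ∀ k, 0 < z.b k := fun k => by
    rw [hzb, HSDMPG.miniSize, ← hγ]
    exact lt_min (Nat.ceil_pos.2 (by positivity)) (by omega)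
  refine (HSDMPG.lintegral_oracleCalls_le hdiff hb
    (hepochs j₀ (by rw [hγ]; exact hj₀))).trans (ENNReal.ofReal_le_ofReal ?_)
  have hcost := HSDMPG.sum_cost_le (r := r) hn3 hd hs hsn hσ hσL hr hμ hκ₀ hκ hΔ hζ1 hν' hX hzs
    (J := (j₀ : ℝ) + 3) (by linarith [(j₀.cast_nonneg : (0 : ℝ) ≤ j₀)]) hJ hzm
  simp only [hK, hzb, hT]
  exact hcost
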